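/- Let $X$ be a (finite dimensional) orbispace: a second countable, locally connected, paracompact Hausdorff space together with an open covering $\mathcal U$ and a functor $\mathsf X$ that assigns to every connected component $U$ of a finite intersection of elements of $\mathcal U$ an orbispace chart $(\tilde U,G,\varrho)$ ($\tilde U$ a connected smooth manifold, $G$ a compact Lie group acting smoothly on $\tilde U$, $\varrho:\tilde U\to X$ a $G$-invariant map inducing a homeomorphism $\tilde U/G\cong U$), and to every inclusion $V\subset U$ an equivariant open embedding $(\varphi,\iota):(\tilde V,H)\to(\tilde U,G)$ with $\varrho_U\circ\varphi=\varrho_V$. Let $\omega=(\omega_{\tilde U})$ be a symplectic form and $\nabla=(\nabla_{\tilde U})$ a torsionfree connection with $\nabla\omega=0$ on $X$, i.e. families of such objects on the charts that are $G$-invariant and preserved by the maps $\varphi$. Let $\mathcal C^\infty(X)$ be the algebra of continuous functions $f:X\to\mathbb C$ such that all $f\circ\varrho$ are smooth, with the Poisson bracket determined by $\{f,g\}\circ\varrho=\{f\circ\varrho,g\circ\varrho\}_{\tilde U}$, where $\{f,g\}_{\tilde U}=\omega(X_f,X_g)$ and $\omega(X_f,\cdot)=df$. Let $\Lambda^l\widehat{\mathbb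 W}X$ be the orbibundle of $l$-forms with values in the completed formal Weyl algebras $\widehat{\mathbb W}(T_{\tilde x}\tilde U)=\widehat{\mathrm{Sym}}^\bullet(T^*_{\tilde x}\tilde U)[[\lambda]]$. Its (smooth stratified) sections are the families of smooth sections over the charts that are $G$-equivariant and compatible with the maps $\varphi$. It carries the Moyal--Weyl product $$a\circ b=\sum_{m\ge 0}\frac{1}{m!}\Big(\frac{-i\lambda}{2}\Big)^m\,\omega^{i_1j_1}\cdots\omega^{i_mj_m}\,\frac{\partial^m a}{\partial y^{i_1}\cdots\partial y^{i_m}}\,\frac{\partial^m b}{\partial y^{j_1}\cdots\partial y^{j_m}},\qquad \omega^{ij}\omega_{jk}=\delta^i_k ,$$ with graded commutator $[\cdot,\cdot]$, and the Fedosov degree ($\deg y=1$, $\deg\lambda=2$). Denote by $\nabla$ also the induced exterior covariant derivative on forms. Put $\delta b=\sum_k dx^k\wedge\partial b/\partial y^k$; put $\delta^-b=\frac1{q+l}\sum_k y^k\,(\partial_{x^k}\llcorner b)$ on components of polynomial degree $q$ and form degree $l$ with $q+l>0$, and $\delta^-b=0$ for $q=l=0$. Let $R$ be the curvature form, $R(u,v)=\frac12\omega\big(y,R^\nabla(u,v)y\big)$,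 which satisfies $\nabla^2b=\frac i\lambda[R,b]$. The symbol map $\sigma$ sends a section of $\widehat{\mathbb W}X$ to its component of polynomial degree $0$. Then, with $r_0=\delta^-R$, there is a unique section $r$ of $\Lambda^1\widehat{\mathbb W}X$ with $\deg r\ge\deg r_0$ and $$r=r_0+\delta^-\Big(\nabla r+\frac i\lambda\,r\circ r\Big).$$ The connection $D=\nabla-\delta+\frac i\lambda[r,\cdot]$ on $\widehat{\mathbb W}X$ is flat, that is, $D^2a=0$ for every section $a$ of $\widehat{\mathbb W}X$. The symbol map restricts to a bijection from the set of flat sections ($Da=0$) of $\widehat{\mathbb W}X$ onto $\mathcal C^\infty(X)[[\lambda]]$; let $Q$ be its inverse. There is a unique $\mathbb C[[\lambda]]$-bilinear map $\star:\mathcal C^\infty(X)[[\lambda]]\times\mathcal C^\infty(X)[[\lambda]]\to\mathcal C^\infty(X)[[\lambda]]$ with $$f\star g=\sigma\big(Q(f)\circ Q(g)\big)\qquad\text{for all } f,g\in\mathcal C^\infty(X),$$ and $\star$ is a star product for $X$: it is associative and, for all $f,g\in\mathcal C^\infty(X)$, 1. $f\star g=\sum_{k\ge 0}\mu_k(f,g)\lambda^k$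 with $\mathbb C$-bilinear maps $\mu_k:\mathcal C^\infty(X)\times\mathcal C^\infty(X)\to\mathcal C^\infty(X)$, and $\mu_0(f,g)=fg$; 2. $f\star g-g\star f-i\lambda\{f,g\}\in\lambda^2\,\mathcal C^\infty(X)[[\lambda]]$ (in particular $\{f,g\}$ is well defined and smooth); 3. $f\star 1=1\star f=f$. -/

import Mathlib

open scoped Manifold ContDiff
open Bundle

universe u v w

noncomputable section

/-! ## Manifolds with compact symmetries -/

/-- Euclidean space, the model of `d`-dimensional manifolds; it is also (definitionally) the type
underlying every tangent space of such a manifold. -/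
abbrev Euc (d : ℕ) : Type := EuclideanSpace ℝ (Fin d)

/-- A smooth (finite dimensional, Hausdorff, second countable) manifold together with a smooth
action of a compact Lie group. -/
structure SymManifold where
  dim : ℕ
  carrier : Type v
  [topology : TopologicalSpace carrier]
  [charted : ChartedSpace (Euc dim) carrier]
  [manifold : IsManifold (𝓡 dim) ∞ carrier]
  [hausdorff : T2Space carrier]
  [secondCountable : SecondCountableTopology carrier]
  groupDim : ℕ
  group : Type w
  [groupStructure : Group group]
  [groupTopology : TopologicalSpace group]
  [groupCharted : ChartedSpace (Euc groupDim) group]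
  [lieGroup : LieGroup (𝓡 groupDim) ∞ group]
  [groupCompact : CompactSpace group]
  [groupHausdorff : T2Space group]
  [action : MulAction group carrier]
  [smoothAction : ContMDiffSMul (𝓡 groupDim) (𝓡 dim) ∞ group carrier]

namespace SymManifold

instance : CoeSort SymManifold.{v, w} (Type v) := ⟨carrier⟩

attribute [instance] topology charted manifold hausdorff secondCountable groupStructure
  groupTopology groupCharted lieGroup groupCompact groupHausdorff action smoothAction

end SymManifold

/-- An open embedding `(φ, ι) : (N, H) → (M, G)` of manifolds with symmetries: `ι` is a continuous
homomorphism and `φ` is an `ι`-equivariant diffeomorphism onto an open submanifold. -/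
structure SymOpenEmbedding (N M : SymManifold.{v, w}) where
  map : N → M
  hom : N.group →* M.group
  hom_continuous : Continuous hom
  equivariant : ∀ (h : N.group) (y : N), map (h • y) = hom h • map y
  localDiffeo : IsLocalDiffeomorph (𝓡 N.dim) (𝓡 M.dim) ∞ map
  injective : Function.Injective map

/-! ## Orbispaces -/

/-- The objects of the category attached to a covering `𝒰`: connected components of finite
intersections `U₁ ∩ ⋯ ∩ Uₖ` (`k ≥ 1`) of elements of `𝒰`. -/
def ChartDomain {X : Type u} [TopologicalSpace X] (𝒰 : Set (Set X)) : Type u :=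
  {V : Set X // ∃ F : Set (Set X), F.Finite ∧ F.Nonempty ∧ F ⊆ 𝒰 ∧
    ∃ x ∈ ⋂₀ F, V = connectedComponentIn (⋂₀ F) x}

/-- An orbispace functor on the topological space `X` (with values in finite dimensional manifolds):
an open covering, and a functor from the category of connected components of finite intersections
(with inclusions as morphisms) to orbispace charts of `X`. -/
structure OrbispaceFunctor (X : Type u) [TopologicalSpace X] where
  cover : Set (Set X)
  cover_isOpen : ∀ U ∈ cover, IsOpen U
  cover_sUnion : ⋃₀ cover = Set.univ
  /-- The domain of the chart, with its symmetry group. -/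
  chart : ChartDomain cover → SymManifold.{v, w}
  connected : ∀ U, ConnectedSpace (chart U)
  /-- The projection `ϱ` of the chart. -/
  proj : ∀ U, chart U → X
  /-- `ϱ` is invariant and induces a homeomorphism from the orbit space onto `U`. -/
  proj_homeo : ∀ U, ∃ h : MulAction.orbitRel.Quotient (chart U).group (chart U) ≃ₜ U.1,
    ∀ x : chart U, ((h (Quotient.mk _ x) : U.1) : X) = proj U x
  /-- The open embedding attached to an inclusion `V ⊆ U`. -/
  trans : ∀ {V U : ChartDomain cover}, V.1 ⊆ U.1 → SymOpenEmbedding (chart V) (chart U)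
  proj_trans : ∀ {V U : ChartDomain cover} (h : V.1 ⊆ U.1) (y : chart V),
    proj U ((trans h).map y) = proj V y
  trans_id_map : ∀ (U : ChartDomain cover) (x : chart U),
    (trans (Set.Subset.refl U.1)).map x = x
  trans_id_hom : ∀ (U : ChartDomain cover) (g : (chart U).group),
    (trans (Set.Subset.refl U.1)).hom g = g
  trans_comp_map : ∀ {W V U : ChartDomain cover} (h : W.1 ⊆ V.1) (k : V.1 ⊆ U.1) (x : chart W),
    (trans (h.trans k)).map x = (trans k).map ((trans h).map x)
  trans_comp_hom : ∀ {W V U : ChartDomain cover} (h : W.1 ⊆ V.1) (k : V.1 ⊆ U.1)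
    (g : (chart W).group), (trans (h.trans k)).hom g = (trans k).hom ((trans h).hom g)

namespace OrbispaceFunctor

variable {X : Type u} [TopologicalSpace X] (S : OrbispaceFunctor.{u, v, w} X)

/-- The index set of the charts. -/
abbrev Index : Type u := ChartDomain S.cover

/-- The algebra `𝒞^∞(X)` of complex valued smooth functions on the orbispace. -/
def smoothFunctions : Subalgebra ℂ (X → ℂ) where
  carrier := {f | Continuous f ∧
    ∀ U : S.Index, ContMDiff (𝓡 (S.chart U).dim) 𝓘(ℝ, ℂ) ∞ (fun x => f (S.proj U x))}
  mul_mem' hf hg := ⟨hf.1.mul hg.1, fun U =>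
    contDiff_mul.contMDiff.comp ((hf.2 U).prodMk_space (hg.2 U))⟩
  add_mem' hf hg := ⟨hf.1.add hg.1, fun U => (hf.2 U).add (hg.2 U)⟩
  algebraMap_mem' _ := ⟨continuous_const, fun _ => contMDiff_const⟩

end OrbispaceFunctor

/-! ## Symplectic forms and connections on a manifold -/

section Manifold

variable {d : ℕ} {M : Type v} [TopologicalSpace M] [ChartedSpace (Euc d) M]
  [IsManifold (𝓡 d) ∞ M]

/-- Smoothness of a (globally defined) vector field. -/
def IsSmoothVF (ξ : ∀ x : M, TangentSpace (𝓡 d) x) : Prop :=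
  ContMDiff (𝓡 d) (𝓡 d).tangent ∞ (fun x => (⟨x, ξ x⟩ : TangentBundle (𝓡 d) M))

/-- A field of bilinear forms on the tangent spaces. -/
abbrev FormField (d : ℕ) (M : Type v) [TopologicalSpace M] [ChartedSpace (Euc d) M] : Type v :=
  ∀ x : M, TangentSpace (𝓡 d) x →L[ℝ] TangentSpace (𝓡 d) x →L[ℝ] ℝ

/-- `Ω` is a symplectic form: smooth, alternating, nondegenerate and closed. -/
structure IsSymplecticForm (Ω : FormField d M) : Prop where
  smooth : ContMDiff (𝓡 d) ((𝓡 d).prod 𝓘(ℝ, Euc d →L[ℝ] Euc d →L[ℝ] ℝ)) ∞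
    (fun x => TotalSpace.mk' (Euc d →L[ℝ] Euc d →L[ℝ] ℝ)
      (E := fun x : M => TangentSpace (𝓡 d) x →L[ℝ] TangentSpace (𝓡 d) x →L[ℝ] ℝ) x (Ω x))
  alternating : ∀ x v, Ω x v v = 0
  nondegenerate : ∀ x v, (∀ w, Ω x v w = 0) → v = 0
  closed : ∀ ξ η ζ : (∀ x : M, TangentSpace (𝓡 d) x), IsSmoothVF ξ → IsSmoothVF η →
    IsSmoothVF ζ → ∀ x,
      mvfderiv (𝓡 d) (fun y => Ω y (η y) (ζ y)) x (ξ x)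
      - mvfderiv (𝓡 d) (fun y => Ω y (ξ y) (ζ y)) x (η x)
      + mvfderiv (𝓡 d) (fun y => Ω y (ξ y) (η y)) x (ζ x)
      - Ω x (VectorField.mlieBracket (𝓡 d) ξ η x) (ζ x)
      + Ω x (VectorField.mlieBracket (𝓡 d) ξ ζ x) (η x)
      - Ω x (VectorField.mlieBracket (𝓡 d) η ζ x) (ξ x) = 0

/-- Affine connections (not necessarily smooth) on the manifold `M`; `∇ η x v` is the covariant
derivative of `η` at `x` in the direction `v`. -/
abbrev AffineConnection (d : ℕ) (M : Type v) [TopologicalSpace M] [ChartedSpace (Euc d) M]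
    [IsManifold (𝓡 d) ∞ M] : Type v :=
  CovariantDerivative (𝓡 d) (Euc d) (fun x : M => TangentSpace (𝓡 d) x)

/-- The connection annihilates `Ω`. -/
def IsParallelForm (cov : AffineConnection d M) (Ω : FormField d M) : Prop :=
  ∀ η ζ : (∀ x : M, TangentSpace (𝓡 d) x), IsSmoothVF η → IsSmoothVF ζ → ∀ x v,
    mvfderiv (𝓡 d) (fun y => Ω y (η y) (ζ y)) x v =
      Ω x (cov η x v) (ζ x) + Ω x (η x) (cov ζ x v)

/-- The standard basis of the tangent space `T_x M = ℝ^d`. -/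
def stdVec (x : M) (i : Fin d) : TangentSpace (𝓡 d) x :=
  (EuclideanSpace.single i (1 : ℝ) : Euc d)

/-- The inverse `(Ω^{ij})` of the matrix `(Ω_{ij})` of the form `Ω_x`. -/
def inverseForm (Ω : FormField d M) (x : M) : Matrix (Fin d) (Fin d) ℝ :=
  (Matrix.of fun i j => Ω x (stdVec x i) (stdVec x j))⁻¹

/-- The Poisson bracket of a symplectic form, `{f, g} = - Ω^{ij} ∂_i f ∂_j g`, i.e.
`{f, g} = Ω (X_f, X_g)` with `Ω (X_f, ·) = df`; for `Ω = ∑ dq_j ∧ dp_j` this is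
`∑ (∂f/∂q_j ∂g/∂p_j - ∂f/∂p_j ∂g/∂q_j)`. -/
def chartPoisson (Ω : FormField d M) (f g : M → ℂ) (x : M) : ℂ :=
  - ∑ i, ∑ j, (inverseForm Ω x i j : ℂ) *
    mvfderiv (𝓡 d) f x (stdVec x i) * mvfderiv (𝓡 d) g x (stdVec x j)

/-- The extension of a tangent vector at `x` to a vector field whose components in the
preferred coordinates around `x` are constant. -/
def extVec (x : M) (v : TangentSpace (𝓡 d) x) : ∀ y : M, TangentSpace (𝓡 d) y :=
  FiberBundle.extend (Euc d) v

/-- The curvature tensor `R(u, v) t = ∇_u ∇_v t - ∇_v ∇_u t - ∇_[u,v] t` of an affine connection. -/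
def curvatureTensor (cov : AffineConnection d M) (x : M) (u v t : TangentSpace (𝓡 d) x) :
    TangentSpace (𝓡 d) x :=
  cov (fun y => cov (extVec x t) y (extVec x v y)) x u
  - cov (fun y => cov (extVec x t) y (extVec x u y)) x v
  - cov (extVec x t) x (VectorField.mlieBracket (𝓡 d) (extVec x u) (extVec x v) x)

end Manifold

/-! ## The formal Weyl algebra -/

/-- The data `(a_{sk})` of an element `∑ a_{sk} λ^k` of the completed formal Weyl algebra of
`ℝ^d`; `a k s : ℝ^d → ℂ` is the component at `λ^k` of degree `s`, which has to be an
`s`-homogeneous polynomial function (see `IsWeylForm`). -/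
abbrev WeylElt (d : ℕ) : Type := ℕ → ℕ → Euc d → ℂ

/-- The Moyal-Weyl product
`a ∘ b = ∑_m (-iλ/2)^m / m! ∑ P^{i₁j₁} ⋯ P^{i_m j_m} ∂_{i₁} ⋯ ∂_{i_m} a · ∂_{j₁} ⋯ ∂_{j_m} b`,
where `P = (Ω^{ij})`; this is `μ ∘ exp (-iλ Π)` for `Π = (1/2) Ω^{ij} ∂_i ⊗ ∂_j`. -/
def moyal {d : ℕ} (P : Matrix (Fin d) (Fin d) ℝ) (a b : WeylElt d) : WeylElt d :=
  fun K S y => ∑ m ∈ Finset.range (K + 1), ∑ k ∈ Finset.HasAntidiagonal.antidiagonal (K - m),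
    ∑ s ∈ Finset.HasAntidiagonal.antidiagonal (S + 2 * m),
      (-Complex.I / 2) ^ m / (m.factorial : ℂ) *
        ∑ I : Fin m → Fin d, ∑ J : Fin m → Fin d, (∏ t, (P (I t) (J t) : ℂ)) *
          iteratedFDeriv ℝ m (a k.1 s.1) y (fun t => EuclideanSpace.single (I t) 1) *
          iteratedFDeriv ℝ m (b k.2 s.2) y (fun t => EuclideanSpace.single (J t) 1)

/-- The operator `(i/λ) [a, b]`, with `[a, b]` the commutator for the Moyal-Weyl product. (The
commutator is divisible by `λ`; division by `λ` is the shift of the `λ`-degree.) -/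
def scaledComm {d : ℕ} (P : Matrix (Fin d) (Fin d) ℝ) (a b : WeylElt d) : WeylElt d :=
  fun K S y => Complex.I * (moyal P a b (K + 1) S y - moyal P b a (K + 1) S y)

/-- The data of an alternating `l`-form on `ℝ^d` with values in the completed formal Weyl algebra:
`a k s y w` is the component at `λ^k` of polynomial degree `s`, evaluated at `y` (polynomial
variable) and at the vectors `w 0, …, w (l-1)` (form variables). -/
abbrev WeylForm (d l : ℕ) : Type := ℕ → ℕ → Euc d → (Fin l → Euc d) → ℂ

/-- The Weyl algebra element obtained by inserting vectors into the form variables. -/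
def WeylForm.eval {d l : ℕ} (a : WeylForm d l) (w : Fin l → Euc d) : WeylElt d :=
  fun k s y => a k s y w

/-- `a` is an element of `Λ^l ⊗ Ŵ`: homogeneous polynomial of degree `s` in `y`, and
alternating multilinear in `w`. -/
structure IsWeylForm {d l : ℕ} (a : WeylForm d l) : Prop where
  polynomial : ∀ k s w, ∃ A : MultilinearMap ℝ (fun _ : Fin s => Euc d) ℂ,
    ∀ y, a k s y w = A (fun _ => y)
  alternating : ∀ k s y, ∃ B : AlternatingMap ℝ (Euc d) ℂ (Fin l), ∀ w, a k s y w = B w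

/-! ## Fedosov's operators on a manifold -/

section Fedosov

variable {d l : ℕ} {M : Type v} [TopologicalSpace M] [ChartedSpace (Euc d) M]
  [IsManifold (𝓡 d) ∞ M]

/-- `a` is a smooth section of the bundle `Λ^l ŴM` over `M` (here `T_x M = ℝ^d`): each `a x` lies
in `Λ^l ⊗ Ŵ (T_x M)`, and inserting smooth vector fields yields smooth functions. -/
structure IsSmoothWeylForm (a : M → WeylForm d l) : Prop where
  isWeylForm : ∀ x, IsWeylForm (a x)
  smooth : ∀ (k s : ℕ) (η : ∀ x : M, TangentSpace (𝓡 d) x)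
    (ζ : Fin l → ∀ x : M, TangentSpace (𝓡 d) x), IsSmoothVF η → (∀ j, IsSmoothVF (ζ j)) →
      ContMDiff (𝓡 d) 𝓘(ℝ, ℂ) ∞ (fun x => a x k s (η x) (fun j => ζ j x))

/-- The exterior covariant derivative `∇` on `Λ^l ŴM` induced by an affine connection: in the
coordinates around `x`, `∇ (∑ b_J dx_J) = ∑ ∇_{∂_j} b_J dx_j ∧ dx_J`, where
`(∇_u b)(η) = u (b (η)) - (d b)(∇_u η)` for polynomial functions `b` on the tangent spaces. -/
def weylNabla (cov : AffineConnection d M) (a : M → WeylForm d l) : M → WeylForm d (l + 1) :=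
  fun x k s y w => ∑ i : Fin (l + 1), (-1 : ℂ) ^ (i : ℕ) *
    (mvfderiv (𝓡 d) (fun z => a z k s (extVec x y z) (fun j => extVec x (w (i.succAbove j)) z))
        x (w i)
      - fderiv ℝ (fun t : Euc d => a x k s t (fun j => w (i.succAbove j))) y
          (cov (extVec x y) x (w i)))

/-- The operator `δ b = ∑ dx_k ∧ ∂b/∂y_k`. -/
def weylDelta (a : M → WeylForm d l) : M → WeylForm d (l + 1) :=
  fun x k s y w => ∑ i : Fin (l + 1), (-1 : ℂ) ^ (i : ℕ) *
    fderiv ℝ (fun t : Euc d => a x k (s + 1) t (fun j => w (i.succAbove j))) y (w i)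

/-- The operator `δ⁻ b = (q + p)⁻¹ ∑ y_k · (∂/∂x_k ⌟ b)` on components `b` of polynomial degree `q`
and form degree `p = l + 1`. -/
def weylDeltaInv (a : M → WeylForm d (l + 1)) : M → WeylForm d l :=
  fun x k s y w => match s with
    | 0 => 0
    | q + 1 => ((q + (l + 1) : ℕ) : ℂ)⁻¹ * a x k q y (Fin.cons y w)

/-- The curvature form `R = (1/4) R_{ijkl} y_i y_j dx_k ∧ dx_l`, `R_{ijkl} = Ω_{im} R^m_{jkl}`,
that is, `R(u, v) = (1/2) Ω(y, R(u, v) y)`. -/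
def weylCurvature (Ω : FormField d M) (cov : AffineConnection d M) : M → WeylForm d 2 :=
  fun x k s y w => if k = 0 ∧ s = 2 then
    (((1 / 2 : ℝ) * Ω x y (curvatureTensor cov x (w 0) (w 1) y) : ℝ) : ℂ) else 0

/-- `(i/λ) [r, b]` for a one-form `r`, with the graded commutator. -/
def weylBracket (Ω : FormField d M) (r : M → WeylForm d 1) (a : M → WeylForm d l) :
    M → WeylForm d (l + 1) :=
  fun x k s y w => ∑ i : Fin (l + 1), (-1 : ℂ) ^ (i : ℕ) *
    scaledComm (inverseForm Ω x) ((r x).eval fun _ => w i)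
      ((a x).eval fun j => w (i.succAbove j)) k s y

/-- `(i/λ) r²` for a one-form `r`; here `r² (u, v) = r(u) ∘ r(v) - r(v) ∘ r(u)`. -/
def weylSquare (Ω : FormField d M) (r : M → WeylForm d 1) : M → WeylForm d 2 :=
  fun x k s y w => scaledComm (inverseForm Ω x) ((r x).eval fun _ => w 0)
    ((r x).eval fun _ => w 1) k s y

/-- The connection `D = ∇ - δ + (i/λ) [r, ·]`. -/
def fedosovD (Ω : FormField d M) (cov : AffineConnection d M) (r : M → WeylForm d 1)
    (a : M → WeylForm d l) : M → WeylForm d (l + 1) :=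
  weylNabla cov a - weylDelta a + weylBracket Ω r a

/-- The fiberwise Moyal-Weyl product of sections of `ŴM`. -/
def weylMul (Ω : FormField d M) (a b : M → WeylForm d 0) : M → WeylForm d 0 :=
  fun x k s y w => moyal (inverseForm Ω x) ((a x).eval w) ((b x).eval w) k s y

end Fedosov

/-! ## Naturality under maps between manifolds -/

section Naturality

variable {d d' l : ℕ} {N : Type v} [TopologicalSpace N] [ChartedSpace (Euc d') N]
  {M : Type v} [TopologicalSpace M] [ChartedSpace (Euc d) M]

/-- `φ^* Ω = Ω'`. -/
def PreservesForm (φ : N → M) (Ω' : FormField d' N) (Ω : FormField d M) : Prop :=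
  ∀ x v w, Ω (φ x) (mfderiv (𝓡 d') (𝓡 d) φ x v) (mfderiv (𝓡 d') (𝓡 d) φ x w) = Ω' x v w

/-- `φ^* a = a'` for `l`-forms with values in the Weyl algebra bundle. -/
def PreservesWeylForm (φ : N → M) (a' : N → WeylForm d' l) (a : M → WeylForm d l) : Prop :=
  ∀ x k s (y : TangentSpace (𝓡 d') x) (w : Fin l → TangentSpace (𝓡 d') x),
    a (φ x) k s (mfderiv (𝓡 d') (𝓡 d) φ x y) (fun j => mfderiv (𝓡 d') (𝓡 d) φ x (w j)) =
      a' x k s y w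

/-- `φ^* ∇ = ∇'` (for a local diffeomorphism `φ`), expressed on pairs of `φ`-related vector
fields. -/
def PreservesConnection [IsManifold (𝓡 d') ∞ N] [IsManifold (𝓡 d) ∞ M] (φ : N → M)
    (cov' : AffineConnection d' N) (cov : AffineConnection d M) : Prop :=
  ∀ (ξ' : ∀ x : N, TangentSpace (𝓡 d') x) (ξ : ∀ x : M, TangentSpace (𝓡 d) x),
    IsSmoothVF ξ' → IsSmoothVF ξ →
    (∀ x, mfderiv (𝓡 d') (𝓡 d) φ x (ξ' x) = ξ (φ x)) →
    ∀ x (v : TangentSpace (𝓡 d') x),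
      mfderiv (𝓡 d') (𝓡 d) φ x (cov' ξ' x v) = cov ξ (φ x) (mfderiv (𝓡 d') (𝓡 d) φ x v)

end Naturality

/-! ## Geometric structures on orbispaces -/

namespace OrbispaceFunctor

variable {X : Type u} [TopologicalSpace X] (S : OrbispaceFunctor.{u, v, w} X)

/-- A symplectic form on an orbispace. -/
structure SymplecticForm where
  form : ∀ U : S.Index, FormField (S.chart U).dim (S.chart U)
  symplectic : ∀ U, IsSymplecticForm (form U)
  invariant : ∀ (U : S.Index) (g : (S.chart U).group),
    PreservesForm (fun x : S.chart U => g • x) (form U) (form U)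
  compatible : ∀ {V U : S.Index} (h : V.1 ⊆ U.1),
    PreservesForm (S.trans h).map (form V) (form U)

/-- A (smooth) connection on an orbispace. -/
structure Connection where
  cov : ∀ U : S.Index, AffineConnection (S.chart U).dim (S.chart U)
  smooth : ∀ U, (cov U).ContMDiffCovariantDerivative ∞
  invariant : ∀ (U : S.Index) (g : (S.chart U).group),
    PreservesConnection (fun x : S.chart U => g • x) (cov U) (cov U)
  compatible : ∀ {V U : S.Index} (h : V.1 ⊆ U.1),
    PreservesConnection (S.trans h).map (cov V) (cov U)

variable {S}

/-- Symplectic connections: torsionfree and with `∇Ω = 0`. -/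
structure Connection.IsSymplectic (nab : S.Connection) (Ω : S.SymplecticForm) : Prop where
  torsionFree : ∀ U, (nab.cov U).torsion = 0
  parallel : ∀ U, IsParallelForm (nab.cov U) (Ω.form U)

variable (S)

/-- A family of fields of `l`-forms with values in the Weyl algebra, one on each chart. -/
abbrev WeylFamily (l : ℕ) : Type max u v :=
  ∀ U : S.Index, S.chart U → WeylForm (S.chart U).dim l

variable {S} {l : ℕ}

/-- The family `a` is a smooth stratified section of the orbibundle `Λ^l ŴX`: a family of smooth
sections over the charts that is equivariant and compatible with the morphisms of charts. -/
structure IsWeylSection (a : S.WeylFamily l) : Prop where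
  smooth : ∀ U, IsSmoothWeylForm (a U)
  equivariant : ∀ (U : S.Index) (g : (S.chart U).group),
    PreservesWeylForm (fun x : S.chart U => g • x) (a U) (a U)
  compatible : ∀ {V U : S.Index} (h : V.1 ⊆ U.1), PreservesWeylForm (S.trans h).map (a V) (a U)

/-- `deg_F a ≥ n`: the component of polynomial degree `s` at `λ^k` vanishes if `s + 2k < n`. -/
def FedosovDegreeGE (n : ℕ) (a : S.WeylFamily l) : Prop :=
  ∀ U x k s y w, s + 2 * k < n → a U x k s y w = 0

/-- `r₀ = δ⁻ R`, with `R` the curvature form of the connection. -/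
def fedosovInit (Ω : S.SymplecticForm) (nab : S.Connection) : S.WeylFamily 1 :=
  fun U => weylDeltaInv (weylCurvature (Ω.form U) (nab.cov U))

/-- `r` is a section of `Λ¹ ŴX` with `deg_F r ≥ deg_F r₀` that solves
`r = r₀ + δ⁻ (∇ r + (i/λ) r²)` for `r₀ = δ⁻ R`. -/
structure IsFedosovForm (Ω : S.SymplecticForm) (nab : S.Connection) (r : S.WeylFamily 1) :
    Prop where
  isSection : IsWeylSection r
  degree : ∀ n, FedosovDegreeGE n (fedosovInit Ω nab) → FedosovDegreeGE n r
  equation : ∀ U, r U = fedosovInit Ω nab U +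
    weylDeltaInv (weylNabla (nab.cov U) (r U) + weylSquare (Ω.form U) (r U))

/-- Fedosov's connection `D = ∇ - δ + (i/λ) [r, ·]` on forms with values in `ŴX`. -/
def connD (Ω : S.SymplecticForm) (nab : S.Connection) (r : S.WeylFamily 1) (a : S.WeylFamily l) :
    S.WeylFamily (l + 1) :=
  fun U => fedosovD (Ω.form U) (nab.cov U) (r U) (a U)

/-- The fiberwise product `a ∘ b` on sections of `ŴX`. -/
def circ (Ω : S.SymplecticForm) (a b : S.WeylFamily 0) : S.WeylFamily 0 :=
  fun U => weylMul (Ω.form U) (a U) (b U)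

/-- The flat sections: sections `a` of `ŴX` with `D a = 0`. -/
def IsFlatSection (Ω : S.SymplecticForm) (nab : S.Connection) (r : S.WeylFamily 1)
    (a : S.WeylFamily 0) : Prop :=
  IsWeylSection a ∧ connD Ω nab r a = 0

/-- `σ(a) = f`, with `σ` the symbol map: over each chart, the component of polynomial degree zero
of `a` is `f`. -/
def HasSymbol (a : S.WeylFamily 0) (f : PowerSeries S.smoothFunctions) : Prop :=
  ∀ (U : S.Index) (x : S.chart U) (k : ℕ) (y : Euc (S.chart U).dim) (w : Fin 0 → _),
    a U x k 0 y w = (PowerSeries.coeff k f : S.smoothFunctions).1 (S.proj U x)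

/-- `h = {f, g}`, the Poisson bracket on `𝒞^∞(X)` computed in the charts. -/
def IsPoissonBracket (Ω : S.SymplecticForm) (f g h : S.smoothFunctions) : Prop :=
  ∀ (U : S.Index) (x : S.chart U), h.1 (S.proj U x) =
    chartPoisson (Ω.form U) (fun z => f.1 (S.proj U z)) (fun z => g.1 (S.proj U z)) x

/-- `ℂ⟦λ⟧`-bilinear maps `𝒞^∞(X)⟦λ⟧ × 𝒞^∞(X)⟦λ⟧ → 𝒞^∞(X)⟦λ⟧`. -/
abbrev FormalProduct (S : OrbispaceFunctor.{u, v, w} X) : Type u :=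
  PowerSeries S.smoothFunctions →ₗ[PowerSeries ℂ]
    PowerSeries S.smoothFunctions →ₗ[PowerSeries ℂ] PowerSeries S.smoothFunctions

/-- Star products (formal deformation quantizations) of `𝒞^∞(X)`. -/
structure IsStarProduct (Ω : S.SymplecticForm) (star : S.FormalProduct) : Prop where
  assoc : ∀ F G H, star (star F G) H = star F (star G H)
  deformation : ∃ μ : ℕ → S.smoothFunctions →ₗ[ℂ] S.smoothFunctions →ₗ[ℂ] S.smoothFunctions,
    (∀ f g, star (PowerSeries.C f) (PowerSeries.C g) = PowerSeries.mk fun k => μ k f g) ∧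
    ∀ f g, μ 0 f g = f * g
  commutator : ∀ f g : S.smoothFunctions, ∃ h, IsPoissonBracket Ω f g h ∧
    PowerSeries.X ^ 2 ∣ star (PowerSeries.C f) (PowerSeries.C g)
      - star (PowerSeries.C g) (PowerSeries.C f) - PowerSeries.X * PowerSeries.C (Complex.I • h)
  unit : ∀ f : S.smoothFunctions, star (PowerSeries.C f) 1 = PowerSeries.C f ∧
    star 1 (PowerSeries.C f) = PowerSeries.C f

end OrbispaceFunctor

end

open OrbispaceFunctor

/-!
Fedosov's construction is local and natural: it uses only the symplectic form and the connection. It is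
carried out in coordinate charts, where it becomes algebra, and its naturality makes the results
invariant under the groups and the transition maps of the orbispace.

*Local algebra.* The functions on the tangent bundle of a coordinate domain form a commutative algebra
with derivations in the base and fibre directions (`MoyalData`, `ConnectionData`). The Moyal-Weyl
product is the exponential of a bidifferential operator with constant coefficients along the fibres,
and it is associative since the operators that act on the three pairs of factors of a triple product
commute (`sum_bidiff_assoc`, `gradedMul_assoc`). The commutator is divisible by `λ`; the quotient is
the bracket `br`. The connection acts by derivations of the product, and its curvature is the bracket
with the form `R` (`bidiff_curvForm`). Fedosov's connection `D = ∇ - δ + (i/λ) [r, ·]` therefore has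
as its square the bracket with a total curvature, which is closed by the Bianchi identities
(`bianchi_totalCurv`). If `r` is a fixed point of `r ↦ r₀ + δ⁻ (∇ r + (i/λ) r ∘ r)`, then `δ⁻` kills the
total curvature. A closed form killed by `δ⁻` vanishes, because the operator `δ` is the part of `D` of
lowest degree: `eq_zero_of_closed_two` gives flatness (`totalCurv_eq_zero`), and `eq_zero_of_closed_one`
shows that fixed points of `a ↦ f + δ⁻ (∇ a + (i/λ) [r, a])` are flat (`totalD_eq_zero`). In the same way
a flat section with vanishing symbol is zero (`eq_zero_of_totalD`).

*From charts to manifolds.* The relations `Rep0`, `Rep1`, `Rep2` say that a form on a manifold has given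
components in a chart. All operators of the construction are compatible with them (for instance
`Rep1.weylNabla`, `Rep1.weylBracket`, `Rep2.weylDeltaInv`, `rep2_weylCurvature`), so that the algebraic
statements hold on symplectic manifolds (`fedosovD_fedosovD`, `fedosovD_eq_zero_of_fixed`,
`eq_of_fedosovD`).

*From manifolds to orbispaces.* Group elements and transition maps are local diffeomorphisms that
preserve the form and the connection (`IsFedosovMap`), and the operators of the construction are natural
for them. Both maps `fedosovStep` and `liftStep` thus act on sections of the orbibundle. They are
contractions for the degree filtration, which is complete, so each has a unique fixed point
(`existsUnique_fixed`). This gives the form `r` and the flat section with a given symbol. Conversely,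
the symbol of a section descends to the orbispace (`exists_smoothFunctions`).

*The star product.* Products of flat sections are flat, so the lift of a star product is the product
of the lifts (`flatLift_starSeries`), whence associativity. Additivity and compatibility with complex
scalars and with `λ` imply linearity over `ℂ[[λ]]` (`powerSeries_map_smul`), and a bilinear map is
determined by its values on functions (`powerSeries_bilinear_ext`). Finally, the linear part of the flat
section with symbol `f` is the differential of `f` (`fderiv_eq_of_flat`); hence the commutator is, to
first order in `λ`, the Poisson bracket (`weylMul_sub_weylMul`).
-/

noncomputable section

namespace Fedosov
open Finset

/-! ### Bidifferential operators -/

section Bidifferential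

variable {ι A : Type*} [Fintype ι] [CommRing A] [Algebra ℂ A]

/-- The `m`-th power of the bidifferential operator `∑ P i j · ∂ᵢ ⊗ ∂ⱼ`, followed by the
multiplication. -/
def bidiff (d : ι → Derivation ℂ A A) (P : ι → ι → A) : ℕ → A → A → A
  | 0, a, b => a * b
  | m + 1, a, b => ∑ i, ∑ j, P i j * bidiff d P m (d i a) (d j b)

variable (d : ι → Derivation ℂ A A) (P : ι → ι → A)

@[simp] lemma bidiff_zero (a b : A) : bidiff d P 0 a b = a * b := rfl

lemma bidiff_succ (m : ℕ) (a b : A) :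
    bidiff d P (m + 1) a b = ∑ i, ∑ j, P i j * bidiff d P m (d i a) (d j b) := rfl

lemma bidiff_add_left (m : ℕ) (a a' b : A) :
    bidiff d P m (a + a') b = bidiff d P m a b + bidiff d P m a' b := by
  induction m generalizing a a' b with
  | zero => simp [add_mul]
  | succ m ih => simp only [bidiff_succ, map_add, ih, mul_add, sum_add_distrib]

lemma bidiff_add_right (m : ℕ) (a b b' : A) :
    bidiff d P m a (b + b') = bidiff d P m a b + bidiff d P m a b' := by
  induction m generalizing a b b' with
  | zero => simp [mul_add]
  | succ m ih => simp only [bidiff_succ, map_add, ih, mul_add, sum_add_distrib]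

lemma bidiff_smul_left (m : ℕ) (c : ℂ) (a b : A) :
    bidiff d P m (c • a) b = c • bidiff d P m a b := by
  induction m generalizing a b with
  | zero => simp
  | succ m ih => simp only [bidiff_succ, Derivation.map_smul, ih, mul_smul_comm, smul_sum]

lemma bidiff_smul_right (m : ℕ) (c : ℂ) (a b : A) :
    bidiff d P m a (c • b) = c • bidiff d P m a b := by
  induction m generalizing a b with
  | zero => simp
  | succ m ih => simp only [bidiff_succ, Derivation.map_smul, ih, mul_smul_comm, smul_sum]

/-- `bidiff` as a bilinear map. -/
def bidiffL (m : ℕ) : A →ₗ[ℂ] A →ₗ[ℂ] A :=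
  LinearMap.mk₂ ℂ (bidiff d P m) (bidiff_add_left d P m) (bidiff_smul_left d P m)
    (bidiff_add_right d P m) (bidiff_smul_right d P m)

lemma bidiffL_apply (m : ℕ) (a b : A) : bidiffL d P m a b = bidiff d P m a b := rfl

@[simp] lemma bidiff_zero_left (m : ℕ) (b : A) : bidiff d P m 0 b = 0 := by
  simp [← bidiffL_apply]

@[simp] lemma bidiff_zero_right (m : ℕ) (a : A) : bidiff d P m a 0 = 0 := by
  simp [← bidiffL_apply]

lemma bidiff_sum_left {κ : Type*} (m : ℕ) (s : Finset κ) (f : κ → A) (b : A) :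
    bidiff d P m (∑ i ∈ s, f i) b = ∑ i ∈ s, bidiff d P m (f i) b := by
  simp [← bidiffL_apply, LinearMap.sum_apply]

lemma bidiff_sum_right {κ : Type*} (m : ℕ) (s : Finset κ) (a : A) (f : κ → A) :
    bidiff d P m a (∑ i ∈ s, f i) = ∑ i ∈ s, bidiff d P m a (f i) := by
  simp [← bidiffL_apply]

variable {d P}

lemma bidiff_const_mul_left {c : A} (hc : ∀ i, d i c = 0) (m : ℕ) (a b : A) :
    bidiff d P m (c * a) b = c * bidiff d P m a b := by
  induction m generalizing a b with
  | zero => simp [mul_assoc]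
  | succ m ih =>
    simp only [bidiff_succ, Derivation.leibniz, hc, mul_zero, add_zero, smul_eq_mul, ih, mul_sum]
    exact sum_congr rfl fun i _ => sum_congr rfl fun j _ => by ring

lemma bidiff_const_mul_right {c : A} (hc : ∀ i, d i c = 0) (m : ℕ) (a b : A) :
    bidiff d P m a (c * b) = c * bidiff d P m a b := by
  induction m generalizing a b with
  | zero => simp; ring
  | succ m ih =>
    simp only [bidiff_succ, Derivation.leibniz, hc, mul_zero, add_zero, smul_eq_mul, ih, mul_sum]
    exact sum_congr rfl fun i _ => sum_congr rfl fun j _ => by ring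

/-- A derivation `X` whose commutators with the `∂ᵢ` are compensated by its action on `P` (as it is
for a covariant derivative that annihilates the Poisson tensor) is a derivation of `bidiff`. -/
lemma bidiff_leibniz (X : Derivation ℂ A A) (g : ι → ι → A) (hg : ∀ k i j, d k (g i j) = 0)
    (hX : ∀ i a, X (d i a) = d i (X a) + ∑ l, g l i * d l a)
    (hP : ∀ i j, X (P i j) = - ∑ l, (g i l * P l j + g j l * P i l)) (m : ℕ) (a b : A) :
    X (bidiff d P m a b) = bidiff d P m (X a) b + bidiff d P m a (X b) := by
  induction m generalizing a b with
  | zero => simp [add_comm, mul_comm]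
  | succ m ih =>
    have h1 : ∑ i, ∑ j, (∑ l, g i l * P l j) * bidiff d P m (d i a) (d j b) =
        ∑ i, ∑ j, P i j * ∑ l, g l i * bidiff d P m (d l a) (d j b) := by
      simp only [sum_mul, mul_sum]
      calc _ = ∑ i, ∑ l, ∑ j, g i l * P l j * bidiff d P m (d i a) (d j b) :=
            sum_congr rfl fun i _ => sum_comm
        _ = ∑ l, ∑ i, ∑ j, g i l * P l j * bidiff d P m (d i a) (d j b) := sum_comm
        _ = ∑ l, ∑ j, ∑ i, g i l * P l j * bidiff d P m (d i a) (d j b) :=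
            sum_congr rfl fun i _ => sum_comm
        _ = _ := sum_congr rfl fun i _ => sum_congr rfl fun j _ => sum_congr rfl fun l _ => by ring
    have h2 : ∑ i, ∑ j, (∑ l, g j l * P i l) * bidiff d P m (d i a) (d j b) =
        ∑ i, ∑ j, P i j * ∑ l, g l j * bidiff d P m (d i a) (d l b) := by
      simp only [sum_mul, mul_sum]
      refine sum_congr rfl fun i _ => ?_
      rw [sum_comm]
      exact sum_congr rfl fun j _ => sum_congr rfl fun l _ => by ring
    have e : ∀ i j, X (P i j * bidiff d P m (d i a) (d j b)) =
        P i j * bidiff d P m (d i (X a)) (d j b) + P i j * bidiff d P m (d i a) (d j (X b))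
        + P i j * (∑ l, g l i * bidiff d P m (d l a) (d j b))
        + P i j * (∑ l, g l j * bidiff d P m (d i a) (d l b))
        - (∑ l, g i l * P l j) * bidiff d P m (d i a) (d j b)
        - (∑ l, g j l * P i l) * bidiff d P m (d i a) (d j b) := by
      intro i j
      have h3 : bidiff d P m (X (d i a)) (d j b) = bidiff d P m (d i (X a)) (d j b)
          + ∑ l, g l i * bidiff d P m (d l a) (d j b) := by
        rw [hX, bidiff_add_left, bidiff_sum_left]
        simp only [bidiff_const_mul_left (fun k => hg k _ _)]
      have h4 : bidiff d P m (d i a) (X (d j b)) = bidiff d P m (d i a) (d j (X b))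
          + ∑ l, g l j * bidiff d P m (d i a) (d l b) := by
        rw [hX, bidiff_add_right, bidiff_sum_right]
        simp only [bidiff_const_mul_right (fun k => hg k _ _)]
      rw [Derivation.leibniz, ih, h3, h4, hP]
      simp only [smul_eq_mul, sum_add_distrib]
      ring
    simp only [bidiff_succ, map_sum, e, sum_add_distrib, sum_sub_distrib, h1, h2]
    ring

lemma bidiff_symm (hP : ∀ i j, P j i = - P i j) (m : ℕ) (a b : A) :
    bidiff d P m b a = (-1) ^ m * bidiff d P m a b := by
  induction m generalizing a b with
  | zero => simp [mul_comm]
  | succ m ih =>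
    rw [bidiff_succ, sum_comm, bidiff_succ, mul_sum]
    refine sum_congr rfl fun i _ => ?_
    rw [mul_sum]
    refine sum_congr rfl fun j _ => ?_
    rw [ih, hP]
    ring

/-- Naturality of `bidiff` under ring homomorphisms that intertwine the derivations up to a constant
matrix `L`. -/
lemma map_bidiff {ι' A' : Type*} [Fintype ι'] [CommRing A'] [Algebra ℂ A']
    {d' : ι' → Derivation ℂ A' A'} {P' : ι' → ι' → A'} (Φ : A →ₐ[ℂ] A') (L : ι → ι' → ℂ)
    (hd : ∀ i' a, d' i' (Φ a) = ∑ i, L i i' • Φ (d i a))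
    (hP : ∀ i j, Φ (P i j) = ∑ i', ∑ j', (L i i' * L j j') • P' i' j') (m : ℕ) (a b : A) :
    Φ (bidiff d P m a b) = bidiff d' P' m (Φ a) (Φ b) := by
  induction m generalizing a b with
  | zero => simp
  | succ m ih =>
    have e : ∀ i' j', P' i' j' * bidiff d' P' m (d' i' (Φ a)) (d' j' (Φ b)) =
        ∑ i, ∑ j, (L i i' * L j j') • P' i' j' * bidiff d' P' m (Φ (d i a)) (Φ (d j b)) := by
      intro i' j'
      rw [hd, hd, bidiff_sum_left, mul_sum]
      refine sum_congr rfl fun i _ => ?_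
      rw [bidiff_smul_left, bidiff_sum_right, smul_sum, mul_sum]
      refine sum_congr rfl fun j _ => ?_
      rw [bidiff_smul_right, smul_smul, mul_smul_comm, smul_mul_assoc]
    simp only [bidiff_succ, map_sum, map_mul, hP, ih, e, sum_mul]
    calc _ = ∑ i, ∑ i', ∑ j, ∑ j', (L i i' * L j j') • P' i' j' *
            bidiff d' P' m (Φ (d i a)) (Φ (d j b)) := sum_congr rfl fun i _ => sum_comm
      _ = ∑ i', ∑ i, ∑ j, ∑ j', (L i i' * L j j') • P' i' j' *
            bidiff d' P' m (Φ (d i a)) (Φ (d j b)) := sum_comm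
      _ = ∑ i', ∑ i, ∑ j', ∑ j, (L i i' * L j j') • P' i' j' *
            bidiff d' P' m (Φ (d i a)) (Φ (d j b)) :=
          sum_congr rfl fun i _ => sum_congr rfl fun j _ => sum_comm
      _ = _ := sum_congr rfl fun i _ => sum_comm

end Bidifferential

section Associativity

variable {ι A : Type*} [Fintype ι] [CommRing A] [Algebra ℂ A]
  (d : ι → Derivation ℂ A A) (P : ι → ι → A)

/-- The bidifferential operator acting on the first two slots of a three-slot operator. -/
def slot12 : Module.End ℂ (A → A → A → A) where
  toFun τ a b c := ∑ p : ι × ι, P p.1 p.2 * τ (d p.1 a) (d p.2 b) c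
  map_add' _ _ := by ext; simp [mul_add, sum_add_distrib]
  map_smul' _ _ := by ext; simp [smul_sum]

/-- The bidifferential operator acting on the first and the third slot. -/
def slot13 : Module.End ℂ (A → A → A → A) where
  toFun τ a b c := ∑ p : ι × ι, P p.1 p.2 * τ (d p.1 a) b (d p.2 c)
  map_add' _ _ := by ext; simp [mul_add, sum_add_distrib]
  map_smul' _ _ := by ext; simp [smul_sum]

/-- The bidifferential operator acting on the last two slots. -/
def slot23 : Module.End ℂ (A → A → A → A) where
  toFun τ a b c := ∑ p : ι × ι, P p.1 p.2 * τ a (d p.1 b) (d p.2 c)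
  map_add' _ _ := by ext; simp [mul_add, sum_add_distrib]
  map_smul' _ _ := by ext; simp [smul_sum]

variable {d P} (hd : ∀ i j a, d i (d j a) = d j (d i a)) (hP : ∀ k i j, d k (P i j) = 0)

include hd in
lemma slot_commute12_13 : Commute (slot12 d P) (slot13 d P) := by
  ext τ a b c
  simp only [Module.End.mul_apply, slot12, slot13, LinearMap.coe_mk, AddHom.coe_mk, mul_sum]
  rw [sum_comm]
  exact sum_congr rfl fun p _ => sum_congr rfl fun q _ => by rw [hd p.1 q.1]; ring

include hd in
lemma slot_commute12_23 : Commute (slot12 d P) (slot23 d P) := by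
  ext τ a b c
  simp only [Module.End.mul_apply, slot12, slot23, LinearMap.coe_mk, AddHom.coe_mk, mul_sum]
  rw [sum_comm]
  exact sum_congr rfl fun p _ => sum_congr rfl fun q _ => by rw [hd p.1 q.2]; ring

include hd in
lemma slot_commute13_23 : Commute (slot13 d P) (slot23 d P) := by
  ext τ a b c
  simp only [Module.End.mul_apply, slot13, slot23, LinearMap.coe_mk, AddHom.coe_mk, mul_sum]
  rw [sum_comm]
  exact sum_congr rfl fun p _ => sum_congr rfl fun q _ => by rw [hd p.2 q.2]; ring

include hd hP in
lemma bidiff_deriv (k : ι) (m : ℕ) (a b : A) :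
    d k (bidiff d P m a b) = bidiff d P m (d k a) b + bidiff d P m a (d k b) :=
  bidiff_leibniz (d k) (fun _ _ => 0) (by simp) (fun i a => by simp [hd k i a])
    (by simp [hP]) m a b

include hd hP in
/-- An iterated product is a word in the commuting operators `slot12`, `slot13`, `slot23`, applied to
the triple product: the outer operator meets each of the two inner factors by the Leibniz rule. -/
lemma bidiff_bidiff_left (m n : ℕ) :
    (fun a b c => bidiff d P m (bidiff d P n a b) c) =
      ((slot13 d P + slot23 d P) ^ m * slot12 d P ^ n) (fun a b c => a * b * c) := by
  induction m with
  | zero =>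
    induction n with
    | zero => rfl
    | succ n ih =>
      rw [pow_zero, one_mul] at ih ⊢
      rw [pow_succ', Module.End.mul_apply, ← ih]
      ext a b c
      simp only [slot12, LinearMap.coe_mk, AddHom.coe_mk, bidiff_zero, bidiff_succ, sum_mul,
        Fintype.sum_prod_type, mul_assoc]
  | succ m ih =>
    rw [pow_succ', mul_assoc, Module.End.mul_apply, ← ih]
    ext a b c
    simp only [slot13, slot23, LinearMap.add_apply, Pi.add_apply, LinearMap.coe_mk, AddHom.coe_mk,
      ← sum_add_distrib, ← mul_add, Fintype.sum_prod_type]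
    rw [bidiff_succ]
    simp only [bidiff_deriv hd hP, bidiff_add_left]

include hd hP in
lemma bidiff_bidiff_right (m n : ℕ) :
    (fun a b c => bidiff d P m a (bidiff d P n b c)) =
      ((slot12 d P + slot13 d P) ^ m * slot23 d P ^ n) (fun a b c => a * b * c) := by
  induction m with
  | zero =>
    induction n with
    | zero => ext a b c; simp [mul_assoc]
    | succ n ih =>
      rw [pow_zero, one_mul] at ih ⊢
      rw [pow_succ', Module.End.mul_apply, ← ih]
      ext a b c
      simp only [slot23, LinearMap.coe_mk, AddHom.coe_mk, bidiff_zero, bidiff_succ, mul_sum,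
        Fintype.sum_prod_type]
      exact sum_congr rfl fun i _ => sum_congr rfl fun j _ => by ring
  | succ m ih =>
    rw [pow_succ', mul_assoc, Module.End.mul_apply, ← ih]
    ext a b c
    simp only [slot12, slot13, LinearMap.add_apply, Pi.add_apply, LinearMap.coe_mk, AddHom.coe_mk,
      ← sum_add_distrib, ← mul_add, Fintype.sum_prod_type]
    rw [bidiff_succ]
    simp only [bidiff_deriv hd hP, bidiff_add_right]

/-- The coefficient of the `m`-th bidifferential operator in the Moyal-Weyl product. -/
def moyalCoeff (m : ℕ) : ℂ := (-Complex.I / 2) ^ m / (m.factorial : ℂ)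

lemma moyalCoeff_mul_moyalCoeff {m n N : ℕ} (h : m + n = N) :
    moyalCoeff m * moyalCoeff n = moyalCoeff N * (N.choose m : ℂ) := by
  subst h
  have h1 : ((m + n).choose m : ℂ) = ((m + n).factorial : ℂ) / (m.factorial * n.factorial) := by
    rw [Nat.cast_add_choose]
  have := Nat.cast_ne_zero (R := ℂ).2 (Nat.factorial_ne_zero (m + n))
  rw [h1, moyalCoeff, moyalCoeff, moyalCoeff, pow_add]
  field_simp

include hd hP in
/-- Associativity of the exponential product, order by order: both sides are the `N`-th term of
`exp (Π₁₂ + Π₁₃ + Π₂₃)` applied to `a ⊗ b ⊗ c`. -/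
lemma sum_bidiff_assoc (N : ℕ) (a b c : A) :
    ∑ m ∈ antidiagonal N, moyalCoeff m.1 • bidiff d P m.1 (moyalCoeff m.2 • bidiff d P m.2 a b) c =
    ∑ m ∈ antidiagonal N,
      moyalCoeff m.1 • bidiff d P m.1 a (moyalCoeff m.2 • bidiff d P m.2 b c) := by
  have key : ∀ x y : Module.End ℂ (A → A → A → A), Commute x y →
      ∑ m ∈ antidiagonal N, (moyalCoeff m.1 * moyalCoeff m.2) • (x ^ m.1 * y ^ m.2) =
        moyalCoeff N • (x + y) ^ N := by
    intro x y h
    rw [h.add_pow', smul_sum]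
    refine sum_congr rfl fun m hm => ?_
    rw [moyalCoeff_mul_moyalCoeff (mem_antidiagonal.1 hm), mul_smul, Nat.cast_smul_eq_nsmul]
  have hL := key (slot13 d P + slot23 d P) (slot12 d P)
    ((slot_commute12_13 hd).symm.add_left (slot_commute12_23 hd).symm)
  have hR := key (slot12 d P + slot13 d P) (slot23 d P)
    ((slot_commute12_23 hd).add_left (slot_commute13_23 hd))
  rw [show slot13 d P + slot23 d P + slot12 d P = slot12 d P + slot13 d P + slot23 d P by abel,
    ← hR] at hL
  have := congrFun (congrFun (congrFun (LinearMap.congr_fun hL (fun a b c => a * b * c)) a) b) c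
  simp only [LinearMap.sum_apply, LinearMap.smul_apply, ← bidiff_bidiff_left hd hP,
    ← bidiff_bidiff_right hd hP, Finset.sum_apply, Pi.smul_apply] at this
  simpa only [bidiff_smul_left, bidiff_smul_right, smul_smul] using this

end Associativity

/-! ### The Moyal-Weyl product on graded families -/

section GradedProduct

variable {ι A : Type*} [Fintype ι] [CommRing A] [Algebra ℂ A]

/-- The Moyal-Weyl product of families `a k s`, the component at `λ ^ k` of polynomial degree `s`. -/
def gradedMul (d : ι → Derivation ℂ A A) (P : ι → ι → A) (a b : ℕ → ℕ → A) : ℕ → ℕ → A :=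
  fun K S => ∑ m ∈ range (K + 1), ∑ k ∈ antidiagonal (K - m), ∑ s ∈ antidiagonal (S + 2 * m),
    moyalCoeff m • bidiff d P m (a k.1 s.1) (b k.2 s.2)

/-- The fibrewise data entering the Moyal-Weyl product: commuting derivations `∂ᵢ` with coordinates
`yᵢ`, and a bivector `P` with coefficients killed by the `∂ᵢ`. The last condition says that the
Euler operator `∑ yᵢ ∂ᵢ` has no eigenvectors of negative integer degree. -/
structure MoyalData (ι A : Type*) [Fintype ι] [DecidableEq ι] [CommRing A] [Algebra ℂ A] where
  /-- the fibre derivations `∂ᵢ` -/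
  d : ι → Derivation ℂ A A
  /-- the fibre coordinates -/
  y : ι → A
  /-- the Poisson tensor -/
  P : ι → ι → A
  d_comm : ∀ i j a, d i (d j a) = d j (d i a)
  d_y : ∀ i j, d i (y j) = if i = j then 1 else 0
  d_P : ∀ k i j, d k (P i j) = 0
  eq_zero_of_euler_neg : ∀ (n : ℕ) (a : A),
    ∑ i, y i * d i a = -((n + 1 : ℕ) : ℂ) • a → a = 0

variable [DecidableEq ι]

namespace MoyalData

variable (𝔐 : MoyalData ι A)

/-- The Euler operator `∑ yᵢ ∂ᵢ`. -/
def euler : Derivation ℂ A A := ∑ i, 𝔐.y i • 𝔐.d i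

lemma euler_apply (a : A) : 𝔐.euler a = ∑ i, 𝔐.y i * 𝔐.d i a := by
  rw [euler]
  have : ∀ s : Finset ι, (∑ i ∈ s, 𝔐.y i • 𝔐.d i : Derivation ℂ A A) a =
      ∑ i ∈ s, 𝔐.y i * 𝔐.d i a := by
    intro s
    classical
    induction s using Finset.induction_on with
    | empty => simp
    | insert i s hi ih => rw [sum_insert hi, sum_insert hi, Derivation.add_apply, ih]; simp
  exact this univ

/-- `a` is homogeneous of polynomial degree `s ∈ ℤ`. -/
def IsHomog (s : ℤ) (a : A) : Prop := 𝔐.euler a = (s : ℂ) • a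

variable {𝔐}

lemma IsHomog.eq_zero {s : ℤ} {a : A} (h : 𝔐.IsHomog s a) (hs : s < 0) : a = 0 := by
  obtain ⟨n, rfl⟩ : ∃ n : ℕ, s = -((n + 1 : ℕ) : ℤ) := ⟨(-s - 1).toNat, by omega⟩
  refine 𝔐.eq_zero_of_euler_neg n a ?_
  rw [← euler_apply, h]
  simp

lemma IsHomog.add {s : ℤ} {a b : A} (ha : 𝔐.IsHomog s a) (hb : 𝔐.IsHomog s b) :
    𝔐.IsHomog s (a + b) := by
  simp only [IsHomog, map_add] at *; rw [ha, hb, smul_add]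

lemma IsHomog.zero (s : ℤ) : 𝔐.IsHomog s 0 := by simp [IsHomog]

lemma IsHomog.smul {s : ℤ} {a : A} (c : ℂ) (ha : 𝔐.IsHomog s a) : 𝔐.IsHomog s (c • a) := by
  simp only [IsHomog, Derivation.map_smul] at *; rw [ha, smul_comm]

lemma IsHomog.sum {κ : Type*} {s : ℤ} (t : Finset κ) {f : κ → A}
    (h : ∀ i ∈ t, 𝔐.IsHomog s (f i)) : 𝔐.IsHomog s (∑ i ∈ t, f i) := by
  simp only [IsHomog, map_sum] at *
  rw [smul_sum]; exact sum_congr rfl h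

lemma IsHomog.mul {s t : ℤ} {a b : A} (ha : 𝔐.IsHomog s a) (hb : 𝔐.IsHomog t b) :
    𝔐.IsHomog (s + t) (a * b) := by
  simp only [IsHomog, Derivation.leibniz] at *
  rw [ha, hb]; simp only [smul_eq_mul, mul_smul_comm, Int.cast_add, add_smul]
  rw [mul_comm b a, add_comm]

lemma euler_d (k : ι) (a : A) : 𝔐.euler (𝔐.d k a) = 𝔐.d k (𝔐.euler a) - 𝔐.d k a := by
  simp only [euler_apply, map_sum, Derivation.leibniz, d_y, smul_eq_mul, sum_add_distrib,
    𝔐.d_comm k, mul_ite, mul_one, mul_zero, sum_ite_eq, mem_univ, if_true]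
  ring

lemma IsHomog.d {s : ℤ} {a : A} (ha : 𝔐.IsHomog s a) (k : ι) :
    𝔐.IsHomog (s - 1) (𝔐.d k a) := by
  rw [IsHomog, euler_d, ha]
  simp [sub_smul]

lemma isHomog_zero_of_const {a : A} (h : ∀ i, 𝔐.d i a = 0) : 𝔐.IsHomog 0 a := by
  simp [IsHomog, euler_apply, h]

lemma IsHomog.const_mul {s : ℤ} {c a : A} (hc : ∀ i, 𝔐.d i c = 0) (ha : 𝔐.IsHomog s a) :
    𝔐.IsHomog s (c * a) := by
  simpa using (isHomog_zero_of_const hc).mul ha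

lemma isHomog_y (i : ι) : 𝔐.IsHomog 1 (𝔐.y i) := by
  simp [IsHomog, euler_apply, d_y]

lemma IsHomog.bidiff {s t : ℤ} {a b : A} (m : ℕ) (ha : 𝔐.IsHomog s a) (hb : 𝔐.IsHomog t b) :
    𝔐.IsHomog (s + t - 2 * m) (bidiff 𝔐.d 𝔐.P m a b) := by
  induction m generalizing a b s t with
  | zero => simpa using ha.mul hb
  | succ m ih =>
    rw [bidiff_succ]
    refine IsHomog.sum _ fun i _ => IsHomog.sum _ fun j _ =>
      IsHomog.const_mul (fun k => 𝔐.d_P k i j) ?_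
    have := ih (ha.d i) (hb.d j)
    convert this using 1; push_cast; ring

lemma bidiff_eq_zero_left {s : ℤ} {a : A} {m : ℕ} (ha : 𝔐.IsHomog s a) (h : s < m) (b : A) :
    Fedosov.bidiff 𝔐.d 𝔐.P m a b = 0 := by
  induction m generalizing a b s with
  | zero => rw [ha.eq_zero (by simpa using h)]; simp
  | succ m ih =>
    rw [bidiff_succ]
    exact sum_eq_zero fun i _ => sum_eq_zero fun j _ => by
      rw [ih (ha.d i) (by push_cast at h; omega), mul_zero]

lemma bidiff_eq_zero_right {t : ℤ} {b : A} {m : ℕ} (hb : 𝔐.IsHomog t b) (h : t < m) (a : A) :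
    Fedosov.bidiff 𝔐.d 𝔐.P m a b = 0 := by
  induction m generalizing a b t with
  | zero => rw [hb.eq_zero (by simpa using h)]; simp
  | succ m ih =>
    rw [bidiff_succ]
    exact sum_eq_zero fun i _ => sum_eq_zero fun j _ => by
      rw [ih (hb.d j) (by push_cast at h; omega), mul_zero]

variable (𝔐) in
/-- The homogeneous families: `a k s` is of polynomial degree `s`. -/
def weyl : Submodule ℂ (ℕ → ℕ → A) where
  carrier := {a | ∀ k s : ℕ, 𝔐.IsHomog s (a k s)}
  add_mem' ha hb k s := (ha k s).add (hb k s)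
  zero_mem' _ _ := IsHomog.zero _
  smul_mem' c _ ha k s := (ha k s).smul c

lemma gradedMul_mem {a b : ℕ → ℕ → A} (ha : a ∈ 𝔐.weyl) (hb : b ∈ 𝔐.weyl) :
    gradedMul 𝔐.d 𝔐.P a b ∈ 𝔐.weyl := by
  intro K S
  refine IsHomog.sum _ fun m _ => IsHomog.sum _ fun k _ => IsHomog.sum _ fun s hs => ?_
  have := ((ha k.1 s.1).bidiff m (hb k.2 s.2)).smul (moyalCoeff m)
  convert this using 1
  have := HasAntidiagonal.mem_antidiagonal.1 hs
  omega

end MoyalData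

section
variable (d : ι → Derivation ℂ A A) (P : ι → ι → A)

omit [DecidableEq ι] in
lemma gradedMul_add_left (a a' b : ℕ → ℕ → A) :
    gradedMul d P (a + a') b = gradedMul d P a b + gradedMul d P a' b := by
  ext K S; simp [gradedMul, bidiff_add_left, sum_add_distrib]

omit [DecidableEq ι] in
lemma gradedMul_add_right (a b b' : ℕ → ℕ → A) :
    gradedMul d P a (b + b') = gradedMul d P a b + gradedMul d P a b' := by
  ext K S; simp [gradedMul, bidiff_add_right, sum_add_distrib]

omit [DecidableEq ι] in
lemma gradedMul_smul_left (c : ℂ) (a b : ℕ → ℕ → A) :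
    gradedMul d P (c • a) b = c • gradedMul d P a b := by
  ext K S; simp only [gradedMul, Pi.smul_apply, bidiff_smul_left, smul_sum, smul_comm c]

omit [DecidableEq ι] in
lemma gradedMul_smul_right (c : ℂ) (a b : ℕ → ℕ → A) :
    gradedMul d P a (c • b) = c • gradedMul d P a b := by
  ext K S; simp only [gradedMul, Pi.smul_apply, bidiff_smul_right, smul_sum, smul_comm c]

end

variable (𝔐 : MoyalData ι A)

/-- The index set of the terms of a triple product: numbers `m`, `n` of contractions, then
`λ`-degrees and polynomial degrees of the three factors. -/
def tripleIndex (K S : ℕ) :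
    Finset ((_ : ℕ × (ℕ × ℕ × ℕ) × (ℕ × ℕ × ℕ)) × (ℕ × ℕ)) :=
  ((range (K + 1) ×ˢ (range (K + 1) ×ˢ range (K + 1) ×ˢ range (K + 1)) ×ˢ
    (range (S + 2 * K + 1) ×ˢ range (S + 2 * K + 1) ×ˢ range (S + 2 * K + 1))).filter fun t =>
      t.1 + t.2.1.1 + t.2.1.2.1 + t.2.1.2.2 = K ∧
      t.2.2.1 + t.2.2.2.1 + t.2.2.2.2 = S + 2 * t.1).sigma fun t => antidiagonal t.1

/-- The iterated product as a sum over `tripleIndex K S`. This index set is symmetric in the order of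
the two products; it has additional terms in which the inner product takes more fibre derivatives than
the polynomial degrees allow, and these vanish. -/
lemma gradedMul_gradedMul_left {a b c : ℕ → ℕ → A} (ha : a ∈ 𝔐.weyl) (hb : b ∈ 𝔐.weyl) (K S : ℕ) :
    gradedMul 𝔐.d 𝔐.P (gradedMul 𝔐.d 𝔐.P a b) c K S = ∑ t ∈ tripleIndex K S,
      moyalCoeff t.2.1 • bidiff 𝔐.d 𝔐.P t.2.1 (moyalCoeff t.2.2 •
        bidiff 𝔐.d 𝔐.P t.2.2 (a t.1.2.1.1 t.1.2.2.1) (b t.1.2.1.2.1 t.1.2.2.2.1))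
          (c t.1.2.1.2.2 t.1.2.2.2.2) := by
  simp only [gradedMul, bidiff_sum_left, smul_sum, Finset.sum_sigma']
  refine Finset.sum_of_injOn
    (fun x => ⟨(x.1 + x.2.2.2.1, (x.2.2.2.2.1.1, x.2.2.2.2.1.2, x.2.1.2),
      (x.2.2.2.2.2.1, x.2.2.2.2.2.2, x.2.2.1.2)), (x.1, x.2.2.2.1)⟩) ?_ ?_ ?_ ?_
  · rintro ⟨m, ⟨k, k3⟩, ⟨s, s3⟩, n, ⟨k1, k2⟩, ⟨s1, s2⟩⟩ h
      ⟨m', ⟨k', k3'⟩, ⟨s', s3'⟩, n', ⟨k1', k2'⟩, ⟨s1', s2'⟩⟩ h' e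
    simp only [coe_sigma, Set.mem_sigma_iff, coe_range, Set.mem_Iio, mem_coe,
      HasAntidiagonal.mem_antidiagonal] at h h'
    simp only [Sigma.mk.injEq, Prod.mk.injEq, heq_eq_eq] at e
    simp only [Sigma.mk.injEq, Prod.mk.injEq, heq_eq_eq]
    omega
  · rintro ⟨m, ⟨k, k3⟩, ⟨s, s3⟩, n, ⟨k1, k2⟩, ⟨s1, s2⟩⟩ h
    simp only [coe_sigma, Set.mem_sigma_iff, coe_range, Set.mem_Iio, mem_coe,
      HasAntidiagonal.mem_antidiagonal] at h
    simp only [tripleIndex, mem_coe, Finset.mem_sigma, mem_filter, mem_product, mem_range,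
      HasAntidiagonal.mem_antidiagonal]
    refine ⟨⟨⟨?_, ⟨?_, ?_, ?_⟩, ?_, ?_, ?_⟩, ?_, ?_⟩, trivial⟩ <;> omega
  · rintro ⟨⟨N, ⟨k1, k2, k3⟩, ⟨s1, s2, s3⟩⟩, ⟨m, n⟩⟩ h hn
    simp only [tripleIndex, Finset.mem_sigma, mem_filter, mem_product, mem_range,
      HasAntidiagonal.mem_antidiagonal] at h
    by_cases hs : 2 * n ≤ s1 + s2
    · refine absurd ⟨⟨m, ⟨k1 + k2 + n, k3⟩, ⟨s1 + s2 - 2 * n, s3⟩, n, ⟨k1, k2⟩, ⟨s1, s2⟩⟩, ?_, ?_⟩ hn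
      · simp only [coe_sigma, Set.mem_sigma_iff, coe_range, Set.mem_Iio, mem_coe,
          HasAntidiagonal.mem_antidiagonal]
        omega
      · simp only [← h.2]
    · have : bidiff 𝔐.d 𝔐.P n (a k1 s1) (b k2 s2) = 0 := by
        by_cases h1 : s1 < n
        · exact MoyalData.bidiff_eq_zero_left (ha k1 s1) (by exact_mod_cast h1) _
        · exact MoyalData.bidiff_eq_zero_right (hb k2 s2) (by omega) _
      simp [this]
  · rintro ⟨m, ⟨k, k3⟩, ⟨s, s3⟩, n, ⟨k1, k2⟩, ⟨s1, s2⟩⟩ h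
    rfl

lemma gradedMul_gradedMul_right {a b c : ℕ → ℕ → A} (hb : b ∈ 𝔐.weyl) (hc : c ∈ 𝔐.weyl) (K S : ℕ) :
    gradedMul 𝔐.d 𝔐.P a (gradedMul 𝔐.d 𝔐.P b c) K S = ∑ t ∈ tripleIndex K S,
      moyalCoeff t.2.1 • bidiff 𝔐.d 𝔐.P t.2.1 (a t.1.2.1.1 t.1.2.2.1) (moyalCoeff t.2.2 •
        bidiff 𝔐.d 𝔐.P t.2.2 (b t.1.2.1.2.1 t.1.2.2.2.1) (c t.1.2.1.2.2 t.1.2.2.2.2)) := by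
  simp only [gradedMul, bidiff_sum_right, smul_sum, Finset.sum_sigma']
  refine Finset.sum_of_injOn
    (fun x => ⟨(x.1 + x.2.2.2.1, (x.2.1.1, x.2.2.2.2.1.1, x.2.2.2.2.1.2),
      (x.2.2.1.1, x.2.2.2.2.2.1, x.2.2.2.2.2.2)), (x.1, x.2.2.2.1)⟩) ?_ ?_ ?_ ?_
  · rintro ⟨m, ⟨k, k3⟩, ⟨s, s3⟩, n, ⟨k1, k2⟩, ⟨s1, s2⟩⟩ h
      ⟨m', ⟨k', k3'⟩, ⟨s', s3'⟩, n', ⟨k1', k2'⟩, ⟨s1', s2'⟩⟩ h' e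
    simp only [coe_sigma, Set.mem_sigma_iff, coe_range, Set.mem_Iio, mem_coe,
      HasAntidiagonal.mem_antidiagonal] at h h'
    simp only [Sigma.mk.injEq, Prod.mk.injEq, heq_eq_eq] at e
    simp only [Sigma.mk.injEq, Prod.mk.injEq, heq_eq_eq]
    omega
  · rintro ⟨m, ⟨k, k3⟩, ⟨s, s3⟩, n, ⟨k1, k2⟩, ⟨s1, s2⟩⟩ h
    simp only [coe_sigma, Set.mem_sigma_iff, coe_range, Set.mem_Iio, mem_coe,
      HasAntidiagonal.mem_antidiagonal] at h
    simp only [tripleIndex, mem_coe, Finset.mem_sigma, mem_filter, mem_product, mem_range,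
      HasAntidiagonal.mem_antidiagonal]
    refine ⟨⟨⟨?_, ⟨?_, ?_, ?_⟩, ?_, ?_, ?_⟩, ?_, ?_⟩, trivial⟩ <;> omega
  · rintro ⟨⟨N, ⟨k1, k2, k3⟩, ⟨s1, s2, s3⟩⟩, ⟨m, n⟩⟩ h hn
    simp only [tripleIndex, Finset.mem_sigma, mem_filter, mem_product, mem_range,
      HasAntidiagonal.mem_antidiagonal] at h
    by_cases hs : 2 * n ≤ s2 + s3
    · refine absurd ⟨⟨m, ⟨k1, k2 + k3 + n⟩, ⟨s1, s2 + s3 - 2 * n⟩, n, ⟨k2, k3⟩, ⟨s2, s3⟩⟩, ?_, ?_⟩ hn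
      · simp only [coe_sigma, Set.mem_sigma_iff, coe_range, Set.mem_Iio, mem_coe,
          HasAntidiagonal.mem_antidiagonal]
        omega
      · simp only [← h.2]
    · have : bidiff 𝔐.d 𝔐.P n (b k2 s2) (c k3 s3) = 0 := by
        by_cases h1 : s2 < n
        · exact MoyalData.bidiff_eq_zero_left (hb k2 s2) (by exact_mod_cast h1) _
        · exact MoyalData.bidiff_eq_zero_right (hc k3 s3) (by omega) _
      simp [this]
  · rintro ⟨m, ⟨k, k3⟩, ⟨s, s3⟩, n, ⟨k1, k2⟩, ⟨s1, s2⟩⟩ h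
    rfl

lemma gradedMul_assoc {a b c : ℕ → ℕ → A} (ha : a ∈ 𝔐.weyl) (hb : b ∈ 𝔐.weyl) (hc : c ∈ 𝔐.weyl) :
    gradedMul 𝔐.d 𝔐.P (gradedMul 𝔐.d 𝔐.P a b) c = gradedMul 𝔐.d 𝔐.P a (gradedMul 𝔐.d 𝔐.P b c) := by
  ext K S
  rw [gradedMul_gradedMul_left 𝔐 ha hb, gradedMul_gradedMul_right 𝔐 hb hc, tripleIndex,
    sum_sigma, sum_sigma]
  exact sum_congr rfl fun t _ => sum_bidiff_assoc 𝔐.d_comm 𝔐.d_P t.1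
    (a t.2.1.1 t.2.2.1) (b t.2.1.2.1 t.2.2.2.1) (c t.2.1.2.2 t.2.2.2.2)

namespace MoyalData

variable {𝔐}

instance : Mul 𝔐.weyl := ⟨fun a b => ⟨gradedMul 𝔐.d 𝔐.P a.1 b.1, gradedMul_mem a.2 b.2⟩⟩

lemma coe_mul (a b : 𝔐.weyl) : (a * b).1 = gradedMul 𝔐.d 𝔐.P a.1 b.1 := rfl

instance : NonUnitalRing 𝔐.weyl where
  left_distrib a b c := Subtype.ext (gradedMul_add_right _ _ _ _ _)
  right_distrib a b c := Subtype.ext (gradedMul_add_left _ _ _ _ _)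
  zero_mul a := Subtype.ext (by
    have := gradedMul_smul_left 𝔐.d 𝔐.P 0 0 a.1
    simpa [coe_mul] using this)
  mul_zero a := Subtype.ext (by
    have := gradedMul_smul_right 𝔐.d 𝔐.P 0 a.1 0
    simpa [coe_mul] using this)
  mul_assoc a b c := Subtype.ext (gradedMul_assoc 𝔐 a.2 b.2 c.2)

lemma smul_mul' (c : ℂ) (a b : 𝔐.weyl) : (c • a) * b = c • (a * b) :=
  Subtype.ext (gradedMul_smul_left _ _ _ _ _)

lemma mul_smul' (c : ℂ) (a b : 𝔐.weyl) : a * (c • b) = c • (a * b) :=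
  Subtype.ext (gradedMul_smul_right _ _ _ _ _)

end MoyalData

end GradedProduct

/-! ### The scaled commutator -/

section ScaledBracket

variable {ι A : Type*} [Fintype ι] [DecidableEq ι] [CommRing A] [Algebra ℂ A]

namespace MoyalData

variable {𝔐 : MoyalData ι A}

@[ext] lemma weyl_ext {a b : 𝔐.weyl} (h : ∀ k s, a.1 k s = b.1 k s) : a = b :=
  Subtype.ext (funext fun k => funext fun s => h k s)

lemma coe_sum {κ : Type*} (t : Finset κ) (f : κ → 𝔐.weyl) (k s : ℕ) :
    (∑ i ∈ t, f i).1 k s = ∑ i ∈ t, (f i).1 k s := by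
  have : (∑ i ∈ t, f i).1 = ∑ i ∈ t, (f i).1 := map_sum 𝔐.weyl.subtype f t
  rw [this]; simp

/-- Multiplication by `λ`. -/
def shift : 𝔐.weyl →ₗ[ℂ] 𝔐.weyl where
  toFun a := ⟨fun k s => match k with
    | 0 => 0
    | k + 1 => a.1 k s, fun k s => match k with
    | 0 => IsHomog.zero _
    | k + 1 => a.2 k s⟩
  map_add' a b := by ext (_ | k) s <;> simp
  map_smul' c a := by ext (_ | k) s <;> simp

@[simp] lemma shift_zero (a : 𝔐.weyl) (s : ℕ) : (shift a).1 0 s = 0 := rfl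

@[simp] lemma shift_succ (a : 𝔐.weyl) (k s : ℕ) : (shift a).1 (k + 1) s = a.1 k s := rfl

lemma shift_injective : Function.Injective (shift : 𝔐.weyl → 𝔐.weyl) := by
  intro a b h
  ext k s
  simpa using congrFun (congrFun (congrArg Subtype.val h) (k + 1)) s

lemma shift_mul (a b : 𝔐.weyl) : shift a * b = shift (a * b) := by
  ext (_ | K) S
  · simp [coe_mul, gradedMul]
  · rw [shift_succ, coe_mul, coe_mul, gradedMul, gradedMul, sum_range_succ]
    have h0 : ∑ k ∈ antidiagonal (K + 1 - (K + 1)), ∑ s ∈ antidiagonal (S + 2 * (K + 1)),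
        moyalCoeff (K + 1) • bidiff 𝔐.d 𝔐.P (K + 1) ((shift a).1 k.1 s.1) (b.1 k.2 s.2) = 0 := by
      simp
    rw [h0, add_zero]
    refine sum_congr rfl fun m hm => ?_
    rw [show K + 1 - m = (K - m) + 1 by have := mem_range.1 hm; omega,
      Nat.sum_antidiagonal_succ]
    simp

lemma mul_shift (a b : 𝔐.weyl) : a * shift b = shift (a * b) := by
  ext (_ | K) S
  · simp [coe_mul, gradedMul]
  · rw [shift_succ, coe_mul, coe_mul, gradedMul, gradedMul, sum_range_succ]
    have h0 : ∑ k ∈ antidiagonal (K + 1 - (K + 1)), ∑ s ∈ antidiagonal (S + 2 * (K + 1)),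
        moyalCoeff (K + 1) • bidiff 𝔐.d 𝔐.P (K + 1) (a.1 k.1 s.1) ((shift b).1 k.2 s.2) = 0 := by
      simp
    rw [h0, add_zero]
    refine sum_congr rfl fun m hm => ?_
    rw [show K + 1 - m = (K - m) + 1 by have := mem_range.1 hm; omega,
      Nat.sum_antidiagonal_succ']
    simp

/-- The operation `(i/λ) (a ∘ b - b ∘ a)`. -/
def brFun (a b : 𝔐.weyl) : 𝔐.weyl :=
  ⟨fun K S => Complex.I • ((a * b).1 (K + 1) S - (b * a).1 (K + 1) S), fun K S =>
    IsHomog.smul _ (𝔐.weyl.sub_mem (a * b).2 (b * a).2 (K + 1) S)⟩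

/-- The Lie bracket `(i/λ) [a, b]`. -/
def br : 𝔐.weyl →ₗ[ℂ] 𝔐.weyl →ₗ[ℂ] 𝔐.weyl :=
  LinearMap.mk₂ ℂ brFun
    (fun a a' b => by ext K S; simp [brFun, add_mul, mul_add]; module)
    (fun c a b => by ext K S; simp [brFun, smul_mul', mul_smul', ← smul_sub, smul_comm c])
    (fun a b b' => by ext K S; simp [brFun, add_mul, mul_add]; module)
    (fun c a b => by ext K S; simp [brFun, smul_mul', mul_smul', ← smul_sub, smul_comm c])

lemma br_apply (a b : 𝔐.weyl) (K S : ℕ) :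
    (br a b).1 K S = Complex.I • ((a * b).1 (K + 1) S - (b * a).1 (K + 1) S) := rfl

lemma mul_apply_zero (a b : 𝔐.weyl) (S : ℕ) : (a * b).1 0 S = (b * a).1 0 S := by
  simp only [coe_mul, gradedMul, zero_add, range_one, sum_singleton, Nat.sub_self,
    Nat.antidiagonal_zero, mul_zero, add_zero, bidiff_zero]
  rw [← Nat.sum_antidiagonal_swap]
  simp [mul_comm]

lemma shift_br (a b : 𝔐.weyl) : shift (br a b) = Complex.I • (a * b - b * a) := by
  ext (_ | K) S
  · have := mul_apply_zero a b S
    simp [this]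
  · simp [br_apply]

lemma br_skew (a b : 𝔐.weyl) : br b a = - br a b := by
  apply shift_injective
  rw [map_neg, shift_br, shift_br, ← smul_neg, neg_sub]

/-- The Jacobi identity, which holds because `λ • br` is a multiple of a commutator. -/
lemma br_jacobi (a b c : 𝔐.weyl) : br a (br b c) = br (br a b) c + br b (br a c) := by
  apply shift_injective
  apply shift_injective
  have h : ∀ a b c : 𝔐.weyl, shift (shift (br a (br b c))) =
      Complex.I • Complex.I • (a * (b * c - c * b) - (b * c - c * b) * a) := by
    intro a b c
    rw [shift_br, map_smul, map_sub, ← mul_shift, ← shift_mul, shift_br, mul_smul', smul_mul',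
      ← smul_sub]
  rw [map_add, map_add, h, br_skew c, map_neg, map_neg, h, h, ← smul_neg, ← smul_neg, ← smul_add,
    ← smul_add]
  congr 2
  noncomm_ring

lemma br_mul (a b c : 𝔐.weyl) : br a (b * c) = br a b * c + b * br a c := by
  apply shift_injective
  rw [map_add, ← shift_mul, ← mul_shift, shift_br, shift_br, shift_br, smul_mul', mul_smul',
    ← smul_add]
  congr 1
  noncomm_ring

/-- Derivations of the Weyl algebra that commute with multiplication by `λ`. -/
structure IsWeylDerivation (θ : 𝔐.weyl →ₗ[ℂ] 𝔐.weyl) : Prop where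
  leibniz : ∀ a b, θ (a * b) = θ a * b + a * θ b
  map_shift : ∀ a, θ (shift a) = shift (θ a)

namespace IsWeylDerivation

variable {θ θ' : 𝔐.weyl →ₗ[ℂ] 𝔐.weyl}

lemma map_br (h : IsWeylDerivation θ) (a b : 𝔐.weyl) : θ (br a b) = br (θ a) b + br a (θ b) := by
  apply shift_injective
  rw [← h.map_shift, shift_br, map_add, shift_br, shift_br, ← smul_add, map_smul, map_sub,
    h.leibniz, h.leibniz]
  congr 1
  abel

lemma add (h : IsWeylDerivation θ) (h' : IsWeylDerivation θ') : IsWeylDerivation (θ + θ') where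
  leibniz a b := by
    simp only [LinearMap.add_apply, h.leibniz, h'.leibniz, add_mul, mul_add]; abel
  map_shift a := by simp [h.map_shift, h'.map_shift]

lemma sub (h : IsWeylDerivation θ) (h' : IsWeylDerivation θ') : IsWeylDerivation (θ - θ') where
  leibniz a b := by
    simp only [LinearMap.sub_apply, h.leibniz, h'.leibniz, sub_mul, mul_sub]; abel
  map_shift a := by simp [h.map_shift, h'.map_shift]

lemma br_left (a : 𝔐.weyl) : IsWeylDerivation (br a) where
  leibniz := br_mul a
  map_shift b := by
    apply shift_injective
    rw [shift_br, mul_shift, shift_mul, ← map_sub, ← map_smul, shift_br]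

end IsWeylDerivation

/-- The degree-wise action of a derivation that commutes with the Euler operator. -/
def liftDeriv (X : Derivation ℂ A A) (hX : ∀ a, 𝔐.euler (X a) = X (𝔐.euler a)) :
    𝔐.weyl →ₗ[ℂ] 𝔐.weyl where
  toFun a := ⟨fun k s => X (a.1 k s), fun k s => by
    have := a.2 k s
    rw [IsHomog] at this ⊢
    rw [hX, this, Derivation.map_smul]⟩
  map_add' a b := by ext; simp
  map_smul' c a := by ext; simp

lemma isWeylDerivation_liftDeriv {X : Derivation ℂ A A} (hX : ∀ a, 𝔐.euler (X a) = X (𝔐.euler a))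
    (hB : ∀ m a b, X (bidiff 𝔐.d 𝔐.P m a b) =
      bidiff 𝔐.d 𝔐.P m (X a) b + bidiff 𝔐.d 𝔐.P m a (X b)) :
    IsWeylDerivation (liftDeriv X hX) where
  leibniz a b := by
    ext K S
    simp [coe_mul, gradedMul, liftDeriv, hB, sum_add_distrib]
  map_shift a := by ext (_ | k) s <;> simp [liftDeriv]

/-- The derivation `∂ᵢ`, which lowers the polynomial degree by one. -/
def fibDeriv (i : ι) : 𝔐.weyl →ₗ[ℂ] 𝔐.weyl where
  toFun a := ⟨fun k s => 𝔐.d i (a.1 k (s + 1)), fun k s => by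
    have := (a.2 k (s + 1)).d i
    simpa using this⟩
  map_add' a b := by ext; simp
  map_smul' c a := by ext; simp

lemma fibDeriv_apply (i : ι) (a : 𝔐.weyl) (k s : ℕ) :
    (fibDeriv i a).1 k s = 𝔐.d i (a.1 k (s + 1)) := rfl

lemma d_apply_zero (i : ι) (a : 𝔐.weyl) (k : ℕ) : 𝔐.d i (a.1 k 0) = 0 :=
  ((a.2 k 0).d i).eq_zero (by simp)

lemma isWeylDerivation_fibDeriv (i : ι) : IsWeylDerivation (fibDeriv i : 𝔐.weyl →ₗ[ℂ] 𝔐.weyl) where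
  leibniz a b := by
    ext K S
    change _ = (fibDeriv i a * b).1 K S + (a * fibDeriv i b).1 K S
    simp only [fibDeriv_apply, coe_mul, gradedMul, map_sum, Derivation.map_smul,
      bidiff_deriv 𝔐.d_comm 𝔐.d_P, smul_add, sum_add_distrib]
    congr 1
    · refine sum_congr rfl fun m _ => sum_congr rfl fun k _ => ?_
      rw [show S + 1 + 2 * m = S + 2 * m + 1 by ring, Nat.sum_antidiagonal_succ]
      simp [d_apply_zero]
    · refine sum_congr rfl fun m _ => sum_congr rfl fun k _ => ?_
      rw [show S + 1 + 2 * m = S + 2 * m + 1 by ring, Nat.sum_antidiagonal_succ']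
      simp [d_apply_zero]
  map_shift a := by ext (_ | k) s <;> simp [fibDeriv_apply]

/-- The element with only one component. -/
def single (k s : ℕ) (q : A) (hq : 𝔐.IsHomog s q) : 𝔐.weyl :=
  ⟨fun k' s' => if k' = k ∧ s' = s then q else 0, fun k' s' => by
    beta_reduce
    split_ifs with h
    · rw [h.2]; exact hq
    · exact IsHomog.zero _⟩

lemma single_apply (k s : ℕ) (q : A) (hq : 𝔐.IsHomog s q) (k' s' : ℕ) :
    (single k s q hq).1 k' s' = if k' = k ∧ s' = s then q else 0 := rfl

/-- Interchanging the factors changes the sign of the `m`-th bidifferential operator by `(-1) ^ m`, so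
that only odd `m` contribute to the commutator; in particular it is divisible by `λ`. -/
lemma mul_sub_mul_apply (hP : ∀ i j, 𝔐.P j i = - 𝔐.P i j) (a b : 𝔐.weyl) (K S : ℕ) :
    (a * b).1 K S - (b * a).1 K S = ∑ m ∈ range (K + 1), ((1 - (-1) ^ m) * moyalCoeff m) •
      ∑ k ∈ antidiagonal (K - m), ∑ s ∈ antidiagonal (S + 2 * m),
        bidiff 𝔐.d 𝔐.P m (a.1 k.1 s.1) (b.1 k.2 s.2) := by
  rw [coe_mul, coe_mul, gradedMul, gradedMul, ← sum_sub_distrib]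
  refine sum_congr rfl fun m _ => ?_
  have : ∑ k ∈ antidiagonal (K - m), ∑ s ∈ antidiagonal (S + 2 * m),
      moyalCoeff m • bidiff 𝔐.d 𝔐.P m (b.1 k.1 s.1) (a.1 k.2 s.2) = ((-1) ^ m * moyalCoeff m) •
      ∑ k ∈ antidiagonal (K - m), ∑ s ∈ antidiagonal (S + 2 * m),
        bidiff 𝔐.d 𝔐.P m (a.1 k.1 s.1) (b.1 k.2 s.2) := by
    rw [← Nat.sum_antidiagonal_swap, smul_sum]
    refine sum_congr rfl fun k _ => ?_
    rw [← Nat.sum_antidiagonal_swap, smul_sum]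
    refine sum_congr rfl fun s _ => ?_
    rw [bidiff_symm hP, mul_comm ((-1 : ℂ) ^ m), mul_smul]
    congr 1
    simp only [Prod.fst_swap, Prod.snd_swap]
    rcases Nat.even_or_odd m with e | e <;> rw [e.neg_one_pow, e.neg_one_pow] <;> simp
  rw [this, sub_mul, sub_smul, one_mul, smul_sum]
  simp only [smul_sum]

/-- A quadratic element acts by its Hamiltonian vector field. -/
lemma br_quadratic (hP : ∀ i j, 𝔐.P j i = - 𝔐.P i j) (q : A) (hq : 𝔐.IsHomog (2 : ℕ) q)
    (a : 𝔐.weyl) (K S : ℕ) :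
    (br (single 0 2 q hq) a).1 K S = bidiff 𝔐.d 𝔐.P 1 q (a.1 K S) := by
  rw [br_apply, mul_sub_mul_apply hP, sum_eq_single 1]
  · rw [sum_eq_single (0, K), sum_eq_single (2, S)]
    · simp only [single_apply, and_self, if_true, smul_smul]
      have : Complex.I * ((1 - (-1) ^ 1) * moyalCoeff 1) = 1 := by
        simp [moyalCoeff]; ring_nf; simp
      rw [this, one_smul]
    · rintro ⟨s, s'⟩ hs hne
      have := HasAntidiagonal.mem_antidiagonal.1 hs
      have h2 : s ≠ 2 := by rintro rfl; apply hne; simp at this ⊢; omega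
      simp [single_apply, h2]
    · intro h; exact absurd (HasAntidiagonal.mem_antidiagonal.2 (by ring)) h
    · rintro ⟨k, k'⟩ hk hne
      have := HasAntidiagonal.mem_antidiagonal.1 hk
      have h2 : k ≠ 0 := by rintro rfl; apply hne; simp at this ⊢; omega
      simp [single_apply, h2]
    · intro h; exact absurd (HasAntidiagonal.mem_antidiagonal.2 (by simp)) h
  · intro m _ hm
    rcases Nat.even_or_odd m with e | e
    · simp [e.neg_one_pow]
    · have hm3 : 2 < m := by obtain ⟨n, rfl⟩ := e; omega
      rw [sum_eq_zero, smul_zero]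
      intro k _
      refine sum_eq_zero fun s _ => ?_
      rw [single_apply]
      split_ifs
      · exact bidiff_eq_zero_left hq (by exact_mod_cast hm3) _
      · simp
  · intro h; exact absurd (mem_range.2 (by omega)) h

/-- `a` has Fedosov degree at least `n`. -/
def DegGE (n : ℕ) (a : 𝔐.weyl) : Prop := ∀ k s, s + 2 * k < n → a.1 k s = 0

/-- The bracket with an element of degree at least three raises the degree: the product has degree at
least `n + 3`, and the division by `λ` costs two. -/
lemma DegGE.br {r a : 𝔐.weyl} {n : ℕ} (hr : DegGE 3 r) (ha : DegGE n a) :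
    DegGE (n + 1) (br r a) := by
  have key : ∀ {b c : 𝔐.weyl}, (∀ k s k' s', s + 2 * k + (s' + 2 * k') < n + 3 →
      b.1 k s = 0 ∨ c.1 k' s' = 0) → ∀ K S, S + 2 * K < n + 1 → (b * c).1 (K + 1) S = 0 := by
    intro b c h K S hKS
    rw [coe_mul, gradedMul]
    refine sum_eq_zero fun m hm => sum_eq_zero fun k hk => sum_eq_zero fun s hs => ?_
    have h1 := mem_range.1 hm
    have h2 := HasAntidiagonal.mem_antidiagonal.1 hk
    have h3 := HasAntidiagonal.mem_antidiagonal.1 hs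
    rcases h k.1 s.1 k.2 s.2 (by omega) with h | h <;> simp [h]
  intro K S hKS
  rw [br_apply, key _ K S hKS, key _ K S hKS]
  · simp
  · intro k s k' s' h
    by_cases h' : s' + 2 * k' < 3
    · exact .inr (hr _ _ h')
    · exact .inl (ha _ _ (by omega))
  · intro k s k' s' h
    by_cases h' : s + 2 * k < 3
    · exact .inl (hr _ _ h')
    · exact .inr (ha _ _ (by omega))

end MoyalData

end ScaledBracket

/-! ### Symplectic connections in local coordinates -/

section Data

variable {ι A : Type*} [Fintype ι] [DecidableEq ι] [CommRing A] [Algebra ℂ A]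

/-- A torsionfree symplectic connection in local coordinates, in algebraic terms: `A` stands for the
functions on the tangent bundle over a coordinate domain, `D i` for the derivatives in the base
directions, `d i` for those in the fibre directions, `Γ i j k` for the `k`-th component of
`∇_{∂ᵢ} ∂ⱼ`, and `Ω` for the symplectic form. -/
structure ConnectionData (ι A : Type*) [Fintype ι] [DecidableEq ι] [CommRing A] [Algebra ℂ A]
    extends MoyalData ι A where
  /-- the derivatives in the base directions -/
  D : ι → Derivation ℂ A A
  /-- the Christoffel symbols -/
  Γ : ι → ι → ι → A
  /-- the symplectic form -/
  Ω : ι → ι → A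
  D_comm : ∀ i j a, D i (D j a) = D j (D i a)
  D_d : ∀ i j a, D i (d j a) = d j (D i a)
  D_y : ∀ i j, D i (y j) = 0
  d_Γ : ∀ l i j k, d l (Γ i j k) = 0
  Γ_symm : ∀ i j k, Γ i j k = Γ j i k
  d_Ω : ∀ k i j, d k (Ω i j) = 0
  Ω_skew : ∀ i j, Ω j i = - Ω i j
  P_Ω : ∀ i k, ∑ j, P i j * Ω j k = if i = k then 1 else 0
  D_Ω : ∀ k i j, D k (Ω i j) = ∑ l, (Γ k i l * Ω l j + Γ k j l * Ω i l)

namespace ConnectionData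

open MoyalData

variable (𝔉 : ConnectionData ι A)

lemma Ω_P (i k : ι) : ∑ j, 𝔉.Ω i j * 𝔉.P j k = if i = k then 1 else 0 := by
  have h : Matrix.of 𝔉.P * Matrix.of 𝔉.Ω = 1 := by
    ext i k; simp [Matrix.mul_apply, 𝔉.P_Ω, Matrix.one_apply]
  have h2 : Matrix.of 𝔉.Ω * Matrix.of 𝔉.P = 1 := mul_eq_one_comm.1 h
  have h' := congrFun (congrFun h2 i) k
  simpa [Matrix.mul_apply, Matrix.one_apply] using h'

lemma eq_zero_of_sum_mul_Ω {q : ι → A} (h : ∀ m, ∑ j, q j * 𝔉.Ω j m = 0) (i : ι) : q i = 0 := by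
  have : ∑ m, (∑ j, q j * 𝔉.Ω j m) * 𝔉.P m i = q i := by
    simp only [sum_mul, mul_assoc]
    rw [sum_comm]
    simp [← mul_sum, 𝔉.Ω_P]
  rw [← this]; simp [h]

lemma P_skew (i j : ι) : 𝔉.P j i = - 𝔉.P i j := by
  rw [← sub_eq_zero, sub_neg_eq_add]
  refine 𝔉.eq_zero_of_sum_mul_Ω (q := fun i => 𝔉.P j i + 𝔉.P i j) (fun m => ?_) i
  have h : ∑ i, 𝔉.P i j * 𝔉.Ω i m = - ∑ i, 𝔉.Ω m i * 𝔉.P i j := by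
    rw [← sum_neg_distrib]
    exact sum_congr rfl fun i _ => by rw [𝔉.Ω_skew m i]; ring
  simp only [add_mul, sum_add_distrib]
  rw [h, 𝔉.P_Ω, 𝔉.Ω_P]
  simp [eq_comm]

/-- The Poisson tensor is parallel, since it is inverse to the symplectic form. -/
lemma D_P (k i j : ι) :
    𝔉.D k (𝔉.P i j) = - ∑ l, (𝔉.Γ k l i * 𝔉.P l j + 𝔉.Γ k l j * 𝔉.P i l) := by
  rw [← sub_eq_zero, sub_neg_eq_add]
  refine 𝔉.eq_zero_of_sum_mul_Ω
    (q := fun j => 𝔉.D k (𝔉.P i j) + ∑ l, (𝔉.Γ k l i * 𝔉.P l j + 𝔉.Γ k l j * 𝔉.P i l))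
    (fun m => ?_) j
  have h0 : ∑ j, (𝔉.D k (𝔉.P i j) * 𝔉.Ω j m + 𝔉.P i j * 𝔉.D k (𝔉.Ω j m)) = 0 := by
    have := congrArg (𝔉.D k) (𝔉.P_Ω i m)
    rw [map_sum] at this
    have h1 : 𝔉.D k (if i = m then 1 else 0) = 0 := by split_ifs <;> simp
    rw [h1] at this
    rw [← this]
    exact sum_congr rfl fun j _ => by rw [Derivation.leibniz]; simp only [smul_eq_mul]; ring
  have h1 : ∑ j, 𝔉.P i j * 𝔉.D k (𝔉.Ω j m) =
      ∑ j, ∑ l, 𝔉.P i j * 𝔉.Γ k j l * 𝔉.Ω l m + 𝔉.Γ k m i := by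
    simp only [𝔉.D_Ω, sum_add_distrib, mul_add, mul_sum]
    congr 1
    · exact sum_congr rfl fun j _ => sum_congr rfl fun l _ => by ring
    · rw [sum_comm]
      have : ∀ l, ∑ j, 𝔉.P i j * (𝔉.Γ k m l * 𝔉.Ω j l) =
          𝔉.Γ k m l * if i = l then 1 else 0 := fun l => by
        rw [← 𝔉.P_Ω, mul_sum]; exact sum_congr rfl fun j _ => by ring
      simp [this]
  have h2 : ∑ j, (∑ l, (𝔉.Γ k l i * 𝔉.P l j + 𝔉.Γ k l j * 𝔉.P i l)) * 𝔉.Ω j m =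
      𝔉.Γ k m i + ∑ j, ∑ l, 𝔉.P i j * 𝔉.Γ k j l * 𝔉.Ω l m := by
    simp only [sum_add_distrib, add_mul, sum_mul]
    congr 1
    · rw [sum_comm]
      have : ∀ l, ∑ j, 𝔉.Γ k l i * 𝔉.P l j * 𝔉.Ω j m =
          𝔉.Γ k l i * if l = m then 1 else 0 := fun l => by
        rw [← 𝔉.P_Ω, mul_sum]; exact sum_congr rfl fun j _ => by ring
      simp [this]
    · rw [sum_comm]
      exact sum_congr rfl fun j _ => sum_congr rfl fun l _ => by ring
  rw [sum_add_distrib] at h0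
  simp only [add_mul, sum_add_distrib (f := fun j => 𝔉.D k (𝔉.P i j) * 𝔉.Ω j m)]
  rw [h2, ← h0, h1]
  ring

/-- The `l`-th component of the vertical part `∑ Γ i k l yₖ` of the horizontal lift of `∂ᵢ`. -/
def vert (i l : ι) : A := ∑ k, 𝔉.Γ i k l * 𝔉.y k

/-- The covariant derivative along `∂ᵢ`, which is the derivative along its horizontal lift. -/
def nabla (i : ι) : Derivation ℂ A A := 𝔉.D i - ∑ l, 𝔉.vert i l • 𝔉.d l

lemma nabla_apply (i : ι) (a : A) : 𝔉.nabla i a = 𝔉.D i a - ∑ l, 𝔉.vert i l * 𝔉.d l a := by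
  have : ∀ s : Finset ι, (∑ l ∈ s, 𝔉.vert i l • 𝔉.d l : Derivation ℂ A A) a =
      ∑ l ∈ s, 𝔉.vert i l * 𝔉.d l a := by
    intro s
    induction s using Finset.induction_on with
    | empty => simp
    | insert i s hi ih => rw [sum_insert hi, sum_insert hi, Derivation.add_apply, ih]; simp
  rw [nabla, Derivation.sub_apply, this univ]

lemma d_vert (j i l : ι) : 𝔉.d j (𝔉.vert i l) = 𝔉.Γ i j l := by
  simp [vert, Derivation.leibniz, 𝔉.d_Γ, 𝔉.d_y]

lemma isHomog_vert (i l : ι) : 𝔉.IsHomog 1 (𝔉.vert i l) :=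
  IsHomog.sum _ fun k _ => (isHomog_y k).const_mul fun m => 𝔉.d_Γ m i k l

lemma nabla_d (i j : ι) (a : A) :
    𝔉.nabla i (𝔉.d j a) = 𝔉.d j (𝔉.nabla i a) + ∑ l, 𝔉.Γ i j l * 𝔉.d l a := by
  simp only [nabla_apply, map_sub, map_sum, Derivation.leibniz, d_vert, 𝔉.D_d, smul_eq_mul,
    sum_add_distrib, 𝔉.d_comm j]
  have : ∑ x, 𝔉.d x a * 𝔉.Γ i j x = ∑ l, 𝔉.Γ i j l * 𝔉.d l a :=
    sum_congr rfl fun l _ => by ring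
  rw [this]; ring

lemma nabla_P (k i j : ι) :
    𝔉.nabla k (𝔉.P i j) = - ∑ l, (𝔉.Γ k l i * 𝔉.P l j + 𝔉.Γ k l j * 𝔉.P i l) := by
  simp [nabla_apply, 𝔉.d_P, 𝔉.D_P]

lemma nabla_bidiff (i : ι) (m : ℕ) (a b : A) : 𝔉.nabla i (bidiff 𝔉.d 𝔉.P m a b) =
    bidiff 𝔉.d 𝔉.P m (𝔉.nabla i a) b + bidiff 𝔉.d 𝔉.P m a (𝔉.nabla i b) :=
  bidiff_leibniz (𝔉.nabla i) (fun l j => 𝔉.Γ i j l) (fun k l j => 𝔉.d_Γ k i j l)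
    (fun j a => 𝔉.nabla_d i j a) (fun j k => 𝔉.nabla_P i j k) m a b

lemma euler_nabla (i : ι) (a : A) : 𝔉.euler (𝔉.nabla i a) = 𝔉.nabla i (𝔉.euler a) := by
  have hD : 𝔉.euler (𝔉.D i a) = 𝔉.D i (𝔉.euler a) := by
    simp [euler_apply, Derivation.leibniz, 𝔉.D_y, 𝔉.D_d]
  have hv : ∀ l, 𝔉.euler (𝔉.vert i l) = 𝔉.vert i l := fun l => by
    have := 𝔉.isHomog_vert i l
    simpa [IsHomog] using this
  simp only [nabla_apply, map_sub, map_sum, hD, Derivation.leibniz, hv, euler_d, smul_eq_mul]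
  congr 1
  exact sum_congr rfl fun l _ => by ring

/-- The vertical vector field `R(∂ᵢ, ∂ⱼ) y`. -/
def curv (i j l : ι) : A := 𝔉.nabla i (𝔉.vert j l) - 𝔉.nabla j (𝔉.vert i l)

/-- The commutator of covariant derivatives is the derivative along the vertical field `R(∂ᵢ, ∂ⱼ) y`,
up to sign. -/
lemma nabla_comm (i j : ι) (a : A) :
    𝔉.nabla i (𝔉.nabla j a) - 𝔉.nabla j (𝔉.nabla i a) = - ∑ l, 𝔉.curv i j l * 𝔉.d l a := by
  have h : ∀ i j, 𝔉.nabla i (𝔉.nabla j a) = 𝔉.D i (𝔉.D j a) - ∑ l, 𝔉.vert i l * 𝔉.d l (𝔉.D j a)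
      - ∑ l, 𝔉.nabla i (𝔉.vert j l) * 𝔉.d l a - ∑ l, 𝔉.vert j l * 𝔉.d l (𝔉.D i a)
      + ∑ l, ∑ m, 𝔉.vert i m * 𝔉.vert j l * 𝔉.d m (𝔉.d l a) := by
    intro i j
    rw [𝔉.nabla_apply j, map_sub, 𝔉.nabla_apply i (𝔉.D j a), map_sum]
    have : ∀ l, 𝔉.nabla i (𝔉.vert j l * 𝔉.d l a) = 𝔉.nabla i (𝔉.vert j l) * 𝔉.d l a
        + 𝔉.vert j l * 𝔉.d l (𝔉.D i a) - ∑ m, 𝔉.vert i m * 𝔉.vert j l * 𝔉.d m (𝔉.d l a) := by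
      intro l
      rw [Derivation.leibniz, 𝔉.nabla_apply i (𝔉.d l a), 𝔉.D_d]
      simp only [smul_eq_mul, mul_sub, mul_sum]
      have : ∑ m, 𝔉.vert j l * (𝔉.vert i m * 𝔉.d m (𝔉.d l a)) =
          ∑ m, 𝔉.vert i m * 𝔉.vert j l * 𝔉.d m (𝔉.d l a) := sum_congr rfl fun m _ => by ring
      rw [this]; ring
    simp only [this, sum_add_distrib, sum_sub_distrib]
    ring
  have hs : ∑ l, ∑ m, 𝔉.vert i m * 𝔉.vert j l * 𝔉.d m (𝔉.d l a) =
      ∑ l, ∑ m, 𝔉.vert j m * 𝔉.vert i l * 𝔉.d m (𝔉.d l a) := by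
    rw [sum_comm]
    exact sum_congr rfl fun l _ => sum_congr rfl fun m _ => by rw [𝔉.d_comm l m]; ring
  rw [h i j, h j i, hs, 𝔉.D_comm i j]
  simp only [curv, sub_mul, sum_sub_distrib]
  ring

lemma isHomog_nabla {s : ℤ} {a : A} (i : ι) (h : 𝔉.IsHomog s a) : 𝔉.IsHomog s (𝔉.nabla i a) := by
  rw [IsHomog] at *
  rw [euler_nabla, h, Derivation.map_smul]

lemma isHomog_curv (i j l : ι) : 𝔉.IsHomog 1 (𝔉.curv i j l) := by
  rw [curv, sub_eq_add_neg, ← neg_one_smul ℂ]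
  exact (𝔉.isHomog_nabla i (𝔉.isHomog_vert j l)).add
    ((𝔉.isHomog_nabla j (𝔉.isHomog_vert i l)).smul _)

/-- The function `Ω(∂ₖ, y)`. -/
def covec (k : ι) : A := ∑ l, 𝔉.Ω k l * 𝔉.y l

lemma d_covec (m k : ι) : 𝔉.d m (𝔉.covec k) = 𝔉.Ω k m := by
  simp [covec, Derivation.leibniz, 𝔉.d_Ω, 𝔉.d_y]

lemma nabla_covec (i k : ι) : 𝔉.nabla i (𝔉.covec k) = ∑ m, 𝔉.Γ i k m * 𝔉.covec m := by
  rw [nabla_apply]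
  simp only [d_covec]
  have h1 : 𝔉.D i (𝔉.covec k) = ∑ m, 𝔉.Γ i k m * 𝔉.covec m + ∑ p, 𝔉.vert i p * 𝔉.Ω k p := by
    simp only [covec, map_sum, Derivation.leibniz, 𝔉.D_y, 𝔉.D_Ω, smul_eq_mul, mul_zero, zero_add,
      vert, mul_sum, sum_mul, mul_add, sum_add_distrib]
    congr 1
    · rw [sum_comm]
      exact sum_congr rfl fun l _ => sum_congr rfl fun m _ => by ring
    · rw [sum_comm]
      exact sum_congr rfl fun l _ => sum_congr rfl fun m _ => by ring
  rw [h1]; ring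

lemma d_nabla (k i : ι) (a : A) :
    𝔉.d k (𝔉.nabla i a) = 𝔉.nabla i (𝔉.d k a) - ∑ l, 𝔉.Γ i k l * 𝔉.d l a := by
  rw [nabla_d]; ring

/-- The curvature is symplectic: `Ω(∂ₖ, R y) = - Ω(R ∂ₖ, y)`. -/
lemma sum_Ω_curv (i j k : ι) :
    ∑ m, 𝔉.Ω k m * 𝔉.curv i j m = - ∑ m, 𝔉.d k (𝔉.curv i j m) * 𝔉.covec m := by
  have h1 := 𝔉.nabla_comm i j (𝔉.covec k)
  have h2 : ∀ i j, 𝔉.nabla i (𝔉.nabla j (𝔉.covec k)) = ∑ m, 𝔉.nabla i (𝔉.Γ j k m) * 𝔉.covec m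
      + ∑ m, ∑ l, 𝔉.Γ j k l * 𝔉.Γ i l m * 𝔉.covec m := by
    intro i j
    rw [nabla_covec, map_sum]
    simp only [Derivation.leibniz, nabla_covec, smul_eq_mul, sum_add_distrib, mul_sum]
    rw [add_comm]
    congr 1
    · exact sum_congr rfl fun m _ => by ring
    · rw [sum_comm]
      exact sum_congr rfl fun m _ => sum_congr rfl fun l _ => by ring
  have h3 : ∀ m, 𝔉.d k (𝔉.curv i j m) = 𝔉.nabla i (𝔉.Γ j k m) - ∑ l, 𝔉.Γ i k l * 𝔉.Γ j l m
      - (𝔉.nabla j (𝔉.Γ i k m) - ∑ l, 𝔉.Γ j k l * 𝔉.Γ i l m) := by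
    intro m
    rw [curv, map_sub, d_nabla, d_nabla]
    simp only [d_vert]
  rw [h2, h2] at h1
  simp only [d_covec] at h1
  have h4 : ∑ m, 𝔉.Ω k m * 𝔉.curv i j m = ∑ l, 𝔉.curv i j l * 𝔉.Ω k l :=
    sum_congr rfl fun m _ => by ring
  rw [h4, ← neg_eq_iff_eq_neg, ← h1]
  simp only [h3, sub_mul, sum_sub_distrib, sum_mul]
  ring

/-- The curvature form `½ Ω(y, R(∂ᵢ, ∂ⱼ) y)`. -/
def curvForm (i j : ι) : A := (1 / 2 : ℂ) • ∑ k, 𝔉.y k * ∑ l, 𝔉.Ω k l * 𝔉.curv i j l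

lemma isHomog_curvForm (i j : ι) : 𝔉.IsHomog (2 : ℕ) (𝔉.curvForm i j) := by
  refine IsHomog.smul _ (IsHomog.sum _ fun k _ => ?_)
  have : 𝔉.IsHomog 1 (∑ l, 𝔉.Ω k l * 𝔉.curv i j l) :=
    IsHomog.sum _ fun l _ => (𝔉.isHomog_curv i j l).const_mul fun m => 𝔉.d_Ω m k l
  simpa using (isHomog_y k).mul this

lemma d_curvForm (i j k : ι) : 𝔉.d k (𝔉.curvForm i j) = ∑ l, 𝔉.Ω k l * 𝔉.curv i j l := by
  have h : ∑ p, 𝔉.y p * ∑ l, 𝔉.Ω p l * 𝔉.d k (𝔉.curv i j l) =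
      ∑ l, 𝔉.Ω k l * 𝔉.curv i j l := by
    rw [sum_Ω_curv, ← sum_neg_distrib]
    simp only [mul_sum, covec]
    rw [sum_comm]
    refine sum_congr rfl fun l _ => ?_
    rw [← sum_neg_distrib]
    refine sum_congr rfl fun p _ => ?_
    rw [𝔉.Ω_skew l p]; ring
  rw [curvForm, Derivation.map_smul, map_sum]
  simp only [Derivation.leibniz, map_sum, 𝔉.d_Ω, 𝔉.d_y, smul_eq_mul, mul_zero, add_zero,
    sum_add_distrib]
  rw [h]
  simp only [mul_ite, mul_one, mul_zero, sum_ite_eq, mem_univ, if_true]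
  module

/-- `[∇ᵢ, ∇ⱼ] = (i/λ) [Rᵢⱼ, ·]`, on a single component. -/
lemma bidiff_curvForm (i j : ι) (a : A) : bidiff 𝔉.d 𝔉.P 1 (𝔉.curvForm i j) a =
    𝔉.nabla i (𝔉.nabla j a) - 𝔉.nabla j (𝔉.nabla i a) := by
  rw [nabla_comm, bidiff_succ, sum_comm, ← sum_neg_distrib]
  refine sum_congr rfl fun l _ => ?_
  simp only [bidiff_zero, d_curvForm, sum_mul, mul_sum]
  rw [sum_comm]
  have : ∀ m, ∑ k, 𝔉.P k l * (𝔉.Ω k m * 𝔉.curv i j m * 𝔉.d l a) =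
      - ((if l = m then 1 else 0) * (𝔉.curv i j m * 𝔉.d l a)) := by
    intro m
    rw [← 𝔉.P_Ω l m, sum_mul, ← sum_neg_distrib]
    refine sum_congr rfl fun k _ => ?_
    rw [𝔉.P_skew l k]; ring
  simp [this]

lemma eq_zero_of_bidiff_one {s : ℤ} (hs : s ≠ 0) {q : A} (hq : 𝔉.IsHomog s q)
    (h : ∀ a, bidiff 𝔉.d 𝔉.P 1 q a = 0) : q = 0 := by
  have h1 : ∀ l, ∑ i, 𝔉.d i q * 𝔉.P i l = 0 := by
    intro l
    have := h (𝔉.y l)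
    rw [bidiff_succ] at this
    simp only [bidiff_zero, 𝔉.d_y, mul_ite, mul_one, mul_zero, sum_ite_eq', mem_univ, if_true]
      at this
    rw [← this]
    exact sum_congr rfl fun i _ => by ring
  have h2 : ∀ m, 𝔉.d m q = 0 := by
    intro m
    have : ∑ l, (∑ i, 𝔉.d i q * 𝔉.P i l) * 𝔉.Ω l m = 𝔉.d m q := by
      simp only [sum_mul, mul_assoc]
      rw [sum_comm]
      simp [← mul_sum, 𝔉.P_Ω]
    rw [← this]; simp [h1]
  have h3 := isHomog_zero_of_const h2
  rw [IsHomog] at h3 hq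
  rw [hq] at h3
  simpa [hs] using h3

/-- The second Bianchi identity. It follows from the Jacobi identity for the `∇ᵢ`, since `P` is
nondegenerate. -/
lemma bianchi_nabla (i j k : ι) : 𝔉.nabla i (𝔉.curvForm j k) + 𝔉.nabla j (𝔉.curvForm k i)
    + 𝔉.nabla k (𝔉.curvForm i j) = 0 := by
  have hh := fun i j k => 𝔉.isHomog_nabla i (𝔉.isHomog_curvForm j k)
  refine 𝔉.eq_zero_of_bidiff_one (by norm_num) (((hh i j k).add (hh j k i)).add (hh k i j)) ?_
  intro a
  have h : ∀ i j k, bidiff 𝔉.d 𝔉.P 1 (𝔉.nabla i (𝔉.curvForm j k)) a =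
      𝔉.nabla i (𝔉.nabla j (𝔉.nabla k a) - 𝔉.nabla k (𝔉.nabla j a)) -
      (𝔉.nabla j (𝔉.nabla k (𝔉.nabla i a)) - 𝔉.nabla k (𝔉.nabla j (𝔉.nabla i a))) := by
    intro i j k
    rw [← bidiff_curvForm, ← bidiff_curvForm, nabla_bidiff]
    ring
  rw [bidiff_add_left, bidiff_add_left, h, h, h]
  simp only [map_sub]
  ring

/-- The first Bianchi identity. -/
lemma bianchi_d (i j k : ι) : 𝔉.d i (𝔉.curvForm j k) + 𝔉.d j (𝔉.curvForm k i)
    + 𝔉.d k (𝔉.curvForm i j) = 0 := by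
  have hh := fun i j k => (𝔉.isHomog_curvForm j k).d i
  refine 𝔉.eq_zero_of_bidiff_one (by norm_num) (((hh i j k).add (hh j k i)).add (hh k i j)) ?_
  intro a
  have h : ∀ i j k, bidiff 𝔉.d 𝔉.P 1 (𝔉.d i (𝔉.curvForm j k)) a =
      𝔉.d i (𝔉.nabla j (𝔉.nabla k a) - 𝔉.nabla k (𝔉.nabla j a)) -
      (𝔉.nabla j (𝔉.nabla k (𝔉.d i a)) - 𝔉.nabla k (𝔉.nabla j (𝔉.d i a))) := by
    intro i j k
    rw [← bidiff_curvForm, ← bidiff_curvForm, bidiff_deriv 𝔉.d_comm 𝔉.d_P]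
    ring
  -- torsion-freeness: `[∇ⱼ, ∂ᵢ]` is symmetric in `i` and `j`
  have hs : ∀ i j, 𝔉.nabla j (𝔉.d i a) - 𝔉.d i (𝔉.nabla j a) =
      𝔉.nabla i (𝔉.d j a) - 𝔉.d j (𝔉.nabla i a) := by
    intro i j
    rw [nabla_d, nabla_d]
    simp only [add_sub_cancel_left, 𝔉.Γ_symm i j]
  have hs' : ∀ i j b, 𝔉.nabla j (𝔉.d i b) - 𝔉.d i (𝔉.nabla j b) =
      𝔉.nabla i (𝔉.d j b) - 𝔉.d j (𝔉.nabla i b) := by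
    intro i j b
    rw [nabla_d, nabla_d]
    simp only [add_sub_cancel_left, 𝔉.Γ_symm i j]
  have n1 := congrArg (𝔉.nabla j) (hs i k)
  have n2 := congrArg (𝔉.nabla k) (hs j i)
  have n3 := congrArg (𝔉.nabla i) (hs k j)
  have m1 := hs' i j (𝔉.nabla k a)
  have m2 := hs' j k (𝔉.nabla i a)
  have m3 := hs' k i (𝔉.nabla j a)
  simp only [map_sub] at n1 n2 n3
  rw [bidiff_add_left, bidiff_add_left, h, h, h]
  simp only [map_sub]
  linear_combination -n1 - n2 - n3 - m1 - m2 - m3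

end ConnectionData

end Data

/-! ### Fedosov's construction in local coordinates -/

section LocalFedosov

variable {ι A : Type*} [Fintype ι] [DecidableEq ι] [CommRing A] [Algebra ℂ A]

lemma MoyalData.IsHomog.eq_zero_of_d {𝔐 : MoyalData ι A} {s : ℤ} {a : A} (ha : 𝔐.IsHomog s a)
    (hs : s ≠ 0) (h : ∀ i, 𝔐.d i a = 0) : a = 0 := by
  have h3 := MoyalData.isHomog_zero_of_const h
  rw [MoyalData.IsHomog] at h3 ha
  rw [ha] at h3
  simpa [hs] using h3

namespace ConnectionData

open MoyalData

variable (𝔉 : ConnectionData ι A)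

/-- The covariant derivative along `∂ᵢ` on the Weyl algebra bundle. -/
def nablaW (i : ι) : 𝔉.weyl →ₗ[ℂ] 𝔉.weyl := liftDeriv (𝔉.nabla i) (𝔉.euler_nabla i)

lemma nablaW_apply (i : ι) (a : 𝔉.weyl) (k s : ℕ) :
    (𝔉.nablaW i a).1 k s = 𝔉.nabla i (a.1 k s) := rfl

/-- The operator `∇ᵢ - ∂/∂yᵢ`, the component of `∇ - δ` along `∂ᵢ`. -/
def baseD (i : ι) : 𝔉.weyl →ₗ[ℂ] 𝔉.weyl := 𝔉.nablaW i - fibDeriv i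

lemma baseD_apply (i : ι) (a : 𝔉.weyl) (k s : ℕ) :
    (𝔉.baseD i a).1 k s = 𝔉.nabla i (a.1 k s) - 𝔉.d i (a.1 k (s + 1)) := rfl

lemma isWeylDerivation_baseD (i : ι) : IsWeylDerivation (𝔉.baseD i) :=
  (isWeylDerivation_liftDeriv _ (𝔉.nabla_bidiff i)).sub (isWeylDerivation_fibDeriv i)

/-- The curvature form as an element of the Weyl algebra. -/
def curvW (i j : ι) : 𝔉.weyl := single 0 2 (𝔉.curvForm i j) (𝔉.isHomog_curvForm i j)

lemma curv_skew (i j l : ι) : 𝔉.curv j i l = - 𝔉.curv i j l := by simp [curv]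

lemma curvForm_skew (i j : ι) : 𝔉.curvForm j i = - 𝔉.curvForm i j := by
  simp [curvForm, 𝔉.curv_skew i j]

lemma curvW_skew (i j : ι) : 𝔉.curvW j i = - 𝔉.curvW i j := by
  ext k s
  have : (-𝔉.curvW i j).1 k s = -((𝔉.curvW i j).1 k s) := rfl
  rw [this, curvW, curvW, single_apply, single_apply]
  split_ifs <;> simp [𝔉.curvForm_skew i j]

lemma baseD_comm (i j : ι) (a : 𝔉.weyl) :
    𝔉.baseD i (𝔉.baseD j a) - 𝔉.baseD j (𝔉.baseD i a) = br (𝔉.curvW i j) a := by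
  ext k s
  rw [curvW, br_quadratic 𝔉.P_skew, bidiff_curvForm]
  change (𝔉.baseD i (𝔉.baseD j a)).1 k s - (𝔉.baseD j (𝔉.baseD i a)).1 k s = _
  simp only [baseD_apply, map_sub, 𝔉.nabla_d, 𝔉.d_comm j i, 𝔉.Γ_symm j i]
  ring

/-- The two Bianchi identities, combined. -/
lemma bianchi_curvW (i j k : ι) :
    𝔉.baseD i (𝔉.curvW j k) + 𝔉.baseD j (𝔉.curvW k i) + 𝔉.baseD k (𝔉.curvW i j) = 0 := by
  ext K S
  change (𝔉.baseD i (𝔉.curvW j k)).1 K S + (𝔉.baseD j (𝔉.curvW k i)).1 K S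
    + (𝔉.baseD k (𝔉.curvW i j)).1 K S = 0
  have e : ∀ i j k, (𝔉.baseD i (𝔉.curvW j k)).1 K S =
      (if K = 0 ∧ S = 2 then 𝔉.nabla i (𝔉.curvForm j k) else 0)
      - (if K = 0 ∧ S + 1 = 2 then 𝔉.d i (𝔉.curvForm j k) else 0) := by
    intro i j k
    rw [baseD_apply, curvW, single_apply, single_apply]
    split_ifs <;> simp
  rw [e, e, e]
  have h1 := 𝔉.bianchi_nabla i j k
  have h2 := 𝔉.bianchi_d i j k
  split_ifs
  · omega
  · linear_combination h1
  · linear_combination -h2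
  · simp

/-- The component along `∂ᵢ` of the connection `∇ - δ + (i/λ) [r, ·]`. -/
def totalD (r : ι → 𝔉.weyl) (i : ι) : 𝔉.weyl →ₗ[ℂ] 𝔉.weyl := 𝔉.baseD i + br (r i)

/-- The components of the total curvature `R + (∇ - δ) r + (i/λ) r ∘ r`. -/
def totalCurv (r : ι → 𝔉.weyl) (i j : ι) : 𝔉.weyl :=
  𝔉.curvW i j + 𝔉.baseD i (r j) - 𝔉.baseD j (r i) + br (r i) (r j)

variable {𝔉} (r : ι → 𝔉.weyl)

lemma totalD_eq (i : ι) (a : 𝔉.weyl) : 𝔉.totalD r i a = 𝔉.baseD i a + br (r i) a := rfl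

lemma totalD_apply (i : ι) (a : 𝔉.weyl) (k s : ℕ) : (𝔉.totalD r i a).1 k s =
    𝔉.nabla i (a.1 k s) - 𝔉.d i (a.1 k (s + 1)) + (br (r i) a).1 k s := rfl

lemma isWeylDerivation_totalD (i : ι) : IsWeylDerivation (𝔉.totalD r i) :=
  (𝔉.isWeylDerivation_baseD i).add (IsWeylDerivation.br_left _)

lemma totalCurv_skew (i j : ι) : 𝔉.totalCurv r j i = - 𝔉.totalCurv r i j := by
  rw [totalCurv, totalCurv, br_skew, curvW_skew]; abel

/-- The square of Fedosov's connection is the bracket with its total curvature. -/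
lemma totalD_comm (i j : ι) (a : 𝔉.weyl) :
    𝔉.totalD r i (𝔉.totalD r j a) - 𝔉.totalD r j (𝔉.totalD r i a) = br (𝔉.totalCurv r i j) a := by
  have h := 𝔉.baseD_comm i j a
  have hJ := br_jacobi (r i) (r j) a
  simp only [totalD_eq, totalCurv, map_add, map_sub, LinearMap.add_apply, LinearMap.sub_apply,
    (𝔉.isWeylDerivation_baseD _).map_br]
  rw [← h, hJ]
  abel

/-- The Bianchi identity for the total curvature. -/
lemma bianchi_totalCurv (i j k : ι) : 𝔉.totalD r i (𝔉.totalCurv r j k)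
    + 𝔉.totalD r j (𝔉.totalCurv r k i) + 𝔉.totalD r k (𝔉.totalCurv r i j) = 0 := by
  have h0 := 𝔉.bianchi_curvW i j k
  have h1 := 𝔉.baseD_comm i j (r k)
  have h2 := 𝔉.baseD_comm j k (r i)
  have h3 := 𝔉.baseD_comm k i (r j)
  have hJ := br_jacobi (r i) (r j) (r k)
  rw [br_skew (r k) (br (r i) (r j)), br_skew (r k) (r i), map_neg] at hJ
  simp only [totalD_eq, totalCurv, map_add, map_sub,
    (𝔉.isWeylDerivation_baseD _).map_br]
  rw [br_skew (𝔉.curvW i j) (r k), br_skew (𝔉.curvW j k) (r i), br_skew (𝔉.curvW k i) (r j),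
    br_skew (𝔉.baseD i (r j)) (r k), br_skew (𝔉.baseD j (r i)) (r k),
    br_skew (𝔉.baseD j (r k)) (r i), br_skew (𝔉.baseD k (r j)) (r i),
    br_skew (𝔉.baseD k (r i)) (r j), br_skew (𝔉.baseD i (r k)) (r j)]
  rw [eq_neg_of_add_eq_zero_right h0, ← h1, ← h2, ← h3, hJ]
  abel

section Vanishing

variable {r} (hr : ∀ i, DegGE 3 (r i))

lemma degGE_eq_zero {a : 𝔉.weyl} (h : ∀ n, DegGE n a) : a = 0 := by
  ext k s; exact h (s + 2 * k + 1) k s (by omega)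

include hr

/-- Modulo terms of higher degree, `D` is `-δ`. -/
lemma totalD_apply_of_degGE {a : 𝔉.weyl} {n : ℕ} (ha : DegGE n a) (i : ι) {k s : ℕ}
    (hn : s + 1 + 2 * k = n) : (𝔉.totalD r i a).1 k s = - 𝔉.d i (a.1 k (s + 1)) := by
  rw [totalD_apply, ha k s (by omega), ((hr i).br ha) k s (by omega)]
  simp

/-- A flat section is determined by its symbol. -/
lemma eq_zero_of_totalD {a : 𝔉.weyl} (h0 : ∀ k, a.1 k 0 = 0) (h : ∀ i, 𝔉.totalD r i a = 0) :
    a = 0 := by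
  refine degGE_eq_zero fun n => ?_
  induction n with
  | zero => intro k s h; omega
  | succ n ih =>
    intro k s hs
    rcases Nat.lt_succ_iff_lt_or_eq.1 hs with hs | hs
    · exact ih k s hs
    rcases s with _ | s
    · exact h0 k
    refine (a.2 k (s + 1)).eq_zero_of_d (by positivity) fun i => ?_
    have := totalD_apply_of_degGE hr ih i hs
    rw [h i] at this
    simpa using this.symm

/-- A closed one-form in the kernel of the contraction `δ⁻` vanishes. -/
lemma eq_zero_of_closed_one {B : ι → 𝔉.weyl} (hy : ∀ k s, ∑ j, 𝔉.y j * (B j).1 k s = 0)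
    (h : ∀ i j, 𝔉.totalD r i (B j) = 𝔉.totalD r j (B i)) (i : ι) : B i = 0 := by
  refine degGE_eq_zero fun n => ?_
  induction n generalizing i with
  | zero => intro k s h; omega
  | succ n ih =>
    intro k s hs
    rcases Nat.lt_succ_iff_lt_or_eq.1 hs with hs | hs
    · exact ih i k s hs
    have hd : ∀ j, 𝔉.d i ((B j).1 k s) = 𝔉.d j ((B i).1 k s) := by
      intro j
      rcases s with _ | s
      · rw [d_apply_zero, d_apply_zero]
      have h1 := totalD_apply_of_degGE hr (ih j) i hs
      have h2 := totalD_apply_of_degGE hr (ih i) j hs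
      rw [h i j, h2] at h1
      exact (neg_injective h1).symm
    have h1 := congrArg (𝔉.d i) (hy k s)
    simp only [map_sum, Derivation.leibniz, 𝔉.d_y, smul_eq_mul, sum_add_distrib, hd, map_zero,
      mul_ite, mul_one, mul_zero, sum_ite_eq, mem_univ, if_true] at h1
    rw [← euler_apply, (B i).2 k s] at h1
    have h2 : ((s : ℂ) + 1) • (B i).1 k s = 0 := by
      rw [add_smul, one_smul, ← h1]; simp
    exact (smul_eq_zero_iff_right (by exact_mod_cast Nat.succ_ne_zero s)).1 h2

/-- A closed two-form in the kernel of the contraction `δ⁻` vanishes. -/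
lemma eq_zero_of_closed_two {B : ι → ι → 𝔉.weyl} (hB : ∀ i j, B j i = - B i j)
    (hy : ∀ j k s, ∑ l, 𝔉.y l * (B l j).1 k s = 0)
    (h : ∀ i j k, 𝔉.totalD r i (B j k) + 𝔉.totalD r j (B k i) + 𝔉.totalD r k (B i j) = 0)
    (i j : ι) : B i j = 0 := by
  refine degGE_eq_zero fun n => ?_
  induction n generalizing i j with
  | zero => intro k s h; omega
  | succ n ih =>
    intro k s hs
    rcases Nat.lt_succ_iff_lt_or_eq.1 hs with hs | hs
    · exact ih i j k s hs
    have hB' : ∀ i j, (B j i).1 k s = - (B i j).1 k s := fun i j => by rw [hB i j]; rfl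
    have hd : ∀ l, 𝔉.d l ((B i j).1 k s) + 𝔉.d i ((B j l).1 k s) + 𝔉.d j ((B l i).1 k s) = 0 := by
      intro l
      rcases s with _ | s
      · simp [d_apply_zero]
      have h1 := totalD_apply_of_degGE hr (ih i j) l hs
      have h2 := totalD_apply_of_degGE hr (ih j l) i hs
      have h3 := totalD_apply_of_degGE hr (ih l i) j hs
      have h4 : (𝔉.totalD r l (B i j)).1 k s + (𝔉.totalD r i (B j l)).1 k s
        + (𝔉.totalD r j (B l i)).1 k s = 0 := congrFun (congrFun (congrArg Subtype.val (h l i j)) k) s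
      rw [h1, h2, h3] at h4
      linear_combination -h4
    have hc : ∀ p q, ∑ l, 𝔉.y l * 𝔉.d q ((B l p).1 k s) = - (B q p).1 k s := by
      intro p q
      have h1 := congrArg (𝔉.d q) (hy p k s)
      simp only [map_sum, Derivation.leibniz, 𝔉.d_y, smul_eq_mul, sum_add_distrib, map_zero,
        mul_ite, mul_one, mul_zero, sum_ite_eq, mem_univ, if_true] at h1
      exact eq_neg_of_add_eq_zero_left h1
    have h1 : ∑ l, 𝔉.y l * (𝔉.d l ((B i j).1 k s) + 𝔉.d i ((B j l).1 k s)
      + 𝔉.d j ((B l i).1 k s)) = 0 := by simp [hd]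
    simp only [mul_add, sum_add_distrib] at h1
    rw [← euler_apply, (B i j).2 k s, hc i j, hB' i j] at h1
    have h3 : ∑ l, 𝔉.y l * 𝔉.d i ((B j l).1 k s) = (B i j).1 k s := by
      have := hc j i
      rw [← neg_inj, ← this, ← sum_neg_distrib]
      exact sum_congr rfl fun l _ => by rw [hB' l j, map_neg]; ring
    rw [h3] at h1
    have h2 : ((s : ℂ) + 2) • (B i j).1 k s = 0 := by
      rw [← h1]; push_cast; module
    exact (smul_eq_zero_iff_right (by exact_mod_cast (Nat.succ_ne_zero (s + 1)))).1 h2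

/-- The equation `r = δ⁻ R + δ⁻ (∇ r + (i/λ) r ∘ r)` implies that the total curvature vanishes. -/
lemma totalCurv_eq_zero (h0 : ∀ j k, (r j).1 k 0 = 0)
    (h : ∀ j k q, ((q + 2 : ℕ) : ℂ) • (r j).1 k (q + 1) = ∑ l, 𝔉.y l *
      (𝔉.curvW l j + 𝔉.nablaW l (r j) - 𝔉.nablaW j (r l) + br (r l) (r j)).1 k q) (i j : ι) :
    𝔉.totalCurv r i j = 0 := by
  set G : ι → ι → 𝔉.weyl := fun l j =>
    𝔉.curvW l j + 𝔉.nablaW l (r j) - 𝔉.nablaW j (r l) + br (r l) (r j) with hG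
  have hGskew : ∀ l j, G j l = - G l j := by
    intro l j; simp only [hG]; rw [curvW_skew, br_skew]; abel
  have hyr : ∀ k s, ∑ j, 𝔉.y j * (r j).1 k s = 0 := by
    rintro k (_ | q)
    · simp [h0]
    have h1 : ((q + 2 : ℕ) : ℂ) • ∑ j, 𝔉.y j * (r j).1 k (q + 1) = 0 := by
      simp only [smul_sum, ← mul_smul_comm, h]
      have h2 : ∑ j, 𝔉.y j * ∑ l, 𝔉.y l * (G l j).1 k q =
          - ∑ j, 𝔉.y j * ∑ l, 𝔉.y l * (G l j).1 k q := by
        conv_lhs => simp only [mul_sum]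
        rw [sum_comm]
        simp only [mul_sum, ← sum_neg_distrib]
        refine sum_congr rfl fun l _ => sum_congr rfl fun j _ => ?_
        have : (G l j).1 k q = - (G j l).1 k q := by rw [hGskew]; rfl
        rw [this]; ring
      have h3 : (2 : ℂ) • ∑ j, 𝔉.y j * ∑ l, 𝔉.y l * (G l j).1 k q = 0 := by
        rw [two_smul]; nth_rw 1 [h2]; simp
      exact (smul_eq_zero_iff_right two_ne_zero).1 h3
    exact (smul_eq_zero_iff_right (by exact_mod_cast (Nat.succ_ne_zero (q + 1)))).1 h1
  refine eq_zero_of_closed_two hr (totalCurv_skew r) ?_ (bianchi_totalCurv r) i j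
  intro j k q
  have hA : ∀ l, (𝔉.totalCurv r l j).1 k q =
      (G l j).1 k q - 𝔉.d l ((r j).1 k (q + 1)) + 𝔉.d j ((r l).1 k (q + 1)) := by
    intro l
    change (𝔉.curvW l j).1 k q + (𝔉.nabla l ((r j).1 k q) - 𝔉.d l ((r j).1 k (q + 1)))
      - (𝔉.nabla j ((r l).1 k q) - 𝔉.d j ((r l).1 k (q + 1))) + (br (r l) (r j)).1 k q = _
    change _ = (𝔉.curvW l j).1 k q + 𝔉.nabla l ((r j).1 k q)
      - 𝔉.nabla j ((r l).1 k q) + (br (r l) (r j)).1 k q - _ + _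
    ring
  have h1 := congrArg (𝔉.d j) (hyr k (q + 1))
  simp only [map_sum, Derivation.leibniz, 𝔉.d_y, smul_eq_mul, sum_add_distrib, map_zero,
    mul_ite, mul_one, mul_zero, sum_ite_eq, mem_univ, if_true] at h1
  simp only [hA, mul_add, mul_sub, sum_add_distrib, sum_sub_distrib]
  rw [← h j k q, ← euler_apply, (r j).2 k (q + 1), eq_neg_of_add_eq_zero_left h1]
  push_cast
  module

omit hr in
lemma totalD_comm_of_totalCurv (h : ∀ i j, 𝔉.totalCurv r i j = 0) (i j : ι) (a : 𝔉.weyl) :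
    𝔉.totalD r i (𝔉.totalD r j a) = 𝔉.totalD r j (𝔉.totalD r i a) := by
  rw [← sub_eq_zero, totalD_comm, h, map_zero, LinearMap.zero_apply]

/-- The equation `a = σ(a) + δ⁻ (∇ a + (i/λ) [r, a])` implies that `a` is flat. -/
lemma totalD_eq_zero (hA : ∀ i j, 𝔉.totalCurv r i j = 0) {a : 𝔉.weyl}
    (h : ∀ k q, ((q + 1 : ℕ) : ℂ) • a.1 k (q + 1) =
      ∑ l, 𝔉.y l * (𝔉.nablaW l a + br (r l) a).1 k q) (i : ι) : 𝔉.totalD r i a = 0 := by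
  refine eq_zero_of_closed_one hr (B := fun i => 𝔉.totalD r i a) ?_
    (fun i j => totalD_comm_of_totalCurv hA i j a) i
  intro k q
  have hB : ∀ l, (𝔉.totalD r l a).1 k q =
      (𝔉.nablaW l a + br (r l) a).1 k q - 𝔉.d l (a.1 k (q + 1)) := by
    intro l
    change 𝔉.nabla l (a.1 k q) - 𝔉.d l (a.1 k (q + 1)) + (br (r l) a).1 k q =
      𝔉.nabla l (a.1 k q) + (br (r l) a).1 k q - _
    ring
  simp only [hB, mul_sub, sum_sub_distrib]
  rw [← h k q, ← euler_apply, a.2 k (q + 1)]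
  simp

end Vanishing

end ConnectionData

end LocalFedosov

/-! ### Smooth functions on open sets and homogeneous polynomials -/

lemma two_le_infty : (2 : ℕ∞ω) ≤ ∞ := ENat.LEInfty.out

section SmoothFunctions

variable {F : Type*} [NormedAddCommGroup F] [NormedSpace ℝ F]
  {G : Type*} [NormedAddCommGroup G] [NormedSpace ℝ G]

/-- The algebra of complex valued smooth functions on an open subset of a normed space. -/
def Sm (O : TopologicalSpace.Opens F) : Subalgebra ℂ (O → ℂ) where
  carrier := {f | ∃ g : F → ℂ, ContDiffOn ℝ ∞ g O ∧ ∀ p : O, f p = g p}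
  mul_mem' := by
    rintro f f' ⟨g, hg, h⟩ ⟨g', hg', h'⟩
    exact ⟨g * g', hg.mul hg', fun p => by simp [h, h']⟩
  add_mem' := by
    rintro f f' ⟨g, hg, h⟩ ⟨g', hg', h'⟩
    exact ⟨g + g', hg.add hg', fun p => by simp [h, h']⟩
  algebraMap_mem' c := ⟨fun _ => c, contDiffOn_const, fun _ => rfl⟩

namespace Sm

variable {O : TopologicalSpace.Opens F}

/-- The smooth function on `O` given by a function that is smooth on `O`. -/
def mk (g : F → ℂ) (hg : ContDiffOn ℝ ∞ g O) : Sm O := ⟨fun p => g p, g, hg, fun _ => rfl⟩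

/-- The extension by zero. -/
def zext (f : Sm O) : F → ℂ := Function.extend Subtype.val f.1 0

lemma zext_coe (f : Sm O) (p : O) : (zext f) p = f.1 p := Subtype.val_injective.extend_apply _ _ _

lemma zext_of_mem (f : Sm O) {p : F} (hp : p ∈ O) : (zext f) p = f.1 ⟨p, hp⟩ := (zext_coe f) ⟨p, hp⟩

lemma contDiffOn_zext (f : Sm O) : ContDiffOn ℝ ∞ (zext f) O := by
  obtain ⟨g, hg, h⟩ := f.2
  exact hg.congr fun p hp => by rw [zext_of_mem f hp, h]

lemma contDiffAt_zext (f : Sm O) {p : F} (hp : p ∈ O) : ContDiffAt ℝ ∞ (zext f) p :=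
  (contDiffOn_zext f).contDiffAt (O.2.mem_nhds hp)

lemma differentiableAt_zext (f : Sm O) {p : F} (hp : p ∈ O) : DifferentiableAt ℝ (zext f) p :=
  ((contDiffAt_zext f) hp).differentiableAt (by simp)

@[ext] lemma sm_ext {f g : Sm O} (h : ∀ p, f.1 p = g.1 p) : f = g := Subtype.ext (funext h)

lemma fderiv_zext (f : Sm O) {g : F → ℂ} (h : ∀ p : O, f.1 p = g p) {p : F} (hp : p ∈ O) :
    fderiv ℝ (zext f) p = fderiv ℝ g p := by
  refine Filter.EventuallyEq.fderiv_eq ?_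
  filter_upwards [O.2.mem_nhds hp] with q hq
  rw [zext_of_mem f hq, h]

/-- The directional derivative along a constant vector. -/
def dirDeriv (v : F) : Derivation ℂ (Sm O) (Sm O) :=
  Derivation.mk'
    { toFun := fun f => mk (fun p => fderiv ℝ (zext f) p v)
        (((contDiffOn_zext f).fderiv_of_isOpen O.2 le_rfl).clm_apply contDiffOn_const)
      map_add' := fun f g => by
        ext p
        change fderiv ℝ (zext (f + g)) p v = fderiv ℝ (zext f) p v + fderiv ℝ (zext g) p v
        rw [fderiv_zext (f + g) (g := (zext f) + (zext g)) (fun q => by simp [zext_coe]) p.2,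
          fderiv_add ((differentiableAt_zext f) p.2) ((differentiableAt_zext g) p.2)]
        rfl
      map_smul' := fun c f => by
        ext p
        change fderiv ℝ (zext (c • f)) p v = c • fderiv ℝ (zext f) p v
        rw [fderiv_zext (c • f) (g := c • (zext f)) (fun q => by simp [zext_coe]) p.2,
          fderiv_const_smul ((differentiableAt_zext f) p.2)]
        rfl }
    (fun f g => by
      ext p
      change fderiv ℝ (zext (f * g)) p v = f.1 p * fderiv ℝ (zext g) p v + g.1 p * fderiv ℝ (zext f) p v
      rw [fderiv_zext (f * g) (g := (zext f) * (zext g)) (fun q => by simp [zext_coe]) p.2,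
        fderiv_mul ((differentiableAt_zext f) p.2) ((differentiableAt_zext g) p.2)]
      simp [zext_coe])

lemma dirDeriv_apply (v : F) (f : Sm O) (p : O) :
    (dirDeriv v f).1 p = fderiv ℝ (zext f) p v := rfl

lemma dirDeriv_apply_of (v : F) (f : Sm O) {g : F → ℂ} (h : ∀ p : O, f.1 p = g p) (p : O) :
    (dirDeriv v f).1 p = fderiv ℝ g p v := by
  rw [dirDeriv_apply, (fderiv_zext f) h p.2]

lemma dirDeriv_comm (v w : F) (f : Sm O) :
    dirDeriv v (dirDeriv w f) = dirDeriv w (dirDeriv v f) := by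
  ext p
  have h : ∀ v w, (dirDeriv v (dirDeriv w f)).1 p = fderiv ℝ (fderiv ℝ (zext f)) p v w := by
    intro v w
    rw [dirDeriv_apply_of v _ (g := fun q => fderiv ℝ (zext f) q w) (fun q => rfl) p]
    have hd : DifferentiableAt ℝ (fderiv ℝ (zext f)) p :=
      (((contDiffAt_zext f) p.2).fderiv_right (m := 1) (by norm_cast)).differentiableAt (by simp)
    rw [fderiv_clm_apply hd (differentiableAt_const _)]
    simp
  rw [h, h]
  exact ((contDiffAt_zext f) p.2).isSymmSndFDerivAt (by simpa using two_le_infty) v w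

lemma fderiv_sum_smul_apply (f : Sm O) {κ : Type*} (t : Finset κ) (c : κ → ℝ) (v : κ → F) (p : O) :
    fderiv ℝ (zext f) p (∑ i ∈ t, c i • v i) = ∑ i ∈ t, (c i : ℂ) * (dirDeriv (v i) f).1 p := by
  rw [map_sum]
  exact sum_congr rfl fun i _ => by rw [map_smul, dirDeriv_apply]; simp

/-- The restriction of smooth functions along a smooth map. -/
def comap {U : TopologicalSpace.Opens G} (φ : G → F) (hφ : ContDiffOn ℝ ∞ φ U)
    (h : ∀ q ∈ U, φ q ∈ O) : Sm O →ₐ[ℂ] Sm U where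
  toFun f := ⟨fun q => f.1 ⟨φ q, h q q.2⟩, (zext f) ∘ φ, (contDiffOn_zext f).comp hφ h, fun q => by
    rw [Function.comp_apply, zext_of_mem f (h q q.2)]⟩
  map_one' := rfl
  map_mul' _ _ := rfl
  map_zero' := rfl
  map_add' _ _ := rfl
  commutes' _ := rfl

lemma comap_apply {U : TopologicalSpace.Opens G} (φ : G → F) (hφ : ContDiffOn ℝ ∞ φ U)
    (h : ∀ q ∈ U, φ q ∈ O) (f : Sm O) (q : U) :
    (comap φ hφ h f).1 q = f.1 ⟨φ q, h q q.2⟩ := rfl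

lemma dirDeriv_comap {U : TopologicalSpace.Opens G} (φ : G → F) (hφ : ContDiffOn ℝ ∞ φ U)
    (h : ∀ q ∈ U, φ q ∈ O) (f : Sm O) (q : U) (v : G) :
    (dirDeriv v (comap φ hφ h f)).1 q = fderiv ℝ (zext f) (φ q) (fderiv ℝ φ q v) := by
  rw [dirDeriv_apply_of v _ (g := (zext f) ∘ φ)
    (fun q => by rw [Function.comp_apply, zext_of_mem f (h q q.2), comap_apply]),
    fderiv_comp _ ((differentiableAt_zext f) (h q q.2))
      ((hφ.contDiffAt (U.2.mem_nhds q.2)).differentiableAt (by simp))]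
  rfl

end Sm

end SmoothFunctions

section Polynomials

variable {d : ℕ}

/-- The standard basis of the coordinate space. -/
def basisVec (i : Fin d) : Euc d := EuclideanSpace.single i (1 : ℝ)

lemma sum_smul_basisVec (y : Euc d) : ∑ i, y i • basisVec i = y := by
  ext j
  simp [basisVec, Pi.single_apply]

lemma basisVec_apply (i j : Fin d) : (basisVec i : Euc d) j = if j = i then 1 else 0 := by
  simp [basisVec]

lemma map_eq_sum_basisVec {V : Type*} [AddCommGroup V] [Module ℝ V] (f : Euc d →ₗ[ℝ] V)
    (y : Euc d) : f y = ∑ i, y i • f (basisVec i) := by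
  conv_lhs => rw [← sum_smul_basisVec y]
  simp

lemma contDiff_coord (i : Fin d) : ContDiff ℝ ∞ (fun y : Euc d => ((y i : ℝ) : ℂ)) :=
  Complex.ofRealCLM.contDiff.comp (EuclideanSpace.proj i : Euc d →L[ℝ] ℝ).contDiff

lemma multilinear_diag_succ {s : ℕ} (A : MultilinearMap ℝ (fun _ : Fin (s + 1) => Euc d) ℂ)
    (y : Euc d) : A (fun _ => y) = ∑ i, (y i : ℂ) * A.curryLeft (basisVec i) (fun _ => y) := by
  have h : A (fun _ => y) = A.curryLeft y (fun _ => y) := by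
    rw [MultilinearMap.curryLeft_apply]
    congr 1
    ext i
    refine Fin.cases ?_ (fun j => ?_) i <;> simp
  rw [h, map_eq_sum_basisVec A.curryLeft y]
  simp [_root_.sum_apply]

lemma contDiff_multilinear_diag {s : ℕ} (A : MultilinearMap ℝ (fun _ : Fin s => Euc d) ℂ) :
    ContDiff ℝ ∞ (fun y => A (fun _ => y)) := by
  induction s with
  | zero =>
    have : (fun y => A (fun _ => y)) = fun _ : Euc d => A (fun _ => 0) := by
      ext y; congr 1; exact Subsingleton.elim _ _
    rw [this]; exact contDiff_const
  | succ s ih =>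
    simp only [multilinear_diag_succ]
    exact ContDiff.sum fun i _ => (contDiff_coord i).mul (ih _)

lemma fderiv_multilinear_diag {s : ℕ} (A : MultilinearMap ℝ (fun _ : Fin s => Euc d) ℂ)
    (y : Euc d) : fderiv ℝ (fun y => A (fun _ => y)) y y = (s : ℂ) * A (fun _ => y) := by
  have h1 : HasDerivAt (fun t : ℝ => t • y) y 1 := by
    simpa using (hasDerivAt_id (1 : ℝ)).smul_const y
  have h2 : HasFDerivAt (fun y => A (fun _ => y)) (fderiv ℝ (fun y => A (fun _ => y)) y)
      ((1 : ℝ) • y) := by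
    rw [one_smul]
    exact ((contDiff_multilinear_diag A).differentiable (by simp) y).hasFDerivAt
  have h3 := h2.comp_hasDerivAt (1 : ℝ) h1
  have h4 : ((fun y => A (fun _ => y)) ∘ fun t : ℝ => t • y) =
      fun t : ℝ => ((t ^ s : ℝ) : ℂ) * A (fun _ => y) := by
    ext t
    have := A.map_smul_univ (fun _ => t) (fun _ => y)
    simpa using this
  rw [h4] at h3
  have h5 : HasDerivAt (fun t : ℝ => ((t ^ s : ℝ) : ℂ) * A (fun _ => y))
      ((((s : ℝ) * 1 ^ (s - 1) : ℝ) : ℂ) * A (fun _ => y)) 1 :=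
    ((hasDerivAt_pow s (1 : ℝ)).ofReal_comp).mul_const _
  rw [h3.unique h5]
  simp

/-- A function with vanishing radial derivative is constant along rays. -/
lemma eq_const_of_fderiv_self {f : Euc d → ℂ} (hf : ContDiff ℝ ∞ f)
    (h : ∀ y, fderiv ℝ f y y = 0) (y : Euc d) : f y = f 0 := by
  have hd : ∀ t : ℝ, HasDerivAt (fun t : ℝ => f (t • y)) (fderiv ℝ f (t • y) y) t := by
    intro t
    have h1 : HasDerivAt (fun t : ℝ => t • y) y t := by
      simpa using (hasDerivAt_id t).smul_const y
    exact ((hf.differentiable (by simp) _).hasFDerivAt).comp_hasDerivAt t h1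
  have h0 : ∀ t : ℝ, t ≠ 0 → fderiv ℝ f (t • y) y = 0 := by
    intro t ht
    have := h (t • y)
    rw [map_smul] at this
    exact (smul_eq_zero_iff_right ht).1 this
  have hc : Continuous fun t : ℝ => fderiv ℝ f (t • y) y := by
    have := hf.continuous_fderiv (by simp)
    fun_prop
  have h00 : ∀ t : ℝ, fderiv ℝ f (t • y) y = 0 := by
    have h1 : Set.EqOn (fun t : ℝ => fderiv ℝ f (t • y) y) (fun _ => 0) ({0}ᶜ : Set ℝ) :=
      fun t ht => h0 t ht
    have := hc.ext_on (dense_compl_singleton (0 : ℝ)) continuous_const h1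
    exact fun t => congrFun this t
  have := is_const_of_deriv_eq_zero (f := fun t : ℝ => f (t • y))
    (fun t => (hd t).differentiableAt) (fun t => by rw [(hd t).deriv, h00]) 1 0
  simpa using this

/-- Smooth solutions of Euler's equation are homogeneous polynomials. -/
lemma exists_multilinear_of_euler {f : Euc d → ℂ} {s : ℕ} (hf : ContDiff ℝ ∞ f)
    (h : ∀ y, fderiv ℝ f y y = (s : ℂ) * f y) :
    ∃ A : MultilinearMap ℝ (fun _ : Fin s => Euc d) ℂ, ∀ y, f y = A (fun _ => y) := by
  induction s generalizing f with
  | zero =>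
    refine ⟨MultilinearMap.constOfIsEmpty ℝ _ (f 0), fun y => ?_⟩
    simpa using eq_const_of_fderiv_self hf (by simpa using h) y
  | succ s ih =>
    have hfd : ContDiff ℝ ∞ (fderiv ℝ f) := hf.fderiv_right (by norm_cast)
    have hd : ∀ i : Fin d, ∀ y, fderiv ℝ (fun y => fderiv ℝ f y (basisVec i)) y y =
        (s : ℂ) * fderiv ℝ f y (basisVec i) := by
      intro i y
      have h1 : fderiv ℝ (fun y => fderiv ℝ f y y) y (basisVec i) =
          ((s + 1 : ℕ) : ℂ) * fderiv ℝ f y (basisVec i) := by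
        have : (fun y => fderiv ℝ f y y) = fun y => ((s + 1 : ℕ) : ℂ) * f y := funext h
        rw [this, fderiv_const_mul (hf.differentiable (by simp) y)]
        simp
      rw [fderiv_clm_apply (hfd.differentiable (by simp) y) differentiableAt_fun_id] at h1
      rw [fderiv_clm_apply (hfd.differentiable (by simp) y) (differentiableAt_const _)]
      have hs := hf.contDiffAt.isSymmSndFDerivAt (x := y) (by simpa using two_le_infty) y (basisVec i)
      simp at h1 ⊢
      rw [hs]
      linear_combination h1
    choose A hA using fun i => ih (f := fun y => fderiv ℝ f y (basisVec i))
      (hfd.clm_apply contDiff_const) (hd i)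
    let L : Euc d →ₗ[ℝ] MultilinearMap ℝ (fun _ : Fin s => Euc d) ℂ :=
      ∑ i, (EuclideanSpace.proj i : Euc d →L[ℝ] ℝ).toLinearMap.smulRight
        (((s + 1 : ℕ) : ℂ)⁻¹ • A i)
    refine ⟨L.uncurryLeft, fun y => ?_⟩
    have h2 : f y = ((s + 1 : ℕ) : ℂ)⁻¹ * fderiv ℝ f y y := by
      rw [h, ← mul_assoc, inv_mul_cancel₀ (by exact_mod_cast Nat.succ_ne_zero s), one_mul]
    have h3 : fderiv ℝ f y y = ∑ i, y i • fderiv ℝ f y (basisVec i) :=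
      map_eq_sum_basisVec (fderiv ℝ f y).toLinearMap y
    rw [h2, h3]
    have ht : Fin.tail (fun _ : Fin (s + 1) => y) = fun _ => y := rfl
    simp only [LinearMap.uncurryLeft_apply, L, LinearMap.sum_apply, _root_.sum_apply,
      LinearMap.smulRight_apply, _root_.smul_apply, ht, hA, mul_sum]
    exact sum_congr rfl fun i _ => by simp; ring

/-- In a finite dimensional space of functions, a function is determined by its values at finitely
many points, linearly. -/
lemma exists_interpolation {α : Type*} (H : Submodule ℂ (α → ℂ)) [FiniteDimensional ℂ H] :
    ∃ (n : ℕ) (y : Fin n → α) (h : Fin n → α → ℂ), (∀ i, h i ∈ H) ∧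
      ∀ f ∈ H, ∀ x, f x = ∑ i, f (y i) * h i x := by
  induction hn : Module.finrank ℂ H using Nat.strong_induction_on generalizing H with
  | _ n ih =>
    by_cases h0 : H = ⊥
    · refine ⟨0, Fin.elim0, Fin.elim0, fun i => i.elim0, fun f hf x => ?_⟩
      rw [h0, Submodule.mem_bot] at hf
      simp [hf]
    obtain ⟨f, hf, hne⟩ := Submodule.exists_mem_ne_zero_of_ne_bot h0
    obtain ⟨x0, hx0⟩ := Function.ne_iff.1 hne
    let H' : Submodule ℂ (α → ℂ) := H ⊓ LinearMap.ker (LinearMap.proj x0 : (α → ℂ) →ₗ[ℂ] ℂ)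
    have hlt : H' < H := by
      refine lt_of_le_of_ne inf_le_left fun e => hx0 ?_
      rw [← e] at hf
      exact hf.2
    have : FiniteDimensional ℂ H' := Submodule.finiteDimensional_of_le inf_le_left
    obtain ⟨m, y, h, hH, hr⟩ := ih _ (by rw [← hn]; exact Submodule.finrank_lt_finrank_of_lt hlt)
      H' rfl
    let e : α → ℂ := (f x0)⁻¹ • f
    have he : e ∈ H := H.smul_mem _ hf
    have he0 : e x0 = 1 := by simpa [e] using inv_mul_cancel₀ hx0
    refine ⟨m + 1, Fin.cons x0 y, Fin.cons (e - ∑ i, e (y i) • h i) h, ?_, ?_⟩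
    · refine Fin.cases ?_ fun i => ?_
      · exact H.sub_mem he (H.sum_mem fun i _ => H.smul_mem _ (hH i).1)
      · simpa using (hH i).1
    · intro g hg x
      have h1 : g - g x0 • e ∈ H' :=
        ⟨H.sub_mem hg (H.smul_mem _ he), by simp [he0]⟩
      have h2 := hr _ h1 x
      rw [Fin.sum_univ_succ]
      simp only [Fin.cons_zero, Fin.cons_succ, Pi.sub_apply, Pi.smul_apply, smul_eq_mul,
        Finset.sum_apply, sub_mul, sum_sub_distrib] at h2 ⊢
      rw [sub_eq_iff_eq_add] at h2
      rw [h2, mul_sub, mul_sum]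
      simp only [mul_assoc]
      ring

/-- The homogeneous polynomial functions of degree `s`. -/
def homogPoly (d s : ℕ) : Submodule ℂ (Euc d → ℂ) :=
  LinearMap.range ({ toFun := fun A y => A (fun _ => y)
                     map_add' := fun _ _ => rfl
                     map_smul' := fun _ _ => rfl } :
    MultilinearMap ℝ (fun _ : Fin s => Euc d) ℂ →ₗ[ℂ] (Euc d → ℂ))

lemma mem_homogPoly {s : ℕ} {f : Euc d → ℂ} : f ∈ homogPoly d s ↔
    ∃ A : MultilinearMap ℝ (fun _ : Fin s => Euc d) ℂ, ∀ y, f y = A (fun _ => y) := by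
  constructor
  · rintro ⟨A, rfl⟩; exact ⟨A, fun _ => rfl⟩
  · rintro ⟨A, h⟩; exact ⟨A, (funext h).symm⟩

instance (s : ℕ) : FiniteDimensional ℂ (homogPoly d s) := by
  have : Module.Finite ℂ (MultilinearMap ℝ (fun _ : Fin s => Euc d) ℂ) :=
    Module.Finite.of_restrictScalars_finite ℝ ℂ _
  exact Module.Finite.range _

lemma contDiff_of_mem_homogPoly {s : ℕ} {f : Euc d → ℂ} (hf : f ∈ homogPoly d s) :
    ContDiff ℝ ∞ f := by
  obtain ⟨A, hA⟩ := mem_homogPoly.1 hf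
  rw [funext hA]
  exact contDiff_multilinear_diag A

lemma fderiv_of_mem_homogPoly {s : ℕ} {f : Euc d → ℂ} (hf : f ∈ homogPoly d s) (y : Euc d) :
    fderiv ℝ f y y = (s : ℂ) * f y := by
  obtain ⟨A, hA⟩ := mem_homogPoly.1 hf
  rw [funext hA]
  exact fderiv_multilinear_diag A y

lemma mem_homogPoly_of_euler {f : Euc d → ℂ} {s : ℕ} (hf : ContDiff ℝ ∞ f)
    (h : ∀ y, fderiv ℝ f y y = (s : ℂ) * f y) : f ∈ homogPoly d s :=
  mem_homogPoly.2 (exists_multilinear_of_euler hf h)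

lemma comp_mem_homogPoly {d' s : ℕ} {f : Euc d → ℂ} (hf : f ∈ homogPoly d s)
    (L : Euc d' →ₗ[ℝ] Euc d) : (fun y => f (L y)) ∈ homogPoly d' s := by
  obtain ⟨A, hA⟩ := mem_homogPoly.1 hf
  exact mem_homogPoly.2 ⟨A.compLinearMap fun _ => L, fun y => by rw [hA]; rfl⟩

end Polynomials

/-! ### The Moyal-Weyl product on fibres and its naturality -/

section MoyalBridge

variable {d d' : ℕ}

lemma map_gradedMul {ι A ι' A' : Type*} [Fintype ι] [CommRing A] [Algebra ℂ A] [Fintype ι']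
    [CommRing A'] [Algebra ℂ A'] {d : ι → Derivation ℂ A A} {P : ι → ι → A}
    {d' : ι' → Derivation ℂ A' A'} {P' : ι' → ι' → A'} (Φ : A →ₐ[ℂ] A') (L : ι → ι' → ℂ)
    (hd : ∀ i' a, d' i' (Φ a) = ∑ i, L i i' • Φ (d i a))
    (hP : ∀ i j, Φ (P i j) = ∑ i', ∑ j', (L i i' * L j j') • P' i' j') (a b : ℕ → ℕ → A)
    (K S : ℕ) : Φ (gradedMul d P a b K S) =
      gradedMul d' P' (fun k s => Φ (a k s)) (fun k s => Φ (b k s)) K S := by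
  simp only [gradedMul, map_sum, map_smul, map_bidiff Φ L hd hP]

/-- The algebra of smooth functions on the whole coordinate space. -/
abbrev SmE (d : ℕ) := Sm (⊤ : TopologicalSpace.Opens (Euc d))

/-- The partial derivatives. -/
def partialE (i : Fin d) : Derivation ℂ (SmE d) (SmE d) := Sm.dirDeriv (basisVec i)

lemma contDiff_zext (f : SmE d) : ContDiff ℝ ∞ (Sm.zext f) := by
  have := Sm.contDiffOn_zext f
  rwa [TopologicalSpace.Opens.coe_top, contDiffOn_univ] at this

lemma zext_partialE (i : Fin d) (f : SmE d) :
    Sm.zext (partialE i f) = fun y => fderiv ℝ (Sm.zext f) y (basisVec i) := by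
  ext y
  exact Sm.zext_coe (O := (⊤ : TopologicalSpace.Opens (Euc d))) _ ⟨y, trivial⟩

lemma bidiff_eval (P : Fin d → Fin d → ℂ) (m : ℕ) (f g : SmE d)
    (y : (⊤ : TopologicalSpace.Opens (Euc d))) :
    (bidiff (A := SmE d) partialE (fun i j => algebraMap ℂ (SmE d) (P i j)) m f g).1 y =
      ∑ I : Fin m → Fin d, ∑ J : Fin m → Fin d, (∏ t, P (I t) (J t)) *
        iteratedFDeriv ℝ m (Sm.zext f) y (fun t => basisVec (I t)) *
        iteratedFDeriv ℝ m (Sm.zext g) y (fun t => basisVec (J t)) := by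
  induction m generalizing f g with
  | zero => simp [Sm.zext_coe]
  | succ m ih =>
    have hd : ∀ (f : SmE d) (I : Fin m → Fin d) (i : Fin d),
        iteratedFDeriv ℝ (m + 1) (Sm.zext f) y
          (fun t => basisVec ((Fin.snocEquiv fun _ => Fin d) (i, I) t)) =
        iteratedFDeriv ℝ m (Sm.zext (partialE i f)) y (fun t => basisVec (I t)) := by
      intro f I i
      rw [iteratedFDeriv_succ_apply_right, zext_partialE]
      have h1 := (ContinuousLinearMap.apply ℝ ℂ (basisVec i : Euc d)).iteratedFDeriv_comp_left
        (f := fderiv ℝ (Sm.zext f)) (x := (y : Euc d)) (n := ∞) (i := m)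
        ((contDiff_zext f).fderiv_right (by norm_cast)).contDiffAt (by exact_mod_cast le_top)
      have h2 : (ContinuousLinearMap.apply ℝ ℂ (basisVec i : Euc d)) ∘ fderiv ℝ (Sm.zext f) =
        fun y => fderiv ℝ (Sm.zext f) y (basisVec i) := rfl
      rw [h2] at h1
      rw [h1]
      simp only [ContinuousLinearMap.compContinuousMultilinearMap_coe, Function.comp_apply,
        ContinuousLinearMap.apply_apply]
      congr 2
      · ext t : 1; simp [Fin.init, Fin.snocEquiv]
      · simp [Fin.snocEquiv]
    rw [bidiff_succ, ← (Fin.snocEquiv fun _ => Fin d).sum_comp, Fintype.sum_prod_type]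
    have hs : ∀ F : Fin d → SmE d, (∑ i, F i).1 y = ∑ i, (F i).1 y := fun F => by simp
    rw [hs]
    refine sum_congr rfl fun i _ => ?_
    rw [hs]
    simp only [hd]
    have hJ : ∀ I : Fin m → Fin d, ∑ J : Fin (m + 1) → Fin d,
        (∏ t, P ((Fin.snocEquiv fun _ => Fin d) (i, I) t) (J t)) *
        iteratedFDeriv ℝ m (Sm.zext (partialE i f)) y (fun t => basisVec (I t)) *
        iteratedFDeriv ℝ (m + 1) (Sm.zext g) y (fun t => basisVec (J t)) =
        ∑ j, ∑ J : Fin m → Fin d, P i j * ((∏ t, P (I t) (J t)) *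
          iteratedFDeriv ℝ m (Sm.zext (partialE i f)) y (fun t => basisVec (I t)) *
          iteratedFDeriv ℝ m (Sm.zext (partialE j g)) y (fun t => basisVec (J t))) := by
      intro I
      rw [← (Fin.snocEquiv fun _ => Fin d).sum_comp, Fintype.sum_prod_type]
      refine sum_congr rfl fun j _ => sum_congr rfl fun J _ => ?_
      rw [hd, Fin.prod_univ_castSucc]
      simp [Fin.snocEquiv]
      ring
    simp only [hJ]
    rw [sum_comm]
    refine sum_congr rfl fun j _ => ?_
    have hm : ∀ F : SmE d, ((algebraMap ℂ (SmE d) (P i j)) * F).1 y = P i j * F.1 y := fun F => rfl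
    rw [hm, ih]
    simp only [mul_sum]

/-- A family of smooth functions as a family of elements of the algebra of smooth functions. -/
def liftElt (a : WeylElt d) (ha : ∀ k s, ContDiff ℝ ∞ (a k s)) : ℕ → ℕ → SmE d :=
  fun k s => Sm.mk (a k s) (ha k s).contDiffOn

lemma zext_liftElt (a : WeylElt d) (ha : ∀ k s, ContDiff ℝ ∞ (a k s)) (k s : ℕ) :
    Sm.zext (liftElt a ha k s) = a k s := by
  ext y; exact Sm.zext_coe (O := (⊤ : TopologicalSpace.Opens (Euc d))) _ ⟨y, trivial⟩

lemma moyal_eq_gradedMul (P : Matrix (Fin d) (Fin d) ℝ) {a b : WeylElt d}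
    (ha : ∀ k s, ContDiff ℝ ∞ (a k s)) (hb : ∀ k s, ContDiff ℝ ∞ (b k s)) (K S : ℕ) (y : Euc d) :
    moyal P a b K S y = (gradedMul (A := SmE d) partialE (fun i j => algebraMap ℂ (SmE d) (P i j : ℂ)) (liftElt a ha)
      (liftElt b hb) K S).1 ⟨y, trivial⟩ := by
  have hs : ∀ {κ : Type} (t : Finset κ) (F : κ → SmE d) (p : (⊤ : TopologicalSpace.Opens (Euc d))),
    (∑ i ∈ t, F i).1 p = ∑ i ∈ t, (F i).1 p := fun t F p => by simp
  simp only [moyal, gradedMul, hs]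
  refine sum_congr rfl fun m _ => sum_congr rfl fun k _ => sum_congr rfl fun s _ => ?_
  have hc : ∀ (c : ℂ) (F : SmE d) (p : (⊤ : TopologicalSpace.Opens (Euc d))),
    (c • F).1 p = c * F.1 p := fun _ _ _ => rfl
  rw [hc, bidiff_eval, zext_liftElt, zext_liftElt]
  rfl

/-- The product of smooth families on an open set `O` is computed by the Moyal-Weyl product on the
fibres of a map `y ↦ φ y` into `O`, if the fibre derivations are `φ`-related up to a matrix `L`. -/
lemma moyal_of_related {F : Type*} [NormedAddCommGroup F] [NormedSpace ℝ F]
    {O : TopologicalSpace.Opens F} {ι : Type*} [Fintype ι] {der : ι → Derivation ℂ (Sm O) (Sm O)}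
    {P : ι → ι → Sm O} {P' : Matrix (Fin d) (Fin d) ℝ} (φ : Euc d → F) (hφ : ContDiff ℝ ∞ φ)
    (h : ∀ y, φ y ∈ O) (L : ι → Fin d → ℂ)
    (hder : ∀ i' f y, fderiv ℝ (Sm.zext f) (φ y) (fderiv ℝ φ y (basisVec i')) =
      ∑ i, L i i' * (der i f).1 ⟨φ y, h y⟩)
    (hP : ∀ i j y, (P i j).1 ⟨φ y, h y⟩ = ∑ i', ∑ j', L i i' * L j j' * (P' i' j' : ℂ))
    {a b : ℕ → ℕ → Sm O} {α β : WeylElt d} (hα : ∀ k s y, α k s y = (a k s).1 ⟨φ y, h y⟩)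
    (hβ : ∀ k s y, β k s y = (b k s).1 ⟨φ y, h y⟩) (K S : ℕ) (y : Euc d) :
    moyal P' α β K S y = (gradedMul der P a b K S).1 ⟨φ y, h y⟩ := by
  set Φ : Sm O →ₐ[ℂ] SmE d := Sm.comap φ hφ.contDiffOn (fun y _ => h y) with hΦ
  have hsα : ∀ k s, ContDiff ℝ ∞ (α k s) := by
    intro k s
    have : α k s = Sm.zext (Φ (a k s)) := by
      ext y; rw [hα]; exact (Sm.zext_coe (Φ (a k s)) ⟨y, trivial⟩).symm
    rw [this]; exact contDiff_zext _
  have hsβ : ∀ k s, ContDiff ℝ ∞ (β k s) := by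
    intro k s
    have : β k s = Sm.zext (Φ (b k s)) := by
      ext y; rw [hβ]; exact (Sm.zext_coe (Φ (b k s)) ⟨y, trivial⟩).symm
    rw [this]; exact contDiff_zext _
  have hs : ∀ {κ : Type _} (t : Finset κ) (F : κ → SmE d)
    (p : (⊤ : TopologicalSpace.Opens (Euc d))),
    (∑ i ∈ t, F i).1 p = ∑ i ∈ t, (F i).1 p := fun t F p => by simp
  have hs' : ∀ {κ : Type} (t : Finset κ) (F : κ → SmE d)
    (p : (⊤ : TopologicalSpace.Opens (Euc d))),
    (∑ i ∈ t, F i).1 p = ∑ i ∈ t, (F i).1 p := fun t F p => by simp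
  have key := map_gradedMul (A := Sm O) (A' := SmE d) (d := der) (P := P) (d' := partialE)
    (P' := fun i j => algebraMap ℂ (SmE d) (P' i j : ℂ)) Φ L (fun i' f => by
      ext q
      rw [hs]
      exact (Sm.dirDeriv_comap φ hφ.contDiffOn (fun y _ => h y) f q (basisVec i')).trans
        (hder i' f q))
    (fun i j => by
      ext q
      rw [hs']
      simp only [hs']
      exact hP i j q) a b K S
  rw [moyal_eq_gradedMul P' hsα hsβ]
  have h1 : liftElt α hsα = fun k s => Φ (a k s) := by
    ext k s q; exact hα k s q
  have h2 : liftElt β hsβ = fun k s => Φ (b k s) := by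
    ext k s q; exact hβ k s q
  rw [h1, h2, ← key]
  rfl

/-- Naturality of the Moyal-Weyl product under linear maps. -/
lemma moyal_comp (L : Euc d' →L[ℝ] Euc d) {P : Matrix (Fin d) (Fin d) ℝ}
    {P' : Matrix (Fin d') (Fin d') ℝ}
    (hP : ∀ i j, P i j = ∑ i', ∑ j', L (basisVec i') i * L (basisVec j') j * P' i' j')
    {a b : WeylElt d} (ha : ∀ k s, ContDiff ℝ ∞ (a k s)) (hb : ∀ k s, ContDiff ℝ ∞ (b k s))
    (K S : ℕ) (y : Euc d') :
    moyal P' (fun k s y => a k s (L y)) (fun k s y => b k s (L y)) K S y =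
      moyal P a b K S (L y) := by
  rw [moyal_eq_gradedMul P ha hb]
  refine moyal_of_related (O := ⊤) (der := partialE)
    (P := fun i j => algebraMap ℂ (SmE d) (P i j : ℂ)) L
    L.contDiff (fun _ => trivial) (fun i i' => ((L (basisVec i') i : ℝ) : ℂ)) ?_ ?_
    (a := liftElt a ha) (b := liftElt b hb) (fun k s y => rfl) (fun k s y => rfl) K S y
  · intro i' f y
    rw [L.fderiv, ← sum_smul_basisVec (L (basisVec i')), Sm.fderiv_sum_smul_apply f _ _ _
      ⟨L y, trivial⟩, sum_smul_basisVec]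
    rfl
  · intro i j y
    have : ((algebraMap ℂ (SmE d) (P i j : ℂ))).1 ⟨L y, trivial⟩ = (P i j : ℂ) := rfl
    rw [this, hP]
    push_cast
    rfl

lemma scaledComm_comp (L : Euc d' →L[ℝ] Euc d) {P : Matrix (Fin d) (Fin d) ℝ}
    {P' : Matrix (Fin d') (Fin d') ℝ}
    (hP : ∀ i j, P i j = ∑ i', ∑ j', L (basisVec i') i * L (basisVec j') j * P' i' j')
    {a b : WeylElt d} (ha : ∀ k s, ContDiff ℝ ∞ (a k s)) (hb : ∀ k s, ContDiff ℝ ∞ (b k s))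
    (K S : ℕ) (y : Euc d') :
    scaledComm P' (fun k s y => a k s (L y)) (fun k s y => b k s (L y)) K S y =
      scaledComm P a b K S (L y) := by
  simp only [scaledComm, moyal_comp L hP ha hb, moyal_comp L hP hb ha]

end MoyalBridge

section FormMatrix

variable {d d' : ℕ}

/-- The matrix of a bilinear form. -/
def formMatrix (B : Euc d →L[ℝ] Euc d →L[ℝ] ℝ) : Matrix (Fin d) (Fin d) ℝ :=
  Matrix.of fun i j => B (basisVec i) (basisVec j)

lemma form_apply_eq_sum (B : Euc d →L[ℝ] Euc d →L[ℝ] ℝ) (v w : Euc d) :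
    B v w = ∑ i, ∑ j, v i * w j * B (basisVec i) (basisVec j) := by
  conv_lhs => rw [← sum_smul_basisVec v, ← sum_smul_basisVec w]
  simp only [map_sum, map_smul, _root_.sum_apply, _root_.smul_apply,
    smul_eq_mul, mul_sum]
  rw [sum_comm]
  exact sum_congr rfl fun i _ => sum_congr rfl fun j _ => by ring

lemma isUnit_det_formMatrix {B : Euc d →L[ℝ] Euc d →L[ℝ] ℝ} (hB : ∀ v, (∀ w, B v w = 0) → v = 0) :
    IsUnit (formMatrix B).det := by
  rw [isUnit_iff_ne_zero]
  intro h0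
  obtain ⟨v, hv, h⟩ := Matrix.exists_vecMul_eq_zero_iff.2 h0
  apply hv
  have := hB (WithLp.toLp 2 v) fun w => by
    rw [form_apply_eq_sum, sum_comm]
    refine sum_eq_zero fun j _ => ?_
    have hj := congrFun h j
    simp only [Matrix.vecMul, dotProduct, formMatrix, Matrix.of_apply, Pi.zero_apply] at hj
    have : ∑ i, (WithLp.toLp 2 v : Euc d) i * w j * B (basisVec i) (basisVec j) =
        w j * ∑ i, v i * B (basisVec i) (basisVec j) := by
      rw [mul_sum]; exact sum_congr rfl fun i _ => by ring
    rw [this, hj, mul_zero]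
  ext i
  exact congrArg (fun z : Euc d => z i) this

lemma formMatrix_inv_of_comp {B : Euc d →L[ℝ] Euc d →L[ℝ] ℝ} {B' : Euc d' →L[ℝ] Euc d' →L[ℝ] ℝ}
    (L : Euc d' ≃L[ℝ] Euc d) (hL : ∀ v w, B (L v) (L w) = B' v w)
    (hB : ∀ v, (∀ w, B' v w = 0) → v = 0) (i j : Fin d) :
    (formMatrix B)⁻¹ i j =
      ∑ i', ∑ j', L (basisVec i') i * L (basisVec j') j * (formMatrix B')⁻¹ i' j' := by
  let N : Matrix (Fin d) (Fin d') ℝ := Matrix.of fun i i' => L (basisVec i') i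
  let N' : Matrix (Fin d') (Fin d) ℝ := Matrix.of fun i' i => L.symm (basisVec i) i'
  have hN : N * N' = 1 := by
    ext i k
    have h1 : (L (L.symm (basisVec k)) : Euc d) i = ∑ j, L.symm (basisVec k) j * L (basisVec j) i := by
      have := map_eq_sum_basisVec (L : Euc d' →L[ℝ] Euc d).toLinearMap (L.symm (basisVec k))
      have h2 := congrArg (fun z : Euc d => z i) this
      simpa using h2
    rw [L.apply_symm_apply, basisVec_apply] at h1
    rw [Matrix.mul_apply, Matrix.one_apply, h1]
    exact sum_congr rfl fun j _ => mul_comm _ _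
  have hB' : N.transpose * formMatrix B * N = formMatrix B' := by
    ext i' j'
    have h1 : formMatrix B' i' j' = B (L (basisVec i')) (L (basisVec j')) := (hL _ _).symm
    rw [h1, form_apply_eq_sum, Matrix.mul_apply]
    simp only [Matrix.mul_apply, sum_mul]
    rw [sum_comm]
    refine sum_congr rfl fun i _ => sum_congr rfl fun j _ => ?_
    simp [N, formMatrix]; ring
  have hu : formMatrix B' * (formMatrix B')⁻¹ = 1 :=
    Matrix.mul_nonsing_inv _ (isUnit_det_formMatrix hB)
  have hinv : formMatrix B * (N * (formMatrix B')⁻¹ * N.transpose) = 1 := by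
    have h1 : N.transpose * (formMatrix B * N * (formMatrix B')⁻¹) = 1 := by
      rw [← Matrix.mul_assoc, ← Matrix.mul_assoc, hB', hu]
    have h2 : N'.transpose * N.transpose = 1 := by
      rw [← Matrix.transpose_mul, hN, Matrix.transpose_one]
    have h3 : formMatrix B * N * (formMatrix B')⁻¹ = N'.transpose := by
      calc formMatrix B * N * (formMatrix B')⁻¹
          = N'.transpose * N.transpose * (formMatrix B * N * (formMatrix B')⁻¹) := by
            rw [h2, Matrix.one_mul]
        _ = N'.transpose := by rw [Matrix.mul_assoc, h1, Matrix.mul_one]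
    rw [← Matrix.mul_assoc, ← Matrix.mul_assoc, h3, h2]
  rw [Matrix.inv_eq_right_inv hinv, Matrix.mul_apply]
  simp only [Matrix.mul_apply, sum_mul]
  rw [sum_comm]
  refine sum_congr rfl fun i _ => sum_congr rfl fun j _ => ?_
  simp [N]; ring

end FormMatrix

/-! ### The geometry of a coordinate domain -/

section LocalGeometry

/-- A torsionfree symplectic connection on an open subset `V` of `ℝ^d`: `Γ u v w` is the Christoffel
symbol (the covariant derivative along `v` of the constant vector field `w`) and `Ω u` the symplectic
form at `u`. -/
structure LocalGeom (d : ℕ) where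
  /-- the coordinate domain -/
  V : TopologicalSpace.Opens (Euc d)
  /-- the Christoffel symbols -/
  Γ : Euc d → Euc d →L[ℝ] Euc d →L[ℝ] Euc d
  /-- the symplectic form -/
  Ω : Euc d → Euc d →L[ℝ] Euc d →L[ℝ] ℝ
  smooth_Γ : ContDiffOn ℝ ∞ Γ V
  smooth_Ω : ContDiffOn ℝ ∞ Ω V
  symm : ∀ u ∈ V, ∀ v w, Γ u v w = Γ u w v
  alternating : ∀ u ∈ V, ∀ v, Ω u v v = 0
  nondegenerate : ∀ u ∈ V, ∀ v, (∀ w, Ω u v w = 0) → v = 0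
  parallel : ∀ u ∈ V, ∀ v w z, fderiv ℝ Ω u v w z = Ω u (Γ u v w) z + Ω u w (Γ u v z)

namespace LocalGeom

variable {d : ℕ} (g : LocalGeom d)

/-- The tangent bundle of the coordinate domain. -/
def tube : TopologicalSpace.Opens (Euc d × Euc d) := ⟨g.V ×ˢ Set.univ, g.V.2.prod isOpen_univ⟩

variable {g} in
lemma mem_tube {p : Euc d × Euc d} : p ∈ g.tube ↔ p.1 ∈ g.V := by
  change p ∈ (g.V : Set (Euc d)) ×ˢ Set.univ ↔ _
  simp

variable {g} in
lemma fst_mem (p : g.tube) : p.1.1 ∈ g.V := mem_tube.1 p.2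

/-- A real valued smooth function on the base, as a function on the tangent bundle. -/
def base (f : Euc d → ℝ) (hf : ContDiffOn ℝ ∞ f g.V) : Sm g.tube :=
  Sm.mk (fun p => (f p.1 : ℂ)) (Complex.ofRealCLM.contDiff.comp_contDiffOn
    (hf.comp contDiff_fst.contDiffOn fun _ hp => mem_tube.1 hp))

lemma base_apply (f : Euc d → ℝ) (hf : ContDiffOn ℝ ∞ f g.V) (p : g.tube) :
    (g.base f hf).1 p = (f p.1.1 : ℂ) := rfl

lemma dirDeriv_base (f : Euc d → ℝ) (hf : ContDiffOn ℝ ∞ f g.V) (v : Euc d × Euc d) (p : g.tube) :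
    (Sm.dirDeriv v (g.base f hf)).1 p = (fderiv ℝ f p.1.1 v.1 : ℂ) := by
  rw [Sm.dirDeriv_apply_of v _ (g := Complex.ofRealCLM ∘ (f ∘ Prod.fst)) (fun _ => rfl) p]
  have hd : DifferentiableAt ℝ f p.1.1 :=
    (hf.contDiffAt (g.V.2.mem_nhds (fst_mem p))).differentiableAt (by simp)
  rw [fderiv_comp _ Complex.ofRealCLM.differentiableAt (hd.comp _ differentiableAt_fst),
    fderiv_comp _ hd differentiableAt_fst, fderiv_fst]
  simp

/-- The derivatives in the base directions. -/
def dBase (i : Fin d) : Derivation ℂ (Sm g.tube) (Sm g.tube) := Sm.dirDeriv (basisVec i, 0)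

/-- The derivatives in the fibre directions. -/
def dFib (i : Fin d) : Derivation ℂ (Sm g.tube) (Sm g.tube) := Sm.dirDeriv (0, basisVec i)

/-- The fibre coordinates. -/
def coord (i : Fin d) : Sm g.tube :=
  Sm.mk (fun p => (p.2 i : ℂ)) ((contDiff_coord i).comp contDiff_snd).contDiffOn

lemma dirDeriv_coord (i : Fin d) (v : Euc d × Euc d) (p : g.tube) :
    (Sm.dirDeriv v (g.coord i)).1 p = (v.2 i : ℂ) := by
  rw [Sm.dirDeriv_apply_of v _ (g := (Complex.ofRealCLM ∘L (EuclideanSpace.proj i : Euc d →L[ℝ] ℝ)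
    ∘L ContinuousLinearMap.snd ℝ (Euc d) (Euc d))) (fun _ => rfl) p, ContinuousLinearMap.fderiv]
  rfl

lemma smooth_Ω_apply (v w : Euc d) : ContDiffOn ℝ ∞ (fun u => g.Ω u v w) g.V :=
  (g.smooth_Ω.clm_apply contDiffOn_const).clm_apply contDiffOn_const

lemma smooth_Γ_apply (v w : Euc d) (k : Fin d) : ContDiffOn ℝ ∞ (fun u => g.Γ u v w k) g.V :=
  (EuclideanSpace.proj k : Euc d →L[ℝ] ℝ).contDiff.comp_contDiffOn
    ((g.smooth_Γ.clm_apply contDiffOn_const).clm_apply contDiffOn_const)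

lemma contDiffOn_det {n : ℕ} {s : Set (Euc d)} {A : Euc d → Matrix (Fin n) (Fin n) ℝ}
    (hA : ∀ i j, ContDiffOn ℝ ∞ (fun u => A u i j) s) : ContDiffOn ℝ ∞ (fun u => (A u).det) s := by
  simp only [Matrix.det_apply]
  refine ContDiffOn.sum fun σ _ => ?_
  simp only [Units.smul_def, zsmul_eq_mul]
  exact contDiffOn_const.mul (contDiffOn_prod fun i _ => hA _ _)

lemma smooth_inv (i j : Fin d) : ContDiffOn ℝ ∞ (fun u => (formMatrix (g.Ω u))⁻¹ i j) g.V := by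
  have h : ∀ u, (formMatrix (g.Ω u))⁻¹ i j =
      (formMatrix (g.Ω u)).det⁻¹ * (formMatrix (g.Ω u)).adjugate i j := by
    intro u; simp [Matrix.inv_def]
  simp only [h, Matrix.adjugate_apply]
  refine ContDiffOn.mul (ContDiffOn.inv (contDiffOn_det fun i j => g.smooth_Ω_apply _ _)
    fun u hu => (isUnit_det_formMatrix (g.nondegenerate u hu)).ne_zero)
    (contDiffOn_det fun k l => ?_)
  by_cases hk : k = j
  · subst hk; simp only [Matrix.updateRow_self]; exact contDiffOn_const
  · simp only [Matrix.updateRow_ne hk]; exact g.smooth_Ω_apply _ _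

lemma sum_apply {κ : Type*} (t : Finset κ) (F : κ → Sm g.tube) (p : g.tube) :
    (∑ i ∈ t, F i).1 p = ∑ i ∈ t, (F i).1 p := by simp

/-- Functions of negative degree vanish, since they would be singular at the zero section. -/
lemma eq_zero_of_euler_neg (n : ℕ) (a : Sm g.tube)
    (h : ∑ i, g.coord i * g.dFib i a = -((n + 1 : ℕ) : ℂ) • a) : a = 0 := by
  have he : ∀ u ∈ g.V, ∀ y : Euc d,
      fderiv ℝ (Sm.zext a) (u, y) (0, y) = -((n + 1 : ℕ) : ℂ) * Sm.zext a (u, y) := by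
    intro u hu y
    have hp : (u, y) ∈ g.tube := mem_tube.2 hu
    have h1 := congrFun (congrArg Subtype.val h) ⟨(u, y), hp⟩
    rw [sum_apply] at h1
    have h2 : ((0 : Euc d), y) = ∑ i, y i • ((0 : Euc d), basisVec i) := by
      refine Prod.ext ?_ ?_
      · simp [Prod.fst_sum]
      · simp [Prod.snd_sum, sum_smul_basisVec]
    rw [h2, Sm.fderiv_sum_smul_apply a _ _ _ ⟨(u, y), hp⟩, Sm.zext_of_mem a hp]
    exact h1
  ext p
  obtain ⟨⟨u, y⟩, hp⟩ := p
  have hu : u ∈ g.V := mem_tube.1 hp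
  have hd : ∀ t : ℝ, HasDerivAt (fun t : ℝ => ((t ^ (n + 1) : ℝ) : ℂ) * Sm.zext a (u, t • y)) 0 t := by
    intro t
    have ht : (u, t • y) ∈ g.tube := mem_tube.2 hu
    have h1 : HasDerivAt (fun t : ℝ => (u, t • y)) (0, y) t :=
      (hasDerivAt_const t u).prodMk (by simpa using (hasDerivAt_id t).smul_const y)
    have h2 : HasDerivAt (fun t : ℝ => Sm.zext a (u, t • y))
        (fderiv ℝ (Sm.zext a) (u, t • y) (0, y)) t :=
      ((Sm.differentiableAt_zext a ht).hasFDerivAt).comp_hasDerivAt t h1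
    have h3 := ((hasDerivAt_pow (n + 1) t).ofReal_comp).mul h2
    refine h3.congr_deriv ?_
    have h4 := he u hu (t • y)
    have h5 : ((0 : Euc d), t • y) = t • ((0 : Euc d), y) := by simp
    rw [h5, map_smul, Complex.real_smul] at h4
    push_cast at h4 ⊢
    linear_combination ((t : ℂ) ^ n) * h4
  have hc := is_const_of_deriv_eq_zero (fun t => (hd t).differentiableAt) (fun t => (hd t).deriv) 1 0
  simp only [one_pow, one_smul, zero_smul, ne_eq, Nat.add_eq_zero_iff, one_ne_zero, and_false,
    not_false_eq_true, zero_pow, Complex.ofReal_zero, Complex.ofReal_one, zero_mul, one_mul] at hc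
  rw [Sm.zext_of_mem a hp] at hc
  exact hc

lemma Ω_skew {u : Euc d} (hu : u ∈ g.V) (v w : Euc d) : g.Ω u w v = - g.Ω u v w := by
  have h := g.alternating u hu (v + w)
  simp only [map_add, _root_.add_apply, g.alternating u hu] at h
  linarith

/-- The local connection data of algebraic type. -/
def data : ConnectionData (Fin d) (Sm g.tube) where
  d := g.dFib
  y := g.coord
  P i j := g.base (fun u => (formMatrix (g.Ω u))⁻¹ i j) (g.smooth_inv i j)
  d_comm i j a := Sm.dirDeriv_comm _ _ _
  d_y i j := by
    ext p
    rw [dFib, dirDeriv_coord, basisVec_apply]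
    by_cases h : i = j
    · simp [h]
    · simp [h, Ne.symm h]
  d_P k i j := by
    ext p
    rw [dFib, dirDeriv_base]; simp
  eq_zero_of_euler_neg := g.eq_zero_of_euler_neg
  D := g.dBase
  Γ i j k := g.base (fun u => g.Γ u (basisVec i) (basisVec j) k) (g.smooth_Γ_apply _ _ _)
  Ω i j := g.base (fun u => g.Ω u (basisVec i) (basisVec j)) (g.smooth_Ω_apply _ _)
  D_comm i j a := Sm.dirDeriv_comm _ _ _
  D_d i j a := Sm.dirDeriv_comm _ _ _
  D_y i j := by
    ext p
    rw [dBase, dirDeriv_coord]; simp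
  d_Γ l i j k := by
    ext p
    rw [dFib, dirDeriv_base]; simp
  Γ_symm i j k := by
    ext p
    rw [base_apply, base_apply, g.symm _ (fst_mem p)]
  d_Ω k i j := by
    ext p
    rw [dFib, dirDeriv_base]; simp
  Ω_skew i j := by
    ext p
    rw [base_apply, g.Ω_skew (fst_mem p)]
    simp [base_apply]
  P_Ω i k := by
    ext p
    rw [sum_apply]
    have h := Matrix.nonsing_inv_mul _ (isUnit_det_formMatrix (g.nondegenerate _ (fst_mem p)))
    have h' := congrFun (congrFun h i) k
    rw [Matrix.mul_apply, Matrix.one_apply] at h'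
    have h2 := congrArg (fun t : ℝ => (t : ℂ)) h'
    push_cast at h2
    have h3 : (if i = k then (1 : Sm g.tube) else 0).1 p = if i = k then 1 else 0 := by
      split_ifs <;> rfl
    rw [h3]
    refine Eq.trans ?_ (h2.trans ?_)
    · rfl
    · split_ifs <;> simp
  D_Ω k i j := by
    ext p
    rw [sum_apply, dBase, dirDeriv_base]
    have hd : DifferentiableAt ℝ g.Ω p.1.1 :=
      (g.smooth_Ω.contDiffAt (g.V.2.mem_nhds (fst_mem p))).differentiableAt (by simp)
    have h1 : fderiv ℝ (fun u => g.Ω u (basisVec i) (basisVec j)) p.1.1 (basisVec k) =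
        fderiv ℝ g.Ω p.1.1 (basisVec k) (basisVec i) (basisVec j) := by
      rw [fderiv_clm_apply (hd.clm_apply (differentiableAt_const _)) (differentiableAt_const _),
        fderiv_clm_apply hd (differentiableAt_const _)]
      simp
    simp only [h1]
    rw [g.parallel _ (fst_mem p)]
    have h2 := map_eq_sum_basisVec (g.Ω p.1.1).toLinearMap
      (g.Γ p.1.1 (basisVec k) (basisVec i))
    have h2' := congrArg (fun f => f (basisVec j)) h2
    have h3 := map_eq_sum_basisVec (g.Ω p.1.1 (basisVec i)).toLinearMap
      (g.Γ p.1.1 (basisVec k) (basisVec j))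
    simp only [ContinuousLinearMap.coe_coe, _root_.sum_apply,
      _root_.smul_apply, smul_eq_mul] at h2' h3
    rw [h2', h3, ← sum_add_distrib]
    push_cast
    exact sum_congr rfl fun l _ => rfl

/-- The elements of the local Weyl algebra bundle. -/
abbrev Weyl := g.data.weyl

variable {g}

lemma eval_nabla (i : Fin d) (f : Sm g.tube) (p : g.tube) : (g.data.nabla i f).1 p =
    fderiv ℝ (Sm.zext f) p (basisVec i, - g.Γ p.1.1 (basisVec i) p.1.2) := by
  have hv : ∀ l, (g.data.vert i l).1 p = (g.Γ p.1.1 (basisVec i) p.1.2 l : ℂ) := by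
    intro l
    rw [ConnectionData.vert, sum_apply]
    have h := map_eq_sum_basisVec (g.Γ p.1.1 (basisVec i)).toLinearMap p.1.2
    have h' := congrArg (fun z : Euc d => ((z l : ℝ) : ℂ)) h
    simp at h'
    rw [h']
    refine sum_congr rfl fun k _ => ?_
    rw [mul_comm]
    rfl
  have h1 : ((basisVec i : Euc d), - g.Γ p.1.1 (basisVec i) p.1.2) = (basisVec i, 0) -
      ∑ l, g.Γ p.1.1 (basisVec i) p.1.2 l • ((0 : Euc d), basisVec l) := by
    refine Prod.ext ?_ ?_
    · simp [Prod.fst_sum]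
    · simp [Prod.snd_sum, sum_smul_basisVec]
  rw [ConnectionData.nabla_apply, h1, map_sub, Sm.fderiv_sum_smul_apply f _ _ _ p]
  have h2 : (g.data.D i f - ∑ l, g.data.vert i l * g.data.d l f).1 p =
    (g.data.D i f).1 p - (∑ l, g.data.vert i l * g.data.d l f).1 p := rfl
  rw [h2, sum_apply]
  congr 1
  refine sum_congr rfl fun l _ => ?_
  rw [← hv l]
  rfl

/-- The curvature tensor in local coordinates. -/
def curvature (g : LocalGeom d) (u a b c : Euc d) : Euc d :=
  fderiv ℝ g.Γ u a b c - fderiv ℝ g.Γ u b a c + g.Γ u a (g.Γ u b c) - g.Γ u b (g.Γ u a c)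

set_option synthInstance.maxHeartbeats 200000 in
lemma eval_curvForm (i j : Fin d) (p : g.tube) : (g.data.curvForm i j).1 p =
    (((1 / 2 : ℝ) * g.Ω p.1.1 p.1.2 (g.curvature p.1.1 (basisVec i) (basisVec j) p.1.2) : ℝ) : ℂ) := by
  have hv : ∀ i l (q : g.tube), (g.data.vert i l).1 q = (g.Γ q.1.1 (basisVec i) q.1.2 l : ℂ) := by
    intro i l q
    rw [ConnectionData.vert, sum_apply]
    have h := map_eq_sum_basisVec (g.Γ q.1.1 (basisVec i)).toLinearMap q.1.2
    have h' := congrArg (fun z : Euc d => ((z l : ℝ) : ℂ)) h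
    simp at h'
    rw [h']
    refine sum_congr rfl fun k _ => ?_
    rw [mul_comm]
    rfl
  have hd : DifferentiableAt ℝ g.Γ p.1.1 :=
    (g.smooth_Γ.contDiffAt (g.V.2.mem_nhds (fst_mem p))).differentiableAt (by simp)
  have hn : ∀ i j l, (g.data.nabla i (g.data.vert j l)).1 p =
      ((fderiv ℝ g.Γ p.1.1 (basisVec i) (basisVec j) p.1.2 -
        g.Γ p.1.1 (basisVec j) (g.Γ p.1.1 (basisVec i) p.1.2)) l : ℝ) := by
    intro i j l
    have hb : ∀ k, fderiv ℝ (fun u => g.Γ u (basisVec j) (basisVec k) l) p.1.1 (basisVec i) =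
        fderiv ℝ g.Γ p.1.1 (basisVec i) (basisVec j) (basisVec k) l := by
      intro k
      have hd2 : DifferentiableAt ℝ (fun u => g.Γ u (basisVec j) (basisVec k)) p.1.1 :=
        (hd.clm_apply (differentiableAt_const _)).clm_apply (differentiableAt_const _)
      have h := ((EuclideanSpace.proj l : Euc d →L[ℝ] ℝ).hasFDerivAt.comp _ hd2.hasFDerivAt).fderiv
      have h' := congrArg (fun L => L (basisVec i)) h
      refine Eq.trans h' ?_
      rw [fderiv_clm_apply (hd.clm_apply (differentiableAt_const _)) (differentiableAt_const _),
        fderiv_clm_apply hd (differentiableAt_const _)]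
      simp
    have hy : ∀ k, g.data.nabla i (g.data.y k) = - g.data.vert i k := by
      intro k
      rw [ConnectionData.nabla_apply, g.data.D_y]
      simp [g.data.d_y]
    have hΓ : ∀ k, (g.data.nabla i (g.data.Γ j k l)).1 p =
        ((fderiv ℝ g.Γ p.1.1 (basisVec i) (basisVec j) (basisVec k) l : ℝ) : ℂ) := by
      intro k
      rw [ConnectionData.nabla_apply]
      simp only [g.data.d_Γ, mul_zero, sum_const_zero, sub_zero]
      rw [← hb]
      exact g.dirDeriv_base _ (g.smooth_Γ_apply _ _ _) _ p
    have hL : ∀ k, (g.data.nabla i (g.data.Γ j k l * g.data.y k)).1 p =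
        ((fderiv ℝ g.Γ p.1.1 (basisVec i) (basisVec j) (basisVec k) l * p.1.2 k -
          g.Γ p.1.1 (basisVec j) (basisVec k) l * g.Γ p.1.1 (basisVec i) p.1.2 k : ℝ) : ℂ) := by
      intro k
      rw [Derivation.leibniz, hy]
      change (g.data.Γ j k l).1 p * (- (g.data.vert i k).1 p) +
        (g.data.y k).1 p * (g.data.nabla i (g.data.Γ j k l)).1 p = _
      rw [hv, hΓ]
      change ((g.Γ p.1.1 (basisVec j) (basisVec k) l : ℝ) : ℂ) * _ + ((p.1.2 k : ℝ) : ℂ) * _ = _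
      push_cast; ring
    have hs := map_eq_sum_basisVec
      (fderiv ℝ g.Γ p.1.1 (basisVec i) (basisVec j)).toLinearMap p.1.2
    have ht := map_eq_sum_basisVec (g.Γ p.1.1 (basisVec j)).toLinearMap
      (g.Γ p.1.1 (basisVec i) p.1.2)
    simp only [ContinuousLinearMap.coe_coe] at hs ht
    rw [ConnectionData.vert, map_sum, sum_apply, hs, ht]
    simp only [hL]
    rw [← Complex.ofReal_sum, sum_sub_distrib]
    congr 1
    simp [mul_comm]
  have hc : ∀ l, (g.data.curv i j l).1 p =
      ((g.curvature p.1.1 (basisVec i) (basisVec j) p.1.2 l : ℝ) : ℂ) := by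
    intro l
    have : (g.data.curv i j l).1 p = (g.data.nabla i (g.data.vert j l)).1 p -
      (g.data.nabla j (g.data.vert i l)).1 p := rfl
    rw [this, hn, hn, curvature]
    simp
    ring
  have h1 : (g.data.curvForm i j).1 p = (1 / 2 : ℂ) * (∑ k, g.data.y k *
    ∑ l, g.data.Ω k l * g.data.curv i j l).1 p := rfl
  rw [h1, sum_apply]
  have h2 : ∀ k, (g.data.y k * ∑ l, g.data.Ω k l * g.data.curv i j l).1 p =
      (p.1.2 k : ℂ) * (∑ l, g.data.Ω k l * g.data.curv i j l).1 p := fun k => rfl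
  have h3 : ∀ k l, (g.data.Ω k l * g.data.curv i j l).1 p =
      (g.Ω p.1.1 (basisVec k) (basisVec l) : ℂ) * (g.data.curv i j l).1 p := fun k l => rfl
  simp only [h2, sum_apply, h3, hc]
  rw [form_apply_eq_sum]
  push_cast
  congr 1
  refine sum_congr rfl fun k _ => ?_
  rw [mul_sum]
  exact sum_congr rfl fun l _ => by ring

/-- A function that is a homogeneous polynomial of degree `s` on each fibre satisfies Euler's equation
in the fibre direction. -/
lemma isHomog_of_poly {s : ℕ} (f : Sm g.tube)
    (h : ∀ u ∈ g.V, (fun y => Sm.zext f (u, y)) ∈ homogPoly d s) : g.data.IsHomog s f := by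
  rw [MoyalData.IsHomog, MoyalData.euler_apply]
  ext p
  rw [sum_apply]
  have h1 := fderiv_of_mem_homogPoly (h _ (fst_mem p)) p.1.2
  have h2 : fderiv ℝ (fun y => Sm.zext f (p.1.1, y)) p.1.2 p.1.2 =
      fderiv ℝ (Sm.zext f) p (0, p.1.2) := by
    have h4 : HasFDerivAt (fun y : Euc d => (p.1.1, y)) (ContinuousLinearMap.inr ℝ (Euc d) (Euc d))
      p.1.2 := hasFDerivAt_prodMk_right _ _
    have h3 := ((Sm.differentiableAt_zext f p.2).hasFDerivAt).comp p.1.2 h4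
    have h5 : HasFDerivAt (fun y => Sm.zext f (p.1.1, y)) _ p.1.2 := h3
    rw [h5.fderiv]
    simp
  have h6 : ((0 : Euc d), p.1.2) = ∑ i, p.1.2 i • ((0 : Euc d), basisVec i) := by
    refine Prod.ext ?_ ?_
    · simp [Prod.fst_sum]
    · simp [Prod.snd_sum, sum_smul_basisVec]
  rw [h2, h6, Sm.fderiv_sum_smul_apply f _ _ _ p] at h1
  refine Eq.trans ?_ (h1.trans ?_)
  · rfl
  · have : Sm.zext f (p.1.1, p.1.2) = f.1 p := Sm.zext_coe f p
    rw [this]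
    simp

lemma poly_of_isHomog {s : ℕ} {f : Sm g.tube} (h : g.data.IsHomog s f) {u : Euc d} (hu : u ∈ g.V) :
    (fun y => Sm.zext f (u, y)) ∈ homogPoly d s := by
  have hs : ContDiff ℝ ∞ (fun y => Sm.zext f (u, y)) := by
    rw [contDiff_iff_contDiffAt]
    intro y
    exact (Sm.contDiffAt_zext f (p := (u, y)) (mem_tube.2 hu)).comp y
      (contDiffAt_const.prodMk contDiffAt_id)
  refine mem_homogPoly_of_euler hs fun y => ?_
  have hp : (u, y) ∈ g.tube := mem_tube.2 hu
  have h2 : fderiv ℝ (fun y => Sm.zext f (u, y)) y y =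
      fderiv ℝ (Sm.zext f) (u, y) (0, y) := by
    have h4 : HasFDerivAt (fun y : Euc d => (u, y)) (ContinuousLinearMap.inr ℝ (Euc d) (Euc d))
      y := hasFDerivAt_prodMk_right _ _
    have h3 := ((Sm.differentiableAt_zext f hp).hasFDerivAt).comp y h4
    have h5 : HasFDerivAt (fun y => Sm.zext f (u, y)) _ y := h3
    rw [h5.fderiv]
    simp
  have h6 : ((0 : Euc d), y) = ∑ i, y i • ((0 : Euc d), basisVec i) := by
    refine Prod.ext ?_ ?_
    · simp [Prod.fst_sum]
    · simp [Prod.snd_sum, sum_smul_basisVec]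
  rw [h2, h6, Sm.fderiv_sum_smul_apply f _ _ _ ⟨(u, y), hp⟩, Sm.zext_of_mem f hp]
  rw [MoyalData.IsHomog, MoyalData.euler_apply] at h
  have h1 := congrFun (congrArg Subtype.val h) ⟨(u, y), hp⟩
  rw [sum_apply] at h1
  refine Eq.trans ?_ (h1.trans ?_)
  · rfl
  · simp

/-- The product of the local Weyl algebra bundle is the fibrewise Moyal-Weyl product. -/
lemma eval_mul {u : Euc d} (hu : u ∈ g.V) {F G : g.Weyl} {α β : WeylElt d}
    (hα : ∀ k s y, α k s y = (F.1 k s).1 ⟨(u, y), mem_tube.2 hu⟩)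
    (hβ : ∀ k s y, β k s y = (G.1 k s).1 ⟨(u, y), mem_tube.2 hu⟩) (K S : ℕ) (y : Euc d) :
    moyal (formMatrix (g.Ω u))⁻¹ α β K S y = ((F * G).1 K S).1 ⟨(u, y), mem_tube.2 hu⟩ := by
  refine moyal_of_related (O := g.tube) (der := g.data.d) (P := g.data.P)
    (P' := (formMatrix (g.Ω u))⁻¹) (fun y => (u, y)) (contDiff_const.prodMk contDiff_id)
    (fun y => mem_tube.2 hu) (fun i j => if i = j then 1 else 0) ?_ ?_ (a := F.1) (b := G.1)
    hα hβ K S y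
  · intro i f y
    have h4 : HasFDerivAt (fun y : Euc d => (u, y)) (ContinuousLinearMap.inr ℝ (Euc d) (Euc d))
      y := hasFDerivAt_prodMk_right _ _
    rw [h4.fderiv]
    simp only [ite_mul, one_mul, zero_mul, sum_ite_eq', mem_univ, if_true]
    rfl
  · intro i j y
    simp_rw [mul_assoc, ← mul_sum]
    simp only [ite_mul, one_mul, zero_mul, sum_ite_eq, mem_univ, if_true]
    rfl

lemma eval_br {u : Euc d} (hu : u ∈ g.V) {F G : g.Weyl} {α β : WeylElt d}
    (hα : ∀ k s y, α k s y = (F.1 k s).1 ⟨(u, y), mem_tube.2 hu⟩)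
    (hβ : ∀ k s y, β k s y = (G.1 k s).1 ⟨(u, y), mem_tube.2 hu⟩) (K S : ℕ) (y : Euc d) :
    scaledComm (formMatrix (g.Ω u))⁻¹ α β K S y =
      ((MoyalData.br F G).1 K S).1 ⟨(u, y), mem_tube.2 hu⟩ := by
  have h1 := eval_mul hu hα hβ (K + 1) S y
  have h2 := eval_mul hu hβ hα (K + 1) S y
  have h3 := congrArg₂ (fun a b : ℂ => Complex.I * (a - b)) h1 h2
  rw [scaledComm, MoyalData.br_apply]
  exact h3

end LocalGeom

end LocalGeometry

/-! ### Coordinate frames of a manifold -/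

section Charts
open scoped Topology

variable {d : ℕ} {M : Type v} [TopologicalSpace M] [ChartedSpace (Euc d) M]

section
variable [IsManifold (𝓡 d) ∞ M]

/-- The coordinate frame of the chart at `x₀`, as a map from `ℝ^d` to the tangent space at `z`. -/
def fr (x₀ z : M) : Euc d →L[ℝ] TangentSpace (𝓡 d) z :=
  (trivializationAt (Euc d) (TangentSpace (𝓡 d)) x₀ :
    Trivialization (Euc d) (π (Euc d) (TangentSpace (𝓡 d) : M → Type))).symmL ℝ z

/-- The components of a tangent vector at `z` in the chart at `x₀`. -/
def co (x₀ z : M) : TangentSpace (𝓡 d) z →L[ℝ] Euc d :=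
  (trivializationAt (Euc d) (TangentSpace (𝓡 d) : M → Type) x₀).continuousLinearMapAt ℝ z

lemma co_fr {x₀ z : M} (hz : z ∈ (chartAt (Euc d) x₀).source) (v : Euc d) :
    co x₀ z (fr x₀ z v) = v :=
  (trivializationAt (Euc d) (TangentSpace (𝓡 d) : M → Type) x₀).continuousLinearMapAt_symmL
    hz v

lemma fr_co {x₀ z : M} (hz : z ∈ (chartAt (Euc d) x₀).source) (v : TangentSpace (𝓡 d) z) :
    fr x₀ z (co x₀ z v) = v :=
  (trivializationAt (Euc d) (TangentSpace (𝓡 d) : M → Type) x₀).symmL_continuousLinearMapAt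
    hz v

/-- The coordinate frame as a linear isomorphism. -/
def frEquiv (x₀ z : M) (hz : z ∈ (chartAt (Euc d) x₀).source) :
    Euc d ≃L[ℝ] TangentSpace (𝓡 d) z :=
  ContinuousLinearEquiv.equivOfInverse (fr x₀ z) (co x₀ z) (co_fr hz) (fr_co hz)

lemma fr_eq {x₀ z : M} (hz : z ∈ (chartAt (Euc d) x₀).source) :
    fr x₀ z = mfderiv (𝓡 d) (𝓡 d) (chartAt (Euc d) x₀).symm (chartAt (Euc d) x₀ z) := by
  have := TangentBundle.symmL_trivializationAt (I := 𝓡 d) hz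
  simp only [mfld_simps, mfderivWithin_univ] at this
  exact this

lemma co_eq {x₀ z : M} (hz : z ∈ (chartAt (Euc d) x₀).source) :
    co x₀ z = mfderiv (𝓡 d) (𝓡 d) (chartAt (Euc d) x₀) z := by
  have := TangentBundle.continuousLinearMapAt_trivializationAt (I := 𝓡 d) hz
  simp only [mfld_simps] at this
  exact this

/-- The vector field with constant components in the chart at `x₀`. -/
def cf (x₀ : M) (v : Euc d) : ∀ z : M, TangentSpace (𝓡 d) z := fun z => fr x₀ z v

lemma co_apply {x₀ z : M} (hz : z ∈ (chartAt (Euc d) x₀).source) (v : TangentSpace (𝓡 d) z) :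
    co x₀ z v = (trivializationAt (Euc d) (TangentSpace (𝓡 d) : M → Type) x₀ ⟨z, v⟩).2 :=
  Trivialization.continuousLinearMapAt_apply_of_mem ℝ
    (trivializationAt (Euc d) (TangentSpace (𝓡 d) : M → Type) x₀) hz v

lemma fr_apply {x₀ z : M} (hz : z ∈ (chartAt (Euc d) x₀).source) (v : Euc d) :
    fr x₀ z v = (trivializationAt (Euc d) (TangentSpace (𝓡 d) : M → Type) x₀).symm z v :=
  Trivialization.symmL_apply (R := ℝ) (trivializationAt (Euc d) (TangentSpace (𝓡 d) : M → Type) x₀)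
    hz v

lemma extVec_apply {x z : M} (hz : z ∈ (chartAt (Euc d) x).source) (v : TangentSpace (𝓡 d) x) :
    extVec x v z = cf x (co x x v) z := by
  rw [cf, fr_apply hz, co_apply (mem_chart_source _ x)]
  rfl

lemma extVec_eventuallyEq (x : M) (v : TangentSpace (𝓡 d) x) :
    ∀ᶠ z in 𝓝 x, extVec x v z = cf x (co x x v) z := by
  filter_upwards [(chartAt (Euc d) x).open_source.mem_nhds (mem_chart_source _ x)] with z hz
  exact extVec_apply hz v

lemma extVec_self (x : M) (v : TangentSpace (𝓡 d) x) : extVec x v x = v := by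
  rw [extVec_apply (mem_chart_source _ x)]
  exact fr_co (mem_chart_source _ x) v

/-- Smoothness of a vector field at a point. -/
def SmAt (η : ∀ z : M, TangentSpace (𝓡 d) z) (z : M) : Prop :=
  ContMDiffAt (𝓡 d) (𝓡 d).tangent ∞ (fun x => (⟨x, η x⟩ : TangentBundle (𝓡 d) M)) z

lemma SmAt.congr {η ζ : ∀ z : M, TangentSpace (𝓡 d) z} {z : M} (h : SmAt η z) (he : ∀ᶠ y in 𝓝 z, ζ y = η y) :
    SmAt ζ z := by
  refine ContMDiffAt.congr_of_eventuallyEq h ?_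
  filter_upwards [he] with y hy
  rw [hy]

lemma SmAt.mdiff {η : ∀ z : M, TangentSpace (𝓡 d) z} {z : M} (h : SmAt η z) :
    MDifferentiableAt (𝓡 d) (𝓡 d).tangent (fun x => (⟨x, η x⟩ : TangentBundle (𝓡 d) M)) z :=
  ContMDiffAt.mdifferentiableAt h (by simp)

/-- The components of a vector field in the chart at `x₀`, as a function of the coordinates. -/
def hat (x₀ : M) (η : ∀ z : M, TangentSpace (𝓡 d) z) (u : Euc d) : Euc d :=
  co x₀ ((chartAt (Euc d) x₀).symm u) (η ((chartAt (Euc d) x₀).symm u))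

lemma smAt_iff {x₀ z : M} (hz : z ∈ (chartAt (Euc d) x₀).source)
    {η : ∀ z : M, TangentSpace (𝓡 d) z} :
    SmAt η z ↔ ContMDiffAt (𝓡 d) 𝓘(ℝ, Euc d) ∞ (fun z' => (co x₀ z' (η z') : Euc d)) z := by
  have h := (trivializationAt (Euc d) (TangentSpace (𝓡 d) : M → Type) x₀).contMDiffAt_section_iff
    (IB := 𝓡 d) (n := ∞) (s := η) (x₀ := z) hz
  refine h.trans ⟨fun h => h.congr_of_eventuallyEq ?_, fun h => h.congr_of_eventuallyEq ?_⟩ <;>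
  · filter_upwards [(chartAt (Euc d) x₀).open_source.mem_nhds hz] with y hy
    rw [co_apply hy]

lemma chart_symm_contMDiffAt {x₀ : M} {u : Euc d} (hu : u ∈ (chartAt (Euc d) x₀).target) :
    ContMDiffAt (𝓡 d) (𝓡 d) ∞ (chartAt (Euc d) x₀).symm u :=
  (contMDiffOn_chart_symm (I := 𝓡 d) (n := ∞) (x := x₀)).contMDiffAt
    ((chartAt (Euc d) x₀).open_target.mem_nhds hu)

lemma chart_contMDiffAt {x₀ z : M} (hz : z ∈ (chartAt (Euc d) x₀).source) :
    ContMDiffAt (𝓡 d) (𝓡 d) ∞ (chartAt (Euc d) x₀) z :=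
  (contMDiffOn_chart (I := 𝓡 d) (n := ∞) (x := x₀)).contMDiffAt
    ((chartAt (Euc d) x₀).open_source.mem_nhds hz)

lemma contMDiffAt_chart_iff {F : Type*} [NormedAddCommGroup F] [NormedSpace ℝ F] {x₀ z : M}
    (hz : z ∈ (chartAt (Euc d) x₀).source) {f : M → F} :
    ContMDiffAt (𝓡 d) 𝓘(ℝ, F) ∞ f z ↔
      ContDiffAt ℝ ∞ (f ∘ (chartAt (Euc d) x₀).symm) (chartAt (Euc d) x₀ z) := by
  rw [← contMDiffAt_iff_contDiffAt]
  constructor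
  · intro h
    refine ContMDiffAt.comp _ ?_ (chart_symm_contMDiffAt ((chartAt (Euc d) x₀).map_source hz))
    rwa [(chartAt (Euc d) x₀).left_inv hz]
  · intro h
    refine (h.comp z (chart_contMDiffAt hz)).congr_of_eventuallyEq ?_
    filter_upwards [(chartAt (Euc d) x₀).open_source.mem_nhds hz] with y hy
    simp [(chartAt (Euc d) x₀).left_inv hy]

lemma smAt_iff_hat {x₀ z : M} (hz : z ∈ (chartAt (Euc d) x₀).source)
    {η : ∀ z : M, TangentSpace (𝓡 d) z} :
    SmAt η z ↔ ContDiffAt ℝ ∞ (hat x₀ η) (chartAt (Euc d) x₀ z) :=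
  (smAt_iff hz).trans (contMDiffAt_chart_iff hz)

lemma smAt_cf {x₀ z : M} (hz : z ∈ (chartAt (Euc d) x₀).source) (v : Euc d) :
    SmAt (cf x₀ v) z := by
  refine (smAt_iff hz).2 ((contMDiffAt_const (c := v)).congr_of_eventuallyEq ?_)
  filter_upwards [(chartAt (Euc d) x₀).open_source.mem_nhds hz] with y hy
  exact co_fr hy v

/-- The derivative of a function along a coordinate vector. -/
lemma mvfderiv_fr {F : Type*} [NormedAddCommGroup F] [NormedSpace ℝ F] {x₀ z : M}
    (hz : z ∈ (chartAt (Euc d) x₀).source) {f : M → F}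
    (hf : MDifferentiableAt (𝓡 d) 𝓘(ℝ, F) f z) (w : Euc d) :
    mvfderiv (𝓡 d) f z (fr x₀ z w) =
      fderiv ℝ (f ∘ (chartAt (Euc d) x₀).symm) (chartAt (Euc d) x₀ z) w := by
  have h1 := (chart_symm_contMDiffAt ((chartAt (Euc d) x₀).map_source hz)).mdifferentiableAt
    (by simp)
  have hf' : MDifferentiableAt (𝓡 d) 𝓘(ℝ, F) f
      ((chartAt (Euc d) x₀).symm (chartAt (Euc d) x₀ z)) := by
    rwa [(chartAt (Euc d) x₀).left_inv hz]
  have h2 := mfderiv_comp (chartAt (Euc d) x₀ z) hf' h1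
  rw [mfderiv_eq_fderiv] at h2
  rw [h2, fr_eq hz]
  have key : ∀ z', z' = z → ∀ v : Euc d,
      mvfderiv (𝓡 d) f z v = mfderiv (𝓡 d) 𝓘(ℝ, F) f z' v := by
    rintro _ rfl v
    rfl
  exact key _ ((chartAt (Euc d) x₀).left_inv hz) _

end
end Charts

/-! ### Affine connections in charts -/

section Connections
open scoped Topology

variable {d : ℕ} {M : Type v} [TopologicalSpace M] [ChartedSpace (Euc d) M]
  [IsManifold (𝓡 d) ∞ M]

/-- Smoothness of a vector field in a neighbourhood of a point. -/
def SmNear (η : ∀ z : M, TangentSpace (𝓡 d) z) (z : M) : Prop := ∀ᶠ y in 𝓝 z, SmAt η y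

lemma SmNear.smAt {η : ∀ z : M, TangentSpace (𝓡 d) z} {z : M} (h : SmNear η z) : SmAt η z :=
  h.self_of_nhds

lemma IsSmoothVF.smNear {η : ∀ z : M, TangentSpace (𝓡 d) z} (h : IsSmoothVF η) (z : M) :
    SmNear η z := Filter.Eventually.of_forall h

lemma smNear_cf {x₀ z : M} (hz : z ∈ (chartAt (Euc d) x₀).source) (v : Euc d) :
    SmNear (cf x₀ v) z := by
  filter_upwards [(chartAt (Euc d) x₀).open_source.mem_nhds hz] with y hy
  exact smAt_cf hy v

lemma SmNear.congr {η ζ : ∀ z : M, TangentSpace (𝓡 d) z} {z : M} (h : SmNear η z)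
    (he : ∀ᶠ y in 𝓝 z, ζ y = η y) : SmNear ζ z := by
  filter_upwards [h, he.eventually_nhds] with y hy hy'
  exact hy.congr hy'

lemma smNear_extVec (x : M) (v : TangentSpace (𝓡 d) x) : SmNear (extVec x v) x :=
  (smNear_cf (mem_chart_source _ x) _).congr (extVec_eventuallyEq x v)

/-- Every germ of a smooth vector field is the germ of a global one. -/
lemma SmNear.exists_global [T2Space M] {η : ∀ z : M, TangentSpace (𝓡 d) z} {z : M}
    (h : SmNear η z) : ∃ ξ, IsSmoothVF ξ ∧ ∀ᶠ y in 𝓝 z, ξ y = η y := by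
  obtain ⟨u, hu, huo, hzu⟩ := eventually_nhds_iff.1 h
  obtain ⟨f, hf, -⟩ := (SmoothBumpFunction.nhds_basis_support (I := 𝓡 d) (huo.mem_nhds hzu)).mem_iff.1
    (huo.mem_nhds hzu)
  refine ⟨fun y => f y • η y, ?_, ?_⟩
  · refine ContMDiffOn.smul_section_of_tsupport (ψ := f) (s := η) f.contMDiff.contMDiffOn huo hf ?_
    intro y hy
    exact (hu y hy).contMDiffWithinAt
  · filter_upwards [f.eventuallyEq_one] with y hy
    rw [hy]
    exact one_smul ℝ _

lemma cov_congr (cov : AffineConnection d M) {η ζ : ∀ z : M, TangentSpace (𝓡 d) z} {z : M}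
    (h : SmAt η z) (he : ∀ᶠ y in 𝓝 z, η y = ζ y) : cov η z = cov ζ z :=
  cov.isCovariantDerivativeOn.congr_of_eventuallyEq h.mdiff
    (h.congr (he.mono fun _ h => h.symm)).mdiff Filter.univ_mem he

lemma mdifferentiableAt_sum_section {κ : Type*} (s : Finset κ)
    {η : κ → ∀ z : M, TangentSpace (𝓡 d) z} {z : M}
    (h : ∀ k ∈ s, MDifferentiableAt (𝓡 d) (𝓡 d).tangent
      (fun x => (⟨x, η k x⟩ : TangentBundle (𝓡 d) M)) z) :
    MDifferentiableAt (𝓡 d) (𝓡 d).tangent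
      (fun x => (⟨x, (∑ k ∈ s, η k) x⟩ : TangentBundle (𝓡 d) M)) z := by
  classical
  induction s using Finset.induction_on with
  | empty => exact mdifferentiableAt_zeroSection ..
  | insert k s hk ih =>
    rw [sum_insert hk]
    exact mdifferentiableAt_add_section (h k (by simp)) (ih fun j hj => h j (by simp [hj]))

lemma cov_sum_smul (cov : AffineConnection d M) {κ : Type*} (s : Finset κ)
    {g : κ → M → ℝ} {η : κ → ∀ z : M, TangentSpace (𝓡 d) z} {z : M}
    (hη : ∀ k ∈ s, SmAt (η k) z) (hg : ∀ k ∈ s, MDifferentiableAt (𝓡 d) 𝓘(ℝ) (g k) z)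
    (v : TangentSpace (𝓡 d) z) :
    cov (∑ k ∈ s, g k • η k) z v =
      ∑ k ∈ s, (g k z • cov (η k) z v + mvfderiv (𝓡 d) (g k) z v • η k z) := by
  classical
  induction s using Finset.induction_on with
  | empty => simp [cov.zero]
  | insert k s hk ih =>
    have h1 : ∀ j ∈ insert k s, MDifferentiableAt (𝓡 d) (𝓡 d).tangent
        (fun x => (⟨x, (g j • η j) x⟩ : TangentBundle (𝓡 d) M)) z := fun j hj =>
      (hg j hj).smul_section (hη j hj).mdiff
    rw [sum_insert hk, sum_insert hk,
      cov.isCovariantDerivativeOn.add (h1 k (by simp))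
        (mdifferentiableAt_sum_section s fun j hj => h1 j (by simp [hj])) (Set.mem_univ z),
      cov.isCovariantDerivativeOn.leibniz (hη k (by simp)).mdiff (hg k (by simp)) (Set.mem_univ z),
      _root_.add_apply, ih (fun j hj => hη j (by simp [hj]))
        (fun j hj => hg j (by simp [hj]))]
    rfl

/-- The Christoffel symbols of a connection in the chart at `x₀`. -/
def christoffel (cov : AffineConnection d M) (x₀ : M) (u : Euc d) : Euc d →L[ℝ] Euc d →L[ℝ] Euc d :=
  ∑ i, ∑ j, (EuclideanSpace.proj i : Euc d →L[ℝ] ℝ).smulRight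
    ((EuclideanSpace.proj j : Euc d →L[ℝ] ℝ).smulRight
      (co x₀ ((chartAt (Euc d) x₀).symm u) (cov (cf x₀ (basisVec j))
        ((chartAt (Euc d) x₀).symm u) (fr x₀ ((chartAt (Euc d) x₀).symm u) (basisVec i)))))

lemma christoffel_apply (cov : AffineConnection d M) (x₀ : M) (u v w : Euc d) :
    christoffel cov x₀ u v w = ∑ i, ∑ j, v i • w j •
      (co x₀ ((chartAt (Euc d) x₀).symm u) (cov (cf x₀ (basisVec j))
        ((chartAt (Euc d) x₀).symm u) (fr x₀ ((chartAt (Euc d) x₀).symm u) (basisVec i)))) := by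
  simp [christoffel, _root_.sum_apply]

lemma mdifferentiableAt_co {x₀ z : M} (hz : z ∈ (chartAt (Euc d) x₀).source)
    {η : ∀ z : M, TangentSpace (𝓡 d) z} (hη : SmAt η z) (j : Fin d) :
    MDifferentiableAt (𝓡 d) 𝓘(ℝ) (fun z' => (co x₀ z' (η z') : Euc d) j) z := by
  have h := (smAt_iff hz).1 hη
  have h2 : ContMDiffAt (𝓡 d) 𝓘(ℝ) ∞ (fun z' => (co x₀ z' (η z') : Euc d) j) z :=
    ((EuclideanSpace.proj j : Euc d →L[ℝ] ℝ).contDiff.contMDiff.contMDiffAt).comp z h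
  exact h2.mdifferentiableAt (by simp)

lemma eventuallyEq_frame {x₀ z : M} (hz : z ∈ (chartAt (Euc d) x₀).source)
    (η : ∀ z : M, TangentSpace (𝓡 d) z) :
    ∀ᶠ y in 𝓝 z, η y = (∑ j, (fun z' => (co x₀ z' (η z')) j) • cf x₀ (basisVec j)) y := by
  filter_upwards [(chartAt (Euc d) x₀).open_source.mem_nhds hz] with y hy
  have h1 : (∑ j, (fun z' => (co x₀ z' (η z') : Euc d) j) • cf x₀ (basisVec j)) y =
      ∑ j, (co x₀ y (η y) : Euc d) j • fr x₀ y (basisVec j) := by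
    rw [Finset.sum_apply]
    rfl
  rw [h1]
  have h2 := map_eq_sum_basisVec (fr x₀ y).toLinearMap (co x₀ y (η y))
  refine Eq.trans ?_ h2
  exact (fr_co hy (η y)).symm

/-- The covariant derivative in local coordinates. -/
lemma cov_fr (cov : AffineConnection d M) {x₀ z : M} (hz : z ∈ (chartAt (Euc d) x₀).source)
    {η : ∀ z : M, TangentSpace (𝓡 d) z} (hη : SmAt η z) (w : Euc d) :
    cov η z (fr x₀ z w) = fr x₀ z (fderiv ℝ (hat x₀ η) (chartAt (Euc d) x₀ z) w +
      christoffel cov x₀ (chartAt (Euc d) x₀ z) w (hat x₀ η (chartAt (Euc d) x₀ z))) := by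
  have hhat : ContDiffAt ℝ ∞ (hat x₀ η) (chartAt (Euc d) x₀ z) := (smAt_iff_hat hz).1 hη
  rw [cov_congr cov hη (eventuallyEq_frame hz η),
    cov_sum_smul cov univ (fun j _ => smAt_cf hz _) (fun j _ => mdifferentiableAt_co hz hη j)]
  have hl : (chartAt (Euc d) x₀).symm (chartAt (Euc d) x₀ z) = z := (chartAt (Euc d) x₀).left_inv hz
  have h0 : hat x₀ η (chartAt (Euc d) x₀ z) = co x₀ z (η z) := by
    unfold hat
    rw [hl]
  have h1 : fderiv ℝ (hat x₀ η) (chartAt (Euc d) x₀ z) w =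
      ∑ j, mvfderiv (𝓡 d) (fun z' => (co x₀ z' (η z') : Euc d) j) z (fr x₀ z w) • basisVec j := by
    rw [← sum_smul_basisVec (fderiv ℝ (hat x₀ η) (chartAt (Euc d) x₀ z) w)]
    refine sum_congr rfl fun j _ => ?_
    congr 1
    rw [mvfderiv_fr hz (mdifferentiableAt_co hz hη j)]
    have h2 := ((EuclideanSpace.proj j : Euc d →L[ℝ] ℝ).hasFDerivAt.comp _
      (hhat.differentiableAt (by simp)).hasFDerivAt).fderiv
    have h3 := congrArg (fun L : Euc d →L[ℝ] ℝ => L w) h2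
    exact h3.symm
  have h2 : christoffel cov x₀ (chartAt (Euc d) x₀ z) w (hat x₀ η (chartAt (Euc d) x₀ z)) =
      ∑ j, (co x₀ z (η z) : Euc d) j • co x₀ z (cov (cf x₀ (basisVec j)) z (fr x₀ z w)) := by
    rw [christoffel_apply, hl, h0, sum_comm]
    refine sum_congr rfl fun j _ => ?_
    simp_rw [smul_comm _ ((co x₀ z (η z) : Euc d) j)]
    rw [← smul_sum]
    congr 1
    exact (map_eq_sum_basisVec ((co x₀ z).comp
      ((cov (cf x₀ (basisVec j)) z).comp (fr x₀ z))).toLinearMap w).symm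
  rw [h1, h2, map_add, map_sum, map_sum, add_comm, ← sum_add_distrib]
  refine sum_congr rfl fun j _ => ?_
  rw [map_smul, map_smul, fr_co hz]
  rfl

lemma IsSmoothVF.cov {cov : AffineConnection d M} (hcov : cov.ContMDiffCovariantDerivative ∞)
    {η ξ : ∀ z : M, TangentSpace (𝓡 d) z} (hη : IsSmoothVF η) (hξ : IsSmoothVF ξ) :
    IsSmoothVF (fun z => cov η z (ξ z)) := by
  have h1 : ContMDiff (𝓡 d) ((𝓡 d).prod 𝓘(ℝ, Euc d →L[ℝ] Euc d)) ∞
      (fun x => TotalSpace.mk' (Euc d →L[ℝ] Euc d)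
        (E := fun x : M => TangentSpace (𝓡 d) x →L[ℝ] TangentSpace (𝓡 d) x) x (cov η x)) := by
    rw [← contMDiffOn_univ]
    exact hcov.contMDiff.contMDiff (σ := η) (contMDiffOn_univ.2 hη)
  exact ContMDiff.clm_bundle_apply h1 hξ

lemma SmNear.cov [T2Space M] {cov : AffineConnection d M}
    (hcov : cov.ContMDiffCovariantDerivative ∞) {η ξ : ∀ z : M, TangentSpace (𝓡 d) z} {z : M}
    (hη : SmNear η z) (hξ : SmNear ξ z) : SmNear (fun z => cov η z (ξ z)) z := by
  obtain ⟨η', h1, h2⟩ := hη.exists_global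
  obtain ⟨ξ', h3, h4⟩ := hξ.exists_global
  refine ((IsSmoothVF.smNear (IsSmoothVF.cov hcov h1 h3) z)).congr ?_
  filter_upwards [h2.eventually_nhds, h4, hη] with y hy hy' hy''
  rw [cov_congr cov hy'' (hy.mono fun _ h => h.symm), hy']

lemma contDiffAt_christoffel [T2Space M] {cov : AffineConnection d M}
    (hcov : cov.ContMDiffCovariantDerivative ∞) {x₀ : M} {u : Euc d}
    (hu : u ∈ (chartAt (Euc d) x₀).target) : ContDiffAt ℝ ∞ (christoffel cov x₀) u := by
  have hz := (chartAt (Euc d) x₀).map_target hu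
  unfold christoffel
  refine ContDiffAt.sum fun i _ => ContDiffAt.sum fun j _ => ?_
  have h : ContDiffAt ℝ ∞ (hat x₀ fun z => cov (cf x₀ (basisVec j)) z (cf x₀ (basisVec i) z)) u := by
    have := (smAt_iff_hat hz).1 ((smNear_cf hz (basisVec j)).cov hcov
      (smNear_cf hz (basisVec i))).smAt
    rwa [(chartAt (Euc d) x₀).right_inv hu] at this
  exact contDiffAt_const.smulRight (contDiffAt_const.smulRight h)

lemma christoffel_eq (cov : AffineConnection d M) {x₀ z : M}
    (hz : z ∈ (chartAt (Euc d) x₀).source) (v w : Euc d) :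
    christoffel cov x₀ (chartAt (Euc d) x₀ z) v w = co x₀ z (cov (cf x₀ w) z (fr x₀ z v)) := by
  rw [cov_fr cov hz (smAt_cf hz w), co_fr hz]
  have h : hat x₀ (cf x₀ w) =ᶠ[𝓝 (chartAt (Euc d) x₀ z)] fun _ => w := by
    filter_upwards [(chartAt (Euc d) x₀).open_target.mem_nhds
      ((chartAt (Euc d) x₀).map_source hz)] with u hu
    exact co_fr ((chartAt (Euc d) x₀).map_target hu) w
  rw [h.fderiv_eq, h.self_of_nhds]
  simp

/-- The vector field on `ℝ^d` with constant components. -/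
def constField (v : Euc d) : ∀ u : Euc d, TangentSpace (𝓡 d) u := fun _ => v

lemma cf_eq_mpullback {x₀ y : M} (hy : y ∈ (chartAt (Euc d) x₀).source) (v : Euc d) :
    cf x₀ v y = VectorField.mpullback (𝓡 d) (𝓡 d) (chartAt (Euc d) x₀) (constField v) y := by
  have h2 : (mfderiv (𝓡 d) (𝓡 d) (chartAt (Euc d) x₀) y).inverse = fr x₀ y := by
    refine ContinuousLinearMap.inverse_eq ?_ ?_ <;> ext1 v
    · exact (congrArg (fun L : TangentSpace (𝓡 d) y →L[ℝ] Euc d => L (fr x₀ y v))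
        (co_eq hy).symm).trans (co_fr hy v)
    · exact (congrArg (fun L : TangentSpace (𝓡 d) y →L[ℝ] Euc d => fr x₀ y (L v))
        (co_eq hy).symm).trans (fr_co hy v)
  exact (congrArg (fun L : Euc d →L[ℝ] TangentSpace (𝓡 d) y => L v) h2).symm

lemma mlieBracket_constField (v w u : Euc d) :
    VectorField.mlieBracket (𝓡 d) (constField v) (constField w) u = 0 := by
  rw [← VectorField.mlieBracketWithin_univ, VectorField.mlieBracketWithin_eq_lieBracketWithin]
  have h : VectorField.lieBracketWithin ℝ (fun _ : Euc d => v) (fun _ => w) Set.univ u = 0 := by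
    simp [VectorField.lieBracketWithin]
  exact h

/-- Coordinate vector fields commute. -/
lemma mlieBracket_cf {x₀ z : M} (hz : z ∈ (chartAt (Euc d) x₀).source) (v w : Euc d) :
    VectorField.mlieBracket (𝓡 d) (cf x₀ v) (cf x₀ w) z = 0 := by
  have : IsManifold (𝓡 d) (minSmoothness ℝ 2) M := .of_le (n := ∞) (by simpa using two_le_infty)
  have hpull : ∀ v : Euc d, ∀ᶠ y in 𝓝 z, cf x₀ v y =
      VectorField.mpullback (𝓡 d) (𝓡 d) (chartAt (Euc d) x₀) (constField v) y := by
    intro v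
    filter_upwards [(chartAt (Euc d) x₀).open_source.mem_nhds hz] with y hy
    exact cf_eq_mpullback hy v
  have hc : ∀ v : Euc d, MDifferentiableAt (𝓡 d) (𝓡 d).tangent
      (fun x => (⟨x, constField v x⟩ : TangentBundle (𝓡 d) (Euc d))) (chartAt (Euc d) x₀ z) := by
    intro v
    exact (contMDiffAt_vectorSpace_iff_contDiffAt (n := ∞).2 contDiffAt_const).mdifferentiableAt
      (by simp)
  have h1 := Filter.EventuallyEq.mlieBracket_vectorField_eq (I := 𝓡 d) (hpull v) (hpull w)
  have h2 := VectorField.mpullback_mlieBracket (n := ∞) (hc v) (hc w)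
    (chart_contMDiffAt hz) (by simpa using two_le_infty)
  rw [h1, ← h2, VectorField.mpullback_apply, mlieBracket_constField]
  exact map_zero _

end Connections

/-! ### Symplectic manifolds in charts -/

section ChartGeometry
open scoped Topology

variable {d : ℕ} {M : Type v} [TopologicalSpace M] [ChartedSpace (Euc d) M]
  [IsManifold (𝓡 d) ∞ M]

/-- A symplectic manifold with a smooth torsionfree connection that annihilates the symplectic
form. -/
structure IsFedosovManifold (Ω : FormField d M) (cov : AffineConnection d M) : Prop where
  symplectic : IsSymplecticForm Ω
  smooth : cov.ContMDiffCovariantDerivative ∞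
  torsionFree : cov.torsion = 0
  parallel : IsParallelForm cov Ω

/-- The components of a form in the chart at `x₀`. -/
def chartForm (Ω : FormField d M) (x₀ : M) (u : Euc d) : Euc d →L[ℝ] Euc d →L[ℝ] ℝ :=
  ∑ i, ∑ j, (EuclideanSpace.proj i : Euc d →L[ℝ] ℝ).smulRight
    ((EuclideanSpace.proj j : Euc d →L[ℝ] ℝ).smulRight
      (Ω ((chartAt (Euc d) x₀).symm u) (fr x₀ ((chartAt (Euc d) x₀).symm u) (basisVec i))
        (fr x₀ ((chartAt (Euc d) x₀).symm u) (basisVec j))))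

lemma chartForm_apply (Ω : FormField d M) (x₀ : M) (u v w : Euc d) :
    chartForm Ω x₀ u v w = Ω ((chartAt (Euc d) x₀).symm u)
      (fr x₀ ((chartAt (Euc d) x₀).symm u) v) (fr x₀ ((chartAt (Euc d) x₀).symm u) w) := by
  set z := (chartAt (Euc d) x₀).symm u
  have h1 := map_eq_sum_basisVec (V := ℝ)
    ({ toFun := fun v => Ω z (fr x₀ z v) (fr x₀ z w)
       map_add' := by simp
       map_smul' := by simp } : Euc d →ₗ[ℝ] ℝ) v
  have h2 := fun v => map_eq_sum_basisVec (V := ℝ)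
    ({ toFun := fun w => Ω z (fr x₀ z v) (fr x₀ z w)
       map_add' := by simp
       map_smul' := by simp } : Euc d →ₗ[ℝ] ℝ) w
  simp only [LinearMap.coe_mk, AddHom.coe_mk] at h1 h2
  rw [h1]
  simp only [chartForm, ContinuousLinearMap.sum_apply, ContinuousLinearMap.smulRight_apply,
    ContinuousLinearMap.smul_apply]
  refine sum_congr rfl fun i _ => ?_
  rw [h2, smul_sum]
  rfl

lemma contMDiffAt_form {Ω : FormField d M} (hΩ : IsSymplecticForm Ω)
    {η ζ : ∀ z : M, TangentSpace (𝓡 d) z} {z : M} (hη : SmAt η z) (hζ : SmAt ζ z) :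
    ContMDiffAt (𝓡 d) 𝓘(ℝ) ∞ (fun y => Ω y (η y) (ζ y)) z := by
  have h := ContMDiffAt.clm_bundle_apply₂ (E₃ := Bundle.Trivial M ℝ) (b := id)
    (ψ := Ω) (hΩ.smooth z) hη hζ
  exact (contMDiffAt_section _).1 h

lemma contDiffAt_chartForm {Ω : FormField d M} (hΩ : IsSymplecticForm Ω) {x₀ : M} {u : Euc d}
    (hu : u ∈ (chartAt (Euc d) x₀).target) : ContDiffAt ℝ ∞ (chartForm Ω x₀) u := by
  have hz := (chartAt (Euc d) x₀).map_target hu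
  unfold chartForm
  refine ContDiffAt.sum fun i _ => ContDiffAt.sum fun j _ => ?_
  have h := (contMDiffAt_chart_iff hz).1
    (contMDiffAt_form hΩ (smAt_cf hz (basisVec i)) (smAt_cf hz (basisVec j)))
  rw [(chartAt (Euc d) x₀).right_inv hu] at h
  exact contDiffAt_const.smulRight (contDiffAt_const.smulRight h)

lemma fderiv_apply_apply {E F G : Type*} [NormedAddCommGroup E] [NormedSpace ℝ E]
    [NormedAddCommGroup F] [NormedSpace ℝ F] [NormedAddCommGroup G] [NormedSpace ℝ G]
    {B : E → F →L[ℝ] F →L[ℝ] G} {u : E} (hB : DifferentiableAt ℝ B u) (v : E) (w t : F) :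
    fderiv ℝ (fun u' => B u' w t) u v = fderiv ℝ B u v w t := by
  have h1 := hB.hasFDerivAt.clm_apply (hasFDerivAt_const w u)
  have h2 := h1.clm_apply (hasFDerivAt_const t u)
  rw [h2.fderiv]
  simp

variable [T2Space M] {Ω : FormField d M} {cov : AffineConnection d M}

lemma IsFedosovManifold.christoffel_symm (h : IsFedosovManifold Ω cov) {x₀ : M} {u : Euc d}
    (hu : u ∈ (chartAt (Euc d) x₀).target) (v w : Euc d) :
    christoffel cov x₀ u v w = christoffel cov x₀ u w v := by
  have hz := (chartAt (Euc d) x₀).map_target hu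
  have h1 := (CovariantDerivative.torsion_eq_zero_iff _).1 h.torsionFree
    (X := cf x₀ v) (Y := cf x₀ w) (smAt_cf hz v).mdiff (smAt_cf hz w).mdiff
  rw [mlieBracket_cf hz] at h1
  have h2 := christoffel_eq cov hz v w
  have h3 := christoffel_eq cov hz w v
  rw [(chartAt (Euc d) x₀).right_inv hu] at h2 h3
  rw [h2, h3]
  exact congrArg _ (sub_eq_zero.1 h1)

lemma IsFedosovManifold.chartForm_parallel (h : IsFedosovManifold Ω cov) {x₀ : M} {u : Euc d}
    (hu : u ∈ (chartAt (Euc d) x₀).target) (v w t : Euc d) :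
    fderiv ℝ (chartForm Ω x₀) u v w t = chartForm Ω x₀ u (christoffel cov x₀ u v w) t +
      chartForm Ω x₀ u w (christoffel cov x₀ u v t) := by
  have hz := (chartAt (Euc d) x₀).map_target hu
  have hu' := (chartAt (Euc d) x₀).right_inv hu
  obtain ⟨η, hη, hη'⟩ := (smNear_cf hz w).exists_global
  obtain ⟨ζ, hζ, hζ'⟩ := (smNear_cf hz t).exists_global
  have h1 := h.parallel η ζ hη hζ _ (fr x₀ ((chartAt (Euc d) x₀).symm u) v)
  rw [mvfderiv_fr hz ((contMDiffAt_form h.symplectic (hη _) (hζ _)).mdifferentiableAt (by simp)),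
    hu', cov_congr cov (hη _) hη', cov_congr cov (hζ _) hζ', hη'.self_of_nhds,
    hζ'.self_of_nhds] at h1
  have h2 : ((fun y => Ω y (η y) (ζ y)) ∘ (chartAt (Euc d) x₀).symm) =ᶠ[𝓝 u]
      fun u' => chartForm Ω x₀ u' w t := by
    filter_upwards [((chartAt (Euc d) x₀).continuousAt_symm hu).eventually hη',
      ((chartAt (Euc d) x₀).continuousAt_symm hu).eventually hζ'] with u' h3 h4
    rw [chartForm_apply, Function.comp_apply, h3, h4]
    rfl
  rw [h2.fderiv_eq] at h1
  have h5 : fderiv ℝ (fun u' => chartForm Ω x₀ u' w t) u v = fderiv ℝ (chartForm Ω x₀) u v w t := by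
    exact fderiv_apply_apply ((contDiffAt_chartForm h.symplectic hu).differentiableAt (by simp)) ..
  have h8 := christoffel_eq cov hz v w
  have h9 := christoffel_eq cov hz v t
  rw [hu'] at h8 h9
  rw [← h5, h1, h8, h9, chartForm_apply, chartForm_apply, fr_co hz, fr_co hz]
  rfl

/-- The geometry of a Fedosov manifold in the chart at `x₀`. -/
def IsFedosovManifold.localGeom (h : IsFedosovManifold Ω cov) (x₀ : M) : LocalGeom d where
  V := ⟨(chartAt (Euc d) x₀).target, (chartAt (Euc d) x₀).open_target⟩
  Γ := christoffel cov x₀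
  Ω := chartForm Ω x₀
  smooth_Γ u hu := (contDiffAt_christoffel h.smooth hu).contDiffWithinAt
  smooth_Ω u hu := (contDiffAt_chartForm h.symplectic hu).contDiffWithinAt
  symm u hu := h.christoffel_symm hu
  alternating u _ v := by
    rw [chartForm_apply]
    exact h.symplectic.alternating _ _
  nondegenerate u hu v hv := by
    have hz := (chartAt (Euc d) x₀).map_target hu
    rw [← co_fr hz v, h.symplectic.nondegenerate _ (fr x₀ _ v), map_zero]
    intro t
    rw [← fr_co hz t, ← chartForm_apply]
    exact hv _
  parallel u hu := h.chartForm_parallel hu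

end ChartGeometry

/-! ### Local representatives of forms -/

section LocalRepresentatives
open scoped Topology

variable {d : ℕ} {M : Type v} [TopologicalSpace M] [ChartedSpace (Euc d) M]
  [IsManifold (𝓡 d) ∞ M]

/-- The covariant derivative at `z` along `v` of a function `β` of `n` tangent vectors, evaluated on
the values at `z` of the vector fields `η t`; by `covD_fr`, it depends only on these values. -/
def covD (cov : AffineConnection d M) {n : ℕ} (β : M → (Fin n → Euc d) → ℂ)
    (η : Fin n → ∀ z : M, TangentSpace (𝓡 d) z) (z : M) (v : TangentSpace (𝓡 d) z) : ℂ :=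
  mvfderiv (𝓡 d) (fun z' => β z' (fun t => η t z')) z v -
    fderiv ℝ (β z) (fun t => η t z) (fun t => cov (η t) z v)

lemma hat_chart {x₀ z : M} (hz : z ∈ (chartAt (Euc d) x₀).source)
    (η : ∀ z : M, TangentSpace (𝓡 d) z) : hat x₀ η (chartAt (Euc d) x₀ z) = co x₀ z (η z) := by
  unfold hat
  rw [(chartAt (Euc d) x₀).left_inv hz]

/-- The covariant derivative of a function of `n` tangent vectors in local coordinates. -/
lemma covD_fr (cov : AffineConnection d M) {n : ℕ} {β : M → (Fin n → Euc d) → ℂ}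
    {η : Fin n → ∀ z : M, TangentSpace (𝓡 d) z} {x₀ z : M}
    (hz : z ∈ (chartAt (Euc d) x₀).source) (hη : ∀ t, SmAt (η t) z)
    {f : Euc d × (Fin n → Euc d) → ℂ}
    (hf : ContDiffAt ℝ ∞ f (chartAt (Euc d) x₀ z, fun t => co x₀ z (η t z)))
    (hβ : ∀ z ∈ (chartAt (Euc d) x₀).source, ∀ Y,
      β z (fun t => fr x₀ z (Y t)) = f (chartAt (Euc d) x₀ z, Y)) (a : Euc d) :
    covD cov β η z (fr x₀ z a) = fderiv ℝ f (chartAt (Euc d) x₀ z, fun t => co x₀ z (η t z))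
      (a, fun t => - christoffel cov x₀ (chartAt (Euc d) x₀ z) a (co x₀ z (η t z))) := by
  set u := chartAt (Euc d) x₀ z with hu
  have hut : u ∈ (chartAt (Euc d) x₀).target := (chartAt (Euc d) x₀).map_source hz
  have hβ' : ∀ z ∈ (chartAt (Euc d) x₀).source, ∀ Y : Fin n → Euc d,
      β z Y = f (chartAt (Euc d) x₀ z, fun t => co x₀ z (Y t)) := by
    intro z hz Y
    rw [← hβ z hz]
    congr 1
    ext1 t
    exact (fr_co hz (Y t)).symm
  have hhat : ∀ t, ContDiffAt ℝ ∞ (hat x₀ (η t)) u := fun t => (smAt_iff_hat hz).1 (hη t)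
  have hY : ContDiffAt ℝ ∞ (fun u t => hat x₀ (η t) u) u := contDiffAt_pi.2 hhat
  have hfu : (u, fun t => co x₀ z (η t z)) = ((fun u' => (u', fun t => hat x₀ (η t) u')) u) := by
    refine Prod.ext rfl ?_
    ext1 t
    exact (hat_chart hz (η t)).symm
  have hcomp : ((fun z' => β z' (fun t => η t z')) ∘ (chartAt (Euc d) x₀).symm) =ᶠ[𝓝 u]
      f ∘ (fun u' => (u', fun t => hat x₀ (η t) u')) := by
    filter_upwards [(chartAt (Euc d) x₀).open_target.mem_nhds hut] with u' hu'
    have h5 := hβ' _ ((chartAt (Euc d) x₀).map_target hu')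
      (fun t => η t ((chartAt (Euc d) x₀).symm u'))
    rw [(chartAt (Euc d) x₀).right_inv hu'] at h5
    exact h5
  rw [hfu] at hf
  have hpair : ContDiffAt ℝ ∞ (fun u' => (u', fun t => hat x₀ (η t) u')) u :=
    contDiffAt_id.prodMk hY
  have hsm : ContMDiffAt (𝓡 d) 𝓘(ℝ, ℂ) ∞ (fun z' => β z' (fun t => η t z')) z :=
    (contMDiffAt_chart_iff hz).2 ((hf.comp u hpair).congr_of_eventuallyEq hcomp)
  have hfd := hf.differentiableAt (by simp)
  have hder : HasFDerivAt (fun u' => (u', fun t => hat x₀ (η t) u'))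
      ((ContinuousLinearMap.id ℝ (Euc d)).prod
        (ContinuousLinearMap.pi fun t => fderiv ℝ (hat x₀ (η t)) u)) u :=
    (hasFDerivAt_id u).prodMk (hasFDerivAt_pi.2 fun t =>
      ((hhat t).differentiableAt (by simp)).hasFDerivAt)
  have h1 : mvfderiv (𝓡 d) (fun z' => β z' (fun t => η t z')) z (fr x₀ z a) =
      fderiv ℝ f (u, fun t => co x₀ z (η t z)) (a, fun t => fderiv ℝ (hat x₀ (η t)) u a) := by
    rw [mvfderiv_fr hz (hsm.mdifferentiableAt (by simp)), ← hu, hcomp.fderiv_eq,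
      (hfd.hasFDerivAt.comp u hder).fderiv, ← hfu]
    rfl
  have h2 : HasFDerivAt (β z) ((fderiv ℝ f (u, fun t => co x₀ z (η t z))).comp
      ((0 : (Fin n → Euc d) →L[ℝ] Euc d).prod (ContinuousLinearMap.pi fun t =>
        (ContinuousLinearMap.comp (co x₀ z : Euc d →L[ℝ] Euc d)
          (ContinuousLinearMap.proj t : (Fin n → Euc d) →L[ℝ] Euc d)))))
      (fun t => η t z) := by
    have h3 : β z = f ∘ (fun Y : Fin n → Euc d => (u, fun t => co x₀ z (Y t))) :=
      funext (hβ' z hz)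
    rw [h3]
    refine HasFDerivAt.comp (E := Fin n → Euc d) (fun t => η t z) (g := f) ?_ ?_
    · rw [← hfu] at hfd
      exact hfd.hasFDerivAt
    · refine (hasFDerivAt_const u _).prodMk (hasFDerivAt_pi.2 fun t => ?_)
      exact ContinuousLinearMap.hasFDerivAt (ContinuousLinearMap.comp (co x₀ z : Euc d →L[ℝ] Euc d)
          (ContinuousLinearMap.proj t : (Fin n → Euc d) →L[ℝ] Euc d))
  have h6 := congrArg (fun L : (Fin n → Euc d) →L[ℝ] ℂ => L fun t => cov (η t) z (fr x₀ z a))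
    h2.fderiv
  refine (congrArg₂ (fun p q : ℂ => p - q) h1 h6).trans ?_
  change fderiv ℝ f (u, fun t => co x₀ z (η t z)) (a, fun t => fderiv ℝ (hat x₀ (η t)) u a) -
    fderiv ℝ f (u, fun t => co x₀ z (η t z))
      ((0 : Euc d), fun t => co x₀ z (cov (η t) z (fr x₀ z a))) = _
  rw [← map_sub]
  congr 1
  refine Prod.ext ?_ ?_
  · simp
  · ext1 t
    have h4 : co x₀ z (cov (η t) z (fr x₀ z a)) = fderiv ℝ (hat x₀ (η t)) u a +
        christoffel cov x₀ u a (co x₀ z (η t z)) := by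
      rw [cov_fr cov hz (hη t), co_fr hz, hat_chart hz]
    change fderiv ℝ (hat x₀ (η t)) u a - co x₀ z (cov (η t) z (fr x₀ z a)) = _
    exact (congrArg (fun q : Euc d => fderiv ℝ (hat x₀ (η t)) u a - q) h4).trans
      (sub_add_cancel_left _ _)

/-- The components of a smooth form with constant arguments in a chart are smooth. -/
lemma contDiffAt_form_chart [T2Space M] {l : ℕ} {b : M → WeylForm d l}
    (hb : IsSmoothWeylForm b) {x₀ : M} {u : Euc d} (hu : u ∈ (chartAt (Euc d) x₀).target)
    (k s : ℕ) (y : Euc d) (w : Fin l → Euc d) :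
    ContDiffAt ℝ ∞ (fun u => b ((chartAt (Euc d) x₀).symm u) k s
      (fr x₀ ((chartAt (Euc d) x₀).symm u) y)
      (fun t => fr x₀ ((chartAt (Euc d) x₀).symm u) (w t))) u := by
  have hz := (chartAt (Euc d) x₀).map_target hu
  obtain ⟨η, hη, hη'⟩ := (smNear_cf hz y).exists_global
  choose ζ hζ hζ' using fun t => (smNear_cf hz (w t)).exists_global
  have h1 := (contMDiffAt_chart_iff hz).1 (hb.smooth k s η ζ hη hζ _)
  rw [(chartAt (Euc d) x₀).right_inv hu] at h1
  refine h1.congr_of_eventuallyEq ?_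
  have hc := (chartAt (Euc d) x₀).continuousAt_symm hu
  filter_upwards [hc.eventually hη', hc.eventually (Filter.eventually_all.2 hζ')] with u' h3 h4
  rw [Function.comp_apply, h3]
  simp_rw [h4]
  rfl

variable [T2Space M] {Ω : FormField d M} {cov : AffineConnection d M}
  (h : IsFedosovManifold Ω cov) (x₀ : M)

/-- The base point in `M` of a point `p` of the coordinate tangent bundle of the chart at `x₀`. -/
def basePt (p : (h.localGeom x₀).tube) : M := (chartAt (Euc d) x₀).symm p.1.1

variable {x₀}

lemma basePt_mem (p : (h.localGeom x₀).tube) : basePt h x₀ p ∈ (chartAt (Euc d) x₀).source :=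
  (chartAt (Euc d) x₀).map_target (LocalGeom.fst_mem p)

lemma chart_basePt (p : (h.localGeom x₀).tube) : chartAt (Euc d) x₀ (basePt h x₀ p) = p.1.1 :=
  (chartAt (Euc d) x₀).right_inv (LocalGeom.fst_mem p)

/-- The coordinate frame at the base point of `p`. -/
def frame (p : (h.localGeom x₀).tube) : Euc d ≃L[ℝ] Euc d := frEquiv x₀ _ (basePt_mem h p)

lemma homogPoly_fr {l : ℕ} {b : WeylForm d l} (hb : IsWeylForm b) (L : Euc d →ₗ[ℝ] Euc d)
    (k s : ℕ) (w : Fin l → Euc d) : (fun y => b k s (L y) w) ∈ homogPoly d s :=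
  comp_mem_homogPoly (mem_homogPoly.2 (hb.polynomial k s w)) L

/-- The component of a smooth form along constant vectors in a chart, as an element of the local Weyl
algebra bundle. -/
def localComp {l : ℕ} {b : M → WeylForm d l} (hb : IsSmoothWeylForm b)
    (w : Fin l → Euc d) : (h.localGeom x₀).Weyl :=
  ⟨fun k s => Sm.mk (fun p => b ((chartAt (Euc d) x₀).symm p.1) k s
      (fr x₀ ((chartAt (Euc d) x₀).symm p.1) p.2)
      (fun t => fr x₀ ((chartAt (Euc d) x₀).symm p.1) (w t))) (by
      -- Smoothness is given for constant fibre arguments only; interpolation expresses the component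
      -- through its values at finitely many of them.
      obtain ⟨n, y, q, hq, hi⟩ := exists_interpolation (homogPoly d s)
      have h1 : (fun p : Euc d × Euc d => b ((chartAt (Euc d) x₀).symm p.1) k s
          (fr x₀ ((chartAt (Euc d) x₀).symm p.1) p.2)
          (fun t => fr x₀ ((chartAt (Euc d) x₀).symm p.1) (w t))) =
          fun p => ∑ i, b ((chartAt (Euc d) x₀).symm p.1) k s
          (fr x₀ ((chartAt (Euc d) x₀).symm p.1) (y i))
          (fun t => fr x₀ ((chartAt (Euc d) x₀).symm p.1) (w t)) * q i p.2 := by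
        ext1 p
        exact hi _ (homogPoly_fr (hb.isWeylForm _)
          (fr x₀ ((chartAt (Euc d) x₀).symm p.1)).toLinearMap k s _) p.2
      rw [h1]
      intro p hp
      refine (ContDiffAt.sum fun i _ => ContDiffAt.mul ?_ ?_).contDiffWithinAt
      · exact (contDiffAt_form_chart hb (LocalGeom.mem_tube.1 hp) k s (y i) w).comp p contDiffAt_fst
      · exact (contDiff_of_mem_homogPoly (hq i)).contDiffAt.comp p contDiffAt_snd),
    fun k s => LocalGeom.isHomog_of_poly (g := h.localGeom x₀) _ fun u hu => by
      have h2 := homogPoly_fr (hb.isWeylForm ((chartAt (Euc d) x₀).symm u))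
          (fr x₀ ((chartAt (Euc d) x₀).symm u)).toLinearMap k s
          (fun t => fr x₀ ((chartAt (Euc d) x₀).symm u) (w t))
      refine (congrArg (· ∈ homogPoly d s) ?_).mp h2
      ext1 y
      symm
      exact Sm.zext_of_mem _ (LocalGeom.mem_tube (g := h.localGeom x₀) (p := (u, y)).2 hu)⟩

@[simp] lemma localComp_apply {l : ℕ} {b : M → WeylForm d l} (hb : IsSmoothWeylForm b)
    (w : Fin l → Euc d) (k s : ℕ) (p : (h.localGeom x₀).tube) :
    ((localComp h hb w).1 k s).1 p = b (basePt h x₀ p) k s (frame h p p.1.2)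
      (fun t => frame h p (w t)) := rfl

variable (x₀) in
/-- `F` represents the `0`-form `b` in the chart at `x₀`. -/
def Rep0 (b : M → WeylForm d 0) (F : (h.localGeom x₀).Weyl) : Prop :=
  ∀ (p : (h.localGeom x₀).tube) k s w,
    b (basePt h x₀ p) k s (frame h p p.1.2) w = (F.1 k s).1 p

variable (x₀) in
/-- The elements `F i` are the components of the `1`-form `b` in the chart at `x₀`. -/
def Rep1 (b : M → WeylForm d 1) (F : Fin d → (h.localGeom x₀).Weyl) : Prop :=
  ∀ (p : (h.localGeom x₀).tube) k s (w : Fin 1 → Euc d),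
    b (basePt h x₀ p) k s (frame h p p.1.2) (fun t => frame h p (w t)) =
      ∑ i, (w 0 i : ℂ) * ((F i).1 k s).1 p

variable (x₀) in
/-- The elements `F i j` are the components of the `2`-form `b` in the chart at `x₀`. -/
def Rep2 (b : M → WeylForm d 2) (F : Fin d → Fin d → (h.localGeom x₀).Weyl) : Prop :=
  ∀ (p : (h.localGeom x₀).tube) k s (w : Fin 2 → Euc d),
    b (basePt h x₀ p) k s (frame h p p.1.2) (fun t => frame h p (w t)) =
      ∑ i, ∑ j, (w 0 i : ℂ) * (w 1 j : ℂ) * ((F i j).1 k s).1 p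

variable {h}

lemma alternating_one {b : WeylForm d 1} (hb : IsWeylForm b) (k s : ℕ) (y : Euc d) :
    ∃ L : Euc d →ₗ[ℝ] ℂ, ∀ w, b k s y w = L (w 0) := by
  obtain ⟨B, hB⟩ := hb.alternating k s y
  have hu : ∀ v : Euc d, Function.update (fun _ : Fin 1 => (0 : Euc d)) 0 v = fun _ => v := by
    intro v
    ext1 t
    rw [Subsingleton.elim t 0, Function.update_self]
  refine ⟨{ toFun := fun v => B (fun _ => v), map_add' := fun v w => ?_,
            map_smul' := fun c v => ?_ }, fun w => ?_⟩
  · have := B.map_update_add (fun _ => (0 : Euc d)) 0 v w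
    rwa [hu, hu, hu] at this
  · have := B.map_update_smul (fun _ => (0 : Euc d)) 0 c v
    rwa [hu, hu] at this
  · rw [hB]
    change B w = B _
    congr 1
    ext1 t
    rw [Subsingleton.elim t 0]

lemma rep0_local {b : M → WeylForm d 0} (hb : IsSmoothWeylForm b) (w : Fin 0 → Euc d) :
    Rep0 h x₀ b (localComp h hb w) := by
  intro p k s w'
  rw [localComp_apply]
  congr 1
  exact Subsingleton.elim _ _

lemma rep1_local {b : M → WeylForm d 1} (hb : IsSmoothWeylForm b) :
    Rep1 h x₀ b (fun i => localComp h hb fun _ => basisVec i) := by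
  intro p k s w
  obtain ⟨L, hL⟩ := alternating_one (hb.isWeylForm (basePt h x₀ p)) k s
    (frame h p p.1.2)
  simp only [localComp_apply]
  simp_rw [hL]
  refine (map_eq_sum_basisVec (L.comp (frame h p : Euc d →L[ℝ] Euc d).toLinearMap) (w 0)).trans ?_
  refine sum_congr rfl fun i _ => ?_
  simp

lemma Rep0.unique {b : M → WeylForm d 0} {F G : (h.localGeom x₀).Weyl} (hF : Rep0 h x₀ b F)
    (hG : Rep0 h x₀ b G) : F = G := by
  ext k s p
  rw [← hF p k s (fun _ => 0), hG]

lemma Rep1.unique {b : M → WeylForm d 1} {F G : Fin d → (h.localGeom x₀).Weyl}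
    (hF : Rep1 h x₀ b F) (hG : Rep1 h x₀ b G) : F = G := by
  ext i k s p
  have h1 := (hF p k s (fun _ => basisVec i)).symm.trans (hG p k s fun _ => basisVec i)
  simpa [basisVec_apply, apply_ite (Complex.ofReal)] using h1

end LocalRepresentatives

/-! ### The exterior covariant derivative of forms of degree zero and one -/

section CovariantDerivativeOfForms
open scoped Topology

variable {d : ℕ} {M : Type v} [TopologicalSpace M] [ChartedSpace (Euc d) M]
  [IsManifold (𝓡 d) ∞ M]

/-- A component of a `0`-form as a function of one tangent vector. -/
def fiberFun0 (b : M → WeylForm d 0) (k s : ℕ) (z : M) (Y : Fin 1 → Euc d) : ℂ :=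
  b z k s (Y 0) Fin.elim0

/-- A component of a `1`-form as a function of two tangent vectors. -/
def fiberFun1 (b : M → WeylForm d 1) (k s : ℕ) (z : M) (Y : Fin 2 → Euc d) : ℂ :=
  b z k s (Y 0) (fun _ => Y 1)

lemma weylNabla_zero (cov : AffineConnection d M) (b : M → WeylForm d 0) (z : M) (k s : ℕ)
    (hb : Differentiable ℝ fun t => b z k s t Fin.elim0)
    (y : Euc d) (w : Fin 1 → Euc d) :
    weylNabla cov b z k s y w =
      covD cov (fiberFun0 b k s) (fun _ => extVec z y) z (w 0) := by
  have he : ∀ w : Fin 0 → Euc d, w = Fin.elim0 := fun w => Subsingleton.elim _ _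
  have h1 : fderiv ℝ (fiberFun0 b k s z) (fun _ => y) (fun _ => cov (extVec z y) z (w 0)) =
      fderiv ℝ (fun t => b z k s t Fin.elim0) y (cov (extVec z y) z (w 0)) := by
    have h2 := HasFDerivAt.comp (g := fun t => b z k s t Fin.elim0) (fun _ : Fin 1 => y)
      (hb y).hasFDerivAt
      ((ContinuousLinearMap.proj 0 : (Fin 1 → Euc d) →L[ℝ] Euc d).hasFDerivAt)
    exact congrArg (fun L : (Fin 1 → Euc d) →L[ℝ] ℂ => L fun _ => cov (extVec z y) z (w 0)) h2.fderiv
  have h0 : (fun _ : Fin 1 => extVec z y z) = fun _ => y := funext fun _ => extVec_self z y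
  unfold covD
  beta_reduce
  rw [h0, h1]
  rw [weylNabla, Fin.sum_univ_one, Fin.val_zero, pow_zero, one_mul]
  exact congrArg₂ (fun p q : ℂ => p - q)
    (congrArg (fun q : M → ℂ => mvfderiv (𝓡 d) q z (w 0))
      (funext fun z' => congrArg (b z' k s _) (he _)))
    (congrArg (fun q : Euc d → ℂ => fderiv ℝ q y (cov (extVec z y) z (w 0)))
      (funext fun t => congrArg (b z k s _) (he _)))

lemma fderiv_pair {β : (Fin 2 → Euc d) → ℂ} {y w : Euc d}
    (hβ : DifferentiableAt ℝ β ![y, w]) (L : Euc d →ₗ[ℝ] ℂ) (hL : ∀ c, β ![y, c] = L c)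
    (a c : Euc d) :
    fderiv ℝ β ![y, w] ![a, c] = fderiv ℝ (fun t => β ![t, w]) y a + β ![y, c] := by
  have h1 : HasFDerivAt (fun t => β ![t, w]) ((fderiv ℝ β ![y, w]).comp
      (ContinuousLinearMap.pi ![ContinuousLinearMap.id ℝ (Euc d), 0])) y := by
    refine HasFDerivAt.comp y hβ.hasFDerivAt (hasFDerivAt_pi.2 fun t => ?_)
    fin_cases t
    · exact hasFDerivAt_id y
    · exact hasFDerivAt_const w y
  have h2 : HasFDerivAt (fun t => β ![y, t]) ((fderiv ℝ β ![y, w]).comp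
      (ContinuousLinearMap.pi ![0, ContinuousLinearMap.id ℝ (Euc d)])) w := by
    refine HasFDerivAt.comp w hβ.hasFDerivAt (hasFDerivAt_pi.2 fun t => ?_)
    fin_cases t
    · exact hasFDerivAt_const y w
    · exact hasFDerivAt_id w
  have h3 : HasFDerivAt (fun t => β ![y, t]) (LinearMap.toContinuousLinearMap L) w := by
    rw [funext hL]
    exact (LinearMap.toContinuousLinearMap L).hasFDerivAt
  have h4 := congrArg (fun K : Euc d →L[ℝ] ℂ => K c) (h2.unique h3)
  rw [h1.fderiv, hL, ContinuousLinearMap.comp_apply]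
  have h5 : (![a, c] : Fin 2 → Euc d) =
      ContinuousLinearMap.pi ![ContinuousLinearMap.id ℝ (Euc d), 0] a +
      ContinuousLinearMap.pi ![0, ContinuousLinearMap.id ℝ (Euc d)] c := by
    ext1 t
    fin_cases t <;> simp
  rw [h5, map_add]
  congr 1

lemma mlieBracket_extVec (z : M) (v w : TangentSpace (𝓡 d) z) :
    VectorField.mlieBracket (𝓡 d) (extVec z v) (extVec z w) z = 0 := by
  have h3 := Filter.EventuallyEq.mlieBracket_vectorField_eq (I := 𝓡 d)
    (extVec_eventuallyEq z v) (extVec_eventuallyEq z w)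
  rw [h3, mlieBracket_cf (mem_chart_source _ z)]

/-- Torsionfreeness, for the extensions of two tangent vectors. -/
lemma cov_extVec_comm {cov : AffineConnection d M} (hcov : cov.torsion = 0) (z : M)
    (v w : TangentSpace (𝓡 d) z) : cov (extVec z w) z v = cov (extVec z v) z w := by
  have h1 := (CovariantDerivative.torsion_eq_zero_iff _).1 hcov (X := extVec z v) (Y := extVec z w)
    (smNear_extVec z v).smAt.mdiff (smNear_extVec z w).smAt.mdiff
  rw [mlieBracket_extVec, extVec_self, extVec_self] at h1
  exact sub_eq_zero.1 h1

/-- In the exterior covariant derivative of a `1`-form, the terms in which the connection acts on the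
form argument cancel against each other by torsionfreeness. -/
lemma weylNabla_one {cov : AffineConnection d M} (hcov : cov.torsion = 0) (b : M → WeylForm d 1)
    (z : M) (k s : ℕ) (hbz : IsWeylForm (b z)) (hb : Differentiable ℝ (fiberFun1 b k s z))
    (y : Euc d) (w : Fin 2 → Euc d) :
    weylNabla cov b z k s y w =
      covD cov (fiberFun1 b k s) ![extVec z y, extVec z (w 1)] z (w 0) -
      covD cov (fiberFun1 b k s) ![extVec z y, extVec z (w 0)] z (w 1) := by
  obtain ⟨L, hL⟩ := alternating_one hbz k s y
  have h0 : ∀ v : TangentSpace (𝓡 d) z, extVec z v z = v := extVec_self z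
  have key : ∀ v c : Euc d, covD cov (fiberFun1 b k s) ![extVec z y, extVec z v] z c =
      mvfderiv (𝓡 d) (fun z' => b z' k s (extVec z y z') (fun _ => extVec z v z')) z c -
      fderiv ℝ (fun t => b z k s t (fun _ => v)) y (cov (extVec z y) z c) -
      L (cov (extVec z v) z c) := by
    intro v c
    have e1 : (fun t => (![extVec z y, extVec z v] : Fin 2 → ∀ z : M, TangentSpace (𝓡 d) z) t z) =
        (![y, v] : Fin 2 → Euc d) := by
      ext1 t
      fin_cases t
      · exact h0 y
      · exact h0 v
    have e2 : (fun t => cov ((![extVec z y, extVec z v] : Fin 2 → ∀ z : M, TangentSpace (𝓡 d) z) t)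
        z c) = (![cov (extVec z y) z c, cov (extVec z v) z c] : Fin 2 → Euc d) := by
      ext1 t
      fin_cases t <;> rfl
    have e3 := fderiv_pair (hb ![y, v]) L (fun c => hL _)
      (cov (extVec z y) z c) (cov (extVec z v) z c)
    have e4 : fiberFun1 b k s z ![y, cov (extVec z v) z c] = L (cov (extVec z v) z c) := hL _
    rw [e4] at e3
    unfold covD
    rw [e1, e2, e3, sub_add_eq_sub_sub]
    rfl
  rw [key, key, cov_extVec_comm hcov z (w 0) (w 1), sub_sub_sub_cancel_right]
  have s1 : ∀ i i' : Fin 2, (∀ j : Fin 1, i.succAbove j = i') →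
      mvfderiv (𝓡 d) (fun z' => b z' k s (extVec z y z')
          (fun j => extVec z (w (i.succAbove j)) z')) z (w i)
        - fderiv ℝ (fun t : Euc d => b z k s t (fun j => w (i.succAbove j))) y
          (cov (extVec z y) z (w i)) =
      mvfderiv (𝓡 d) (fun z' => b z' k s (extVec z y z') (fun _ => extVec z (w i') z')) z (w i)
        - fderiv ℝ (fun t : Euc d => b z k s t (fun _ => w i')) y (cov (extVec z y) z (w i)) := by
    intro i i' hi
    exact congrArg₂ (fun p q : ℂ => p - q)
      (congrArg (fun q : M → ℂ => mvfderiv (𝓡 d) q z (w i))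
        (funext fun z' => congrArg (b z' k s _) (funext fun j => by rw [hi])))
      (congrArg (fun q : Euc d → ℂ => fderiv ℝ q y (cov (extVec z y) z (w i)))
        (funext fun t => congrArg (b z k s _) (funext fun j => by rw [hi])))
  rw [weylNabla, Fin.sum_univ_two, s1 0 1 (by decide), s1 1 0 (by decide)]
  simp only [Fin.val_zero, pow_zero, one_mul, Fin.val_one, pow_one, neg_mul, ← sub_eq_add_neg]

end CovariantDerivativeOfForms

/-! ### The exterior covariant derivative in charts -/

section TransferDerivatives
open scoped Topology

lemma LocalGeom.sum_nabla {d : ℕ} {g : LocalGeom d} (f : Sm g.tube) (p : g.tube) (a : Euc d) :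
    ∑ i, (a i : ℂ) * (g.data.nabla i f).1 p =
      fderiv ℝ (Sm.zext f) p (a, - g.Γ p.1.1 a p.1.2) := by
  simp_rw [LocalGeom.eval_nabla]
  have h := map_eq_sum_basisVec ((fderiv ℝ (Sm.zext f) p).toLinearMap.comp
    (LinearMap.prod LinearMap.id (-(((ContinuousLinearMap.apply ℝ (Euc d) p.1.2).comp
      (g.Γ p.1.1)).toLinearMap)))) a
  refine Eq.trans ?_ h.symm
  refine sum_congr rfl fun i _ => ?_
  rw [Complex.real_smul]
  rfl

variable {d : ℕ} {M : Type v} [TopologicalSpace M] [ChartedSpace (Euc d) M]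
  [IsManifold (𝓡 d) ∞ M] [T2Space M] {Ω : FormField d M} {cov : AffineConnection d M}
  {h : IsFedosovManifold Ω cov} {x₀ : M}

/-- The point of the coordinate tangent bundle with base point `z` and fibre component `y`. -/
def tubePt (h : IsFedosovManifold Ω cov) {z : M} (hz : z ∈ (chartAt (Euc d) x₀).source)
    (y : Euc d) : (h.localGeom x₀).tube :=
  ⟨(chartAt (Euc d) x₀ z, y), LocalGeom.mem_tube.2 ((chartAt (Euc d) x₀).map_source hz)⟩

lemma basePt_tubePt {z : M} (hz : z ∈ (chartAt (Euc d) x₀).source) (y : Euc d) :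
    basePt h x₀ (tubePt h hz y) = z := (chartAt (Euc d) x₀).left_inv hz

lemma frame_apply (p : (h.localGeom x₀).tube) (v : Euc d) :
    frame h p v = fr x₀ (basePt h x₀ p) v := rfl

lemma co_frame (p : (h.localGeom x₀).tube) (v : Euc d) :
    co x₀ (basePt h x₀ p) (frame h p v) = v := co_fr (basePt_mem h p) v

lemma Rep0.apply {b : M → WeylForm d 0} {F : (h.localGeom x₀).Weyl} (hF : Rep0 h x₀ b F) {z : M}
    (hz : z ∈ (chartAt (Euc d) x₀).source) (k s : ℕ) (y : Euc d) (w : Fin 0 → Euc d) :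
    b z k s (fr x₀ z y) w = Sm.zext (F.1 k s) (chartAt (Euc d) x₀ z, y) := by
  have h1 := hF (tubePt h hz y) k s w
  rw [← Sm.zext_coe, frame_apply, basePt_tubePt] at h1
  exact h1

lemma Rep1.apply {b : M → WeylForm d 1} {F : Fin d → (h.localGeom x₀).Weyl} (hF : Rep1 h x₀ b F)
    {z : M} (hz : z ∈ (chartAt (Euc d) x₀).source) (k s : ℕ) (y w : Euc d) :
    b z k s (fr x₀ z y) (fun _ => fr x₀ z w) =
      ∑ j, (w j : ℂ) * Sm.zext ((F j).1 k s) (chartAt (Euc d) x₀ z, y) := by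
  have h1 := hF (tubePt h hz y) k s (fun _ => w)
  simp only [← Sm.zext_coe, frame_apply] at h1
  rw [basePt_tubePt] at h1
  exact h1

lemma Rep0.differentiable {b : M → WeylForm d 0} (hb : ∀ z, IsWeylForm (b z)) (z : M) (k s : ℕ)
    (w : Fin 0 → Euc d) : Differentiable ℝ fun t => b z k s t w :=
  (contDiff_of_mem_homogPoly (mem_homogPoly.2 ((hb z).polynomial k s w))).differentiable (by simp)

/-- A component of a `0`-form in local coordinates, as a function of base point and one vector. -/
def localFun0 (F : (h.localGeom x₀).Weyl) (k s : ℕ) (q : Euc d × (Fin 1 → Euc d)) : ℂ :=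
  Sm.zext (F.1 k s) (q.1, q.2 0)

/-- A component of a `1`-form in local coordinates, as a function of base point and two vectors. -/
def localFun1 (F : Fin d → (h.localGeom x₀).Weyl) (k s : ℕ) (q : Euc d × (Fin 2 → Euc d)) : ℂ :=
  ∑ j, ((q.2 1) j : ℂ) * Sm.zext ((F j).1 k s) (q.1, q.2 0)

/-- The projection of `(u, Y)` to `(u, Y t)`. -/
def projPair (d n : ℕ) (t : Fin n) : Euc d × (Fin n → Euc d) →L[ℝ] Euc d × Euc d :=
  (ContinuousLinearMap.fst ℝ _ _).prod
    ((ContinuousLinearMap.proj t).comp (ContinuousLinearMap.snd ℝ _ _))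

lemma contDiffAt_localFun0 (F : (h.localGeom x₀).Weyl) (k s : ℕ) {q : Euc d × (Fin 1 → Euc d)}
    (hq : q.1 ∈ (chartAt (Euc d) x₀).target) : ContDiffAt ℝ ∞ (localFun0 F k s) q :=
  ContDiffAt.comp q (Sm.contDiffAt_zext (F.1 k s) (p := (q.1, q.2 0)) (LocalGeom.mem_tube.2 hq))
    (projPair d 1 0).contDiff.contDiffAt

lemma contDiffAt_localFun1 (F : Fin d → (h.localGeom x₀).Weyl) (k s : ℕ)
    {q : Euc d × (Fin 2 → Euc d)} (hq : q.1 ∈ (chartAt (Euc d) x₀).target) :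
    ContDiffAt ℝ ∞ (localFun1 F k s) q := by
  refine ContDiffAt.sum fun j _ => ContDiffAt.mul ?_ ?_
  · exact (contDiff_coord j).contDiffAt.comp q
      ((ContinuousLinearMap.proj 1).comp
        (ContinuousLinearMap.snd ℝ (Euc d) (Fin 2 → Euc d))).contDiff.contDiffAt
  · exact ContDiffAt.comp q
      (Sm.contDiffAt_zext ((F j).1 k s) (p := (q.1, q.2 0)) (LocalGeom.mem_tube.2 hq))
      (projPair d 2 0).contDiff.contDiffAt

lemma fderiv_localFun0 (F : (h.localGeom x₀).Weyl) (k s : ℕ) {q : Euc d × (Fin 1 → Euc d)}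
    (hq : q.1 ∈ (chartAt (Euc d) x₀).target) (a : Euc d) (Z : Fin 1 → Euc d) :
    fderiv ℝ (localFun0 F k s) q (a, Z) =
      fderiv ℝ (Sm.zext (F.1 k s)) (q.1, q.2 0) (a, Z 0) := by
  have h1 := (Sm.differentiableAt_zext (F.1 k s) (p := (q.1, q.2 0)) (LocalGeom.mem_tube.2 hq))
  have h2 := HasFDerivAt.comp (f := projPair d 1 0) q h1.hasFDerivAt (projPair d 1 0).hasFDerivAt
  exact congrArg (fun L : Euc d × (Fin 1 → Euc d) →L[ℝ] ℂ => L (a, Z)) h2.fderiv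

lemma fderiv_localFun1 (F : Fin d → (h.localGeom x₀).Weyl) (k s : ℕ)
    {q : Euc d × (Fin 2 → Euc d)} (hq : q.1 ∈ (chartAt (Euc d) x₀).target) (a : Euc d)
    (Z : Fin 2 → Euc d) : fderiv ℝ (localFun1 F k s) q (a, Z) =
      ∑ j, ((q.2 1 j : ℂ) * fderiv ℝ (Sm.zext ((F j).1 k s)) (q.1, q.2 0) (a, Z 0) +
        (Z 1 j : ℂ) * Sm.zext ((F j).1 k s) (q.1, q.2 0)) := by
  have h1 := fun j =>
    (Sm.differentiableAt_zext ((F j).1 k s) (p := (q.1, q.2 0)) (LocalGeom.mem_tube.2 hq))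
  have h2 := fun j => HasFDerivAt.comp (f := projPair d 2 0) q (h1 j).hasFDerivAt
    (projPair d 2 0).hasFDerivAt
  have h3 : ∀ j, HasFDerivAt (fun q : Euc d × (Fin 2 → Euc d) => ((q.2 1 j : ℝ) : ℂ)) _ q :=
    fun j => (Complex.ofRealCLM.comp ((EuclideanSpace.proj j : Euc d →L[ℝ] ℝ).comp
      ((ContinuousLinearMap.proj 1).comp
        (ContinuousLinearMap.snd ℝ (Euc d) (Fin 2 → Euc d))))).hasFDerivAt
  have h4 := HasFDerivAt.fun_sum (u := univ) fun j _ => (h3 j).mul (h2 j)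
  have h5 := congrArg (fun L : Euc d × (Fin 2 → Euc d) →L[ℝ] ℂ => L (a, Z)) h4.fderiv
  refine h5.trans ?_
  simp only [_root_.sum_apply]
  refine sum_congr rfl fun j _ => ?_
  simp only [_root_.add_apply, _root_.smul_apply, smul_eq_mul]
  congr 1
  exact mul_comm _ _

lemma Rep0.covD {b : M → WeylForm d 0} {F : (h.localGeom x₀).Weyl} (hF : Rep0 h x₀ b F)
    (k s : ℕ) (p : (h.localGeom x₀).tube) {η : Fin 1 → ∀ z : M, TangentSpace (𝓡 d) z}
    (hη : ∀ t, SmAt (η t) (basePt h x₀ p)) (h0 : η 0 (basePt h x₀ p) = frame h p p.1.2)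
    (a : Euc d) : covD cov (fiberFun0 b k s) η (basePt h x₀ p) (frame h p a) =
      ∑ i, (a i : ℂ) * (((h.localGeom x₀).data.nablaW i F).1 k s).1 p := by
  have hz := basePt_mem h p
  have h0' : co x₀ (basePt h x₀ p) (η 0 (basePt h x₀ p)) = p.1.2 := by
    rw [h0]
    exact co_frame p p.1.2
  have h1 := covD_fr cov (β := fiberFun0 b k s) (f := localFun0 F k s) hz hη
    (contDiffAt_localFun0 F k s ((chartAt (Euc d) x₀).map_source hz))
    (fun z hz Y => hF.apply hz k s (Y 0) _) a
  rw [fderiv_localFun0 F k s ((chartAt (Euc d) x₀).map_source hz)] at h1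
  simp only [h0', chart_basePt h p] at h1
  refine h1.trans ?_
  exact (LocalGeom.sum_nabla (F.1 k s) p a).symm

lemma Rep1.covD {b : M → WeylForm d 1} {F : Fin d → (h.localGeom x₀).Weyl} (hF : Rep1 h x₀ b F)
    (k s : ℕ) (p : (h.localGeom x₀).tube) {η : Fin 2 → ∀ z : M, TangentSpace (𝓡 d) z}
    (hη : ∀ t, SmAt (η t) (basePt h x₀ p)) (h0 : η 0 (basePt h x₀ p) = frame h p p.1.2)
    (a w : Euc d) (hw : η 1 (basePt h x₀ p) = frame h p w) :
    covD cov (fiberFun1 b k s) η (basePt h x₀ p) (frame h p a) =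
      ∑ i, ∑ j, (a i : ℂ) * (w j : ℂ) * (((h.localGeom x₀).data.nablaW i (F j)).1 k s).1 p -
      ∑ j, ((h.localGeom x₀).Γ p.1.1 a w j : ℂ) * ((F j).1 k s).1 p := by
  have hz := basePt_mem h p
  have h0' : co x₀ (basePt h x₀ p) (η 0 (basePt h x₀ p)) = p.1.2 := by
    rw [h0]
    exact co_frame p p.1.2
  have hw' : co x₀ (basePt h x₀ p) (η 1 (basePt h x₀ p)) = w := by
    rw [hw]
    exact co_frame p w
  have h1 := covD_fr cov (β := fiberFun1 b k s) (f := localFun1 F k s) hz hη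
    (contDiffAt_localFun1 F k s ((chartAt (Euc d) x₀).map_source hz))
    (fun z hz Y => hF.apply hz k s (Y 0) (Y 1)) a
  rw [fderiv_localFun1 F k s ((chartAt (Euc d) x₀).map_source hz)] at h1
  simp only [h0', hw', chart_basePt h p] at h1
  refine h1.trans ?_
  rw [sum_add_distrib, sub_eq_add_neg, ← sum_neg_distrib]
  congr 1
  · rw [sum_comm]
    refine sum_congr rfl fun j _ => ?_
    have h2 := LocalGeom.sum_nabla ((F j).1 k s) p a
    simp_rw [mul_comm (((a _ : ℝ) : ℂ)) ((w j : ℝ) : ℂ), mul_assoc, ← mul_sum]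
    congr 1
    exact h2.symm
  · refine sum_congr rfl fun j _ => ?_
    rw [← neg_mul]
    congr 1
    · simp
      rfl
    · exact Sm.zext_coe ((F j).1 k s) p

lemma Rep0.weylNabla {b : M → WeylForm d 0} (hb : ∀ z, IsWeylForm (b z))
    {F : (h.localGeom x₀).Weyl} (hF : Rep0 h x₀ b F) :
    Rep1 h x₀ (weylNabla cov b) (fun i => (h.localGeom x₀).data.nablaW i F) := by
  intro p k s w
  rw [weylNabla_zero cov b _ k s (Rep0.differentiable hb _ k s _)]
  exact hF.covD k s p (fun _ => (smNear_extVec _ _).smAt) (extVec_self _ _) (w 0)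

lemma Rep1.differentiable {b : M → WeylForm d 1} {F : Fin d → (h.localGeom x₀).Weyl}
    (hF : Rep1 h x₀ b F) {z : M} (hz : z ∈ (chartAt (Euc d) x₀).source) (k s : ℕ) :
    Differentiable ℝ (fiberFun1 b k s z) := by
  have h1 : fiberFun1 b k s z = localFun1 F k s ∘
      fun Y => (chartAt (Euc d) x₀ z, fun t => co x₀ z (Y t)) := by
    ext1 Y
    rw [Function.comp_apply, localFun1, ← hF.apply hz]
    exact congrArg₂ (b z k s) (fr_co hz _).symm (funext fun _ => (fr_co hz _).symm)
  rw [h1]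
  intro Y
  refine ((contDiffAt_localFun1 F k s ((chartAt (Euc d) x₀).map_source hz)).differentiableAt
    (by simp)).comp Y ((differentiableAt_const _).prodMk (differentiableAt_pi.2 fun t => ?_))
  exact (ContinuousLinearMap.comp (co x₀ z : Euc d →L[ℝ] Euc d)
    (ContinuousLinearMap.proj t : (Fin 2 → Euc d) →L[ℝ] Euc d)).differentiableAt

lemma sub_sub_sub_cancel_right_sum (v w : Fin d → ℂ) (f : Fin d → Fin d → ℂ) (c : ℂ) :
    (∑ i, ∑ j, v i * w j * f i j - c) - (∑ i, ∑ j, w i * v j * f i j - c) =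
      ∑ i, ∑ j, v i * w j * (f i j - f j i) := by
  rw [sub_sub_sub_cancel_right, sum_comm (γ := Fin d) (f := fun i j => w i * v j * f i j),
    ← sum_sub_distrib]
  refine sum_congr rfl fun i _ => ?_
  rw [← sum_sub_distrib]
  exact sum_congr rfl fun j _ => by ring

lemma Rep1.weylNabla {b : M → WeylForm d 1} (hb : ∀ z, IsWeylForm (b z))
    {F : Fin d → (h.localGeom x₀).Weyl} (hF : Rep1 h x₀ b F) :
    Rep2 h x₀ (weylNabla cov b) (fun i j => (h.localGeom x₀).data.nablaW i (F j) -
      (h.localGeom x₀).data.nablaW j (F i)) := by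
  intro p k s w
  rw [weylNabla_one h.torsionFree b _ k s (hb _) (hF.differentiable (basePt_mem h p) k s)]
  have hs : ∀ v : Euc d, ∀ t, SmAt ((![extVec (basePt h x₀ p) (frame h p p.1.2),
      extVec (basePt h x₀ p) v] : Fin 2 → ∀ z : M, TangentSpace (𝓡 d) z) t) (basePt h x₀ p) := by
    intro v t
    fin_cases t
    · exact (smNear_extVec _ _).smAt
    · exact (smNear_extVec _ _).smAt
  have h1 := hF.covD k s p (hs (frame h p (w 1))) (extVec_self _ _) (w 0) (w 1) (extVec_self _ _)
  have h2 := hF.covD k s p (hs (frame h p (w 0))) (extVec_self _ _) (w 1) (w 0) (extVec_self _ _)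
  refine (congrArg₂ (fun p q : ℂ => p - q) h1 h2).trans ?_
  rw [(h.localGeom x₀).symm _ (LocalGeom.fst_mem p) (w 1) (w 0)]
  exact sub_sub_sub_cancel_right_sum (fun i => ((w 0 i : ℝ) : ℂ)) (fun i => ((w 1 i : ℝ) : ℂ))
    (fun i j => (((h.localGeom x₀).data.nablaW i (F j)).1 k s).1 p) _

end TransferDerivatives

/-! ### The algebraic operators in charts -/

namespace MoyalData

variable {ι A : Type*} [Fintype ι] [DecidableEq ι] [CommRing A] [Algebra ℂ A] {𝔐 : MoyalData ι A}

/-- The operator `(q + n)⁻¹ ∑ yₗ Fₗ` on components of polynomial degree `q`; for the components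
`F l` of a form of degree `n` along `dxₗ`, this is the homotopy operator `δ⁻`. -/
def radial (n : ℕ) (F : ι → 𝔐.weyl) : 𝔐.weyl :=
  ⟨fun k s => match s with
    | 0 => 0
    | q + 1 => ((q + n : ℕ) : ℂ)⁻¹ • ∑ l, 𝔐.y l * (F l).1 k q, fun k s => match s with
    | 0 => IsHomog.zero _
    | q + 1 => by
      have : 𝔐.IsHomog (1 + q) (∑ l, 𝔐.y l * (F l).1 k q) :=
        IsHomog.sum _ fun l _ => (isHomog_y l).mul ((F l).2 k q)
      have h2 : ((q + 1 : ℕ) : ℤ) = 1 + q := by push_cast; ring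
      simp only
      rw [h2]
      exact this.smul _⟩

lemma radial_succ (n : ℕ) (F : ι → 𝔐.weyl) (k q : ℕ) :
    (radial n F).1 k (q + 1) = ((q + n : ℕ) : ℂ)⁻¹ • ∑ l, 𝔐.y l * (F l).1 k q := rfl

end MoyalData

section TransferOperators
open scoped Topology
open MoyalData

variable {d : ℕ} {M : Type v} [TopologicalSpace M] [ChartedSpace (Euc d) M]
  [IsManifold (𝓡 d) ∞ M] [T2Space M] {Ω : FormField d M} {cov : AffineConnection d M}
  {h : IsFedosovManifold Ω cov} {x₀ : M}

lemma bilinear_sum_smul {V W Z κ : Type*} [AddCommGroup V] [Module ℂ V] [AddCommGroup W]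
    [Module ℂ W] [AddCommGroup Z] [Module ℂ Z] [Fintype κ] (B : V →ₗ[ℂ] W →ₗ[ℂ] Z) (v w : κ → ℂ)
    (x : κ → V) (y : κ → W) :
    B (∑ i, v i • x i) (∑ j, w j • y j) = ∑ i, v i • ∑ j, w j • B (x i) (y j) := by
  have h1 : B (∑ i, v i • x i) = ∑ i, v i • B (x i) := by
    rw [map_sum]
    exact sum_congr rfl fun i _ => map_smul B _ _
  rw [h1, LinearMap.sum_apply]
  refine sum_congr rfl fun i _ => ?_
  rw [LinearMap.smul_apply, map_sum]
  exact congrArg _ (sum_congr rfl fun j _ => map_smul (B (x i)) _ _)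

lemma br_sum_smul {κ ι A : Type*} [Fintype κ] [Fintype ι] [DecidableEq ι] [CommRing A]
    [Algebra ℂ A] {𝔐 : MoyalData ι A} (v w : κ → ℂ) (F G : κ → 𝔐.weyl) :
    br (∑ i, v i • F i) (∑ j, w j • G j) = ∑ i, v i • ∑ j, w j • br (F i) (G j) :=
  bilinear_sum_smul br v w F G

lemma br_sum_smul_left {κ ι A : Type*} [Fintype κ] [Fintype ι] [DecidableEq ι] [CommRing A]
    [Algebra ℂ A] {𝔐 : MoyalData ι A} (v : κ → ℂ) (F : κ → 𝔐.weyl) (G : 𝔐.weyl) :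
    ∑ i, v i • br (F i) G = br (∑ i, v i • F i) G := by
  simp [map_sum, LinearMap.sum_apply]

lemma fibDeriv_sum_smul {κ ι A : Type*} [Fintype κ] [Fintype ι] [DecidableEq ι] [CommRing A]
    [Algebra ℂ A] {𝔐 : MoyalData ι A} (i : ι) (v : κ → ℂ) (F : κ → 𝔐.weyl) :
    fibDeriv i (∑ j, v j • F j) = ∑ j, v j • fibDeriv i (F j) := by
  simp [map_sum]

lemma sum_sub_sum_swap (v w : Fin d → ℂ) (f : Fin d → Fin d → ℂ) :
    (∑ i, ∑ j, v i * w j * f i j) - (∑ i, ∑ j, w i * v j * f i j) =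
      ∑ i, ∑ j, v i * w j * (f i j - f j i) := by
  have h1 := sub_sub_sub_cancel_right_sum v w f 0
  rwa [sub_zero, sub_zero] at h1

lemma inv_mul_sum_sum (c : ℂ) (v w : Fin d → ℂ) (f : Fin d → Fin d → ℂ) :
    c * ∑ i, ∑ j, v i * w j * f i j = ∑ j, w j * (c * ∑ l, v l * f l j) := by
  rw [Finset.sum_comm, mul_sum]
  refine sum_congr rfl fun j _ => ?_
  rw [mul_left_comm, mul_sum (a := w j)]
  exact congrArg _ (sum_congr rfl fun i _ => by ring)

section Expansions

omit [T2Space M]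
variable (Ω : FormField d M) (r : M → WeylForm d 1) (z : M) (k s : ℕ) (y : Euc d)

omit [IsManifold (𝓡 d) ∞ M]

lemma weylBracket_zero (b : M → WeylForm d 0) (w : Fin 1 → Euc d) :
    weylBracket Ω r b z k s y w = scaledComm (inverseForm Ω z) ((r z).eval fun _ => w 0)
      ((b z).eval fun j => w (Fin.succAbove 0 j)) k s y := by
  rw [weylBracket, Fin.sum_univ_one, Fin.val_zero, pow_zero, one_mul]

lemma weylBracket_one (b : M → WeylForm d 1) (w : Fin 2 → Euc d) :
    weylBracket Ω r b z k s y w =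
      scaledComm (inverseForm Ω z) ((r z).eval fun _ => w 0) ((b z).eval fun _ => w 1) k s y -
      scaledComm (inverseForm Ω z) ((r z).eval fun _ => w 1) ((b z).eval fun _ => w 0) k s y := by
  have s0 : (fun j : Fin 1 => w (Fin.succAbove 0 j)) = fun _ => w 1 := by
    ext1 j
    rw [Subsingleton.elim j 0]
    rfl
  have s1 : (fun j : Fin 1 => w (Fin.succAbove 1 j)) = fun _ => w 0 := by
    ext1 j
    rw [Subsingleton.elim j 0]
    rfl
  rw [weylBracket, Fin.sum_univ_two, s0, s1]
  simp only [Fin.val_zero, pow_zero, one_mul, Fin.val_one, pow_one, neg_mul, ← sub_eq_add_neg]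

lemma weylDelta_zero (b : M → WeylForm d 0) (w : Fin 1 → Euc d) :
    weylDelta b z k s y w =
      fderiv ℝ (fun t => b z k (s + 1) t (fun j => w (Fin.succAbove 0 j))) y (w 0) := by
  rw [weylDelta, Fin.sum_univ_one, Fin.val_zero, pow_zero, one_mul]

lemma weylDelta_one (b : M → WeylForm d 1) (w : Fin 2 → Euc d) :
    weylDelta b z k s y w = fderiv ℝ (fun t => b z k (s + 1) t (fun _ => w 1)) y (w 0) -
      fderiv ℝ (fun t => b z k (s + 1) t (fun _ => w 0)) y (w 1) := by
  have s0 : (fun j : Fin 1 => w (Fin.succAbove 0 j)) = fun _ => w 1 := by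
    ext1 j
    rw [Subsingleton.elim j 0]
    rfl
  have s1 : (fun j : Fin 1 => w (Fin.succAbove 1 j)) = fun _ => w 0 := by
    ext1 j
    rw [Subsingleton.elim j 0]
    rfl
  rw [weylDelta, Fin.sum_univ_two, s0, s1]
  simp only [Fin.val_zero, pow_zero, one_mul, Fin.val_one, pow_one, neg_mul, ← sub_eq_add_neg]

end Expansions

/-- The point with the same base point as `p` and fibre component `y`. -/
def withFib (p : (h.localGeom x₀).tube) (y : Euc d) : (h.localGeom x₀).tube :=
  ⟨(p.1.1, y), LocalGeom.mem_tube.2 (LocalGeom.fst_mem p)⟩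

lemma inverseForm_basePt (p : (h.localGeom x₀).tube) (i j : Fin d) :
    inverseForm Ω (basePt h x₀ p) i j = ∑ i', ∑ j', frame h p (basisVec i') i *
      frame h p (basisVec j') j * (formMatrix ((h.localGeom x₀).Ω p.1.1))⁻¹ i' j' :=
  formMatrix_inv_of_comp (B := Ω (basePt h x₀ p)) (frame h p)
    (fun v w => (chartForm_apply Ω x₀ p.1.1 v w).symm)
    ((h.localGeom x₀).nondegenerate _ (LocalGeom.fst_mem p)) i j

lemma moyal_basePt (p : (h.localGeom x₀).tube) {α β : WeylElt d} {F G : (h.localGeom x₀).Weyl}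
    (ha : ∀ k s, ContDiff ℝ ∞ (α k s)) (hb : ∀ k s, ContDiff ℝ ∞ (β k s))
    (hα : ∀ k s y, α k s (frame h p y) = (F.1 k s).1 (withFib p y))
    (hβ : ∀ k s y, β k s (frame h p y) = (G.1 k s).1 (withFib p y)) (K S : ℕ) :
    moyal (inverseForm Ω (basePt h x₀ p)) α β K S (frame h p p.1.2) = ((F * G).1 K S).1 p := by
  have h1 := moyal_comp (frame h p : Euc d →L[ℝ] Euc d) (inverseForm_basePt p) ha hb K S p.1.2
  refine h1.symm.trans ?_
  exact LocalGeom.eval_mul (LocalGeom.fst_mem p) hα hβ K S p.1.2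

lemma scaledComm_basePt (p : (h.localGeom x₀).tube) {α β : WeylElt d}
    {F G : (h.localGeom x₀).Weyl}
    (ha : ∀ k s, ContDiff ℝ ∞ (α k s)) (hb : ∀ k s, ContDiff ℝ ∞ (β k s))
    (hα : ∀ k s y, α k s (frame h p y) = (F.1 k s).1 (withFib p y))
    (hβ : ∀ k s y, β k s (frame h p y) = (G.1 k s).1 (withFib p y)) (K S : ℕ) :
    scaledComm (inverseForm Ω (basePt h x₀ p)) α β K S (frame h p p.1.2) =
      ((br F G).1 K S).1 p := by
  have h1 := scaledComm_comp (frame h p : Euc d →L[ℝ] Euc d) (inverseForm_basePt p) ha hb K S p.1.2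
  refine h1.symm.trans ?_
  exact LocalGeom.eval_br (LocalGeom.fst_mem p) hα hβ K S p.1.2

lemma contDiff_eval {l : ℕ} {b : WeylForm d l} (hb : IsWeylForm b) (w : Fin l → Euc d) (k s : ℕ) :
    ContDiff ℝ ∞ (b.eval w k s) :=
  contDiff_of_mem_homogPoly (mem_homogPoly.2 (hb.polynomial k s w))

lemma weyl_sum_smul_apply (v : Euc d) (F : Fin d → (h.localGeom x₀).Weyl) (k s : ℕ)
    (p : (h.localGeom x₀).tube) :
    ((∑ i, (v i : ℂ) • F i).1 k s).1 p = ∑ i, (v i : ℂ) * ((F i).1 k s).1 p := by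
  rw [MoyalData.coe_sum, LocalGeom.sum_apply]
  rfl

lemma weyl_br_sum_apply (v w : Euc d) (F G : Fin d → (h.localGeom x₀).Weyl) (k s : ℕ)
    (p : (h.localGeom x₀).tube) :
    ((br (∑ i, (v i : ℂ) • F i) (∑ j, (w j : ℂ) • G j)).1 k s).1 p =
      ∑ i, ∑ j, (v i : ℂ) * (w j : ℂ) * ((br (F i) (G j)).1 k s).1 p := by
  rw [br_sum_smul]
  refine (weyl_sum_smul_apply v _ k s p).trans (sum_congr rfl fun i _ => ?_)
  refine (congrArg (fun t => (v i : ℂ) * t) (weyl_sum_smul_apply w (fun j => br (F i) (G j)) k s p)).trans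
    (mul_sum _ _ _ |>.trans ?_)
  exact sum_congr rfl fun j _ => (mul_assoc _ _ _).symm

lemma Rep0.weylMul {a b : M → WeylForm d 0} (ha : ∀ z, IsWeylForm (a z))
    (hb : ∀ z, IsWeylForm (b z)) {F G : (h.localGeom x₀).Weyl} (hF : Rep0 h x₀ a F)
    (hG : Rep0 h x₀ b G) : Rep0 h x₀ (weylMul Ω a b) (F * G) := fun p k s w =>
  moyal_basePt p (α := (a (basePt h x₀ p)).eval w) (β := (b (basePt h x₀ p)).eval w)
    (contDiff_eval (ha _) w) (contDiff_eval (hb _) w)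
    (fun k s y => hF (withFib p y) k s w) (fun k s y => hG (withFib p y) k s w) k s

lemma Rep1.scaledComm_zero {r : M → WeylForm d 1} {b : M → WeylForm d 0}
    (hr : ∀ z, IsWeylForm (r z)) (hb : ∀ z, IsWeylForm (b z)) {ρ : Fin d → (h.localGeom x₀).Weyl}
    {F : (h.localGeom x₀).Weyl} (hρ : Rep1 h x₀ r ρ) (hF : Rep0 h x₀ b F)
    (p : (h.localGeom x₀).tube) (v : Euc d) (w : Fin 0 → Euc d) (k s : ℕ) :
    scaledComm (inverseForm Ω (basePt h x₀ p)) ((r (basePt h x₀ p)).eval fun _ => frame h p v)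
      ((b (basePt h x₀ p)).eval w) k s (frame h p p.1.2) =
      ∑ i, (v i : ℂ) * ((br (ρ i) F).1 k s).1 p := by
  rw [← weyl_sum_smul_apply v (fun i => br (ρ i) F)]
  rw [br_sum_smul_left]
  refine scaledComm_basePt p (contDiff_eval (hr _) _) (contDiff_eval (hb _) _) ?_ ?_ k s
  · intro k s y
    rw [weyl_sum_smul_apply]
    exact hρ (withFib p y) k s (fun _ => v)
  · exact fun k s y => hF (withFib p y) k s w

lemma Rep1.scaledComm_one {r b : M → WeylForm d 1}
    (hr : ∀ z, IsWeylForm (r z)) (hb : ∀ z, IsWeylForm (b z))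
    {ρ F : Fin d → (h.localGeom x₀).Weyl} (hρ : Rep1 h x₀ r ρ) (hF : Rep1 h x₀ b F)
    (p : (h.localGeom x₀).tube) (v w : Euc d) (k s : ℕ) :
    scaledComm (inverseForm Ω (basePt h x₀ p)) ((r (basePt h x₀ p)).eval fun _ => frame h p v)
      ((b (basePt h x₀ p)).eval fun _ => frame h p w) k s (frame h p p.1.2) =
      ∑ i, ∑ j, (v i : ℂ) * (w j : ℂ) * ((br (ρ i) (F j)).1 k s).1 p := by
  refine Eq.trans ?_ (weyl_br_sum_apply v w ρ F k s p)
  refine scaledComm_basePt p (contDiff_eval (hr _) _) (contDiff_eval (hb _) _) ?_ ?_ k s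
  · intro k s y
    rw [weyl_sum_smul_apply]
    exact hρ (withFib p y) k s (fun _ => v)
  · intro k s y
    rw [weyl_sum_smul_apply]
    exact hF (withFib p y) k s (fun _ => w)

lemma Rep0.weylBracket {r : M → WeylForm d 1} {b : M → WeylForm d 0}
    (hr : ∀ z, IsWeylForm (r z)) (hb : ∀ z, IsWeylForm (b z)) {ρ : Fin d → (h.localGeom x₀).Weyl}
    {F : (h.localGeom x₀).Weyl} (hρ : Rep1 h x₀ r ρ) (hF : Rep0 h x₀ b F) :
    Rep1 h x₀ (weylBracket Ω r b) (fun i => br (ρ i) F) := fun p k s w =>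
  (weylBracket_zero Ω r _ k s _ b _).trans (Rep1.scaledComm_zero hr hb hρ hF p (w 0) _ k s)

lemma Rep1.weylBracket {r b : M → WeylForm d 1}
    (hr : ∀ z, IsWeylForm (r z)) (hb : ∀ z, IsWeylForm (b z))
    {ρ F : Fin d → (h.localGeom x₀).Weyl} (hρ : Rep1 h x₀ r ρ) (hF : Rep1 h x₀ b F) :
    Rep2 h x₀ (weylBracket Ω r b) (fun i j => br (ρ i) (F j) - br (ρ j) (F i)) := fun p k s w =>
  (weylBracket_one Ω r _ k s _ b _).trans <|
    (congrArg₂ (fun p q : ℂ => p - q) (Rep1.scaledComm_one hr hb hρ hF p (w 0) (w 1) k s)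
      (Rep1.scaledComm_one hr hb hρ hF p (w 1) (w 0) k s)).trans <|
    sum_sub_sum_swap (fun i => ((w 0 i : ℝ) : ℂ)) (fun i => ((w 1 i : ℝ) : ℂ))
      (fun i j => ((br (ρ i) (F j)).1 k s).1 p)

lemma Rep1.weylSquare {r : M → WeylForm d 1} (hr : ∀ z, IsWeylForm (r z))
    {ρ : Fin d → (h.localGeom x₀).Weyl} (hρ : Rep1 h x₀ r ρ) :
    Rep2 h x₀ (weylSquare Ω r) (fun i j => br (ρ i) (ρ j)) := fun p k s w =>
  Rep1.scaledComm_one hr hr hρ hρ p (w 0) (w 1) k s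

lemma fderiv_fib {B : Euc d → ℂ} {f : Sm (h.localGeom x₀).tube} (p : (h.localGeom x₀).tube)
    (hB : Differentiable ℝ B) (hf : ∀ y, B (frame h p y) = f.1 (withFib p y)) (v : Euc d) :
    fderiv ℝ B (frame h p p.1.2) (frame h p v) =
      ∑ i, (v i : ℂ) * ((h.localGeom x₀).data.d i f).1 p := by
  have h1 : HasFDerivAt (fun y => B (frame h p y)) _ p.1.2 :=
    HasFDerivAt.comp p.1.2 (hB _).hasFDerivAt (frame h p).hasFDerivAt
  have h4 : HasFDerivAt (fun y : Euc d => (p.1.1, y)) (ContinuousLinearMap.inr ℝ (Euc d) (Euc d))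
    p.1.2 := hasFDerivAt_prodMk_right _ _
  have h3 : HasFDerivAt (fun y => Sm.zext f (p.1.1, y)) _ p.1.2 :=
    ((Sm.differentiableAt_zext f p.2).hasFDerivAt).comp p.1.2 h4
  have h5 : (fun y => B (frame h p y)) = fun y => Sm.zext f (p.1.1, y) := by
    ext1 y
    rw [hf]
    exact (Sm.zext_coe f (withFib p y)).symm
  rw [h5] at h1
  have h6 := congrArg (fun L : Euc d →L[ℝ] ℂ => L v) (h1.unique h3)
  refine h6.trans ?_
  have h7 : ((0 : Euc d), v) = ∑ i, v i • ((0 : Euc d), basisVec i) := by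
    refine Prod.ext ?_ ?_
    · simp [Prod.fst_sum]
    · simp [Prod.snd_sum, sum_smul_basisVec]
  refine Eq.trans ?_ (Sm.fderiv_sum_smul_apply f univ (fun i => v i)
    (fun i => ((0 : Euc d), basisVec i)) p)
  rw [← h7]
  rfl

lemma Rep0.weylDelta {b : M → WeylForm d 0} (hb : ∀ z, IsWeylForm (b z))
    {F : (h.localGeom x₀).Weyl} (hF : Rep0 h x₀ b F) :
    Rep1 h x₀ (weylDelta b) (fun i => fibDeriv i F) := fun p k s w =>
  (weylDelta_zero _ k s _ b _).trans
    (fderiv_fib (f := F.1 k (s + 1)) p (Rep0.differentiable hb _ k (s + 1) _)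
      (fun y => hF (withFib p y) k (s + 1) _) (w 0))

lemma Rep1.fderiv {b : M → WeylForm d 1} (hb : ∀ z, IsWeylForm (b z))
    {F : Fin d → (h.localGeom x₀).Weyl} (hF : Rep1 h x₀ b F) (p : (h.localGeom x₀).tube)
    (v w : Euc d) (k s : ℕ) :
    fderiv ℝ (fun t : Euc d => b (basePt h x₀ p) k (s + 1) t (fun _ => frame h p w))
      (frame h p p.1.2) (frame h p v) =
      ∑ i, ∑ j, (v i : ℂ) * (w j : ℂ) * ((fibDeriv i (F j)).1 k s).1 p := by
  rw [fderiv_fib (f := (∑ j, (w j : ℂ) • F j).1 k (s + 1)) p]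
  · refine sum_congr rfl fun i1 _ => ?_
    rw [← fibDeriv_apply, fibDeriv_sum_smul, weyl_sum_smul_apply, mul_sum]
    exact sum_congr rfl fun j _ => (mul_assoc _ _ _).symm
  · exact (contDiff_of_mem_homogPoly
      (mem_homogPoly.2 ((hb _).polynomial k (s + 1) _))).differentiable (by simp)
  · intro y
    rw [weyl_sum_smul_apply]
    exact hF (withFib p y) k (s + 1) (fun _ => w)

lemma Rep1.weylDelta {b : M → WeylForm d 1} (hb : ∀ z, IsWeylForm (b z))
    {F : Fin d → (h.localGeom x₀).Weyl} (hF : Rep1 h x₀ b F) :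
    Rep2 h x₀ (weylDelta b) (fun i j => fibDeriv i (F j) - fibDeriv j (F i)) := fun p k s w =>
  (weylDelta_one _ k s _ b _).trans <|
    (congrArg₂ (fun p q : ℂ => p - q) (hF.fderiv hb p (w 0) (w 1) k s)
      (hF.fderiv hb p (w 1) (w 0) k s)).trans <|
    sum_sub_sum_swap (fun i => ((w 0 i : ℝ) : ℂ)) (fun i => ((w 1 i : ℝ) : ℂ))
      (fun i j => ((fibDeriv i (F j)).1 k s).1 p)

lemma Rep1.add {a b : M → WeylForm d 1} {F G : Fin d → (h.localGeom x₀).Weyl}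
    (hF : Rep1 h x₀ a F) (hG : Rep1 h x₀ b G) : Rep1 h x₀ (a + b) (fun i => F i + G i) := by
  intro p k s w
  refine (congrArg₂ (fun p q : ℂ => p + q) (hF p k s w) (hG p k s w)).trans ?_
  rw [← sum_add_distrib]
  exact sum_congr rfl fun i _ => (mul_add _ _ _).symm

lemma Rep1.sub {a b : M → WeylForm d 1} {F G : Fin d → (h.localGeom x₀).Weyl}
    (hF : Rep1 h x₀ a F) (hG : Rep1 h x₀ b G) : Rep1 h x₀ (a - b) (fun i => F i - G i) := by
  intro p k s w
  refine (congrArg₂ (fun p q : ℂ => p - q) (hF p k s w) (hG p k s w)).trans ?_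
  rw [← sum_sub_distrib]
  exact sum_congr rfl fun i _ => (mul_sub _ _ _).symm

lemma Rep2.add {a b : M → WeylForm d 2} {F G : Fin d → Fin d → (h.localGeom x₀).Weyl}
    (hF : Rep2 h x₀ a F) (hG : Rep2 h x₀ b G) : Rep2 h x₀ (a + b) (fun i j => F i j + G i j) := by
  intro p k s w
  refine (congrArg₂ (fun p q : ℂ => p + q) (hF p k s w) (hG p k s w)).trans ?_
  simp_rw [← sum_add_distrib]
  exact sum_congr rfl fun i _ => sum_congr rfl fun j _ => (mul_add _ _ _).symm

lemma Rep2.sub {a b : M → WeylForm d 2} {F G : Fin d → Fin d → (h.localGeom x₀).Weyl}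
    (hF : Rep2 h x₀ a F) (hG : Rep2 h x₀ b G) : Rep2 h x₀ (a - b) (fun i j => F i j - G i j) := by
  intro p k s w
  refine (congrArg₂ (fun p q : ℂ => p - q) (hF p k s w) (hG p k s w)).trans ?_
  simp_rw [← sum_sub_distrib]
  exact sum_congr rfl fun i _ => sum_congr rfl fun j _ => (mul_sub _ _ _).symm

lemma Rep0.fedosovD {r : M → WeylForm d 1} {b : M → WeylForm d 0}
    (hr : ∀ z, IsWeylForm (r z)) (hb : ∀ z, IsWeylForm (b z)) {ρ : Fin d → (h.localGeom x₀).Weyl}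
    {F : (h.localGeom x₀).Weyl} (hρ : Rep1 h x₀ r ρ) (hF : Rep0 h x₀ b F) :
    Rep1 h x₀ (fedosovD Ω cov r b) (fun i => (h.localGeom x₀).data.totalD ρ i F) :=
  ((hF.weylNabla hb).sub (hF.weylDelta hb)).add (Rep0.weylBracket hr hb hρ hF)

lemma Rep1.fedosovD {r b : M → WeylForm d 1}
    (hr : ∀ z, IsWeylForm (r z)) (hb : ∀ z, IsWeylForm (b z))
    {ρ F : Fin d → (h.localGeom x₀).Weyl} (hρ : Rep1 h x₀ r ρ) (hF : Rep1 h x₀ b F) :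
    Rep2 h x₀ (fedosovD Ω cov r b) (fun i j => (h.localGeom x₀).data.totalD ρ i (F j) -
      (h.localGeom x₀).data.totalD ρ j (F i)) := by
  have h1 := ((hF.weylNabla hb).sub (hF.weylDelta hb)).add (Rep1.weylBracket hr hb hρ hF)
  have h2 : (fun i j => (h.localGeom x₀).data.totalD ρ i (F j) -
      (h.localGeom x₀).data.totalD ρ j (F i)) = fun i j =>
      ((h.localGeom x₀).data.nablaW i (F j) - (h.localGeom x₀).data.nablaW j (F i) -
        (fibDeriv i (F j) - fibDeriv j (F i)) + (br (ρ i) (F j) - br (ρ j) (F i)) :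
          (h.localGeom x₀).Weyl) := by
    ext1 i
    ext1 j
    simp only [ConnectionData.totalD_eq, ConnectionData.baseD, LinearMap.sub_apply]
    abel
  rw [h2]
  exact h1

lemma Rep1.weylDeltaInv {b : M → WeylForm d 1} {F : Fin d → (h.localGeom x₀).Weyl}
    (hF : Rep1 h x₀ b F) : Rep0 h x₀ (weylDeltaInv b) (radial 1 F) := by
  intro p k s w
  cases s with
  | zero => rfl
  | succ q =>
    have h1 := hF p k q (fun _ => p.1.2)
    have h2 : (Fin.cons (frame h p p.1.2) w : Fin 1 → Euc d) = fun _ => frame h p p.1.2 := by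
      ext1 t
      rw [Subsingleton.elim (α := Fin 1) t 0]
      rfl
    have h3 : ((radial 1 F).1 k (q + 1)).1 p = ((q + 1 : ℕ) : ℂ)⁻¹ *
        (∑ l, (h.localGeom x₀).coord l * (F l).1 k q : Sm (h.localGeom x₀).tube).1 p := rfl
    rw [h3, LocalGeom.sum_apply]
    change _ * b (basePt h x₀ p) k q (frame h p p.1.2) (Fin.cons (frame h p p.1.2) w) = _
    rw [h2, h1]
    rfl

lemma Rep2.weylDeltaInv {b : M → WeylForm d 2} {F : Fin d → Fin d → (h.localGeom x₀).Weyl}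
    (hF : Rep2 h x₀ b F) : Rep1 h x₀ (weylDeltaInv b) (fun j => radial 2 (fun l => F l j)) := by
  intro p k s w
  cases s with
  | zero =>
    have h4 : ∀ i, ((radial 2 (fun l => F l i)).1 k 0).1 p = 0 := fun i => rfl
    simp_rw [h4, mul_zero, sum_const_zero]
    rfl
  | succ q =>
    have h1 := hF p k q (Fin.cons p.1.2 w)
    have h2 : (Fin.cons (frame h p p.1.2) (fun t => frame h p (w t)) : Fin 2 → Euc d) =
        fun t => frame h p ((Fin.cons p.1.2 w : Fin 2 → Euc d) t) := by
      ext1 t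
      refine Fin.cases ?_ (fun i => ?_) t <;> simp
    have h3 : ∀ j, ((radial 2 (fun l => F l j)).1 k (q + 1)).1 p = ((q + 2 : ℕ) : ℂ)⁻¹ *
        ∑ l, (p.1.2 l : ℂ) * ((F l j).1 k q).1 p := by
      intro j
      have h4 : ((radial 2 (fun l => F l j)).1 k (q + 1)).1 p = ((q + 2 : ℕ) : ℂ)⁻¹ *
        (∑ l, (h.localGeom x₀).coord l * (F l j).1 k q : Sm (h.localGeom x₀).tube).1 p := rfl
      rw [h4, LocalGeom.sum_apply]
      rfl
    have h5 : (Fin.cons p.1.2 w : Fin 2 → Euc d) 0 = p.1.2 := rfl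
    have h6 : (Fin.cons p.1.2 w : Fin 2 → Euc d) 1 = w 0 := rfl
    have h7 : b (basePt h x₀ p) k q (frame h p p.1.2)
        (Fin.cons (frame h p p.1.2) (fun t => frame h p (w t))) =
        ∑ i, ∑ j, (p.1.2 i : ℂ) * (w 0 j : ℂ) * ((F i j).1 k q).1 p := by
      rw [h2, ← h5, ← h6]
      exact h1
    refine (congrArg (fun t => ((q + 2 : ℕ) : ℂ)⁻¹ * t) h7).trans ?_
    refine (inv_mul_sum_sum _ _ _ _).trans (sum_congr rfl fun j _ => ?_)
    exact congrArg _ (h3 j).symm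

end TransferOperators

/-! ### The curvature form in charts -/

section Curvature
open scoped Topology

variable {d : ℕ} {M : Type v} [TopologicalSpace M] [ChartedSpace (Euc d) M]
  [IsManifold (𝓡 d) ∞ M] [T2Space M]

lemma hat_cov_apply {cov : AffineConnection d M} {x₀ z : M}
    (hz : z ∈ (chartAt (Euc d) x₀).source) {T V : ∀ z : M, TangentSpace (𝓡 d) z} (hT : SmNear T z) :
    hat x₀ (fun y => cov T y (V y)) =ᶠ[𝓝 (chartAt (Euc d) x₀ z)] fun u =>
      fderiv ℝ (hat x₀ T) u (hat x₀ V u) + christoffel cov x₀ u (hat x₀ V u) (hat x₀ T u) := by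
  have hu := (chartAt (Euc d) x₀).map_source hz
  have hc := (chartAt (Euc d) x₀).continuousAt_symm hu
  have hT' : ∀ᶠ y in 𝓝 ((chartAt (Euc d) x₀).symm (chartAt (Euc d) x₀ z)), SmAt T y := by
    rwa [(chartAt (Euc d) x₀).left_inv hz]
  filter_upwards [hc.eventually hT', (chartAt (Euc d) x₀).open_target.mem_nhds hu] with u h1 h2
  have h3 := (chartAt (Euc d) x₀).map_target h2
  have h4 := cov_fr cov h3 h1 (hat x₀ V u)
  rw [(chartAt (Euc d) x₀).right_inv h2] at h4
  have h5 : fr x₀ ((chartAt (Euc d) x₀).symm u) (hat x₀ V u) = V ((chartAt (Euc d) x₀).symm u) :=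
    fr_co h3 _
  rw [h5] at h4
  change co x₀ _ (cov T ((chartAt (Euc d) x₀).symm u) (V ((chartAt (Euc d) x₀).symm u))) = _
  rw [h4]
  exact co_fr h3 _

set_option synthInstance.maxHeartbeats 200000 in
lemma cov_cov_fr {cov : AffineConnection d M} (hcov : cov.ContMDiffCovariantDerivative ∞) {x₀ z : M}
    (hz : z ∈ (chartAt (Euc d) x₀).source) {T V : ∀ z : M, TangentSpace (𝓡 d) z} (hT : SmNear T z)
    (hV : SmNear V z) (w : Euc d) :
    cov (fun y => cov T y (V y)) z (fr x₀ z w) = fr x₀ z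
      (fderiv ℝ (fderiv ℝ (hat x₀ T)) (chartAt (Euc d) x₀ z) w (hat x₀ V (chartAt (Euc d) x₀ z)) +
        fderiv ℝ (hat x₀ T) (chartAt (Euc d) x₀ z)
          (fderiv ℝ (hat x₀ V) (chartAt (Euc d) x₀ z) w) +
        (fderiv ℝ (christoffel cov x₀) (chartAt (Euc d) x₀ z) w (hat x₀ V (chartAt (Euc d) x₀ z))
            (hat x₀ T (chartAt (Euc d) x₀ z)) +
          christoffel cov x₀ (chartAt (Euc d) x₀ z) (fderiv ℝ (hat x₀ V) (chartAt (Euc d) x₀ z) w)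
            (hat x₀ T (chartAt (Euc d) x₀ z)) +
          christoffel cov x₀ (chartAt (Euc d) x₀ z) (hat x₀ V (chartAt (Euc d) x₀ z))
            (fderiv ℝ (hat x₀ T) (chartAt (Euc d) x₀ z) w)) +
        christoffel cov x₀ (chartAt (Euc d) x₀ z) w
          (fderiv ℝ (hat x₀ T) (chartAt (Euc d) x₀ z) (hat x₀ V (chartAt (Euc d) x₀ z)) +
            christoffel cov x₀ (chartAt (Euc d) x₀ z) (hat x₀ V (chartAt (Euc d) x₀ z))
              (hat x₀ T (chartAt (Euc d) x₀ z)))) := by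
  have hu := (chartAt (Euc d) x₀).map_source hz
  rw [cov_fr cov hz (hT.cov hcov hV).smAt, (hat_cov_apply hz hT).fderiv_eq,
    (hat_cov_apply hz hT).self_of_nhds]
  congr 2
  have hTs : ContDiffAt ℝ ∞ (hat x₀ T) (chartAt (Euc d) x₀ z) := (smAt_iff_hat hz).1 hT.smAt
  have hVs : ContDiffAt ℝ ∞ (hat x₀ V) (chartAt (Euc d) x₀ z) := (smAt_iff_hat hz).1 hV.smAt
  have hd2 : DifferentiableAt ℝ (fderiv ℝ (hat x₀ T)) (chartAt (Euc d) x₀ z) :=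
    (hTs.fderiv_right (m := 1) (by rw [one_add_one_eq_two]; exact two_le_infty)).differentiableAt (by simp)
  have hTd := (hTs.differentiableAt (by simp)).hasFDerivAt
  have hVd := (hVs.differentiableAt (by simp)).hasFDerivAt
  have hΓd := ((contDiffAt_christoffel hcov hu).differentiableAt (by simp)).hasFDerivAt
  have h1 := hd2.hasFDerivAt.clm_apply hVd
  have h2 := (hΓd.clm_apply hVd).clm_apply hTd
  have h3 := congrArg (fun L : Euc d →L[ℝ] Euc d => L w) (h1.add h2).fderiv
  refine h3.trans ?_
  simp only [_root_.add_apply, ContinuousLinearMap.comp_apply,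
    ContinuousLinearMap.flip_apply]
  abel

set_option synthInstance.maxHeartbeats 200000 in
/-- The curvature of arbitrary vector fields depends only on their values: this is its expression in
local coordinates. -/
lemma curvature_fr {Ω : FormField d M} {cov : AffineConnection d M} (h : IsFedosovManifold Ω cov)
    {x₀ z : M} (hz : z ∈ (chartAt (Euc d) x₀).source) {T U V : ∀ z : M, TangentSpace (𝓡 d) z}
    (hT : SmNear T z) (hU : SmNear U z) (hV : SmNear V z) :
    cov (fun y => cov T y (V y)) z (U z) - cov (fun y => cov T y (U y)) z (V z)
      - cov T z (cov V z (U z) - cov U z (V z)) =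
    fr x₀ z ((h.localGeom x₀).curvature (chartAt (Euc d) x₀ z) (co x₀ z (U z)) (co x₀ z (V z))
      (co x₀ z (T z))) := by
  have hu := (chartAt (Euc d) x₀).map_source hz
  have h0 : ∀ η : ∀ z : M, TangentSpace (𝓡 d) z, fr x₀ z (co x₀ z (η z)) = η z :=
    fun η => fr_co hz _
  have hTs : ContDiffAt ℝ ∞ (hat x₀ T) (chartAt (Euc d) x₀ z) := (smAt_iff_hat hz).1 hT.smAt
  have hsym : ∀ v w : Euc d, fderiv ℝ (fderiv ℝ (hat x₀ T)) (chartAt (Euc d) x₀ z) v w =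
      fderiv ℝ (fderiv ℝ (hat x₀ T)) (chartAt (Euc d) x₀ z) w v := fun v w =>
    (hTs.isSymmSndFDerivAt (by simpa using two_le_infty)) v w
  have e1 := cov_cov_fr h.smooth hz hT hV (co x₀ z (U z))
  have e2 := cov_cov_fr h.smooth hz hT hU (co x₀ z (V z))
  have e3 := cov_fr cov hz hV.smAt (co x₀ z (U z))
  have e4 := cov_fr cov hz hU.smAt (co x₀ z (V z))
  rw [h0] at e1 e2 e3 e4
  have hs : ∀ a b : Euc d, fr x₀ z a - fr x₀ z b = fr x₀ z (a - b) :=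
    fun a b => (map_sub (fr x₀ z) a b).symm
  rw [e1, e2, e3, e4, hs, hs, cov_fr cov hz hT.smAt, hs]
  congr 1
  simp only [hat_chart hz]
  rw [h.christoffel_symm hu (co x₀ z (V z)) (co x₀ z (U z)), add_sub_add_right_eq_sub,
    hsym (co x₀ z (U z))]
  have hc : (h.localGeom x₀).curvature (chartAt (Euc d) x₀ z) (co x₀ z (U z)) (co x₀ z (V z))
      (co x₀ z (T z)) = fderiv ℝ (christoffel cov x₀) (chartAt (Euc d) x₀ z) (co x₀ z (U z))
        (co x₀ z (V z)) (co x₀ z (T z)) - fderiv ℝ (christoffel cov x₀) (chartAt (Euc d) x₀ z)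
        (co x₀ z (V z)) (co x₀ z (U z)) (co x₀ z (T z)) +
      christoffel cov x₀ (chartAt (Euc d) x₀ z) (co x₀ z (U z))
        (christoffel cov x₀ (chartAt (Euc d) x₀ z) (co x₀ z (V z)) (co x₀ z (T z))) -
      christoffel cov x₀ (chartAt (Euc d) x₀ z) (co x₀ z (V z))
        (christoffel cov x₀ (chartAt (Euc d) x₀ z) (co x₀ z (U z)) (co x₀ z (T z))) := rfl
  rw [hc]
  simp only [map_sub, map_add, _root_.sub_apply]
  abel

/-- The curvature tensor, computed from arbitrary extensions of the three vectors. -/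
lemma curvatureTensor_eq {Ω : FormField d M} {cov : AffineConnection d M}
    (h : IsFedosovManifold Ω cov) {z : M} {T U V : ∀ z : M, TangentSpace (𝓡 d) z}
    (hT : SmNear T z) (hU : SmNear U z) (hV : SmNear V z) :
    curvatureTensor cov z (U z) (V z) (T z) =
      cov (fun y => cov T y (V y)) z (U z) - cov (fun y => cov T y (U y)) z (V z)
        - cov T z (cov V z (U z) - cov U z (V z)) := by
  have hz := mem_chart_source (Euc d) z
  have h1 := curvature_fr h hz (smNear_extVec z (T z)) (smNear_extVec z (U z))
    (smNear_extVec z (V z))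
  rw [curvature_fr h hz hT hU hV]
  simp only [extVec_self] at h1
  rw [← h1, curvatureTensor, mlieBracket_extVec, cov_extVec_comm h.torsionFree z (U z) (V z),
    sub_self]

lemma curvatureTensor_fr {Ω : FormField d M} {cov : AffineConnection d M}
    (h : IsFedosovManifold Ω cov) {x₀ z : M} (hz : z ∈ (chartAt (Euc d) x₀).source)
    (a b c : Euc d) :
    curvatureTensor cov z (fr x₀ z a) (fr x₀ z b) (fr x₀ z c) =
      fr x₀ z ((h.localGeom x₀).curvature (chartAt (Euc d) x₀ z) a b c) := by
  have h1 := curvatureTensor_eq h (smNear_cf hz c) (smNear_cf hz a) (smNear_cf hz b)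
  have h2 := curvature_fr h hz (smNear_cf hz c) (smNear_cf hz a) (smNear_cf hz b)
  have h3 : ∀ v, co x₀ z (cf x₀ v z) = v := fun v => co_fr hz v
  simp only [h3] at h2
  exact h1.trans h2

lemma bilinear_apply_eq_sum (B : Euc d →ₗ[ℝ] Euc d →ₗ[ℝ] ℝ) (v w : Euc d) :
    ((B v w : ℝ) : ℂ) =
      ∑ i, ∑ j, (v i : ℂ) * (w j : ℂ) * ((B (basisVec i) (basisVec j) : ℝ) : ℂ) := by
  have h1 : B v w = ∑ i, ∑ j, v i * w j * B (basisVec i) (basisVec j) := by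
    conv_lhs => rw [← sum_smul_basisVec v, ← sum_smul_basisVec w]
    simp only [map_sum, map_smul, LinearMap.sum_apply, LinearMap.smul_apply,
      smul_eq_mul, mul_sum]
    rw [sum_comm]
    exact sum_congr rfl fun i _ => sum_congr rfl fun j _ => by ring
  rw [h1]
  push_cast
  rfl

lemma LocalGeom.curvature_swap (g : LocalGeom d) (u a b c : Euc d) :
    g.curvature u b a c = - g.curvature u a b c := by
  unfold LocalGeom.curvature
  abel

set_option synthInstance.maxHeartbeats 200000 in
lemma LocalGeom.curvature_add (g : LocalGeom d) (u a a' b c : Euc d) :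
    g.curvature u (a + a') b c = g.curvature u a b c + g.curvature u a' b c := by
  unfold LocalGeom.curvature
  rw [(fderiv ℝ g.Γ u).map_add a a', (g.Γ u).map_add a a', (fderiv ℝ g.Γ u b).map_add a a']
  simp only [_root_.add_apply]
  rw [(g.Γ u b).map_add]
  abel

set_option synthInstance.maxHeartbeats 200000 in
lemma LocalGeom.curvature_smul (g : LocalGeom d) (u a b c : Euc d) (t : ℝ) :
    g.curvature u (t • a) b c = t • g.curvature u a b c := by
  unfold LocalGeom.curvature
  rw [(fderiv ℝ g.Γ u).map_smul t a, (g.Γ u).map_smul t a, (fderiv ℝ g.Γ u b).map_smul t a]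
  simp only [_root_.smul_apply]
  rw [(g.Γ u b).map_smul, smul_sub, smul_add, smul_sub]

/-- `(1/2) Ω(y, R(a, b) y)` in local coordinates, as a bilinear form in `a` and `b`. -/
def LocalGeom.curvBilin (g : LocalGeom d) (u y : Euc d) : Euc d →ₗ[ℝ] Euc d →ₗ[ℝ] ℝ :=
  LinearMap.mk₂ ℝ (fun a b => (1 / 2 : ℝ) * g.Ω u y (g.curvature u a b y))
    (fun a b c => by rw [g.curvature_add, (g.Ω u y).map_add, mul_add])
    (fun a b c => by rw [g.curvature_smul, (g.Ω u y).map_smul, mul_smul_comm])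
    (fun a b c => by
      rw [g.curvature_swap, g.curvature_add, neg_add, ← g.curvature_swap, ← g.curvature_swap,
        (g.Ω u y).map_add, mul_add])
    (fun t a b => by
      rw [g.curvature_swap, g.curvature_smul, ← smul_neg, ← g.curvature_swap, (g.Ω u y).map_smul,
        mul_smul_comm])

/-- The local components of the curvature form. -/
lemma rep2_weylCurvature {Ω : FormField d M} {cov : AffineConnection d M}
    (h : IsFedosovManifold Ω cov) (x₀ : M) :
    Rep2 h x₀ (weylCurvature Ω cov) (fun i j => (h.localGeom x₀).data.curvW i j) := by
  intro p k s w
  have hz := basePt_mem h p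
  have h2 : ∀ i j, (((h.localGeom x₀).data.curvW i j).1 k s).1 p =
      if k = 0 ∧ s = 2 then (((h.localGeom x₀).curvBilin p.1.1 p.1.2 (basisVec i) (basisVec j) : ℝ) : ℂ)
        else 0 := by
    intro i j
    by_cases hk : k = 0 ∧ s = 2
    · rw [if_pos hk, ConnectionData.curvW, MoyalData.single_apply, if_pos hk]
      exact LocalGeom.eval_curvForm i j p
    · rw [if_neg hk, ConnectionData.curvW, MoyalData.single_apply, if_neg hk]
      rfl
  rw [weylCurvature]
  by_cases hk : k = 0 ∧ s = 2
  · simp only [h2, if_pos hk]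
    rw [← bilinear_apply_eq_sum]
    congr 1
    have h3 := curvatureTensor_fr h hz (w 0) (w 1) p.1.2
    rw [chart_basePt] at h3
    refine congrArg (fun t : ℝ => (1 / 2 : ℝ) * t) ?_
    refine (congrArg (fun t => Ω (basePt h x₀ p) (frame h p p.1.2) t) h3).trans ?_
    exact (chartForm_apply Ω x₀ p.1.1 p.1.2 _).symm
  · simp only [h2, if_neg hk, mul_zero, sum_const_zero]

end Curvature

/-! ### Smoothness and vanishing of forms in charts -/

section SmoothForms
open scoped Topology
open MoyalData

variable {d : ℕ} {M : Type v} [TopologicalSpace M] [ChartedSpace (Euc d) M]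
  [IsManifold (𝓡 d) ∞ M] [T2Space M] {Ω : FormField d M} {cov : AffineConnection d M}
  {h : IsFedosovManifold Ω cov} {x₀ : M}

lemma Rep0.apply_co {b : M → WeylForm d 0} {F : (h.localGeom x₀).Weyl} (hF : Rep0 h x₀ b F) {z : M}
    (hz : z ∈ (chartAt (Euc d) x₀).source) (k s : ℕ) (y : Euc d) (w : Fin 0 → Euc d) :
    b z k s y w = Sm.zext (F.1 k s) (chartAt (Euc d) x₀ z, co x₀ z y) :=
  (congrArg (fun t => b z k s t w) (fr_co hz y).symm).trans (hF.apply hz k s _ w)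

lemma Rep1.apply_co {b : M → WeylForm d 1} {F : Fin d → (h.localGeom x₀).Weyl}
    (hF : Rep1 h x₀ b F) {z : M} (hz : z ∈ (chartAt (Euc d) x₀).source) (k s : ℕ) (y : Euc d)
    (w : Fin 1 → Euc d) : b z k s y w =
      ∑ j, ((co x₀ z (w 0) : Euc d) j : ℂ) *
        Sm.zext ((F j).1 k s) (chartAt (Euc d) x₀ z, co x₀ z y) := by
  have h1 := hF.apply hz k s (co x₀ z y) (co x₀ z (w 0))
  refine Eq.trans ?_ h1
  refine congrArg₂ (b z k s) (fr_co hz y).symm (funext fun t => ?_)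
  rw [Subsingleton.elim t 0]
  exact (fr_co hz _).symm

lemma Rep2.apply_co {b : M → WeylForm d 2} {F : Fin d → Fin d → (h.localGeom x₀).Weyl}
    (hF : Rep2 h x₀ b F) {z : M} (hz : z ∈ (chartAt (Euc d) x₀).source) (k s : ℕ) (y : Euc d)
    (w : Fin 2 → Euc d) : b z k s y w =
      ∑ i, ∑ j, ((co x₀ z (w 0) : Euc d) i : ℂ) * ((co x₀ z (w 1) : Euc d) j : ℂ) *
        Sm.zext ((F i j).1 k s) (chartAt (Euc d) x₀ z, co x₀ z y) := by
  have h1 := hF (tubePt h hz (co x₀ z y)) k s (fun t => co x₀ z (w t))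
  simp only [← Sm.zext_coe, frame_apply] at h1
  rw [basePt_tubePt] at h1
  refine Eq.trans ?_ h1
  exact congrArg₂ (b z k s) (fr_co hz y).symm (funext fun t => (fr_co hz _).symm)

lemma smooth_component {l : ℕ} {b : M → WeylForm d l} {n : ℕ} {z : M} {k s : ℕ}
    (f : Euc d × (Fin n → Euc d) → ℂ) {η : ∀ z : M, TangentSpace (𝓡 d) z}
    {ζ : Fin l → ∀ z : M, TangentSpace (𝓡 d) z} {θ : Fin n → ∀ z : M, TangentSpace (𝓡 d) z}
    (hθ : ∀ t, IsSmoothVF (θ t))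
    (hf : ∀ q : Euc d × (Fin n → Euc d), q.1 ∈ (chartAt (Euc d) z).target → ContDiffAt ℝ ∞ f q)
    (hb : ∀ y ∈ (chartAt (Euc d) z).source, b y k s (η y) (fun j => ζ j y) =
      f (chartAt (Euc d) z y, fun t => co z y (θ t y))) :
    ContMDiffAt (𝓡 d) 𝓘(ℝ, ℂ) ∞ (fun x => b x k s (η x) (fun j => ζ j x)) z := by
  have hz := mem_chart_source (Euc d) z
  have hu := (chartAt (Euc d) z).map_source hz
  rw [contMDiffAt_chart_iff hz]
  have h1 : ContDiffAt ℝ ∞ (fun u t => hat z (θ t) u) (chartAt (Euc d) z z) :=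
    contDiffAt_pi.2 fun t => (smAt_iff_hat hz).1 (hθ t z)
  have h2 := ContDiffAt.comp (g := f) (f := fun u => (u, fun t => hat z (θ t) u))
    (chartAt (Euc d) z z) (hf _ hu) (contDiffAt_id.prodMk h1)
  refine h2.congr_of_eventuallyEq ?_
  filter_upwards [(chartAt (Euc d) z).open_target.mem_nhds hu] with u hu'
  rw [Function.comp_apply, hb _ ((chartAt (Euc d) z).map_target hu'),
    (chartAt (Euc d) z).right_inv hu']
  rfl

/-- A `0`-form with smooth local components is smooth. -/
lemma isSmoothWeylForm_of_rep0 {b : M → WeylForm d 0} (H : ∀ x₀, ∃ F, Rep0 h x₀ b F) :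
    IsSmoothWeylForm b where
  isWeylForm z := by
    obtain ⟨F, hF⟩ := H z
    have hz := mem_chart_source (Euc d) z
    refine ⟨fun k s w => ?_, fun k s y => ?_⟩
    · rw [← mem_homogPoly]
      have h1 : (fun y => b z k s y w) = fun y => Sm.zext (F.1 k s) (chartAt (Euc d) z z, co z z y) :=
        funext fun y => hF.apply_co hz k s y w
      rw [h1]
      exact comp_mem_homogPoly (LocalGeom.poly_of_isHomog (F.2 k s)
        ((chartAt (Euc d) z).map_source hz)) (co z z : Euc d →L[ℝ] Euc d).toLinearMap
    · refine ⟨AlternatingMap.constOfIsEmpty ℝ (Euc d) (Fin 0) (b z k s y Fin.elim0), fun w => ?_⟩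
      rw [Subsingleton.elim w Fin.elim0]
      rfl
  smooth k s η ζ hη hζ z := by
    obtain ⟨F, hF⟩ := H z
    exact smooth_component (localFun0 F k s) (θ := fun _ => η) (fun _ => hη)
      (fun q hq => contDiffAt_localFun0 F k s hq) fun y hy => hF.apply_co hy k s _ _

lemma sum_mul_mem_homogPoly {s : ℕ} (c : Fin d → ℂ) {g : Fin d → Euc d → ℂ}
    (hg : ∀ j, g j ∈ homogPoly d s) : (fun y => ∑ j, c j * g j y) ∈ homogPoly d s := by
  have h1 : (fun y => ∑ j, c j * g j y) = ∑ j, c j • g j := by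
    ext1 y
    rw [Finset.sum_apply]
    rfl
  rw [h1]
  exact Submodule.sum_mem _ fun j _ => Submodule.smul_mem _ _ (hg j)

lemma exists_linear_coord (c : Fin d → ℂ) :
    ∃ L : Euc d →ₗ[ℝ] ℂ, ∀ v : Euc d, L v = ∑ j, (v j : ℂ) * c j := by
  refine ⟨{ toFun := fun v => ∑ j, (v j : ℂ) * c j, map_add' := fun v w => ?_,
            map_smul' := fun t v => ?_ }, fun v => rfl⟩
  · simp [add_mul, sum_add_distrib]
  · simp [mul_assoc, mul_sum]

/-- A `1`-form with smooth local components is smooth. -/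
lemma isSmoothWeylForm_of_rep1 {b : M → WeylForm d 1} (H : ∀ x₀, ∃ F, Rep1 h x₀ b F) :
    IsSmoothWeylForm b where
  isWeylForm z := by
    obtain ⟨F, hF⟩ := H z
    have hz := mem_chart_source (Euc d) z
    refine ⟨fun k s w => ?_, fun k s y => ?_⟩
    · rw [← mem_homogPoly]
      rw [funext fun y => hF.apply_co hz k s y w]
      exact sum_mul_mem_homogPoly (fun j => ((co z z (w 0) : Euc d) j : ℂ)) fun j =>
        comp_mem_homogPoly (LocalGeom.poly_of_isHomog ((F j).2 k s)
          ((chartAt (Euc d) z).map_source hz)) (co z z : Euc d →L[ℝ] Euc d).toLinearMap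
    · obtain ⟨L, hL⟩ := exists_linear_coord
        fun j => Sm.zext ((F j).1 k s) (chartAt (Euc d) z z, co z z y)
      exact ⟨AlternatingMap.ofSubsingleton ℝ (Euc d) ℂ 0
        (L.comp (co z z : Euc d →L[ℝ] Euc d).toLinearMap), fun w =>
        (hF.apply_co hz k s y w).trans (hL _).symm⟩
  smooth k s η ζ hη hζ z := by
    obtain ⟨F, hF⟩ := H z
    refine smooth_component (localFun1 F k s) (θ := ![η, ζ 0]) (fun t => ?_)
      (fun q hq => contDiffAt_localFun1 F k s hq) fun y hy => hF.apply_co hy k s _ _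
    fin_cases t
    · exact hη
    · exact hζ 0

lemma Rep0.degGE {b : M → WeylForm d 0} {F : (h.localGeom x₀).Weyl} (hF : Rep0 h x₀ b F) {n : ℕ}
    (hb : ∀ z k s y w, s + 2 * k < n → b z k s y w = 0) : DegGE n F := by
  intro k s hks
  ext p
  rw [← hF p k s Fin.elim0, hb _ _ _ _ _ hks]
  rfl

lemma Rep1.degGE {b : M → WeylForm d 1} {F : Fin d → (h.localGeom x₀).Weyl} (hF : Rep1 h x₀ b F)
    {n : ℕ} (hb : ∀ z k s y w, s + 2 * k < n → b z k s y w = 0) (i : Fin d) : DegGE n (F i) := by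
  intro k s hks
  ext p
  have h1 := hF p k s (fun _ => basisVec i)
  rw [hb _ _ _ _ _ hks] at h1
  simpa [basisVec_apply, apply_ite (Complex.ofReal)] using h1.symm

lemma zext_zero {O : TopologicalSpace.Opens (Euc d × Euc d)} (p : Euc d × Euc d) :
    Sm.zext (0 : Sm O) p = 0 := by
  by_cases hp : p ∈ O
  · exact Sm.zext_coe (0 : Sm O) ⟨p, hp⟩
  · refine Function.extend_apply' _ _ _ ?_
    rintro ⟨a, rfl⟩
    exact hp a.2

lemma eq_zero_of_rep0 {b : M → WeylForm d 0} {n : ℕ}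
    (H : ∀ x₀, ∃ F, Rep0 h x₀ b F ∧ DegGE n F) (z : M) (k s : ℕ) (y : Euc d) (w : Fin 0 → Euc d)
    (hks : s + 2 * k < n) : b z k s y w = 0 := by
  obtain ⟨F, hF, h0⟩ := H z
  rw [hF.apply_co (mem_chart_source _ z), h0 k s hks, zext_zero]

lemma eq_zero_of_rep1 {b : M → WeylForm d 1} {n : ℕ}
    (H : ∀ x₀, ∃ F, Rep1 h x₀ b F ∧ ∀ i, DegGE n (F i)) (z : M) (k s : ℕ) (y : Euc d)
    (w : Fin 1 → Euc d) (hks : s + 2 * k < n) : b z k s y w = 0 := by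
  obtain ⟨F, hF, h0⟩ := H z
  rw [hF.apply_co (mem_chart_source _ z)]
  exact sum_eq_zero fun j _ => by rw [h0 j k s hks, zext_zero, mul_zero]

lemma eq_zero_of_rep2 {b : M → WeylForm d 2} (H : ∀ x₀, Rep2 h x₀ b (fun _ _ => 0)) : b = 0 := by
  ext z k s y w
  rw [(H z).apply_co (mem_chart_source _ z)]
  refine sum_eq_zero fun i _ => sum_eq_zero fun j _ => ?_
  refine (congrArg _ ?_).trans (mul_zero _)
  exact zext_zero (O := ((h.localGeom z).tube)) _

/-- The covariant derivative of a smooth function of tangent vectors depends only on the values of the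
vector fields at the point. -/
lemma covD_congr {n : ℕ} {β : M → (Fin n → Euc d) → ℂ} {z : M}
    {η ζ : Fin n → ∀ z : M, TangentSpace (𝓡 d) z} (hη : ∀ t, SmAt (η t) z)
    (hζ : ∀ t, SmAt (ζ t) z) (he : ∀ t, η t z = ζ t z) {f : Euc d × (Fin n → Euc d) → ℂ}
    (hf : ∀ q : Euc d × (Fin n → Euc d), q.1 ∈ (chartAt (Euc d) z).target → ContDiffAt ℝ ∞ f q)
    (hβ : ∀ y ∈ (chartAt (Euc d) z).source, ∀ Y,
      β y (fun t => fr z y (Y t)) = f (chartAt (Euc d) z y, Y)) (v : TangentSpace (𝓡 d) z) :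
    covD cov β η z v = covD cov β ζ z v := by
  have hz := mem_chart_source (Euc d) z
  have hu := (chartAt (Euc d) z).map_source hz
  have h1 := covD_fr cov hz hη (hf _ hu) hβ (co z z v)
  have h2 := covD_fr cov hz hζ (hf _ hu) hβ (co z z v)
  rw [fr_co hz] at h1 h2
  rw [h1, h2]
  simp only [he]

/-- The covariant derivative of a smooth `0`-form depends only on the values of the vector field. -/
lemma covD_fiberFun0_congr (h : IsFedosovManifold Ω cov) {b : M → WeylForm d 0}
    (hb : IsSmoothWeylForm b) {z : M} {η ζ : Fin 1 → ∀ z : M, TangentSpace (𝓡 d) z}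
    (hη : ∀ t, SmAt (η t) z) (hζ : ∀ t, SmAt (ζ t) z) (he : ∀ t, η t z = ζ t z) (k s : ℕ)
    (v : TangentSpace (𝓡 d) z) :
    covD cov (fiberFun0 b k s) η z v = covD cov (fiberFun0 b k s) ζ z v :=
  have hF := rep0_local (h := h) (x₀ := z) hb Fin.elim0
  covD_congr hη hζ he (f := localFun0 (localComp h hb Fin.elim0) k s)
    (fun _ hq => contDiffAt_localFun0 _ k s hq) (fun _ hy Y => hF.apply hy k s (Y 0) _) v

/-- The covariant derivative of a smooth `1`-form depends only on the values of the vector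
fields. -/
lemma covD_fiberFun1_congr (h : IsFedosovManifold Ω cov) {b : M → WeylForm d 1}
    (hb : IsSmoothWeylForm b) {z : M} {η ζ : Fin 2 → ∀ z : M, TangentSpace (𝓡 d) z}
    (hη : ∀ t, SmAt (η t) z) (hζ : ∀ t, SmAt (ζ t) z) (he : ∀ t, η t z = ζ t z) (k s : ℕ)
    (v : TangentSpace (𝓡 d) z) :
    covD cov (fiberFun1 b k s) η z v = covD cov (fiberFun1 b k s) ζ z v :=
  have hF := rep1_local (h := h) (x₀ := z) hb
  covD_congr hη hζ he (f := localFun1 (fun i => localComp h hb fun _ => basisVec i) k s)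
    (fun _ hq => contDiffAt_localFun1 _ k s hq) (fun _ hy Y => hF.apply hy k s (Y 0) (Y 1)) v

end SmoothForms

/-! ### Naturality under structure preserving local diffeomorphisms -/

section Naturality
open scoped Topology

variable {d' : ℕ} {N : Type v} [TopologicalSpace N] [ChartedSpace (Euc d') N]
  [IsManifold (𝓡 d') ∞ N]
  {d : ℕ} {M : Type v} [TopologicalSpace M] [ChartedSpace (Euc d) M]
  [IsManifold (𝓡 d) ∞ M]

/-- A local diffeomorphism that preserves given forms and connections. -/
structure IsFedosovMap (φ : N → M) (Ω' : FormField d' N) (cov' : AffineConnection d' N)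
    (Ω : FormField d M) (cov : AffineConnection d M) : Prop where
  localDiffeo : IsLocalDiffeomorph (𝓡 d') (𝓡 d) ∞ φ
  form : PreservesForm φ Ω' Ω
  conn : PreservesConnection φ cov' cov

namespace IsFedosovMap

variable {φ : N → M} {Ω' : FormField d' N} {cov' : AffineConnection d' N}
    {Ω : FormField d M} {cov : AffineConnection d M} (hφ : IsFedosovMap φ Ω' cov' Ω cov)

/-- The differential of `φ` at `x`. -/
def diff (x : N) : Euc d' ≃L[ℝ] Euc d :=
  hφ.localDiffeo.mfderivToContinuousLinearEquiv (by simp) x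

lemma preserves_iff {l : ℕ} {a' : N → WeylForm d' l} {a : M → WeylForm d l} :
    PreservesWeylForm φ a' a ↔ ∀ x k s (y : Euc d') (w : Fin l → Euc d'),
      a (φ x) k s (hφ.diff x y) (fun j => hφ.diff x (w j)) = a' x k s y w := Iff.rfl

/-- The pullback of a vector field. -/
def pull (_ : IsFedosovMap φ Ω' cov' Ω cov) (ξ : ∀ z : M, TangentSpace (𝓡 d) z) :
    ∀ x : N, TangentSpace (𝓡 d') x := VectorField.mpullback (𝓡 d') (𝓡 d) φ ξ

include hφ in
lemma isInvertible (x : N) : (mfderiv (𝓡 d') (𝓡 d) φ x).IsInvertible :=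
  ⟨hφ.localDiffeo.mfderivToContinuousLinearEquiv (by simp) x, rfl⟩

lemma isSmoothVF_pull {ξ : ∀ z : M, TangentSpace (𝓡 d) z} (hξ : IsSmoothVF ξ) :
    IsSmoothVF (hφ.pull ξ) :=
  ContMDiff.mpullback_vectorField (n := ∞) hξ hφ.localDiffeo.contMDiff hφ.isInvertible (by simp)

lemma diff_pull (ξ : ∀ z : M, TangentSpace (𝓡 d) z) (x : N) :
    mfderiv (𝓡 d') (𝓡 d) φ x (hφ.pull ξ x) = ξ (φ x) := by
  rw [pull, VectorField.mpullback_apply]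
  exact (hφ.isInvertible x).self_apply_inverse _

lemma pull_apply_of_eq {ξ : ∀ z : M, TangentSpace (𝓡 d) z} {x : N} {v : Euc d'}
    (h : ξ (φ x) = hφ.diff x v) : hφ.pull ξ x = v := by
  apply (hφ.diff x).injective
  rw [← h]
  exact hφ.diff_pull ξ x

lemma diff_cov_pull {ξ : ∀ z : M, TangentSpace (𝓡 d) z} (hξ : IsSmoothVF ξ) (x : N)
    (v : TangentSpace (𝓡 d') x) : mfderiv (𝓡 d') (𝓡 d) φ x (cov' (hφ.pull ξ) x v) =
      cov ξ (φ x) (mfderiv (𝓡 d') (𝓡 d) φ x v) :=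
  hφ.conn _ ξ (hφ.isSmoothVF_pull hξ) hξ (hφ.diff_pull ξ) x v

/-- Naturality of the covariant derivative of a function of tangent vectors, along vector fields related
by `φ`. The fields `extVec` of the two charts are not related by `φ`; below, they are replaced by
related global fields with the same values at the point, on which the covariant derivative alone
depends. -/
lemma covD_comp {n : ℕ} {β : M → (Fin n → Euc d) → ℂ} {β' : N → (Fin n → Euc d') → ℂ}
    (hβ : ∀ x (Y : Fin n → Euc d'), β (φ x) (fun t => hφ.diff x (Y t)) = β' x Y)
    {η : Fin n → ∀ z : M, TangentSpace (𝓡 d) z} (hη : ∀ t, IsSmoothVF (η t)) (x : N)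
    (h1 : MDifferentiableAt (𝓡 d) 𝓘(ℝ, ℂ) (fun z => β z (fun t => η t z)) (φ x))
    (h2 : Differentiable ℝ (β (φ x))) (v : TangentSpace (𝓡 d') x) :
    covD cov' β' (fun t => hφ.pull (η t)) x v =
      covD cov β η (φ x) (mfderiv (𝓡 d') (𝓡 d) φ x v) := by
  have e1 : (fun z' => β' z' (fun t => hφ.pull (η t) z')) =
      (fun z => β z (fun t => η t z)) ∘ φ := by
    ext1 z'
    refine (hβ z' (fun t => hφ.pull (η t) z')).symm.trans ?_
    exact congrArg (β (φ z')) (funext fun t => hφ.diff_pull (η t) z')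
  have e2 : mvfderiv (𝓡 d') (fun z' => β' z' (fun t => hφ.pull (η t) z')) x v =
      mvfderiv (𝓡 d) (fun z => β z (fun t => η t z)) (φ x) (mfderiv (𝓡 d') (𝓡 d) φ x v) := by
    rw [e1]
    exact congrArg (fun L : TangentSpace (𝓡 d') x →L[ℝ] ℂ => L v)
      (mfderiv_comp x h1 ((hφ.localDiffeo.contMDiff x).mdifferentiableAt (by simp)))
  have e3 : HasFDerivAt (β' x) ((fderiv ℝ (β (φ x)) (fun t => η t (φ x))).comp
      (ContinuousLinearMap.pi fun t => (hφ.diff x : Euc d' →L[ℝ] Euc d).comp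
        (ContinuousLinearMap.proj t : (Fin n → Euc d') →L[ℝ] Euc d')))
      (fun t => hφ.pull (η t) x) := by
    have e4 : β' x = β (φ x) ∘ fun Y t => hφ.diff x (Y t) := funext fun Y => (hβ x Y).symm
    rw [e4]
    refine HasFDerivAt.comp (E := Fin n → Euc d') _ (g := β (φ x)) ?_ ?_
    · have e5 : (fun t => hφ.diff x (hφ.pull (η t) x)) = fun t => η t (φ x) :=
        funext fun t => hφ.diff_pull (η t) x
      rw [e5]
      exact (h2 _).hasFDerivAt
    · exact hasFDerivAt_pi.2 fun t => ContinuousLinearMap.hasFDerivAt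
        ((hφ.diff x : Euc d' →L[ℝ] Euc d).comp
          (ContinuousLinearMap.proj t : (Fin n → Euc d') →L[ℝ] Euc d'))
  have e6 := congrArg (fun L : (Fin n → Euc d') →L[ℝ] ℂ => L fun t => cov' (hφ.pull (η t)) x v)
    e3.fderiv
  refine congrArg₂ (fun p q : ℂ => p - q) e2 (e6.trans ?_)
  exact congrArg (fderiv ℝ (β (φ x)) fun t => η t (φ x))
    (funext fun t => hφ.diff_cov_pull (hη t) x v)

include hφ in
lemma weylDeltaInv {l : ℕ} {b' : N → WeylForm d' (l + 1)} {b : M → WeylForm d (l + 1)}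
    (hbb : PreservesWeylForm φ b' b) :
    PreservesWeylForm φ (weylDeltaInv b') (weylDeltaInv b) := by
  rw [hφ.preserves_iff] at hbb ⊢
  intro x k s y w
  cases s with
  | zero => rfl
  | succ q =>
    have h1 : (Fin.cons (hφ.diff x y) (fun j => hφ.diff x (w j)) : Fin (l + 1) → Euc d) =
        fun j => hφ.diff x ((Fin.cons y w : Fin (l + 1) → Euc d') j) := by
      ext1 j
      refine Fin.cases ?_ (fun i => ?_) j <;> simp
    refine congrArg (fun t => ((q + (l + 1) : ℕ) : ℂ)⁻¹ * t) ?_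
    rw [h1]
    exact hbb x k q y _

section Operators

variable [T2Space N] [T2Space M] (h' : IsFedosovManifold Ω' cov') (h : IsFedosovManifold Ω cov)

include hφ h' h in
lemma weylNabla_zero {b' : N → WeylForm d' 0} {b : M → WeylForm d 0} (hb' : IsSmoothWeylForm b')
    (hb : IsSmoothWeylForm b) (hbb : PreservesWeylForm φ b' b) :
    PreservesWeylForm φ (weylNabla cov' b') (weylNabla cov b) := by
  rw [hφ.preserves_iff] at hbb ⊢
  intro x k s y w
  obtain ⟨ξ, hξ, hξ'⟩ := (smNear_extVec (φ x) (hφ.diff x y)).exists_global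
  have e1 : ξ (φ x) = hφ.diff x y := hξ'.self_of_nhds.trans (extVec_self _ _)
  rw [Fedosov.weylNabla_zero cov b _ k s (Rep0.differentiable hb.isWeylForm _ k s _),
    Fedosov.weylNabla_zero cov' b' _ k s (Rep0.differentiable hb'.isWeylForm _ k s _)]
  refine (covD_fiberFun0_congr h hb (ζ := fun _ => ξ) (fun _ => (smNear_extVec _ _).smAt)
    (fun _ => hξ _) (fun _ => (extVec_self _ _).trans e1.symm) k s _).trans (Eq.trans ?_
    (covD_fiberFun0_congr h' hb' (ζ := fun _ => hφ.pull ξ) (fun _ => (smNear_extVec _ _).smAt)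
    (fun _ => hφ.isSmoothVF_pull hξ _)
    (fun _ => (extVec_self _ _).trans (hφ.pull_apply_of_eq e1).symm) k s (w 0)).symm)
  refine (hφ.covD_comp (β := fiberFun0 b k s) (β' := fiberFun0 b' k s) (η := fun _ => ξ) ?_
    (fun _ => hξ) x ?_ ?_ (w 0)).symm
  · intro x Y
    rw [fiberFun0, fiberFun0, ← hbb]
    exact congrArg (b (φ x) k s _) (Subsingleton.elim _ _)
  · exact (hb.smooth k s ξ Fin.elim0 hξ (fun j => j.elim0) _ |>.congr_of_eventuallyEq
      (Filter.Eventually.of_forall fun z => congrArg (b z k s _)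
        (Subsingleton.elim _ _))).mdifferentiableAt (by simp)
  · exact fun Y => DifferentiableAt.comp (g := fun t => b (φ x) k s t Fin.elim0)
      (f := fun Y : Fin 1 → Euc d => Y 0) Y
      (Rep0.differentiable hb.isWeylForm (φ x) k s Fin.elim0 (Y 0))
      (ContinuousLinearMap.proj 0 : (Fin 1 → Euc d) →L[ℝ] Euc d).differentiableAt

include hφ h' h in
lemma covD_fiberFun1 {b' : N → WeylForm d' 1} {b : M → WeylForm d 1} (hb' : IsSmoothWeylForm b')
    (hb : IsSmoothWeylForm b) (hbb : PreservesWeylForm φ b' b) (x : N) (k s : ℕ)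
    (y v w : Euc d') :
    covD cov (fiberFun1 b k s) ![extVec (φ x) (hφ.diff x y), extVec (φ x) (hφ.diff x v)] (φ x)
      (hφ.diff x w) = covD cov' (fiberFun1 b' k s) ![extVec x y, extVec x v] x w := by
  rw [hφ.preserves_iff] at hbb
  obtain ⟨ξ, hξ, hξ'⟩ := (smNear_extVec (φ x) (hφ.diff x y)).exists_global
  have e1 : ξ (φ x) = hφ.diff x y := hξ'.self_of_nhds.trans (extVec_self _ _)
  obtain ⟨ζ, hζ, hζ'⟩ := (smNear_extVec (φ x) (hφ.diff x v)).exists_global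
  have e2 : ζ (φ x) = hφ.diff x v := hζ'.self_of_nhds.trans (extVec_self _ _)
  have hs : ∀ t, IsSmoothVF ((![ξ, ζ] : Fin 2 → ∀ z : M, TangentSpace (𝓡 d) z) t) := by
    intro t
    fin_cases t
    · exact hξ
    · exact hζ
  refine (covD_fiberFun1_congr h hb (ζ := ![ξ, ζ]) (fun t => by
      fin_cases t <;> exact (smNear_extVec _ _).smAt) (fun t => hs t _) (fun t => by
      fin_cases t
      · exact (extVec_self _ _).trans e1.symm
      · exact (extVec_self _ _).trans e2.symm) k s _).trans (Eq.trans ?_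
    (covD_fiberFun1_congr h' hb'
      (ζ := fun t => hφ.pull ((![ξ, ζ] : Fin 2 → ∀ z : M, TangentSpace (𝓡 d) z) t)) (fun t => by
      fin_cases t <;> exact (smNear_extVec _ _).smAt)
      (fun t => hφ.isSmoothVF_pull (hs t) _) (fun t => by
      fin_cases t
      · exact (extVec_self _ _).trans (hφ.pull_apply_of_eq e1).symm
      · exact (extVec_self _ _).trans (hφ.pull_apply_of_eq e2).symm) k s w).symm)
  refine (hφ.covD_comp (β := fiberFun1 b k s) (β' := fiberFun1 b' k s) (η := ![ξ, ζ]) ?_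
    hs x ?_ ?_ w).symm
  · intro x Y
    rw [fiberFun1, fiberFun1, ← hbb]
  · exact (hb.smooth k s ξ (fun _ => ζ) hξ (fun _ => hζ) _).mdifferentiableAt (by simp)
  · exact (rep1_local (h := h) (x₀ := φ x) hb).differentiable (mem_chart_source _ _) k s

include hφ h' h in
lemma weylNabla_one {b' : N → WeylForm d' 1} {b : M → WeylForm d 1} (hb' : IsSmoothWeylForm b')
    (hb : IsSmoothWeylForm b) (hbb : PreservesWeylForm φ b' b) :
    PreservesWeylForm φ (weylNabla cov' b') (weylNabla cov b) := by
  have hbb' := hbb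
  rw [hφ.preserves_iff] at hbb ⊢
  intro x k s y w
  rw [Fedosov.weylNabla_one h.torsionFree b _ k s (hb.isWeylForm _)
      ((rep1_local (h := h) (x₀ := φ x) hb).differentiable (mem_chart_source _ _) k s),
    Fedosov.weylNabla_one h'.torsionFree b' _ k s (hb'.isWeylForm _)
      ((rep1_local (h := h') (x₀ := x) hb').differentiable (mem_chart_source _ _) k s)]
  exact congrArg₂ (fun p q : ℂ => p - q)
    (hφ.covD_fiberFun1 h' h hb' hb hbb' x k s y (w 1) (w 0))
    (hφ.covD_fiberFun1 h' h hb' hb hbb' x k s y (w 0) (w 1))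

include hφ h' h in
lemma curvatureTensor_map (x : N) (a b c : Euc d') :
    curvatureTensor cov (φ x) (hφ.diff x a) (hφ.diff x b) (hφ.diff x c) =
      hφ.diff x (curvatureTensor cov' x a b c) := by
  have hext : ∀ v : Euc d', ∃ ξ, IsSmoothVF ξ ∧ ξ (φ x) = hφ.diff x v ∧ hφ.pull ξ x = v := by
    intro v
    obtain ⟨ξ, hξ, hξ'⟩ := (smNear_extVec (φ x) (hφ.diff x v)).exists_global
    have e1 : ξ (φ x) = hφ.diff x v := hξ'.self_of_nhds.trans (extVec_self _ _)
    exact ⟨ξ, hξ, e1, hφ.pull_apply_of_eq e1⟩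
  obtain ⟨U, hU, hU1, hU2⟩ := hext a
  obtain ⟨V, hV, hV1, hV2⟩ := hext b
  obtain ⟨T, hT, hT1, hT2⟩ := hext c
  have k1 := curvatureTensor_eq h (IsSmoothVF.smNear hT (φ x)) (IsSmoothVF.smNear hU (φ x))
    (IsSmoothVF.smNear hV (φ x))
  have k2 := curvatureTensor_eq h' (IsSmoothVF.smNear (hφ.isSmoothVF_pull hT) x)
    (IsSmoothVF.smNear (hφ.isSmoothVF_pull hU) x) (IsSmoothVF.smNear (hφ.isSmoothVF_pull hV) x)
  have k3 : ∀ {A B C : ∀ z : M, TangentSpace (𝓡 d) z}, IsSmoothVF A → IsSmoothVF B →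
      cov (fun y => cov A y (B y)) (φ x) (C (φ x)) =
        hφ.diff x (cov' (fun y => cov' (hφ.pull A) y (hφ.pull B y)) x (hφ.pull C x)) := by
    intro A B C hA hB
    refine Eq.symm ((hφ.conn _ (fun y => cov A y (B y))
      (IsSmoothVF.cov h'.smooth (hφ.isSmoothVF_pull hA) (hφ.isSmoothVF_pull hB))
      (IsSmoothVF.cov h.smooth hA hB) (fun y => ?_) x _).trans ?_)
    · rw [hφ.diff_cov_pull hA, hφ.diff_pull]
    · rw [hφ.diff_pull]
  have k4 : ∀ {A B : ∀ z : M, TangentSpace (𝓡 d) z}, IsSmoothVF A →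
      cov A (φ x) (B (φ x)) = hφ.diff x (cov' (hφ.pull A) x (hφ.pull B x)) := by
    intro A B hA
    refine Eq.symm ((hφ.diff_cov_pull hA x _).trans ?_)
    rw [hφ.diff_pull]
  have hsub : ∀ {p q : Euc d} {p' q' : Euc d'}, p = hφ.diff x p' → q = hφ.diff x q' →
      p - q = hφ.diff x (p' - q') := by
    rintro _ _ p' q' rfl rfl
    exact (map_sub (hφ.diff x) p' q').symm
  have k5 : cov T (φ x) (cov V (φ x) (U (φ x)) - cov U (φ x) (V (φ x))) =
      hφ.diff x (cov' (hφ.pull T) x (cov' (hφ.pull V) x (hφ.pull U x) -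
        cov' (hφ.pull U) x (hφ.pull V x))) := by
    refine Eq.symm ((hφ.diff_cov_pull hT x _).trans ?_)
    exact congrArg (cov T (φ x)) (hsub (k4 hV) (k4 hU)).symm
  have k6 := k1.trans ((hsub (hsub (k3 hT hV) (k3 hT hU)) k5).trans
    (congrArg (hφ.diff x) k2.symm))
  rw [hU1, hV1, hT1, hU2, hV2, hT2] at k6
  exact k6

include hφ h' h in
lemma weylCurvature : PreservesWeylForm φ (weylCurvature Ω' cov') (weylCurvature Ω cov) := by
  rw [hφ.preserves_iff]
  intro x k s y w
  have h1 : Ω (φ x) (hφ.diff x y)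
      (curvatureTensor cov (φ x) (hφ.diff x (w 0)) (hφ.diff x (w 1)) (hφ.diff x y)) =
      Ω' x y (curvatureTensor cov' x (w 0) (w 1) y) :=
    (congrArg (Ω (φ x) (hφ.diff x y)) (hφ.curvatureTensor_map h' h x _ _ _)).trans
      (hφ.form x y _)
  exact congrArg (fun t : ℝ => if k = 0 ∧ s = 2 then (((1 / 2 : ℝ) * t : ℝ) : ℂ) else 0) h1

include h' in
lemma inverseForm_map (x : N) (i j : Fin d) : inverseForm Ω (φ x) i j =
    ∑ i', ∑ j', hφ.diff x (basisVec i') i * hφ.diff x (basisVec j') j * inverseForm Ω' x i' j' :=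
  formMatrix_inv_of_comp (B := Ω (φ x)) (B' := Ω' x) (hφ.diff x) (hφ.form x)
    (h'.symplectic.nondegenerate x) i j

include h' in
lemma scaledComm_map {x : N} {α β : WeylElt d} {α' β' : WeylElt d'}
    (ha : ∀ k s, ContDiff ℝ ∞ (α k s)) (hb : ∀ k s, ContDiff ℝ ∞ (β k s))
    (hα : ∀ k s y, α k s (hφ.diff x y) = α' k s y) (hβ : ∀ k s y, β k s (hφ.diff x y) = β' k s y)
    (K S : ℕ) (y : Euc d') :
    scaledComm (inverseForm Ω (φ x)) α β K S (hφ.diff x y) =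
      scaledComm (inverseForm Ω' x) α' β' K S y := by
  have h1 := scaledComm_comp (hφ.diff x : Euc d' →L[ℝ] Euc d) (hφ.inverseForm_map h' x) ha hb K S y
  have e1 : (fun k s y => α k s (hφ.diff x y)) = α' := by
    ext k s y
    exact hα k s y
  have e2 : (fun k s y => β k s (hφ.diff x y)) = β' := by
    ext k s y
    exact hβ k s y
  rw [← e1, ← e2]
  exact h1.symm

include hφ h' in
lemma weylMul {a' b' : N → WeylForm d' 0} {a b : M → WeylForm d 0} (ha : ∀ z, IsWeylForm (a z))
    (hb : ∀ z, IsWeylForm (b z)) (haa : PreservesWeylForm φ a' a) (hbb : PreservesWeylForm φ b' b) :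
    PreservesWeylForm φ (weylMul Ω' a' b') (weylMul Ω a b) := by
  rw [hφ.preserves_iff] at haa hbb ⊢
  intro x k s y w
  have h1 := moyal_comp (hφ.diff x : Euc d' →L[ℝ] Euc d) (hφ.inverseForm_map h' x)
    (contDiff_eval (ha (φ x)) fun j => hφ.diff x (w j))
    (contDiff_eval (hb (φ x)) fun j => hφ.diff x (w j)) k s y
  refine h1.symm.trans ?_
  have e1 : (fun k s y => (a (φ x)).eval (fun j => hφ.diff x (w j)) k s (hφ.diff x y)) =
      (a' x).eval w := by
    ext k s y
    exact haa x k s y w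
  have e2 : (fun k s y => (b (φ x)).eval (fun j => hφ.diff x (w j)) k s (hφ.diff x y)) =
      (b' x).eval w := by
    ext k s y
    exact hbb x k s y w
  exact congrArg₂ (fun α β => moyal (inverseForm Ω' x) α β k s y) e1 e2

include hφ h' in
lemma weylBracket_zero {r' : N → WeylForm d' 1} {r : M → WeylForm d 1} {b' : N → WeylForm d' 0}
    {b : M → WeylForm d 0} (hr : ∀ z, IsWeylForm (r z)) (hb : ∀ z, IsWeylForm (b z))
    (hrr : PreservesWeylForm φ r' r) (hbb : PreservesWeylForm φ b' b) :
    PreservesWeylForm φ (weylBracket Ω' r' b') (weylBracket Ω r b) := by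
  rw [hφ.preserves_iff] at hrr hbb ⊢
  intro x k s y w
  exact (Fedosov.weylBracket_zero Ω r _ k s _ b _).trans ((hφ.scaledComm_map h'
    (contDiff_eval (hr _) _) (contDiff_eval (hb _) _) (fun k s y => hrr x k s y fun _ => w 0)
    (fun k s y => hbb x k s y fun j => w (Fin.succAbove 0 j)) k s y).trans
    (Fedosov.weylBracket_zero Ω' r' _ k s _ b' _).symm)

include hφ h' in
lemma weylSquare {r' : N → WeylForm d' 1} {r : M → WeylForm d 1}
    (hr : ∀ z, IsWeylForm (r z)) (hrr : PreservesWeylForm φ r' r) :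
    PreservesWeylForm φ (weylSquare Ω' r') (weylSquare Ω r) := by
  rw [hφ.preserves_iff] at hrr ⊢
  intro x k s y w
  exact hφ.scaledComm_map h' (contDiff_eval (hr _) _) (contDiff_eval (hr _) _)
    (fun k s y => hrr x k s y fun _ => w 0) (fun k s y => hrr x k s y fun _ => w 1) k s y

end Operators

end IsFedosovMap

lemma preservesWeylForm_add {φ : N → M} {l : ℕ} {a' b' : N → WeylForm d' l}
    {a b : M → WeylForm d l} (ha : PreservesWeylForm φ a' a) (hb : PreservesWeylForm φ b' b) :
    PreservesWeylForm φ (a' + b') (a + b) := fun x k s y w =>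
  congrArg₂ (fun p q : ℂ => p + q) (ha x k s y w) (hb x k s y w)

end Naturality

/-! ### Fedosov's connection on a symplectic manifold -/

namespace MoyalData

variable {ι A : Type*} [Fintype ι] [DecidableEq ι] [CommRing A] [Algebra ℂ A] {𝔐 : MoyalData ι A}

lemma DegGE.add {n : ℕ} {a b : 𝔐.weyl} (ha : DegGE n a) (hb : DegGE n b) : DegGE n (a + b) := by
  intro k s hs
  change a.1 k s + b.1 k s = 0
  rw [ha k s hs, hb k s hs, add_zero]

lemma DegGE.neg {n : ℕ} {a : 𝔐.weyl} (ha : DegGE n a) : DegGE n (-a) := by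
  intro k s hs
  change - a.1 k s = 0
  rw [ha k s hs, neg_zero]

lemma DegGE.sub {n : ℕ} {a b : 𝔐.weyl} (ha : DegGE n a) (hb : DegGE n b) : DegGE n (a - b) := by
  rw [sub_eq_add_neg]
  exact ha.add hb.neg

lemma DegGE.mono {m n : ℕ} (hmn : m ≤ n) {a : 𝔐.weyl} (ha : DegGE n a) : DegGE m a :=
  fun k s hs => ha k s (by omega)

lemma DegGE.radial {n : ℕ} (m : ℕ) {F : ι → 𝔐.weyl} (hF : ∀ l, DegGE n (F l)) :
    DegGE (n + 1) (radial m F) := by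
  rintro k (_ | q) hs
  · rfl
  · rw [radial_succ, sum_eq_zero fun l _ => by rw [hF l k q (by omega), mul_zero], smul_zero]

lemma radial_sub (m : ℕ) (F G : ι → 𝔐.weyl) :
    radial m F - radial m G = radial m (fun l => F l - G l) := by
  ext k s
  cases s with
  | zero => exact sub_zero _
  | succ q =>
    change (radial m F).1 k (q + 1) - (radial m G).1 k (q + 1) = _
    rw [radial_succ, radial_succ, radial_succ, ← smul_sub, ← sum_sub_distrib]
    exact congrArg _ (sum_congr rfl fun l _ => (mul_sub _ _ _).symm)

lemma radial_add (m : ℕ) (F G : ι → 𝔐.weyl) :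
    radial m F + radial m G = radial m (fun l => F l + G l) := by
  ext k s
  cases s with
  | zero => exact add_zero _
  | succ q =>
    change (radial m F).1 k (q + 1) + (radial m G).1 k (q + 1) = _
    rw [radial_succ, radial_succ, radial_succ, ← smul_add, ← sum_add_distrib]
    exact congrArg _ (sum_congr rfl fun l _ => (mul_add _ _ _).symm)

lemma natCast_smul_radial (m : ℕ) (hm : m ≠ 0) (F : ι → 𝔐.weyl) (k q : ℕ) :
    ((q + m : ℕ) : ℂ) • (radial m F).1 k (q + 1) = ∑ l, 𝔐.y l * (F l).1 k q := by
  rw [radial_succ, smul_inv_smul₀]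
  exact_mod_cast (by omega : q + m ≠ 0)

lemma br_sub_br_degGE {n : ℕ} {a a' b b' : 𝔐.weyl} (ha : DegGE 3 a) (hb' : DegGE 3 b')
    (h1 : DegGE n (a - a')) (h2 : DegGE n (b - b')) : DegGE n (br a b - br a' b') := by
  have h3 : br a b - br a' b' = br a (b - b') - br b' (a - a') := by
    rw [map_sub, map_sub, br_skew b' a, br_skew b' a']
    abel
  rw [h3]
  exact ((ha.br h2).sub (hb'.br h1)).mono (Nat.le_succ n)

end MoyalData

namespace ConnectionData
open MoyalData

variable {ι A : Type*} [Fintype ι] [DecidableEq ι] [CommRing A] [Algebra ℂ A]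
  {𝔉 : ConnectionData ι A}

lemma degGE_nablaW {n : ℕ} {a : 𝔉.weyl} (ha : MoyalData.DegGE n a) (i : ι) :
    MoyalData.DegGE n (𝔉.nablaW i a) := by
  intro k s hs
  rw [nablaW_apply, ha k s hs, map_zero]

/-- The components of `R + ∇ ρ + (i/λ) ρ²`. -/
def stepTerm (ρ : ι → 𝔉.weyl) (l j : ι) : 𝔉.weyl :=
  𝔉.curvW l j + 𝔉.nablaW l (ρ j) - 𝔉.nablaW j (ρ l) + br (ρ l) (ρ j)

/-- `F + δ⁻ (∇ a + (i/λ) [ρ, a])`. -/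
def liftTerm (ρ : ι → 𝔉.weyl) (F a : 𝔉.weyl) : 𝔉.weyl :=
  F + radial 1 (fun l => 𝔉.nablaW l a + br (ρ l) a)

lemma radial_stepTerm (ρ : ι → 𝔉.weyl) (j : ι) :
    radial 2 (fun l => 𝔉.curvW l j) +
      radial 2 (fun l => 𝔉.nablaW l (ρ j) - 𝔉.nablaW j (ρ l) + br (ρ l) (ρ j)) =
    radial 2 (fun l => stepTerm ρ l j) := by
  rw [radial_add]
  congr 1
  ext1 l
  rw [stepTerm]
  abel

lemma curvW_degGE (l j : ι) : DegGE 2 (𝔉.curvW l j) := by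
  intro k s hs
  rw [curvW, single_apply, if_neg (by omega)]

lemma stepTerm_degGE {ρ : ι → 𝔉.weyl} (h1 : ∀ i, DegGE 3 (ρ i)) (j : ι) :
    DegGE 3 (radial 2 (fun l => stepTerm ρ l j)) := by
  refine DegGE.radial 2 fun l => ?_
  have h2 := fun i j => (degGE_nablaW (h1 i) j).mono (show 2 ≤ 3 by omega)
  exact (((curvW_degGE l j).add (h2 j l)).sub (h2 l j)).add
    (((h1 l).br (h1 j)).mono (by omega))

lemma stepTerm_contract {ρ ρ' : ι → 𝔉.weyl} (h1 : ∀ i, DegGE 3 (ρ i)) (h2 : ∀ i, DegGE 3 (ρ' i))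
    {n : ℕ} (h3 : ∀ i, DegGE n (ρ i - ρ' i)) (j : ι) :
    DegGE (n + 1) (radial 2 (fun l => stepTerm ρ l j) - radial 2 (fun l => stepTerm ρ' l j)) := by
  rw [radial_sub]
  refine DegGE.radial 2 fun l => ?_
  have h4 := fun i j => degGE_nablaW (h3 i) j
  have h5 := ((h4 j l).sub (h4 l j)).add (br_sub_br_degGE (h1 l) (h2 j) (h3 l) (h3 j))
  rw [map_sub, map_sub] at h5
  refine (congrArg (DegGE n) ?_).mp h5
  rw [stepTerm, stepTerm]
  abel

lemma liftTerm_contract {ρ : ι → 𝔉.weyl} (h1 : ∀ i, DegGE 3 (ρ i)) {F a a' : 𝔉.weyl}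
    {n : ℕ} (h3 : DegGE n (a - a')) : DegGE (n + 1) (liftTerm ρ F a - liftTerm ρ F a') := by
  rw [liftTerm, liftTerm, add_sub_add_left_eq_sub, radial_sub]
  refine DegGE.radial 1 fun l => ?_
  have h5 := (degGE_nablaW h3 l).add (((h1 l).br h3).mono (Nat.le_succ n))
  rw [map_sub, map_sub] at h5
  refine (congrArg (DegGE n) ?_).mp h5
  abel

lemma totalCurv_eq_zero_of_fixed {ρ : ι → 𝔉.weyl} (h1 : ∀ i, DegGE 3 (ρ i))
    (h2 : ∀ j, ρ j = radial 2 (fun l => stepTerm ρ l j)) (i j : ι) : 𝔉.totalCurv ρ i j = 0 := by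
  refine totalCurv_eq_zero h1 (fun j k => ?_) (fun j k q => ?_) i j
  · rw [h2]
    rfl
  · conv_lhs => rw [h2]
    exact natCast_smul_radial 2 (by omega) _ k q

lemma totalD_eq_zero_of_fixed {ρ : ι → 𝔉.weyl} (h1 : ∀ i, DegGE 3 (ρ i))
    (h2 : ∀ j, ρ j = radial 2 (fun l => stepTerm ρ l j)) {F a : 𝔉.weyl}
    (hF : ∀ k q, F.1 k (q + 1) = 0) (ha : a = liftTerm ρ F a) (i : ι) : 𝔉.totalD ρ i a = 0 := by
  refine totalD_eq_zero h1 (totalCurv_eq_zero_of_fixed h1 h2) (fun k q => ?_) i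
  have h3 : a.1 k (q + 1) =
      F.1 k (q + 1) + (radial 1 (fun l => 𝔉.nablaW l a + br (ρ l) a)).1 k (q + 1) :=
    congrArg (fun t : 𝔉.weyl => t.1 k (q + 1)) ha
  rw [h3, hF, zero_add]
  exact natCast_smul_radial 1 (by omega) _ k q

lemma totalD_mul_eq_zero {ρ : ι → 𝔉.weyl} {a b : 𝔉.weyl} {i : ι} (ha : 𝔉.totalD ρ i a = 0)
    (hb : 𝔉.totalD ρ i b = 0) : 𝔉.totalD ρ i (a * b) = 0 := by
  rw [(isWeylDerivation_totalD ρ i).leibniz, ha, hb, zero_mul, mul_zero, add_zero]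

lemma totalD_add_eq_zero {ρ : ι → 𝔉.weyl} {a b : 𝔉.weyl} {i : ι} (ha : 𝔉.totalD ρ i a = 0)
    (hb : 𝔉.totalD ρ i b = 0) : 𝔉.totalD ρ i (a + b) = 0 := by
  rw [map_add, ha, hb, add_zero]

lemma totalD_smul_eq_zero {ρ : ι → 𝔉.weyl} {a : 𝔉.weyl} {i : ι} (c : ℂ)
    (ha : 𝔉.totalD ρ i a = 0) : 𝔉.totalD ρ i (c • a) = 0 := by
  rw [map_smul, ha, smul_zero]

lemma totalD_shift_eq_zero {ρ : ι → 𝔉.weyl} {a : 𝔉.weyl} {i : ι}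
    (ha : 𝔉.totalD ρ i a = 0) : 𝔉.totalD ρ i (shift a) = 0 := by
  rw [(isWeylDerivation_totalD ρ i).map_shift, ha, map_zero]

lemma sub_eq_zero_of_totalD {ρ : ι → 𝔉.weyl} (h1 : ∀ i, DegGE 3 (ρ i)) {a b : 𝔉.weyl}
    (h0 : ∀ k, a.1 k 0 = b.1 k 0) (h : ∀ i, 𝔉.totalD ρ i a = 𝔉.totalD ρ i b) : a - b = 0 := by
  refine eq_zero_of_totalD h1 (fun k => ?_) fun i => by rw [map_sub, h, sub_self]
  exact sub_eq_zero.2 (h0 k)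

lemma degGE_zero (n : ℕ) : DegGE n (0 : 𝔉.weyl) := fun _ _ _ => rfl

end ConnectionData

/-- `deg_F b ≥ n`: the component of polynomial degree `s` at `λ^k` vanishes if `s + 2k < n`. -/
def FormDegGE {d l : ℕ} {M : Type v} (n : ℕ) (b : M → WeylForm d l) : Prop :=
  ∀ z k s y w, s + 2 * k < n → b z k s y w = 0

section Steps
open scoped Topology
open MoyalData

variable {d : ℕ} {M : Type v} [TopologicalSpace M] [ChartedSpace (Euc d) M]
  [IsManifold (𝓡 d) ∞ M]

/-- The map `r ↦ r₀ + δ⁻ (∇ r + (i/λ) r²)`, whose fixed point is Fedosov's form. -/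
def fedosovStep (Ω : FormField d M) (cov : AffineConnection d M) (r : M → WeylForm d 1) :
    M → WeylForm d 1 :=
  weylDeltaInv (weylCurvature Ω cov) + weylDeltaInv (weylNabla cov r + weylSquare Ω r)

/-- The map `a ↦ f + δ⁻ (∇ a + (i/λ) [r, a])`, whose fixed point is the flat section with
symbol `f`. -/
def liftStep (Ω : FormField d M) (cov : AffineConnection d M) (r : M → WeylForm d 1)
    (f a : M → WeylForm d 0) : M → WeylForm d 0 :=
  f + weylDeltaInv (weylNabla cov a + weylBracket Ω r a)

variable [T2Space M] {Ω : FormField d M} {cov : AffineConnection d M}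
  {h : IsFedosovManifold Ω cov} {x₀ : M}

lemma Rep0.add {a b : M → WeylForm d 0} {F G : (h.localGeom x₀).Weyl}
    (hF : Rep0 h x₀ a F) (hG : Rep0 h x₀ b G) : Rep0 h x₀ (a + b) (F + G) := fun p k s w =>
  congrArg₂ (fun p q : ℂ => p + q) (hF p k s w) (hG p k s w)

lemma Rep0.sub {a b : M → WeylForm d 0} {F G : (h.localGeom x₀).Weyl}
    (hF : Rep0 h x₀ a F) (hG : Rep0 h x₀ b G) : Rep0 h x₀ (a - b) (F - G) := fun p k s w =>
  congrArg₂ (fun p q : ℂ => p - q) (hF p k s w) (hG p k s w)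

open ConnectionData

lemma Rep1.fedosovStep {r : M → WeylForm d 1} (hr : ∀ z, IsWeylForm (r z))
    {ρ : Fin d → (h.localGeom x₀).Weyl} (hρ : Rep1 h x₀ r ρ) : Rep1 h x₀ (fedosovStep Ω cov r)
      (fun j => radial 2 (fun l => stepTerm (𝔉 := (h.localGeom x₀).data) ρ l j)) :=
  (congrArg (Rep1 h x₀ (Fedosov.fedosovStep Ω cov r))
    (funext fun j => radial_stepTerm (𝔉 := (h.localGeom x₀).data) ρ j)).mp
    ((rep2_weylCurvature h x₀).weylDeltaInv.add
      ((hρ.weylNabla hr).add (hρ.weylSquare hr)).weylDeltaInv)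

lemma isSmooth_fedosovStep (h : IsFedosovManifold Ω cov) {r : M → WeylForm d 1}
    (hr : IsSmoothWeylForm r) : IsSmoothWeylForm (fedosovStep Ω cov r) :=
  isSmoothWeylForm_of_rep1 (h := h) fun x₀ =>
    ⟨_, (rep1_local (h := h) (x₀ := x₀) hr).fedosovStep hr.isWeylForm⟩

lemma fedosovStep_degGE (h : IsFedosovManifold Ω cov) {r : M → WeylForm d 1}
    (hr : IsSmoothWeylForm r) (hd : FormDegGE 3 r) : FormDegGE 3 (fedosovStep Ω cov r) :=
  eq_zero_of_rep1 (h := h) fun x₀ =>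
    have hρ := rep1_local (h := h) (x₀ := x₀) hr
    ⟨_, hρ.fedosovStep hr.isWeylForm, stepTerm_degGE (hρ.degGE hd)⟩

/-- The map defining Fedosov's form is a contraction for the degree filtration. -/
lemma fedosovStep_contract (h : IsFedosovManifold Ω cov) {r r' : M → WeylForm d 1}
    (hr : IsSmoothWeylForm r) (hr' : IsSmoothWeylForm r') (hd : FormDegGE 3 r)
    (hd' : FormDegGE 3 r') {n : ℕ} (hn : FormDegGE n (r - r')) :
    FormDegGE (n + 1) (fedosovStep Ω cov r - fedosovStep Ω cov r') :=
  eq_zero_of_rep1 (h := h) fun x₀ =>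
    have hρ := rep1_local (h := h) (x₀ := x₀) hr
    have hρ' := rep1_local (h := h) (x₀ := x₀) hr'
    ⟨_, (hρ.fedosovStep hr.isWeylForm).sub (hρ'.fedosovStep hr'.isWeylForm),
      stepTerm_contract (hρ.degGE hd) (hρ'.degGE hd') ((hρ.sub hρ').degGE hn)⟩

lemma eq_zero_of_formDegGE {l : ℕ} {b : M → WeylForm d l} (hb : ∀ n, FormDegGE n b) : b = 0 := by
  ext z k s y w
  exact hb (s + 2 * k + 1) z k s y w (by omega)

lemma rep1_zero : Rep1 h x₀ (0 : M → WeylForm d 1) (fun _ => 0) := fun _ _ _ _ =>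
  (sum_eq_zero fun _ _ => mul_zero _).symm

/-- A `1`-form with vanishing local components is zero. -/
lemma eq_zero_of_rep1_zero (h : IsFedosovManifold Ω cov) {b : M → WeylForm d 1}
    (H : ∀ x₀, ∃ F, Rep1 h x₀ b F ∧ ∀ i, F i = 0) : b = 0 :=
  eq_zero_of_formDegGE fun n => eq_zero_of_rep1 (h := h) fun x₀ =>
    let ⟨F, hF, h0⟩ := H x₀
    ⟨F, hF, fun i => (congrArg (DegGE n) (h0 i)).mpr
      (degGE_zero (𝔉 := (h.localGeom x₀).data) n)⟩

section Fixed

variable {r : M → WeylForm d 1} (hr : IsSmoothWeylForm r) (hfix : Fedosov.fedosovStep Ω cov r = r)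

include hr hfix in
lemma Rep1.eq_radial {ρ : Fin d → (h.localGeom x₀).Weyl}
    (hρ : Rep1 h x₀ r ρ) (j : Fin d) :
    ρ j = radial 2 (fun l => stepTerm (𝔉 := (h.localGeom x₀).data) ρ l j) :=
  congrFun (hρ.unique ((congrArg (fun b => Rep1 h x₀ b _) hfix).mp
    (hρ.fedosovStep hr.isWeylForm))) j

lemma isSmooth_fedosovD (h : IsFedosovManifold Ω cov) {r : M → WeylForm d 1}
    (hr : IsSmoothWeylForm r) {a : M → WeylForm d 0} (ha : IsSmoothWeylForm a) :
    IsSmoothWeylForm (fedosovD Ω cov r a) :=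
  isSmoothWeylForm_of_rep1 (h := h) fun x₀ =>
    ⟨_, Rep0.fedosovD hr.isWeylForm ha.isWeylForm (rep1_local (h := h) (x₀ := x₀) hr)
      (rep0_local (h := h) (x₀ := x₀) ha Fin.elim0)⟩

include hr hfix in
/-- Fedosov's connection is flat. -/
lemma fedosovD_fedosovD (h : IsFedosovManifold Ω cov) (hd : FormDegGE 3 r) {a : M → WeylForm d 0}
    (ha : IsSmoothWeylForm a) : fedosovD Ω cov r (fedosovD Ω cov r a) = 0 :=
  eq_zero_of_rep2 (h := h) fun x₀ =>
    have hρ := rep1_local (h := h) (x₀ := x₀) hr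
    have hF := rep0_local (h := h) (x₀ := x₀) ha Fin.elim0
    have h1 := Rep0.fedosovD hr.isWeylForm ha.isWeylForm hρ hF
    have h2 := Rep1.fedosovD hr.isWeylForm (isSmooth_fedosovD h hr ha).isWeylForm hρ h1
    (congrArg (Rep2 h x₀ _) (funext fun i => funext fun j => sub_eq_zero.2
      (totalD_comm_of_totalCurv (totalCurv_eq_zero_of_fixed (hρ.degGE hd)
        (Rep1.eq_radial hr hfix hρ)) i j _))).mp h2

end Fixed

section Lift

variable {r : M → WeylForm d 1} (hr : IsSmoothWeylForm r) {f a : M → WeylForm d 0}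

lemma Rep0.liftStep {r : M → WeylForm d 1} {f a : M → WeylForm d 0} (hr : ∀ z, IsWeylForm (r z))
    (ha : ∀ z, IsWeylForm (a z))
    {ρ : Fin d → (h.localGeom x₀).Weyl} {F G : (h.localGeom x₀).Weyl} (hρ : Rep1 h x₀ r ρ)
    (hF : Rep0 h x₀ f F) (hG : Rep0 h x₀ a G) :
    Rep0 h x₀ (liftStep Ω cov r f a) (liftTerm (𝔉 := (h.localGeom x₀).data) ρ F G) :=
  hF.add ((hG.weylNabla ha).add (Rep0.weylBracket hr ha hρ hG)).weylDeltaInv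

include hr in
lemma isSmooth_liftStep (h : IsFedosovManifold Ω cov) (hf : IsSmoothWeylForm f)
    (ha : IsSmoothWeylForm a) : IsSmoothWeylForm (liftStep Ω cov r f a) :=
  isSmoothWeylForm_of_rep0 (h := h) fun x₀ =>
    ⟨_, Rep0.liftStep hr.isWeylForm ha.isWeylForm (rep1_local (h := h) (x₀ := x₀) hr)
      (rep0_local (h := h) (x₀ := x₀) hf Fin.elim0) (rep0_local (h := h) (x₀ := x₀) ha Fin.elim0)⟩

include hr in
lemma liftStep_contract (h : IsFedosovManifold Ω cov) (hd : FormDegGE 3 r)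
    {a' : M → WeylForm d 0} (hf : IsSmoothWeylForm f) (ha : IsSmoothWeylForm a)
    (ha' : IsSmoothWeylForm a') {n : ℕ} (hn : FormDegGE n (a - a')) :
    FormDegGE (n + 1) (liftStep Ω cov r f a - liftStep Ω cov r f a') :=
  eq_zero_of_rep0 (h := h) fun x₀ =>
    have hρ := rep1_local (h := h) (x₀ := x₀) hr
    have hF := rep0_local (h := h) (x₀ := x₀) hf Fin.elim0
    have hG := rep0_local (h := h) (x₀ := x₀) ha Fin.elim0
    have hG' := rep0_local (h := h) (x₀ := x₀) ha' Fin.elim0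
    ⟨_, (Rep0.liftStep hr.isWeylForm ha.isWeylForm hρ hF hG).sub
      (Rep0.liftStep hr.isWeylForm ha'.isWeylForm hρ hF hG'),
      liftTerm_contract (hρ.degGE hd) ((hG.sub hG').degGE hn)⟩

lemma localComp_eq_zero {hf : IsSmoothWeylForm f} {k s : ℕ}
    (hf0 : ∀ z y w, f z k s y w = 0) : (localComp h hf (x₀ := x₀) Fin.elim0).1 k s = 0 := by
  ext p
  rw [localComp_apply, hf0]
  rfl

lemma localComp_eq {b : M → WeylForm d 0} {ha : IsSmoothWeylForm a} {hb : IsSmoothWeylForm b}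
    {k s : ℕ} (h0 : ∀ z y w, a z k s y w = b z k s y w) :
    (localComp h ha (x₀ := x₀) Fin.elim0).1 k s = (localComp h hb (x₀ := x₀) Fin.elim0).1 k s := by
  ext p
  rw [localComp_apply, localComp_apply, h0]

include hr in
/-- A fixed point of `liftStep` is flat. -/
lemma fedosovD_eq_zero_of_fixed (h : IsFedosovManifold Ω cov) (hfix : fedosovStep Ω cov r = r)
    (hd : FormDegGE 3 r) (hf : IsSmoothWeylForm f) (hf0 : ∀ z k s y w, s ≠ 0 → f z k s y w = 0)
    (ha : IsSmoothWeylForm a) (h1 : liftStep Ω cov r f a = a) : fedosovD Ω cov r a = 0 :=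
  eq_zero_of_rep1_zero h fun x₀ =>
    have hρ := rep1_local (h := h) (x₀ := x₀) hr
    have hF := rep0_local (h := h) (x₀ := x₀) hf Fin.elim0
    have hG := rep0_local (h := h) (x₀ := x₀) ha Fin.elim0
    have h2 := Rep0.liftStep hr.isWeylForm ha.isWeylForm hρ hF hG
    ⟨_, Rep0.fedosovD hr.isWeylForm ha.isWeylForm hρ hG,
      totalD_eq_zero_of_fixed (hρ.degGE hd) (Rep1.eq_radial hr hfix hρ)
        (fun k q => localComp_eq_zero fun z y w => hf0 z k (q + 1) y w q.succ_ne_zero)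
        (hG.unique ((congrArg (fun b => Rep0 h x₀ b _) h1).mp h2))⟩

include hr in
/-- Flat sections are determined by their symbols. -/
lemma eq_of_fedosovD (h : IsFedosovManifold Ω cov) (hd : FormDegGE 3 r) {b : M → WeylForm d 0}
    (ha : IsSmoothWeylForm a) (hb : IsSmoothWeylForm b) (h0 : ∀ z k y w, a z k 0 y w = b z k 0 y w)
    (ha0 : fedosovD Ω cov r a = 0) (hb0 : fedosovD Ω cov r b = 0) : a = b :=
  sub_eq_zero.1 <| eq_zero_of_formDegGE fun n => eq_zero_of_rep0 (h := h) fun x₀ =>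
    have hρ := rep1_local (h := h) (x₀ := x₀) hr
    have hF := rep0_local (h := h) (x₀ := x₀) ha Fin.elim0
    have hG := rep0_local (h := h) (x₀ := x₀) hb Fin.elim0
    have h1 := (congrArg (fun b => Rep1 h x₀ b _) ha0).mp
      (Rep0.fedosovD hr.isWeylForm ha.isWeylForm hρ hF)
    have h2 := (congrArg (fun b => Rep1 h x₀ b _) hb0).mp
      (Rep0.fedosovD hr.isWeylForm hb.isWeylForm hρ hG)
    have h3 := sub_eq_zero_of_totalD (hρ.degGE hd) (fun k => localComp_eq fun z y w => h0 z k y w)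
      fun i => (congrFun (h1.unique h2) i)
    ⟨_, hF.sub hG, (congrArg (DegGE n) h3).mpr (degGE_zero (𝔉 := (h.localGeom x₀).data) n)⟩

lemma isSmooth_weylMul (h : IsFedosovManifold Ω cov) {a b : M → WeylForm d 0}
    (ha : IsSmoothWeylForm a) (hb : IsSmoothWeylForm b) : IsSmoothWeylForm (weylMul Ω a b) :=
  isSmoothWeylForm_of_rep0 (h := h) fun x₀ => ⟨_, Rep0.weylMul ha.isWeylForm hb.isWeylForm
    (rep0_local (h := h) (x₀ := x₀) ha Fin.elim0) (rep0_local (h := h) (x₀ := x₀) hb Fin.elim0)⟩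

include hr in
/-- The fibrewise product of flat sections is flat. -/
lemma fedosovD_weylMul (h : IsFedosovManifold Ω cov) {b : M → WeylForm d 0}
    (ha : IsSmoothWeylForm a) (hb : IsSmoothWeylForm b)
    (ha0 : fedosovD Ω cov r a = 0) (hb0 : fedosovD Ω cov r b = 0) :
    fedosovD Ω cov r (weylMul Ω a b) = 0 :=
  eq_zero_of_rep1_zero h fun x₀ =>
    have hρ := rep1_local (h := h) (x₀ := x₀) hr
    have hF := rep0_local (h := h) (x₀ := x₀) ha Fin.elim0
    have hG := rep0_local (h := h) (x₀ := x₀) hb Fin.elim0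
    have h1 := (congrArg (fun b => Rep1 h x₀ b _) ha0).mp
      (Rep0.fedosovD hr.isWeylForm ha.isWeylForm hρ hF)
    have h2 := (congrArg (fun b => Rep1 h x₀ b _) hb0).mp
      (Rep0.fedosovD hr.isWeylForm hb.isWeylForm hρ hG)
    ⟨_, Rep0.fedosovD hr.isWeylForm (isSmooth_weylMul h ha hb).isWeylForm hρ
      (Rep0.weylMul ha.isWeylForm hb.isWeylForm hF hG), fun i => totalD_mul_eq_zero
        (congrFun (h1.unique rep1_zero) i) (congrFun (h2.unique rep1_zero) i)⟩

end Lift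

end Steps

/-! ### Naturality and linearity of Fedosov's construction -/

section NaturalSteps

variable {d' : ℕ} {N : Type v} [TopologicalSpace N] [ChartedSpace (Euc d') N]
  [IsManifold (𝓡 d') ∞ N]
  {d : ℕ} {M : Type v} [TopologicalSpace M] [ChartedSpace (Euc d) M]
  [IsManifold (𝓡 d) ∞ M] [T2Space N] [T2Space M]
  {φ : N → M} {Ω' : FormField d' N} {cov' : AffineConnection d' N}
  {Ω : FormField d M} {cov : AffineConnection d M}

lemma IsFedosovMap.fedosovStep (hφ : IsFedosovMap φ Ω' cov' Ω cov)
    (h' : IsFedosovManifold Ω' cov') (h : IsFedosovManifold Ω cov) {r' : N → WeylForm d' 1}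
    {r : M → WeylForm d 1} (hr' : IsSmoothWeylForm r') (hr : IsSmoothWeylForm r)
    (hrr : PreservesWeylForm φ r' r) :
    PreservesWeylForm φ (fedosovStep Ω' cov' r') (fedosovStep Ω cov r) :=
  preservesWeylForm_add (hφ.weylDeltaInv (hφ.weylCurvature h' h))
    (hφ.weylDeltaInv (preservesWeylForm_add (hφ.weylNabla_one h' h hr' hr hrr)
      (hφ.weylSquare h' hr.isWeylForm hrr)))

lemma IsFedosovMap.liftStep (hφ : IsFedosovMap φ Ω' cov' Ω cov)
    (h' : IsFedosovManifold Ω' cov') (h : IsFedosovManifold Ω cov) {r' : N → WeylForm d' 1}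
    {r : M → WeylForm d 1} {f' a' : N → WeylForm d' 0} {f a : M → WeylForm d 0}
    (hr : IsSmoothWeylForm r) (ha' : IsSmoothWeylForm a') (ha : IsSmoothWeylForm a)
    (hrr : PreservesWeylForm φ r' r) (hff : PreservesWeylForm φ f' f)
    (haa : PreservesWeylForm φ a' a) :
    PreservesWeylForm φ (liftStep Ω' cov' r' f' a') (liftStep Ω cov r f a) :=
  preservesWeylForm_add hff (hφ.weylDeltaInv (preservesWeylForm_add
    (hφ.weylNabla_zero h' h ha' ha haa)
      (hφ.weylBracket_zero h' hr.isWeylForm ha.isWeylForm hrr haa)))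

end NaturalSteps

section Linearity
open MoyalData ConnectionData

variable {d : ℕ} {M : Type v} [TopologicalSpace M] [ChartedSpace (Euc d) M]
  [IsManifold (𝓡 d) ∞ M]

/-- Multiplication of a form by `λ`. -/
def mulLambda {l : ℕ} (a : M → WeylForm d l) : M → WeylForm d l := fun z k s y w => match k with
  | 0 => 0
  | k + 1 => a z k s y w

/-- The section `1`. -/
def oneForm : M → WeylForm d 0 := fun _ k s _ _ => if k = 0 ∧ s = 0 then 1 else 0

variable [T2Space M] {Ω : FormField d M} {cov : AffineConnection d M}
  {h : IsFedosovManifold Ω cov} {x₀ : M}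

lemma Rep0.smul (c : ℂ) {a : M → WeylForm d 0} {F : (h.localGeom x₀).Weyl}
    (hF : Rep0 h x₀ a F) : Rep0 h x₀ (c • a) (c • F) := fun p k s w =>
  congrArg (fun q : ℂ => c * q) (hF p k s w)

lemma Rep0.mulLambda {a : M → WeylForm d 0} {F : (h.localGeom x₀).Weyl}
    (hF : Rep0 h x₀ a F) : Rep0 h x₀ (mulLambda a) (shift F) := by
  intro p k s w
  cases k with
  | zero => rfl
  | succ k => exact hF p k s w

lemma eq_of_rep0 (h : IsFedosovManifold Ω cov) {a b : M → WeylForm d 0}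
    (H : ∀ x₀, ∃ F G, Rep0 h x₀ a F ∧ Rep0 h x₀ b G ∧ F = G) : a = b := by
  ext z k s y w
  obtain ⟨F, G, hF, hG, rfl⟩ := H z
  rw [hF.apply_co (mem_chart_source _ z), hG.apply_co (mem_chart_source _ z)]

variable {a b c : M → WeylForm d 0}

lemma IsSmoothWeylForm.add (h : IsFedosovManifold Ω cov) (ha : IsSmoothWeylForm a)
    (hb : IsSmoothWeylForm b) : IsSmoothWeylForm (a + b) :=
  isSmoothWeylForm_of_rep0 (h := h) fun x₀ => ⟨_,
    (rep0_local (h := h) (x₀ := x₀) ha Fin.elim0).add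
      (rep0_local (h := h) (x₀ := x₀) hb Fin.elim0)⟩

lemma IsSmoothWeylForm.smul (h : IsFedosovManifold Ω cov) (t : ℂ) (ha : IsSmoothWeylForm a) :
    IsSmoothWeylForm (t • a) :=
  isSmoothWeylForm_of_rep0 (h := h) fun x₀ => ⟨_,
    (rep0_local (h := h) (x₀ := x₀) ha Fin.elim0).smul t⟩

lemma IsSmoothWeylForm.mulLambda (h : IsFedosovManifold Ω cov) (ha : IsSmoothWeylForm a) :
    IsSmoothWeylForm (mulLambda a) :=
  isSmoothWeylForm_of_rep0 (h := h) fun x₀ => ⟨_,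
    (rep0_local (h := h) (x₀ := x₀) ha Fin.elim0).mulLambda⟩

section FlatLinear

variable {r : M → WeylForm d 1} (hr : IsSmoothWeylForm r)

include hr

lemma fedosovD_add_eq_zero (h : IsFedosovManifold Ω cov) (ha : IsSmoothWeylForm a)
    (hb : IsSmoothWeylForm b) (ha0 : fedosovD Ω cov r a = 0) (hb0 : fedosovD Ω cov r b = 0) :
    fedosovD Ω cov r (a + b) = 0 :=
  eq_zero_of_rep1_zero h fun x₀ =>
    have hρ := rep1_local (h := h) (x₀ := x₀) hr
    have hF := rep0_local (h := h) (x₀ := x₀) ha Fin.elim0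
    have hG := rep0_local (h := h) (x₀ := x₀) hb Fin.elim0
    have h1 := (congrArg (fun b => Rep1 h x₀ b _) ha0).mp
      (Rep0.fedosovD hr.isWeylForm ha.isWeylForm hρ hF)
    have h2 := (congrArg (fun b => Rep1 h x₀ b _) hb0).mp
      (Rep0.fedosovD hr.isWeylForm hb.isWeylForm hρ hG)
    ⟨_, Rep0.fedosovD hr.isWeylForm (IsSmoothWeylForm.add h ha hb).isWeylForm hρ (hF.add hG),
      fun i => totalD_add_eq_zero (congrFun (h1.unique rep1_zero) i)
        (congrFun (h2.unique rep1_zero) i)⟩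

lemma fedosovD_smul_eq_zero (h : IsFedosovManifold Ω cov) (t : ℂ) (ha : IsSmoothWeylForm a)
    (ha0 : fedosovD Ω cov r a = 0) : fedosovD Ω cov r (t • a) = 0 :=
  eq_zero_of_rep1_zero h fun x₀ =>
    have hρ := rep1_local (h := h) (x₀ := x₀) hr
    have hF := rep0_local (h := h) (x₀ := x₀) ha Fin.elim0
    have h1 := (congrArg (fun b => Rep1 h x₀ b _) ha0).mp
      (Rep0.fedosovD hr.isWeylForm ha.isWeylForm hρ hF)
    ⟨_, Rep0.fedosovD hr.isWeylForm (IsSmoothWeylForm.smul h t ha).isWeylForm hρ (hF.smul t),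
      fun i => totalD_smul_eq_zero t (congrFun (h1.unique rep1_zero) i)⟩

lemma fedosovD_mulLambda_eq_zero (h : IsFedosovManifold Ω cov) (ha : IsSmoothWeylForm a)
    (ha0 : fedosovD Ω cov r a = 0) : fedosovD Ω cov r (mulLambda a) = 0 :=
  eq_zero_of_rep1_zero h fun x₀ =>
    have hρ := rep1_local (h := h) (x₀ := x₀) hr
    have hF := rep0_local (h := h) (x₀ := x₀) ha Fin.elim0
    have h1 := (congrArg (fun b => Rep1 h x₀ b _) ha0).mp
      (Rep0.fedosovD hr.isWeylForm ha.isWeylForm hρ hF)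
    ⟨_, Rep0.fedosovD hr.isWeylForm (IsSmoothWeylForm.mulLambda h ha).isWeylForm hρ hF.mulLambda,
      fun i => totalD_shift_eq_zero (congrFun (h1.unique rep1_zero) i)⟩

end FlatLinear

section Products

lemma weylMul_add_left (h : IsFedosovManifold Ω cov) (ha : IsSmoothWeylForm a)
    (hb : IsSmoothWeylForm b) (hc : IsSmoothWeylForm c) :
    weylMul Ω (a + b) c = weylMul Ω a c + weylMul Ω b c :=
  eq_of_rep0 h fun x₀ =>
    have hF := rep0_local (h := h) (x₀ := x₀) ha Fin.elim0
    have hG := rep0_local (h := h) (x₀ := x₀) hb Fin.elim0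
    have hH := rep0_local (h := h) (x₀ := x₀) hc Fin.elim0
    ⟨_, _, Rep0.weylMul (IsSmoothWeylForm.add h ha hb).isWeylForm hc.isWeylForm (hF.add hG) hH,
      (Rep0.weylMul ha.isWeylForm hc.isWeylForm hF hH).add
        (Rep0.weylMul hb.isWeylForm hc.isWeylForm hG hH), add_mul _ _ _⟩

lemma weylMul_add_right (h : IsFedosovManifold Ω cov) (ha : IsSmoothWeylForm a)
    (hb : IsSmoothWeylForm b) (hc : IsSmoothWeylForm c) :
    weylMul Ω a (b + c) = weylMul Ω a b + weylMul Ω a c :=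
  eq_of_rep0 h fun x₀ =>
    have hF := rep0_local (h := h) (x₀ := x₀) ha Fin.elim0
    have hG := rep0_local (h := h) (x₀ := x₀) hb Fin.elim0
    have hH := rep0_local (h := h) (x₀ := x₀) hc Fin.elim0
    ⟨_, _, Rep0.weylMul ha.isWeylForm (IsSmoothWeylForm.add h hb hc).isWeylForm hF (hG.add hH),
      (Rep0.weylMul ha.isWeylForm hb.isWeylForm hF hG).add
        (Rep0.weylMul ha.isWeylForm hc.isWeylForm hF hH), mul_add _ _ _⟩

lemma weylMul_smul_left (h : IsFedosovManifold Ω cov) (t : ℂ) (ha : IsSmoothWeylForm a)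
    (hb : IsSmoothWeylForm b) : weylMul Ω (t • a) b = t • weylMul Ω a b :=
  eq_of_rep0 h fun x₀ =>
    have hF := rep0_local (h := h) (x₀ := x₀) ha Fin.elim0
    have hG := rep0_local (h := h) (x₀ := x₀) hb Fin.elim0
    ⟨_, _, Rep0.weylMul (IsSmoothWeylForm.smul h t ha).isWeylForm hb.isWeylForm (hF.smul t) hG,
      (Rep0.weylMul ha.isWeylForm hb.isWeylForm hF hG).smul t, smul_mul' _ _ _⟩

lemma weylMul_smul_right (h : IsFedosovManifold Ω cov) (t : ℂ) (ha : IsSmoothWeylForm a)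
    (hb : IsSmoothWeylForm b) : weylMul Ω a (t • b) = t • weylMul Ω a b :=
  eq_of_rep0 h fun x₀ =>
    have hF := rep0_local (h := h) (x₀ := x₀) ha Fin.elim0
    have hG := rep0_local (h := h) (x₀ := x₀) hb Fin.elim0
    ⟨_, _, Rep0.weylMul ha.isWeylForm (IsSmoothWeylForm.smul h t hb).isWeylForm hF (hG.smul t),
      (Rep0.weylMul ha.isWeylForm hb.isWeylForm hF hG).smul t, mul_smul' _ _ _⟩

lemma weylMul_mulLambda_left (h : IsFedosovManifold Ω cov) (ha : IsSmoothWeylForm a)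
    (hb : IsSmoothWeylForm b) : weylMul Ω (mulLambda a) b = mulLambda (weylMul Ω a b) :=
  eq_of_rep0 h fun x₀ =>
    have hF := rep0_local (h := h) (x₀ := x₀) ha Fin.elim0
    have hG := rep0_local (h := h) (x₀ := x₀) hb Fin.elim0
    ⟨_, _, Rep0.weylMul (IsSmoothWeylForm.mulLambda h ha).isWeylForm hb.isWeylForm hF.mulLambda hG,
      (Rep0.weylMul ha.isWeylForm hb.isWeylForm hF hG).mulLambda, shift_mul _ _⟩

lemma weylMul_mulLambda_right (h : IsFedosovManifold Ω cov) (ha : IsSmoothWeylForm a)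
    (hb : IsSmoothWeylForm b) : weylMul Ω a (mulLambda b) = mulLambda (weylMul Ω a b) :=
  eq_of_rep0 h fun x₀ =>
    have hF := rep0_local (h := h) (x₀ := x₀) ha Fin.elim0
    have hG := rep0_local (h := h) (x₀ := x₀) hb Fin.elim0
    ⟨_, _, Rep0.weylMul ha.isWeylForm (IsSmoothWeylForm.mulLambda h hb).isWeylForm hF hG.mulLambda,
      (Rep0.weylMul ha.isWeylForm hb.isWeylForm hF hG).mulLambda, mul_shift _ _⟩

lemma weylMul_assoc (h : IsFedosovManifold Ω cov) (ha : IsSmoothWeylForm a)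
    (hb : IsSmoothWeylForm b) (hc : IsSmoothWeylForm c) :
    weylMul Ω (weylMul Ω a b) c = weylMul Ω a (weylMul Ω b c) :=
  eq_of_rep0 h fun x₀ =>
    have hF := rep0_local (h := h) (x₀ := x₀) ha Fin.elim0
    have hG := rep0_local (h := h) (x₀ := x₀) hb Fin.elim0
    have hH := rep0_local (h := h) (x₀ := x₀) hc Fin.elim0
    ⟨_, _, Rep0.weylMul (isSmooth_weylMul h ha hb).isWeylForm hc.isWeylForm
        (Rep0.weylMul ha.isWeylForm hb.isWeylForm hF hG) hH,
      Rep0.weylMul ha.isWeylForm (isSmooth_weylMul h hb hc).isWeylForm hF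
        (Rep0.weylMul hb.isWeylForm hc.isWeylForm hG hH), mul_assoc _ _ _⟩

end Products

end Linearity

section Unit

variable {d : ℕ}

lemma iteratedFDeriv_const_apply {m : ℕ} (hm : m ≠ 0) (c : ℂ) (y : Euc d) (v : Fin m → Euc d) :
    iteratedFDeriv ℝ m (fun _ : Euc d => c) y v = 0 := by
  rw [iteratedFDeriv_const_of_ne hm]
  rfl

/-- The unit of the Weyl algebra. -/
def oneElt (d : ℕ) : WeylElt d := fun k s _ => if k = 0 ∧ s = 0 then 1 else 0

lemma moyal_oneElt (P : Matrix (Fin d) (Fin d) ℝ) (a : WeylElt d) : moyal P a (oneElt d) = a := by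
  ext K S y
  rw [moyal, sum_eq_single 0]
  · rw [sum_eq_single (K, 0), sum_eq_single (S, 0)]
    · simp [oneElt]
    · rintro ⟨s, s'⟩ hs hne
      have := HasAntidiagonal.mem_antidiagonal.1 hs
      have h2 : s' ≠ 0 := by rintro rfl; apply hne; simp at this ⊢; omega
      simp [oneElt, h2]
    · intro h; exact absurd (HasAntidiagonal.mem_antidiagonal.2 (by ring)) h
    · rintro ⟨k, k'⟩ hk hne
      have := HasAntidiagonal.mem_antidiagonal.1 hk
      have h2 : k' ≠ 0 := by rintro rfl; apply hne; simp at this ⊢; omega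
      refine sum_eq_zero fun s _ => ?_
      simp [oneElt, h2]
    · intro h; exact absurd (HasAntidiagonal.mem_antidiagonal.2 (by simp)) h
  · intro m _ hm
    refine sum_eq_zero fun k _ => sum_eq_zero fun s _ => ?_
    refine mul_eq_zero_of_right _ (sum_eq_zero fun I _ => sum_eq_zero fun J _ => ?_)
    exact mul_eq_zero_of_right _ (iteratedFDeriv_const_apply hm _ _ _)
  · intro h; exact absurd (mem_range.2 (Nat.succ_pos K)) h

lemma oneElt_moyal (P : Matrix (Fin d) (Fin d) ℝ) (a : WeylElt d) : moyal P (oneElt d) a = a := by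
  ext K S y
  rw [moyal, sum_eq_single 0]
  · rw [sum_eq_single (0, K), sum_eq_single (0, S)]
    · simp [oneElt]
    · rintro ⟨s', s⟩ hs hne
      have := HasAntidiagonal.mem_antidiagonal.1 hs
      have h2 : s' ≠ 0 := by rintro rfl; apply hne; simp at this ⊢; omega
      simp [oneElt, h2]
    · intro h; exact absurd (HasAntidiagonal.mem_antidiagonal.2 (by ring)) h
    · rintro ⟨k', k⟩ hk hne
      have := HasAntidiagonal.mem_antidiagonal.1 hk
      have h2 : k' ≠ 0 := by rintro rfl; apply hne; simp at this ⊢; omega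
      refine sum_eq_zero fun s _ => ?_
      simp [oneElt, h2]
    · intro h; exact absurd (HasAntidiagonal.mem_antidiagonal.2 (by simp)) h
  · intro m _ hm
    refine sum_eq_zero fun k _ => sum_eq_zero fun s _ => ?_
    refine mul_eq_zero_of_right _ (sum_eq_zero fun I _ => sum_eq_zero fun J _ => ?_)
    exact mul_eq_zero_of_left (mul_eq_zero_of_right _ (iteratedFDeriv_const_apply hm _ _ _)) _
  · intro h; exact absurd (mem_range.2 (Nat.succ_pos K)) h

variable {M : Type v} [TopologicalSpace M] [ChartedSpace (Euc d) M]
  [IsManifold (𝓡 d) ∞ M] {Ω : FormField d M} {cov : AffineConnection d M}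

omit [IsManifold (𝓡 d) ∞ M] in
lemma weylMul_oneForm (a : M → WeylForm d 0) : weylMul Ω a oneForm = a := by
  ext z k s y w
  exact congrFun (congrFun (congrFun (moyal_oneElt (inverseForm Ω z) ((a z).eval w)) k) s) y

omit [IsManifold (𝓡 d) ∞ M] in
lemma oneForm_weylMul (a : M → WeylForm d 0) : weylMul Ω oneForm a = a := by
  ext z k s y w
  exact congrFun (congrFun (congrFun (oneElt_moyal (inverseForm Ω z) ((a z).eval w)) k) s) y

lemma fedosovD_oneForm (r : M → WeylForm d 1) : fedosovD Ω cov r oneForm = 0 := by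
  ext z k s y w
  have h1 : weylNabla cov oneForm z k s y w = 0 := by
    rw [weylNabla]
    refine sum_eq_zero fun i _ => mul_eq_zero_of_right _ ?_
    have e1 : fderiv ℝ (fun t : Euc d => (oneForm (M := M) z k s t
        (fun j => w (i.succAbove j)))) y = 0 := (hasFDerivAt_const _ _).fderiv
    have e2 : mvfderiv (𝓡 d) (fun z' : M => oneForm z' k s (extVec z y z')
        (fun j => extVec z (w (i.succAbove j)) z')) z = 0 := mfderiv_const
    rw [e1, e2]
    exact sub_zero _
  have h2 : weylDelta (oneForm (M := M)) z k s y w = 0 := by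
    rw [weylDelta]
    refine sum_eq_zero fun i _ => mul_eq_zero_of_right _ ?_
    have e1 : fderiv ℝ (fun t : Euc d => (oneForm (M := M) z k (s + 1) t
        (fun j => w (i.succAbove j)))) y = 0 := (hasFDerivAt_const _ _).fderiv
    rw [e1]
    rfl
  have h3 : weylBracket Ω r (oneForm (M := M)) z k s y w = 0 := by
    rw [weylBracket]
    refine sum_eq_zero fun i _ => mul_eq_zero_of_right _ ?_
    have e1 : (oneForm z).eval (fun j => w (i.succAbove j)) = oneElt d := rfl
    rw [e1, scaledComm, moyal_oneElt, oneElt_moyal, sub_self, mul_zero]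
  change weylNabla cov oneForm z k s y w - weylDelta oneForm z k s y w +
    weylBracket Ω r oneForm z k s y w = 0
  rw [h1, h2, h3, sub_zero, add_zero]

end Unit

/-! ### The semiclassical limit -/

section Semiclassical
open MoyalData

variable {d : ℕ}

lemma moyal_zero_zero (P : Matrix (Fin d) (Fin d) ℝ) (a b : WeylElt d) (y : Euc d) :
    moyal P a b 0 0 y = a 0 0 y * b 0 0 y := by
  simp [moyal]

lemma sum_fin_one_fun (g : (Fin 1 → Fin d) → ℂ) : ∑ I, g I = ∑ i, g (fun _ => i) :=
  Fintype.sum_equiv (Equiv.funUnique (Fin 1) (Fin d)) _ _ fun I => congrArg g <|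
    funext fun t => congrArg I (Subsingleton.elim t 0)

/-- The first order part of the Moyal-Weyl product in polynomial degree zero. -/
lemma moyal_one_zero (P : Matrix (Fin d) (Fin d) ℝ) {a b : WeylElt d} {y : Euc d}
    (ha : ∀ t, a 0 0 t = a 0 0 y) (hb : ∀ t, b 0 0 t = b 0 0 y) (ha1 : a 1 0 y = 0)
    (hb1 : b 1 0 y = 0) :
    moyal P a b 1 0 y = (-Complex.I / 2) * ∑ i, ∑ j, (P i j : ℂ) *
      fderiv ℝ (a 0 1) y (EuclideanSpace.single i 1) *
      fderiv ℝ (b 0 1) y (EuclideanSpace.single j 1) := by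
  have ha' : fderiv ℝ (a 0 0) y = 0 := by
    rw [show a 0 0 = fun _ => a 0 0 y from funext ha]
    exact (hasFDerivAt_const _ _).fderiv
  have hb' : fderiv ℝ (b 0 0) y = 0 := by
    rw [show b 0 0 = fun _ => b 0 0 y from funext hb]
    exact (hasFDerivAt_const _ _).fderiv
  have h2 : Finset.HasAntidiagonal.antidiagonal 2 = {(0, 2), (1, 1), (2, 0)} := by decide
  have h1 : Finset.HasAntidiagonal.antidiagonal 1 = {(0, 1), (1, 0)} := by decide
  rw [moyal, sum_range_succ, sum_range_one]
  simp [h1, h2, ha1, hb1, sum_fin_one_fun, ha', hb', iteratedFDeriv_one_apply]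

variable {M : Type v} [TopologicalSpace M] [ChartedSpace (Euc d) M]
  [IsManifold (𝓡 d) ∞ M] {Ω : FormField d M} {cov : AffineConnection d M}

lemma matrix_inv_neg (A : Matrix (Fin d) (Fin d) ℝ) : (-A)⁻¹ = -A⁻¹ := by
  by_cases h : IsUnit A.det
  · exact Matrix.inv_eq_right_inv (by rw [neg_mul_neg, Matrix.mul_nonsing_inv A h])
  · have h' : ¬ IsUnit (-A).det := by
      rw [Matrix.det_neg, isUnit_iff_ne_zero] at *
      simpa using h
    rw [Matrix.nonsing_inv_apply_not_isUnit A h, Matrix.nonsing_inv_apply_not_isUnit _ h', neg_zero]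

lemma inverseForm_antisymm (hΩ : ∀ x v, Ω x v v = 0) (x : M) (i j : Fin d) :
    inverseForm Ω x j i = -inverseForm Ω x i j := by
  have h1 : (Matrix.of fun i j => Ω x (stdVec x i) (stdVec x j)).transpose =
      -(Matrix.of fun i j => Ω x (stdVec x i) (stdVec x j)) := by
    ext i j
    have h := hΩ x (stdVec x i + stdVec x j)
    simp only [map_add, _root_.add_apply, hΩ] at h
    simp only [Matrix.transpose_apply, Matrix.of_apply, Matrix.neg_apply]
    linarith
  have h2 := congrArg (fun A : Matrix (Fin d) (Fin d) ℝ => A⁻¹ i j) h1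
  simp only [← Matrix.transpose_nonsing_inv] at h2
  have h3 : (-(Matrix.of fun i j => Ω x (stdVec x i) (stdVec x j)))⁻¹ = -inverseForm Ω x :=
    matrix_inv_neg _
  exact h2.trans (congrFun (congrFun h3 i) j)

variable [T2Space M] {r : M → WeylForm d 1} {a b : M → WeylForm d 0} {f g : M → ℂ}

/-- The linear part of a flat section with symbol `f` is the differential of `f`. -/
lemma fderiv_eq_of_flat (h : IsFedosovManifold Ω cov) (hr : IsSmoothWeylForm r)
    (hd : FormDegGE 3 r) (ha : IsSmoothWeylForm a) (ha0 : fedosovD Ω cov r a = 0)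
    (hf : ∀ z y w, a z 0 0 y w = f z) (z : M) (y v : Euc d) (w : Fin 0 → Euc d) :
    fderiv ℝ (fun t => a z 0 1 t w) y v = mvfderiv (𝓡 d) f z v := by
  have h1 : FormDegGE 1 (weylBracket Ω r a) := eq_zero_of_rep1 (h := h) fun x₀ =>
    have hρ := rep1_local (h := h) (x₀ := x₀) hr
    have hF := rep0_local (h := h) (x₀ := x₀) ha Fin.elim0
    ⟨_, Rep0.weylBracket hr.isWeylForm ha.isWeylForm hρ hF, fun i =>
      DegGE.br (hρ.degGE hd i) (hF.degGE (fun _ _ _ _ _ h => absurd h (Nat.not_lt_zero _)))⟩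
  have h2 : weylNabla cov a z 0 0 y (fun _ => v) = mvfderiv (𝓡 d) f z v := by
    have e1 : (fun t : Euc d => a z 0 0 t fun j => v) = fun _ => f z := funext fun t => hf _ _ _
    have e2 : fderiv ℝ (fun t : Euc d => a z 0 0 t fun j => v) y = 0 := by
      rw [e1]
      exact (hasFDerivAt_const _ _).fderiv
    have e3 : (fun z' : M => a z' 0 0 (extVec z y z') fun j => extVec z v z') = f :=
      funext fun t => hf _ _ _
    rw [weylNabla, Fin.sum_univ_one, Fin.val_zero, pow_zero, one_mul, e2]
    refine (sub_zero _).trans ?_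
    exact congrArg (fun q : M → ℂ => mvfderiv (𝓡 d) q z v) e3
  -- The component of `D a = 0` of degree zero, to which the bracket with `r` does not contribute.
  have h3 : weylNabla cov a z 0 0 y (fun _ => v) - weylDelta a z 0 0 y (fun _ => v) +
      weylBracket Ω r a z 0 0 y (fun _ => v) = 0 :=
    congrFun (congrFun (congrFun (congrFun (congrFun ha0 z) 0) 0) y) (fun _ => v)
  rw [h1 z 0 0 y _ (by norm_num), h2, weylDelta_zero, add_zero, sub_eq_zero] at h3
  rw [h3]
  exact congrArg (fun w' => fderiv ℝ (fun t => a z 0 1 t w') y v) (Subsingleton.elim _ _)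

/-- The commutator of two flat sections is given to first order by the Poisson bracket of their
symbols. -/
lemma weylMul_sub_weylMul (h : IsFedosovManifold Ω cov) (hr : IsSmoothWeylForm r)
    (hd : FormDegGE 3 r) (ha : IsSmoothWeylForm a) (hb : IsSmoothWeylForm b)
    (ha0 : fedosovD Ω cov r a = 0) (hb0 : fedosovD Ω cov r b = 0)
    (hf : ∀ z y w, a z 0 0 y w = f z) (hg : ∀ z y w, b z 0 0 y w = g z)
    (ha1 : ∀ z y w, a z 1 0 y w = 0) (hb1 : ∀ z y w, b z 1 0 y w = 0)
    (z : M) (y : Euc d) (w : Fin 0 → Euc d) :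
    weylMul Ω a b z 1 0 y w - weylMul Ω b a z 1 0 y w = Complex.I * chartPoisson Ω f g z := by
  have e1 : weylMul Ω a b z 1 0 y w = _ := moyal_one_zero (inverseForm Ω z) (a := (a z).eval w)
    (b := (b z).eval w) (y := y) (fun t => (hf z t w).trans (hf z y w).symm)
    (fun t => (hg z t w).trans (hg z y w).symm) (ha1 z y w) (hb1 z y w)
  have e2 : weylMul Ω b a z 1 0 y w = _ := moyal_one_zero (inverseForm Ω z) (a := (b z).eval w)
    (b := (a z).eval w) (y := y) (fun t => (hg z t w).trans (hg z y w).symm)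
    (fun t => (hf z t w).trans (hf z y w).symm) (hb1 z y w) (ha1 z y w)
  have da : ∀ i, fderiv ℝ ((a z).eval w 0 1) y (EuclideanSpace.single i 1) =
    mvfderiv (𝓡 d) f z (stdVec z i) := fun i => fderiv_eq_of_flat h hr hd ha ha0 hf z y _ w
  have db : ∀ i, fderiv ℝ ((b z).eval w 0 1) y (EuclideanSpace.single i 1) =
    mvfderiv (𝓡 d) g z (stdVec z i) := fun i => fderiv_eq_of_flat h hr hd hb hb0 hg z y _ w
  have e3 : ∑ i, ∑ j, (inverseForm Ω z i j : ℂ) * mvfderiv (𝓡 d) g z (stdVec z i) *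
      mvfderiv (𝓡 d) f z (stdVec z j) = -∑ i, ∑ j, (inverseForm Ω z i j : ℂ) *
        mvfderiv (𝓡 d) f z (stdVec z i) * mvfderiv (𝓡 d) g z (stdVec z j) := by
    rw [sum_comm, ← sum_neg_distrib]
    refine sum_congr rfl fun i _ => ?_
    rw [← sum_neg_distrib]
    refine sum_congr rfl fun j _ => ?_
    rw [inverseForm_antisymm h.symplectic.alternating z i j]
    push_cast
    ring
  rw [e1, e2, chartPoisson]
  simp only [da, db]
  rw [e3]
  ring

/-- The symbol of a product is the product of the symbols modulo `λ`. -/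
lemma weylMul_zero_zero (a b : M → WeylForm d 0) (z : M) (y : Euc d) (w : Fin 0 → Euc d) :
    weylMul Ω a b z 0 0 y w = a z 0 0 y w * b z 0 0 y w :=
  moyal_zero_zero _ _ _ _

end Semiclassical

/-! ### Sections over an orbispace and Fedosov's one-form -/

section Families
open OrbispaceFunctor

variable {X : Type u} [TopologicalSpace X] {S : OrbispaceFunctor.{u, v, w} X} {l : ℕ}

/-- The maps between the charts of an orbispace with which sections have to be compatible: the
elements of the groups and the transition maps. -/
inductive IsStructureMap (S : OrbispaceFunctor.{u, v, w} X) :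
    ∀ V U : S.Index, (S.chart V → S.chart U) → Prop
  | action (U : S.Index) (g : (S.chart U).group) : IsStructureMap S U U (fun x => g • x)
  | trans {V U : S.Index} (h : V.1 ⊆ U.1) : IsStructureMap S V U (S.trans h).map

lemma isLocalDiffeomorph_smul (N : SymManifold.{v, w}) (g : N.group) :
    IsLocalDiffeomorph (𝓡 N.dim) (𝓡 N.dim) ∞ (fun x : N => g • x) := by
  have h1 : ∀ g : N.group, ContMDiff (𝓡 N.dim) (𝓡 N.dim) ∞ (fun x : N => g • x) := fun g =>
    ContMDiff.smul (I := 𝓡 N.groupDim) (f := fun _ => g) contMDiff_const contMDiff_id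
  let Φ : Diffeomorph (𝓡 N.dim) (𝓡 N.dim) N N ∞ :=
    { toEquiv := MulAction.toPerm g
      contMDiff_toFun := h1 g
      contMDiff_invFun := h1 g⁻¹ }
  exact Φ.isLocalDiffeomorph

lemma isWeylSection_iff {a : S.WeylFamily l} : IsWeylSection a ↔
    (∀ U, IsSmoothWeylForm (a U)) ∧
      ∀ V U φ, IsStructureMap S V U φ → PreservesWeylForm φ (a V) (a U) := by
  constructor
  · rintro ⟨h1, h2, h3⟩
    refine ⟨h1, ?_⟩
    rintro _ _ _ (g | h)
    · exact h2 _ g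
    · exact h3 h
  · rintro ⟨h1, h2⟩
    exact ⟨h1, fun U g => h2 _ _ _ (.action U g), fun h => h2 _ _ _ (.trans h)⟩

variable {Ω : S.SymplecticForm} {nab : S.Connection}

lemma isFedosovManifold (hnab : nab.IsSymplectic Ω) (U : S.Index) :
    IsFedosovManifold (Ω.form U) (nab.cov U) :=
  ⟨Ω.symplectic U, nab.smooth U, hnab.torsionFree U, hnab.parallel U⟩

lemma IsStructureMap.isFedosovMap (Ω : S.SymplecticForm) (nab : S.Connection) {V U : S.Index}
    {φ : S.chart V → S.chart U} (hφ : IsStructureMap S V U φ) :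
    IsFedosovMap φ (Ω.form V) (nab.cov V) (Ω.form U) (nab.cov U) := by
  cases hφ with
  | action g => exact ⟨isLocalDiffeomorph_smul _ g, Ω.invariant _ g, nab.invariant _ g⟩
  | trans h => exact ⟨(S.trans h).localDiffeo, Ω.compatible h, nab.compatible h⟩

lemma degreeGE_mono {m n : ℕ} (hmn : m ≤ n) {a : S.WeylFamily l}
    (ha : FedosovDegreeGE n a) : FedosovDegreeGE m a := fun U x k s y w h =>
  ha U x k s y w (h.trans_le hmn)

lemma degreeGE_sub_trans {n : ℕ} {a b c : S.WeylFamily l} (h1 : FedosovDegreeGE n (a - b))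
    (h2 : FedosovDegreeGE n (b - c)) : FedosovDegreeGE n (a - c) := fun U x k s y w h => by
  have e1 : a U x k s y w - b U x k s y w = 0 := h1 U x k s y w h
  have e2 : b U x k s y w - c U x k s y w = 0 := h2 U x k s y w h
  exact (sub_eq_zero.2 ((sub_eq_zero.1 e1).trans (sub_eq_zero.1 e2)) :
    a U x k s y w - c U x k s y w = 0)

lemma degreeGE_sub_symm {n : ℕ} {a b : S.WeylFamily l} (h1 : FedosovDegreeGE n (a - b)) :
    FedosovDegreeGE n (b - a) := fun U x k s y w h => by
  have e1 : a U x k s y w - b U x k s y w = 0 := h1 U x k s y w h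
  exact (sub_eq_zero.2 (sub_eq_zero.1 e1).symm : b U x k s y w - a U x k s y w = 0)

lemma eq_of_fedosovDegreeGE {a b : S.WeylFamily l} (h : ∀ n, FedosovDegreeGE n (a - b)) :
    a = b := by
  ext U x k s y w
  exact sub_eq_zero.1 (h (s + 2 * k + 1) U x k s y w (by omega) :
    a U x k s y w - b U x k s y w = 0)

/-- Banach's fixed point theorem for the degree filtration. -/
lemma existsUnique_fixed {P : S.WeylFamily l → Prop} {T : S.WeylFamily l → S.WeylFamily l}
    (hT : ∀ a, P a → P (T a))
    (hc : ∀ a b n, P a → P b → FedosovDegreeGE n (a - b) → FedosovDegreeGE (n + 1) (T a - T b))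
    (hcl : ∀ a, (∀ n, ∃ b, P b ∧ FedosovDegreeGE n (a - b)) → P a) {a₀ : S.WeylFamily l}
    (h0 : P a₀) : ∃! a, P a ∧ T a = a := by
  set q : ℕ → S.WeylFamily l := fun n => T^[n] a₀ with hq
  have hs : ∀ n, q (n + 1) = T (q n) := fun n => Function.iterate_succ_apply' T n a₀
  have hP : ∀ n, P (q n) := fun n => by
    induction n with
    | zero => exact h0
    | succ n ih => rw [hs]; exact hT _ ih
  have h1 : ∀ n, FedosovDegreeGE n (q (n + 1) - q n) := fun n => by
    induction n with
    | zero => exact fun _ _ _ _ _ _ h => absurd h (Nat.not_lt_zero _)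
    | succ n ih =>
      rw [hs (n + 1), hs n]
      refine hc _ _ _ (hT _ (hP n)) (hP n) ?_
      rw [← hs n]
      exact ih
  have h2 : ∀ n m, FedosovDegreeGE n (q (n + m) - q n) := fun n m => by
    induction m with
    | zero => exact fun _ _ _ _ _ _ _ => sub_self _
    | succ m ih => exact degreeGE_sub_trans (degreeGE_mono (Nat.le_add_right n m) (h1 (n + m))) ih
  -- The components of degree `n` of the iterates are constant from the index `n + 1` on.
  let a : S.WeylFamily l := fun U x k s => q (s + 2 * k + 1) U x k s
  have h3 : ∀ n, FedosovDegreeGE n (a - q n) := fun n U x k s y w h => by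
    obtain ⟨m, rfl⟩ := Nat.exists_eq_add_of_lt h
    have := degreeGE_sub_symm (h2 (s + 2 * k + 1) m) U x k s y w (by omega)
    rw [show s + 2 * k + m + 1 = s + 2 * k + 1 + m by ring]
    exact this
  have ha : P a := hcl a fun n => ⟨q n, hP n, h3 n⟩
  refine ⟨a, ⟨ha, eq_of_fedosovDegreeGE fun n => ?_⟩, ?_⟩
  · have h4 := hc _ _ n ha (hP n) (h3 n)
    rw [← hs n] at h4
    exact degreeGE_mono n.le_succ (degreeGE_sub_trans h4 (degreeGE_sub_symm (h3 (n + 1))))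
  · rintro b ⟨hb, hb'⟩
    refine eq_of_fedosovDegreeGE fun n => ?_
    induction n with
    | zero => exact fun _ _ _ _ _ _ h => absurd h (Nat.not_lt_zero _)
    | succ n ih =>
      have h4 := hc _ _ n ha (hP n) (h3 n)
      have h5 := hc _ _ n hb ha ih
      rw [hb'] at h5
      rw [← hs n] at h4
      exact degreeGE_sub_trans h5 (degreeGE_sub_trans h4 (degreeGE_sub_symm (h3 (n + 1))))

/-- The set of sections is closed for the degree filtration. -/
lemma isWeylSection_of_approx {a : S.WeylFamily l}
    (h : ∀ n, ∃ b, IsWeylSection b ∧ FedosovDegreeGE n (a - b)) : IsWeylSection a := by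
  have h' : ∀ k s : ℕ, ∃ b : S.WeylFamily l, IsWeylSection b ∧
      ∀ U x, a U x k s = b U x k s := fun k s => by
    obtain ⟨b, hb, hab⟩ := h (s + 2 * k + 1)
    exact ⟨b, hb, fun U x => funext fun y => funext fun w =>
      sub_eq_zero.1 (hab U x k s y w (by omega))⟩
  refine isWeylSection_iff.2 ⟨fun U => ⟨fun x => ⟨fun k s w => ?_, fun k s y => ?_⟩,
    fun k s η ζ hη hζ => ?_⟩, fun V U φ hφ x k s y w => ?_⟩ <;> obtain ⟨b, hb, hab⟩ := h' k s
  · obtain ⟨A, hA⟩ := ((hb.smooth U).isWeylForm x).polynomial k s w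
    exact ⟨A, fun y => by rw [hab, hA]⟩
  · obtain ⟨B, hB⟩ := ((hb.smooth U).isWeylForm x).alternating k s y
    exact ⟨B, fun w => by rw [hab, hB]⟩
  · simp only [hab]
    exact (hb.smooth U).smooth k s η ζ hη hζ
  · rw [hab, hab]
    exact (isWeylSection_iff.1 hb).2 V U φ hφ x k s y w

lemma isSmoothWeylForm_zero {d l : ℕ} {M : Type v} [TopologicalSpace M] [ChartedSpace (Euc d) M]
    [IsManifold (𝓡 d) ∞ M] : IsSmoothWeylForm (0 : M → WeylForm d l) :=
  ⟨fun _ => ⟨fun _ _ _ => ⟨0, fun _ => rfl⟩, fun _ _ _ => ⟨0, fun _ => rfl⟩⟩,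
    fun _ _ _ _ _ _ => contMDiff_const⟩

lemma isWeylSection_zero : IsWeylSection (0 : S.WeylFamily l) :=
  isWeylSection_iff.2 ⟨fun _ => isSmoothWeylForm_zero, fun _ _ _ _ _ _ _ _ _ => rfl⟩

lemma fedosovStep_zero {d : ℕ} {M : Type v} [TopologicalSpace M] [ChartedSpace (Euc d) M]
    [IsManifold (𝓡 d) ∞ M] (Ω : FormField d M) (cov : AffineConnection d M) :
    fedosovStep Ω cov 0 = weylDeltaInv (weylCurvature Ω cov) := by
  have h1 : weylNabla cov (0 : M → WeylForm d 1) = 0 := by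
    ext z k s y w
    refine sum_eq_zero fun i _ => mul_eq_zero_of_right _ ?_
    have e1 : fderiv ℝ (fun t : Euc d => ((0 : M → WeylForm d 1) z k s t
        (fun j => w (i.succAbove j)))) y = 0 := (hasFDerivAt_const _ _).fderiv
    have e2 : mvfderiv (𝓡 d) (fun z' : M => (0 : M → WeylForm d 1) z' k s (extVec z y z')
        (fun j => extVec z (w (i.succAbove j)) z')) z = 0 := mfderiv_const
    rw [e1, e2]
    exact sub_zero _
  have h2 : weylSquare Ω (0 : M → WeylForm d 1) = 0 := by
    ext z k s y w
    exact mul_eq_zero_of_right _ (sub_self _)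
  have h3 : weylDeltaInv (0 : M → WeylForm d 2) = 0 := by
    ext z k s y w
    cases s with
    | zero => rfl
    | succ q => exact mul_zero _
  rw [fedosovStep, h1, h2, add_zero, h3, add_zero]

lemma fedosovInit_eq_zero {U : S.Index} {x : S.chart U} {k s : ℕ} (hks : ¬ (k = 0 ∧ s = 3))
    (y : Euc (S.chart U).dim) (w : Fin 1 → Euc (S.chart U).dim) :
    fedosovInit Ω nab U x k s y w = 0 := by
  cases s with
  | zero => rfl
  | succ q => exact mul_eq_zero_of_right _ (if_neg fun h => hks ⟨h.1, by omega⟩)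

lemma existsUnique_fixed_fedosovStep (hnab : nab.IsSymplectic Ω) :
    ∃! r : S.WeylFamily 1, (IsWeylSection r ∧ FedosovDegreeGE 3 r) ∧
      (fun U => fedosovStep (Ω.form U) (nab.cov U) (r U)) = r := by
  refine existsUnique_fixed (P := fun r => IsWeylSection r ∧ FedosovDegreeGE 3 r)
    (T := fun r U => fedosovStep (Ω.form U) (nab.cov U) (r U)) ?_ ?_ ?_
    ⟨isWeylSection_zero, fun _ _ _ _ _ _ _ => rfl⟩
  · rintro r ⟨hr, hd⟩
    exact ⟨isWeylSection_iff.2 ⟨fun U => isSmooth_fedosovStep (isFedosovManifold hnab U)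
      (hr.smooth U), fun V U φ hφ => (hφ.isFedosovMap Ω nab).fedosovStep
        (isFedosovManifold hnab V) (isFedosovManifold hnab U) (hr.smooth V) (hr.smooth U)
        ((isWeylSection_iff.1 hr).2 V U φ hφ)⟩,
      fun U => fedosovStep_degGE (isFedosovManifold hnab U) (hr.smooth U) (hd U)⟩
  · rintro a b n ⟨ha, ha'⟩ ⟨hb, hb'⟩ h U
    exact fedosovStep_contract (isFedosovManifold hnab U) (ha.smooth U) (hb.smooth U) (ha' U)
      (hb' U) (h U)
  · intro a h
    refine ⟨isWeylSection_of_approx fun n => ?_, fun U x k s y w hks => ?_⟩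
    · obtain ⟨b, hb, hab⟩ := h n
      exact ⟨b, hb.1, hab⟩
    · obtain ⟨b, hb, hab⟩ := h 3
      exact (sub_eq_zero.1 (hab U x k s y w hks)).trans (hb.2 U x k s y w hks)

/-- Fedosov's form is the fixed point of degree at least three of `fedosovStep`. The degree
condition is relative to the degree of `δ⁻ R`, which is infinite if the connection has no
curvature; then the fixed point is zero. -/
lemma isFedosovForm_iff (hnab : nab.IsSymplectic Ω) (r : S.WeylFamily 1) :
    IsFedosovForm Ω nab r ↔ (IsWeylSection r ∧ FedosovDegreeGE 3 r) ∧
      (fun U => fedosovStep (Ω.form U) (nab.cov U) (r U)) = r := by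
  have h3 : FedosovDegreeGE 3 (fedosovInit Ω nab) := fun U x k s y w hks =>
    fedosovInit_eq_zero (by omega) y w
  constructor
  · rintro ⟨h1, h2, h4⟩
    exact ⟨⟨h1, h2 3 h3⟩, funext fun U => (h4 U).symm⟩
  · rintro ⟨⟨h1, h2⟩, h4⟩
    refine ⟨h1, fun n hn => ?_, fun U => (congrFun h4 U).symm⟩
    by_cases hn3 : n ≤ 3
    · exact degreeGE_mono hn3 h2
    · have h0 : fedosovInit Ω nab = 0 := by
        ext U x k s y w
        by_cases hks : k = 0 ∧ s = 3
        · exact hn U x k s y w (by omega)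
        · exact fedosovInit_eq_zero hks y w
      have h5 : r = 0 := (existsUnique_fixed_fedosovStep hnab).unique ⟨⟨h1, h2⟩, h4⟩
        ⟨⟨isWeylSection_zero, fun _ _ _ _ _ _ _ => rfl⟩,
          funext fun U => (fedosovStep_zero _ _).trans (congrFun h0 U)⟩
      rw [h5]
      exact fun _ _ _ _ _ _ _ => rfl

lemma existsUnique_isFedosovForm (hnab : nab.IsSymplectic Ω) :
    ∃! r : S.WeylFamily 1, IsFedosovForm Ω nab r := by
  simpa only [isFedosovForm_iff hnab] using existsUnique_fixed_fedosovStep hnab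

section Flat

variable (hnab : nab.IsSymplectic Ω) {r : S.WeylFamily 1} (hr : IsFedosovForm Ω nab r)

include hnab hr

lemma isFedosovForm_formDegGE (U : S.Index) : FormDegGE 3 (r U) :=
  ((isFedosovForm_iff hnab r).1 hr).1.2 U

lemma isFedosovForm_step_eq (U : S.Index) :
    fedosovStep (Ω.form U) (nab.cov U) (r U) = r U :=
  congrFun ((isFedosovForm_iff hnab r).1 hr).2 U

lemma connD_connD {a : S.WeylFamily 0} (ha : IsWeylSection a) :
    connD Ω nab r (connD Ω nab r a) = 0 :=
  funext fun U => fedosovD_fedosovD (hr.isSection.smooth U) (isFedosovForm_step_eq hnab hr U)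
    (isFedosovManifold hnab U) (isFedosovForm_formDegGE hnab hr U) (ha.smooth U)

end Flat

end Families

/-! ### Flat sections and their symbols -/

section Symbols
open OrbispaceFunctor

variable {X : Type u} [TopologicalSpace X] {S : OrbispaceFunctor.{u, v, w} X}

lemma proj_mem (U : S.Index) (x : S.chart U) : S.proj U x ∈ U.1 := by
  obtain ⟨h, hh⟩ := S.proj_homeo U
  rw [← hh x]
  exact (h _).2

lemma exists_proj_eq (U : S.Index) {p : X} (hp : p ∈ U.1) : ∃ x, S.proj U x = p := by
  obtain ⟨h, hh⟩ := S.proj_homeo U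
  obtain ⟨x, hx⟩ := Quotient.exists_rep (h.symm ⟨p, hp⟩)
  refine ⟨x, ?_⟩
  rw [← hh x]
  have : h (Quotient.mk _ x) = ⟨p, hp⟩ := by rw [hx]; exact h.apply_symm_apply _
  exact congrArg Subtype.val this

lemma proj_smul (U : S.Index) (g : (S.chart U).group) (x : S.chart U) :
    S.proj U (g • x) = S.proj U x := by
  obtain ⟨h, hh⟩ := S.proj_homeo U
  rw [← hh x, ← hh (g • x)]
  exact congrArg (fun q => ((h q : U.1) : X)) (Quotient.sound ⟨g, rfl⟩)

lemma exists_smul_eq_of_proj_eq {U : S.Index} {x x' : S.chart U}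
    (hx : S.proj U x = S.proj U x') : ∃ g : (S.chart U).group, g • x' = x := by
  obtain ⟨h, hh⟩ := S.proj_homeo U
  rw [← hh x, ← hh x'] at hx
  exact Quotient.exact (h.injective (Subtype.ext hx))

lemma IsStructureMap.proj_eq {V U : S.Index} {φ : S.chart V → S.chart U}
    (hφ : IsStructureMap S V U φ) (x : S.chart V) : S.proj U (φ x) = S.proj V x := by
  cases hφ with
  | action g => exact proj_smul _ g x
  | trans h => exact S.proj_trans h x

lemma exists_index_mem (S : OrbispaceFunctor.{u, v, w} X) (p : X) : ∃ U : S.Index, p ∈ U.1 := by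
  obtain ⟨u, hu, hp⟩ : ∃ u ∈ S.cover, p ∈ u := by
    have : p ∈ ⋃₀ S.cover := by rw [S.cover_sUnion]; trivial
    exact this
  have hp' : p ∈ ⋂₀ ({u} : Set (Set X)) := by simpa using hp
  exact ⟨⟨connectedComponentIn (⋂₀ {u}) p, {u}, Set.finite_singleton u,
    Set.singleton_nonempty u, Set.singleton_subset_iff.2 hu, p, hp', rfl⟩,
    mem_connectedComponentIn hp'⟩

/-- The chart domains form a basis of neighbourhoods relative to any two of them. -/
lemma exists_index_subset {U V : S.Index} {p : X} (hU : p ∈ U.1) (hV : p ∈ V.1) :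
    ∃ W : S.Index, p ∈ W.1 ∧ W.1 ⊆ U.1 ∧ W.1 ⊆ V.1 := by
  obtain ⟨U, F, hF1, hF2, hF3, x, hx, rfl⟩ := U
  obtain ⟨V, G, hG1, hG2, hG3, y, hy, rfl⟩ := V
  have hp : p ∈ ⋂₀ (F ∪ G) := by
    rw [Set.sInter_union]
    exact ⟨connectedComponentIn_subset _ _ hU, connectedComponentIn_subset _ _ hV⟩
  refine ⟨⟨connectedComponentIn (⋂₀ (F ∪ G)) p, F ∪ G, hF1.union hG1, hF2.inl,
    Set.union_subset hF3 hG3, p, hp, rfl⟩, mem_connectedComponentIn hp, ?_, ?_⟩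
  · change connectedComponentIn (⋂₀ (F ∪ G)) p ⊆ connectedComponentIn (⋂₀ F) x
    rw [connectedComponentIn_eq hU]
    exact isPreconnected_connectedComponentIn.subset_connectedComponentIn
      (mem_connectedComponentIn hp) ((connectedComponentIn_subset _ _).trans
        (Set.sInter_subset_sInter Set.subset_union_left))
  · change connectedComponentIn (⋂₀ (F ∪ G)) p ⊆ connectedComponentIn (⋂₀ G) y
    rw [connectedComponentIn_eq hV]
    exact isPreconnected_connectedComponentIn.subset_connectedComponentIn
      (mem_connectedComponentIn hp) ((connectedComponentIn_subset _ _).trans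
        (Set.sInter_subset_sInter Set.subset_union_right))

lemma isOpen_index [LocallyConnectedSpace X] (U : S.Index) : IsOpen U.1 := by
  obtain ⟨U, F, hF1, hF2, hF3, x, hx, rfl⟩ := U
  exact (hF1.isOpen_sInter fun u hu => S.cover_isOpen u (hF3 hu)).connectedComponentIn

/-- Compatible families of smooth functions on the charts descend to the orbispace. -/
lemma exists_smoothFunctions [LocallyConnectedSpace X] {φ : ∀ U : S.Index, S.chart U → ℂ}
    (hs : ∀ U, ContMDiff (𝓡 (S.chart U).dim) 𝓘(ℝ, ℂ) ∞ (φ U))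
    (hφ : ∀ V U ψ, IsStructureMap S V U ψ → ∀ x, φ U (ψ x) = φ V x) :
    ∃ f : S.smoothFunctions, ∀ U x, f.1 (S.proj U x) = φ U x := by
  have h1 : ∀ {U : S.Index} {x x' : S.chart U}, S.proj U x = S.proj U x' → φ U x = φ U x' := by
    intro U x x' hx
    obtain ⟨g, rfl⟩ := exists_smul_eq_of_proj_eq hx
    exact hφ U U _ (.action U g) x'
  -- Values in different charts are compared in a chart that embeds into both.
  have h2 : ∀ {U V : S.Index} {x : S.chart U} {y : S.chart V}, S.proj U x = S.proj V y →
      φ U x = φ V y := by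
    intro U V x y hxy
    obtain ⟨W, hW, hWU, hWV⟩ := exists_index_subset (proj_mem U x)
      (by rw [hxy]; exact proj_mem V y)
    obtain ⟨z, hz⟩ := exists_proj_eq W hW
    have e1 : φ U x = φ U ((S.trans hWU).map z) := h1 (by rw [S.proj_trans, hz])
    have e2 : φ V y = φ V ((S.trans hWV).map z) := h1 (by rw [S.proj_trans, hz, hxy])
    rw [e1, e2, hφ _ _ _ (.trans hWU), hφ _ _ _ (.trans hWV)]
  choose I hI using exists_index_mem S
  choose s hs' using fun p => exists_proj_eq (I p) (hI p)
  let f : X → ℂ := fun p => φ (I p) (s p)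
  have hf : ∀ U x, f (S.proj U x) = φ U x := fun U x => h2 (hs' _)
  refine ⟨⟨f, continuous_iff_continuousAt.2 fun p => ?_, fun U => ?_⟩, hf⟩
  · refine ContinuousOn.continuousAt ?_ ((isOpen_index (I p)).mem_nhds (hI p))
    obtain ⟨h, hh⟩ := S.proj_homeo (I p)
    have hq : Topology.IsQuotientMap (fun x : S.chart (I p) =>
        (Quotient.mk _ x : MulAction.orbitRel.Quotient (S.chart (I p)).group (S.chart (I p)))) :=
      isQuotientMap_quotient_mk'
    refine continuousOn_iff_continuous_domRestrict.2 (h.comp_continuous_iff'.1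
      (hq.continuous_iff.2 ((hs (I p)).continuous.congr fun x => ?_)))
    rw [← hf, ← hh x]
    rfl
  · have e1 : (fun x => f (S.proj U x)) = φ U := funext (hf U)
    exact (congrArg (ContMDiff (𝓡 (S.chart U).dim) 𝓘(ℝ, ℂ) ∞) e1).mpr (hs U)

lemma smoothFunctions_ext {f g : S.smoothFunctions}
    (h : ∀ U x, f.1 (S.proj U x) = g.1 (S.proj U x)) : f = g := by
  refine Subtype.ext (funext fun p => ?_)
  obtain ⟨U, hU⟩ := exists_index_mem S p
  obtain ⟨x, rfl⟩ := exists_proj_eq U hU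
  exact h U x

/-- A section has at most one symbol. -/
lemma hasSymbol_unique {a : S.WeylFamily 0} {f g : PowerSeries S.smoothFunctions}
    (hf : HasSymbol a f) (hg : HasSymbol a g) : f = g :=
  PowerSeries.ext fun k => smoothFunctions_ext fun U x =>
    (hf U x k 0 Fin.elim0).symm.trans (hg U x k 0 Fin.elim0)

lemma component_zero_eq {d : ℕ} {a : WeylForm d 0} (ha : IsWeylForm a) (k : ℕ) (y y' : Euc d)
    (w w' : Fin 0 → Euc d) : a k 0 y w = a k 0 y' w' := by
  obtain ⟨A, hA⟩ := ha.polynomial k 0 w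
  rw [Subsingleton.elim w' w, hA, hA]
  exact congrArg A (Subsingleton.elim _ _)

/-- Every section has a symbol. -/
lemma exists_hasSymbol [LocallyConnectedSpace X] {a : S.WeylFamily 0} (ha : IsWeylSection a) :
    ∃ f, HasSymbol a f := by
  have h1 : ∀ k, ∃ f : S.smoothFunctions, ∀ U x, f.1 (S.proj U x) = a U x k 0 0 Fin.elim0 := by
    intro k
    refine exists_smoothFunctions (fun U => ?_) fun V U ψ hψ x => ?_
    · have h2 := (ha.smooth U).smooth k 0 (fun _ => 0) Fin.elim0
        (contMDiff_zeroSection ℝ _) (fun j => j.elim0)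
      refine (congrArg (ContMDiff (𝓡 (S.chart U).dim) 𝓘(ℝ, ℂ) ∞) (funext fun x => ?_)).mp h2
      exact component_zero_eq ((ha.smooth U).isWeylForm x) k _ _ _ _
    · refine Eq.trans ?_ ((isWeylSection_iff.1 ha).2 V U ψ hψ x k 0 0 Fin.elim0)
      exact component_zero_eq ((ha.smooth U).isWeylForm _) k _ _ _ _
  choose f hf using h1
  refine ⟨PowerSeries.mk f, fun U x k y w => ?_⟩
  rw [PowerSeries.coeff_mk, hf]
  exact component_zero_eq ((ha.smooth U).isWeylForm _) k _ _ _ _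

/-- The section of polynomial degree zero given by a formal power series of functions. -/
def symbolFamily (f : PowerSeries S.smoothFunctions) : S.WeylFamily 0 := fun U x k s _ _ =>
  if s = 0 then (PowerSeries.coeff k f : S.smoothFunctions).1 (S.proj U x) else 0

lemma isWeylSection_symbolFamily (f : PowerSeries S.smoothFunctions) :
    IsWeylSection (symbolFamily f) := by
  refine isWeylSection_iff.2 ⟨fun U => ⟨fun x => ⟨fun k s w => ?_, fun k s y => ?_⟩,
    fun k s η ζ hη hζ => ?_⟩, fun V U φ hφ x k s y w => ?_⟩
  · cases s with
    | zero => exact ⟨MultilinearMap.constOfIsEmpty ℝ _ _, fun _ => rfl⟩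
    | succ s => exact ⟨0, fun _ => rfl⟩
  · exact ⟨AlternatingMap.constOfIsEmpty ℝ _ _ _, fun _ => rfl⟩
  · cases s with
    | zero => exact (PowerSeries.coeff k f).2.2 U
    | succ s => exact contMDiff_const
  · cases s with
    | zero => exact congrArg (PowerSeries.coeff k f).1 (hφ.proj_eq x)
    | succ s => rfl

variable {Ω : S.SymplecticForm} {nab : S.Connection} (hnab : nab.IsSymplectic Ω)
  {r : S.WeylFamily 1} (hr : IsFedosovForm Ω nab r)

include hnab hr

lemma existsUnique_fixed_liftStep (f : PowerSeries S.smoothFunctions) :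
    ∃! a : S.WeylFamily 0, IsWeylSection a ∧
      (fun U => liftStep (Ω.form U) (nab.cov U) (r U) (symbolFamily f U) (a U)) = a := by
  refine existsUnique_fixed (P := IsWeylSection)
    (T := fun a U => liftStep (Ω.form U) (nab.cov U) (r U) (symbolFamily f U) (a U)) ?_ ?_
    (fun a => isWeylSection_of_approx) isWeylSection_zero
  · intro a ha
    exact isWeylSection_iff.2 ⟨fun U => isSmooth_liftStep (hr.isSection.smooth U)
      (isFedosovManifold hnab U) ((isWeylSection_symbolFamily f).smooth U) (ha.smooth U),
      fun V U φ hφ => (hφ.isFedosovMap Ω nab).liftStep (isFedosovManifold hnab V)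
        (isFedosovManifold hnab U) (hr.isSection.smooth U) (ha.smooth V) (ha.smooth U)
        ((isWeylSection_iff.1 hr.isSection).2 V U φ hφ)
        ((isWeylSection_iff.1 (isWeylSection_symbolFamily f)).2 V U φ hφ)
        ((isWeylSection_iff.1 ha).2 V U φ hφ)⟩
  · intro a b n ha hb h U
    exact liftStep_contract (hr.isSection.smooth U) (isFedosovManifold hnab U)
      (isFedosovForm_formDegGE hnab hr U) ((isWeylSection_symbolFamily f).smooth U) (ha.smooth U)
      (hb.smooth U) (h U)

/-- Every formal power series of functions is the symbol of a flat section. -/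
lemma exists_flatSection (f : PowerSeries S.smoothFunctions) :
    ∃ a, IsFlatSection Ω nab r a ∧ HasSymbol a f := by
  obtain ⟨a, ⟨ha, ha'⟩, -⟩ := existsUnique_fixed_liftStep hnab hr f
  refine ⟨a, ⟨ha, funext fun U => fedosovD_eq_zero_of_fixed (hr.isSection.smooth U)
    (isFedosovManifold hnab U) (isFedosovForm_step_eq hnab hr U)
    (isFedosovForm_formDegGE hnab hr U) ((isWeylSection_symbolFamily f).smooth U)
    (fun z k s y w hs => if_neg hs) (ha.smooth U) (congrFun ha' U)⟩, fun U x k y w => ?_⟩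
  have h1 : a U x k 0 y w = symbolFamily f U x k 0 y w + 0 :=
    (congrFun (congrFun (congrFun (congrFun (congrFun (congrFun ha' U) x) k) 0) y) w).symm
  rw [h1, add_zero]
  rfl

lemma isFlatSection_unique {a b : S.WeylFamily 0} {f : PowerSeries S.smoothFunctions}
    (ha : IsFlatSection Ω nab r a) (hb : IsFlatSection Ω nab r b) (haf : HasSymbol a f)
    (hbf : HasSymbol b f) : a = b :=
  funext fun U => eq_of_fedosovD (hr.isSection.smooth U) (isFedosovManifold hnab U)
    (isFedosovForm_formDegGE hnab hr U) (ha.1.smooth U) (hb.1.smooth U)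
    (fun z k y w => (haf U z k y w).trans (hbf U z k y w).symm) (congrFun ha.2 U) (congrFun hb.2 U)

end Symbols

/-! ### Formal power series as modules over formal power series of scalars -/

section FormalLinear
open PowerSeries

variable {K A B : Type*} [CommRing K] [CommRing A] [Algebra K A] [CommRing B] [Algebra K B]

lemma powerSeries_smul_eq (c : K⟦X⟧) (F : A⟦X⟧) :
    c • F = constantCoeff c • F + X * ((PowerSeries.mk fun n => coeff (n + 1) c) • F) := by
  have h1 : C (algebraMap K A (constantCoeff c)) * F = constantCoeff c • F := by
    ext n
    rw [coeff_C_mul, coeff_smul, Algebra.smul_def]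
  conv_lhs => rw [eq_X_mul_shift_add_const c]
  rw [Algebra.smul_def, algebraMap_apply'', map_add, map_mul, map_X, map_C, add_mul, h1, add_comm,
    mul_assoc]
  rfl

lemma powerSeries_X_smul (F : A⟦X⟧) : (X : K⟦X⟧) • F = X * F := by
  rw [Algebra.smul_def, algebraMap_apply'', map_X]

lemma powerSeries_map_X_mul (T : A⟦X⟧ →ₗ[K⟦X⟧] B⟦X⟧) (F : A⟦X⟧) : T (X * F) = X * T F := by
  rw [← powerSeries_X_smul (K := K), ← powerSeries_X_smul (K := K), map_smul]

/-- An additive map that commutes with scalars and with the formal parameter is linear over the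
formal power series of scalars: it is compatible with truncations. -/
lemma powerSeries_map_smul {T : A⟦X⟧ → B⟦X⟧} (hadd : ∀ F G, T (F + G) = T F + T G)
    (hsmul : ∀ (c : K) F, T (c • F) = c • T F) (hX : ∀ F, T (X * F) = X * T F) (c : K⟦X⟧)
    (F : A⟦X⟧) : T (c • F) = c • T F := by
  have h1 : ∀ (n : ℕ) (c : K⟦X⟧), coeff n (T (c • F)) = coeff n (c • T F) := by
    intro n
    induction n with
    | zero =>
      intro c
      rw [powerSeries_smul_eq c F, powerSeries_smul_eq c (T F), hadd, hsmul, hX, map_add, map_add,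
        coeff_zero_X_mul, coeff_zero_X_mul]
    | succ n ih =>
      intro c
      rw [powerSeries_smul_eq c F, powerSeries_smul_eq c (T F), hadd, hsmul, hX, map_add, map_add,
        coeff_succ_X_mul, coeff_succ_X_mul, ih]
  exact PowerSeries.ext fun n => h1 n c

lemma powerSeries_linearMap_ext {T T' : A⟦X⟧ →ₗ[K⟦X⟧] B⟦X⟧} (h : ∀ f, T (C f) = T' (C f)) :
    T = T' := by
  have h1 : ∀ (n : ℕ) (F : A⟦X⟧), coeff n (T F) = coeff n (T' F) := by
    intro n
    induction n with
    | zero =>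
      intro F
      rw [eq_X_mul_shift_add_const F, map_add T, map_add T', h, powerSeries_map_X_mul,
        powerSeries_map_X_mul, map_add, map_add, coeff_zero_X_mul, coeff_zero_X_mul]
    | succ n ih =>
      intro F
      rw [eq_X_mul_shift_add_const F, map_add T, map_add T', h, powerSeries_map_X_mul,
        powerSeries_map_X_mul, map_add, map_add, coeff_succ_X_mul, coeff_succ_X_mul, ih]
  exact LinearMap.ext fun F => PowerSeries.ext fun n => h1 n F

/-- Bilinear maps on formal power series are determined by their values on coefficients. -/
lemma powerSeries_bilinear_ext {T T' : A⟦X⟧ →ₗ[K⟦X⟧] A⟦X⟧ →ₗ[K⟦X⟧] B⟦X⟧}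
    (h : ∀ f g, T (C f) (C g) = T' (C f) (C g)) : T = T' := by
  refine LinearMap.ext fun F => LinearMap.ext fun G => ?_
  have h1 : T.flip G = T'.flip G := powerSeries_linearMap_ext fun f => by
    have h2 : T (C f) = T' (C f) := powerSeries_linearMap_ext (h f)
    exact congrArg (fun t => t G) h2
  exact congrArg (fun t => t F) h1

end FormalLinear

/-! ### The star product -/

section Star
open OrbispaceFunctor PowerSeries

variable {X : Type u} [TopologicalSpace X] {S : OrbispaceFunctor.{u, v, w} X}
  {Ω : S.SymplecticForm} {nab : S.Connection} {a b c : S.WeylFamily 0}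
  {f g : PowerSeries S.smoothFunctions}

lemma C_smul_eq (t : ℂ) (f : S.smoothFunctions) : C (t • f) = t • C f := by
  ext1 n
  rw [coeff_smul, coeff_C, coeff_C]
  split_ifs
  · rfl
  · rw [smul_zero]

/-- Multiplication of a family by the formal parameter. -/
def lambdaFamily (a : S.WeylFamily 0) : S.WeylFamily 0 := fun U => mulLambda (a U)

/-- The section `1`. -/
def oneFamily : S.WeylFamily 0 := fun _ => oneForm

section Symbol

lemma hasSymbol_add (ha : HasSymbol a f) (hb : HasSymbol b g) : HasSymbol (a + b) (f + g) :=
  fun U x k y w => by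
    rw [map_add]
    exact congrArg₂ (fun p q : ℂ => p + q) (ha U x k y w) (hb U x k y w)

lemma hasSymbol_smul (t : ℂ) (ha : HasSymbol a f) : HasSymbol (t • a) (t • f) :=
  fun U x k y w => by
    rw [coeff_smul]
    exact congrArg (fun p : ℂ => t * p) (ha U x k y w)

lemma hasSymbol_lambda (ha : HasSymbol a f) :
    HasSymbol (lambdaFamily a) (PowerSeries.X * f) := fun U x k y w => by
  cases k with
  | zero => rw [coeff_zero_X_mul]; rfl
  | succ k => rw [coeff_succ_X_mul]; exact ha U x k y w

lemma hasSymbol_one : HasSymbol (oneFamily : S.WeylFamily 0) 1 := fun U x k y w => by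
  rw [coeff_one]
  cases k with
  | zero => rfl
  | succ k => rfl

end Symbol

section Flat

variable (hnab : nab.IsSymplectic Ω) {r : S.WeylFamily 1} (hr : IsFedosovForm Ω nab r)

include hnab in
lemma isWeylSection_circ (ha : IsWeylSection a) (hb : IsWeylSection b) :
    IsWeylSection (circ Ω a b) :=
  isWeylSection_iff.2 ⟨fun U => isSmooth_weylMul (isFedosovManifold hnab U) (ha.smooth U)
    (hb.smooth U), fun V U φ hφ => (hφ.isFedosovMap Ω nab).weylMul (isFedosovManifold hnab V)
      (ha.smooth U).isWeylForm (hb.smooth U).isWeylForm ((isWeylSection_iff.1 ha).2 V U φ hφ)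
      ((isWeylSection_iff.1 hb).2 V U φ hφ)⟩

include hnab in
lemma isWeylSection_add (ha : IsWeylSection a) (hb : IsWeylSection b) : IsWeylSection (a + b) :=
  isWeylSection_iff.2 ⟨fun U => IsSmoothWeylForm.add (isFedosovManifold hnab U) (ha.smooth U)
    (hb.smooth U), fun V U φ hφ => preservesWeylForm_add ((isWeylSection_iff.1 ha).2 V U φ hφ)
      ((isWeylSection_iff.1 hb).2 V U φ hφ)⟩

include hnab in
lemma isWeylSection_smul (t : ℂ) (ha : IsWeylSection a) : IsWeylSection (t • a) :=
  isWeylSection_iff.2 ⟨fun U => IsSmoothWeylForm.smul (isFedosovManifold hnab U) t (ha.smooth U),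
    fun V U φ hφ x k s y w => congrArg (fun p : ℂ => t * p)
      ((isWeylSection_iff.1 ha).2 V U φ hφ x k s y w)⟩

include hnab in
lemma isWeylSection_lambda (ha : IsWeylSection a) : IsWeylSection (lambdaFamily a) :=
  isWeylSection_iff.2 ⟨fun U => IsSmoothWeylForm.mulLambda (isFedosovManifold hnab U) (ha.smooth U),
    fun V U φ hφ x k s y w => by
      cases k with
      | zero => rfl
      | succ k => exact (isWeylSection_iff.1 ha).2 V U φ hφ x k s y w⟩

lemma isWeylSection_one : IsWeylSection (oneFamily : S.WeylFamily 0) := by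
  have h1 : (oneFamily : S.WeylFamily 0) = symbolFamily 1 := by
    ext U x k s y w
    change (if k = 0 ∧ s = 0 then (1 : ℂ) else 0) = if s = 0 then _ else 0
    rw [coeff_one]
    cases s <;> cases k <;> rfl
  rw [h1]
  exact isWeylSection_symbolFamily 1

include hnab hr

lemma isFlatSection_circ (ha : IsFlatSection Ω nab r a) (hb : IsFlatSection Ω nab r b) :
    IsFlatSection Ω nab r (circ Ω a b) :=
  ⟨isWeylSection_circ hnab ha.1 hb.1, funext fun U => fedosovD_weylMul (hr.isSection.smooth U)
    (isFedosovManifold hnab U) (ha.1.smooth U) (hb.1.smooth U) (congrFun ha.2 U)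
    (congrFun hb.2 U)⟩

lemma isFlatSection_add (ha : IsFlatSection Ω nab r a) (hb : IsFlatSection Ω nab r b) :
    IsFlatSection Ω nab r (a + b) :=
  ⟨isWeylSection_add hnab ha.1 hb.1, funext fun U => fedosovD_add_eq_zero (hr.isSection.smooth U)
    (isFedosovManifold hnab U) (ha.1.smooth U) (hb.1.smooth U) (congrFun ha.2 U)
    (congrFun hb.2 U)⟩

lemma isFlatSection_smul (t : ℂ) (ha : IsFlatSection Ω nab r a) :
    IsFlatSection Ω nab r (t • a) :=
  ⟨isWeylSection_smul hnab t ha.1, funext fun U => fedosovD_smul_eq_zero (hr.isSection.smooth U)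
    (isFedosovManifold hnab U) t (ha.1.smooth U) (congrFun ha.2 U)⟩

lemma isFlatSection_lambda (ha : IsFlatSection Ω nab r a) :
    IsFlatSection Ω nab r (lambdaFamily a) :=
  ⟨isWeylSection_lambda hnab ha.1, funext fun U => fedosovD_mulLambda_eq_zero
    (hr.isSection.smooth U) (isFedosovManifold hnab U) (ha.1.smooth U) (congrFun ha.2 U)⟩

omit hnab hr in
lemma isFlatSection_one : IsFlatSection Ω nab r oneFamily :=
  ⟨isWeylSection_one, funext fun U => fedosovD_oneForm (r U)⟩

end Flat

section Product

variable [LocallyConnectedSpace X] (hnab : nab.IsSymplectic Ω) {r : S.WeylFamily 1}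
  (hr : IsFedosovForm Ω nab r)

/-- The flat section with a given symbol. -/
def flatLift (f : PowerSeries S.smoothFunctions) : S.WeylFamily 0 :=
  (exists_flatSection hnab hr f).choose

omit [LocallyConnectedSpace X] in
lemma flatLift_flat (f : PowerSeries S.smoothFunctions) :
    IsFlatSection Ω nab r (flatLift hnab hr f) :=
  (exists_flatSection hnab hr f).choose_spec.1

omit [LocallyConnectedSpace X] in
lemma flatLift_symbol (f : PowerSeries S.smoothFunctions) : HasSymbol (flatLift hnab hr f) f :=
  (exists_flatSection hnab hr f).choose_spec.2

omit [LocallyConnectedSpace X] in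
lemma flatLift_eq (ha : IsFlatSection Ω nab r a) (haf : HasSymbol a f) : flatLift hnab hr f = a :=
  isFlatSection_unique hnab hr (flatLift_flat hnab hr f) ha (flatLift_symbol hnab hr f) haf

/-- The symbol of the product of the flat sections with symbols `f` and `g`. -/
def starSeries (f g : PowerSeries S.smoothFunctions) : PowerSeries S.smoothFunctions :=
  (exists_hasSymbol (isWeylSection_circ hnab (flatLift_flat hnab hr f).1
    (flatLift_flat hnab hr g).1)).choose

lemma starSeries_symbol (f g : PowerSeries S.smoothFunctions) :
    HasSymbol (circ Ω (flatLift hnab hr f) (flatLift hnab hr g)) (starSeries hnab hr f g) :=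
  (exists_hasSymbol (isWeylSection_circ hnab (flatLift_flat hnab hr f).1
    (flatLift_flat hnab hr g).1)).choose_spec

lemma starSeries_eq {f g h : PowerSeries S.smoothFunctions}
    (H : HasSymbol (circ Ω (flatLift hnab hr f) (flatLift hnab hr g)) h) :
    starSeries hnab hr f g = h :=
  hasSymbol_unique (starSeries_symbol hnab hr f g) H

/-- The lift is multiplicative, because products of flat sections are flat. -/
lemma flatLift_starSeries (f g : PowerSeries S.smoothFunctions) :
    flatLift hnab hr (starSeries hnab hr f g) =
      circ Ω (flatLift hnab hr f) (flatLift hnab hr g) :=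
  flatLift_eq hnab hr (isFlatSection_circ hnab hr (flatLift_flat hnab hr f)
    (flatLift_flat hnab hr g)) (starSeries_symbol hnab hr f g)

omit [LocallyConnectedSpace X] in
lemma flatLift_add (f g : PowerSeries S.smoothFunctions) :
    flatLift hnab hr (f + g) = flatLift hnab hr f + flatLift hnab hr g :=
  flatLift_eq hnab hr (isFlatSection_add hnab hr (flatLift_flat hnab hr f)
    (flatLift_flat hnab hr g)) (hasSymbol_add (flatLift_symbol hnab hr f)
    (flatLift_symbol hnab hr g))

omit [LocallyConnectedSpace X] in
lemma flatLift_smul (t : ℂ) (f : PowerSeries S.smoothFunctions) :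
    flatLift hnab hr (t • f) = t • flatLift hnab hr f :=
  flatLift_eq hnab hr (isFlatSection_smul hnab hr t (flatLift_flat hnab hr f))
    (hasSymbol_smul t (flatLift_symbol hnab hr f))

omit [LocallyConnectedSpace X] in
lemma flatLift_X_mul (f : PowerSeries S.smoothFunctions) :
    flatLift hnab hr (PowerSeries.X * f) = lambdaFamily (flatLift hnab hr f) :=
  flatLift_eq hnab hr (isFlatSection_lambda hnab hr (flatLift_flat hnab hr f))
    (hasSymbol_lambda (flatLift_symbol hnab hr f))

omit [LocallyConnectedSpace X] in
lemma flatLift_one : flatLift hnab hr 1 = oneFamily :=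
  flatLift_eq hnab hr isFlatSection_one hasSymbol_one

omit [LocallyConnectedSpace X] in
lemma flatLift_smooth (f : PowerSeries S.smoothFunctions) (U : S.Index) :
    IsSmoothWeylForm (flatLift hnab hr f U) :=
  (flatLift_flat hnab hr f).1.smooth U

lemma starSeries_add_left (f f' g : PowerSeries S.smoothFunctions) :
    starSeries hnab hr (f + f') g = starSeries hnab hr f g + starSeries hnab hr f' g :=
  starSeries_eq hnab hr <| by
    have h1 : circ Ω (flatLift hnab hr (f + f')) (flatLift hnab hr g) =
        circ Ω (flatLift hnab hr f) (flatLift hnab hr g) +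
          circ Ω (flatLift hnab hr f') (flatLift hnab hr g) := by
      rw [flatLift_add]
      exact funext fun U => weylMul_add_left (isFedosovManifold hnab U)
        (flatLift_smooth hnab hr f U) (flatLift_smooth hnab hr f' U) (flatLift_smooth hnab hr g U)
    rw [h1]
    exact hasSymbol_add (starSeries_symbol hnab hr f g) (starSeries_symbol hnab hr f' g)

lemma starSeries_add_right (f g g' : PowerSeries S.smoothFunctions) :
    starSeries hnab hr f (g + g') = starSeries hnab hr f g + starSeries hnab hr f g' :=
  starSeries_eq hnab hr <| by
    have h1 : circ Ω (flatLift hnab hr f) (flatLift hnab hr (g + g')) =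
        circ Ω (flatLift hnab hr f) (flatLift hnab hr g) +
          circ Ω (flatLift hnab hr f) (flatLift hnab hr g') := by
      rw [flatLift_add]
      exact funext fun U => weylMul_add_right (isFedosovManifold hnab U)
        (flatLift_smooth hnab hr f U) (flatLift_smooth hnab hr g U) (flatLift_smooth hnab hr g' U)
    rw [h1]
    exact hasSymbol_add (starSeries_symbol hnab hr f g) (starSeries_symbol hnab hr f g')

lemma starSeries_smul_left (t : ℂ) (f g : PowerSeries S.smoothFunctions) :
    starSeries hnab hr (t • f) g = t • starSeries hnab hr f g :=
  starSeries_eq hnab hr <| by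
    have h1 : circ Ω (flatLift hnab hr (t • f)) (flatLift hnab hr g) =
        t • circ Ω (flatLift hnab hr f) (flatLift hnab hr g) := by
      rw [flatLift_smul]
      exact funext fun U => weylMul_smul_left (isFedosovManifold hnab U) t
        (flatLift_smooth hnab hr f U) (flatLift_smooth hnab hr g U)
    rw [h1]
    exact hasSymbol_smul t (starSeries_symbol hnab hr f g)

lemma starSeries_smul_right (t : ℂ) (f g : PowerSeries S.smoothFunctions) :
    starSeries hnab hr f (t • g) = t • starSeries hnab hr f g :=
  starSeries_eq hnab hr <| by
    have h1 : circ Ω (flatLift hnab hr f) (flatLift hnab hr (t • g)) =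
        t • circ Ω (flatLift hnab hr f) (flatLift hnab hr g) := by
      rw [flatLift_smul]
      exact funext fun U => weylMul_smul_right (isFedosovManifold hnab U) t
        (flatLift_smooth hnab hr f U) (flatLift_smooth hnab hr g U)
    rw [h1]
    exact hasSymbol_smul t (starSeries_symbol hnab hr f g)

lemma starSeries_X_mul_left (f g : PowerSeries S.smoothFunctions) :
    starSeries hnab hr (PowerSeries.X * f) g = PowerSeries.X * starSeries hnab hr f g :=
  starSeries_eq hnab hr <| by
    have h1 : circ Ω (flatLift hnab hr (PowerSeries.X * f)) (flatLift hnab hr g) =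
        lambdaFamily (circ Ω (flatLift hnab hr f) (flatLift hnab hr g)) := by
      rw [flatLift_X_mul]
      exact funext fun U => weylMul_mulLambda_left (isFedosovManifold hnab U)
        (flatLift_smooth hnab hr f U) (flatLift_smooth hnab hr g U)
    rw [h1]
    exact hasSymbol_lambda (starSeries_symbol hnab hr f g)

lemma starSeries_X_mul_right (f g : PowerSeries S.smoothFunctions) :
    starSeries hnab hr f (PowerSeries.X * g) = PowerSeries.X * starSeries hnab hr f g :=
  starSeries_eq hnab hr <| by
    have h1 : circ Ω (flatLift hnab hr f) (flatLift hnab hr (PowerSeries.X * g)) =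
        lambdaFamily (circ Ω (flatLift hnab hr f) (flatLift hnab hr g)) := by
      rw [flatLift_X_mul]
      exact funext fun U => weylMul_mulLambda_right (isFedosovManifold hnab U)
        (flatLift_smooth hnab hr f U) (flatLift_smooth hnab hr g U)
    rw [h1]
    exact hasSymbol_lambda (starSeries_symbol hnab hr f g)

/-- The product of formal power series of functions induced by the product of flat sections. -/
def starProduct : S.FormalProduct :=
  LinearMap.mk₂ (PowerSeries ℂ) (starSeries hnab hr) (starSeries_add_left hnab hr)
    (fun t f g => powerSeries_map_smul (T := fun f => starSeries hnab hr f g)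
      (fun f f' => starSeries_add_left hnab hr f f' g)
      (fun t f => starSeries_smul_left hnab hr t f g)
      (fun f => starSeries_X_mul_left hnab hr f g) t f)
    (starSeries_add_right hnab hr)
    (fun t f g => powerSeries_map_smul (T := starSeries hnab hr f) (starSeries_add_right hnab hr f)
      (fun t g => starSeries_smul_right hnab hr t f g) (starSeries_X_mul_right hnab hr f) t g)

lemma starProduct_apply (f g : PowerSeries S.smoothFunctions) :
    starProduct hnab hr f g = starSeries hnab hr f g := rfl

lemma starSeries_assoc (f g h : PowerSeries S.smoothFunctions) :
    starSeries hnab hr (starSeries hnab hr f g) h =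
      starSeries hnab hr f (starSeries hnab hr g h) :=
  starSeries_eq hnab hr <| by
    have h1 : circ Ω (flatLift hnab hr (starSeries hnab hr f g)) (flatLift hnab hr h) =
        circ Ω (flatLift hnab hr f) (flatLift hnab hr (starSeries hnab hr g h)) := by
      rw [flatLift_starSeries, flatLift_starSeries]
      exact funext fun U => weylMul_assoc (isFedosovManifold hnab U)
        (flatLift_smooth hnab hr f U) (flatLift_smooth hnab hr g U) (flatLift_smooth hnab hr h U)
    rw [h1]
    exact starSeries_symbol hnab hr f _

lemma starSeries_one (f : PowerSeries S.smoothFunctions) : starSeries hnab hr f 1 = f :=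
  starSeries_eq hnab hr <| by
    have h1 : circ Ω (flatLift hnab hr f) (flatLift hnab hr 1) = flatLift hnab hr f := by
      rw [flatLift_one]
      exact funext fun U => weylMul_oneForm _
    rw [h1]
    exact flatLift_symbol hnab hr f

lemma one_starSeries (f : PowerSeries S.smoothFunctions) : starSeries hnab hr 1 f = f :=
  starSeries_eq hnab hr <| by
    have h1 : circ Ω (flatLift hnab hr 1) (flatLift hnab hr f) = flatLift hnab hr f := by
      rw [flatLift_one]
      exact funext fun U => oneForm_weylMul _
    rw [h1]
    exact flatLift_symbol hnab hr f

/-- The coefficients of the star product of two functions. -/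
def starCoeff (k : ℕ) : S.smoothFunctions →ₗ[ℂ] S.smoothFunctions →ₗ[ℂ] S.smoothFunctions :=
  LinearMap.mk₂ ℂ (fun f g => coeff k (starSeries hnab hr (C f) (C g)))
    (fun f f' g => by rw [map_add C, starSeries_add_left, map_add])
    (fun t f g => by rw [C_smul_eq, starSeries_smul_left, coeff_smul])
    (fun f g g' => by rw [map_add C, starSeries_add_right, map_add])
    (fun t f g => by rw [C_smul_eq, starSeries_smul_right, coeff_smul])

lemma coeff_zero_starSeries (f g : S.smoothFunctions) :
    coeff 0 (starSeries hnab hr (C f) (C g)) = f * g := by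
  refine smoothFunctions_ext fun U x => ?_
  rw [← starSeries_symbol hnab hr (C f) (C g) U x 0 0 Fin.elim0]
  refine (weylMul_zero_zero _ _ _ _ _).trans ?_
  rw [flatLift_symbol hnab hr (C f) U x, flatLift_symbol hnab hr (C g) U x, coeff_zero_C,
    coeff_zero_C]
  rfl

/-- The Poisson bracket is the first order part of the commutator. -/
lemma isPoissonBracket_starSeries (f g : S.smoothFunctions) :
    IsPoissonBracket Ω f g (-Complex.I • coeff 1 (starSeries hnab hr (C f) (C g) -
      starSeries hnab hr (C g) (C f))) := by
  intro U x
  have h0 : ∀ (f : S.smoothFunctions) (z : S.chart U) y w,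
      flatLift hnab hr (C f) U z 0 0 y w = f.1 (S.proj U z) := fun f z y w => by
    rw [flatLift_symbol hnab hr (C f) U z 0 y w, coeff_zero_C]
  have h1 : ∀ (f : S.smoothFunctions) (z : S.chart U) y w,
      flatLift hnab hr (C f) U z 1 0 y w = 0 := fun f z y w => by
    rw [flatLift_symbol hnab hr (C f) U z 1 y w, coeff_C, if_neg one_ne_zero]
    rfl
  have h2 := weylMul_sub_weylMul (isFedosovManifold hnab U) (hr.isSection.smooth U)
    (isFedosovForm_formDegGE hnab hr U) (flatLift_smooth hnab hr (C f) U)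
    (flatLift_smooth hnab hr (C g) U) (congrFun (flatLift_flat hnab hr (C f)).2 U)
    (congrFun (flatLift_flat hnab hr (C g)).2 U) (h0 f) (h0 g) (h1 f) (h1 g) x 0 Fin.elim0
  have h3 : (coeff 1 (starSeries hnab hr (C f) (C g) - starSeries hnab hr (C g) (C f))).1
      (S.proj U x) = Complex.I * chartPoisson (Ω.form U) (fun z => f.1 (S.proj U z))
        (fun z => g.1 (S.proj U z)) x := by
    rw [← h2, map_sub]
    exact (congrArg₂ (fun p q : ℂ => p - q)
      (starSeries_symbol hnab hr (C f) (C g) U x 1 0 Fin.elim0)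
      (starSeries_symbol hnab hr (C g) (C f) U x 1 0 Fin.elim0)).symm
  refine (congrArg (fun q : ℂ => -Complex.I * q) h3).trans ?_
  rw [← mul_assoc, neg_mul, Complex.I_mul_I, neg_neg, one_mul]

lemma isStarProduct_starProduct : IsStarProduct Ω (starProduct hnab hr) where
  assoc := starSeries_assoc hnab hr
  deformation := ⟨starCoeff hnab hr, fun f g => PowerSeries.ext fun k => by rw [coeff_mk]; rfl,
    coeff_zero_starSeries hnab hr⟩
  commutator f g := by
    refine ⟨_, isPoissonBracket_starSeries hnab hr f g, ?_⟩
    simp only [starProduct_apply]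
    rw [X_pow_dvd_iff]
    intro m hm
    have h1 : Complex.I • -Complex.I • coeff 1 (starSeries hnab hr (C f) (C g) -
        starSeries hnab hr (C g) (C f)) = coeff 1 (starSeries hnab hr (C f) (C g) -
        starSeries hnab hr (C g) (C f)) := by
      rw [smul_smul, mul_neg, Complex.I_mul_I, neg_neg, one_smul]
    rw [h1]
    interval_cases m
    · rw [map_sub, map_sub, coeff_zero_starSeries, coeff_zero_starSeries, coeff_zero_X_mul,
        mul_comm, sub_self, sub_zero]
    · rw [map_sub, coeff_succ_X_mul, coeff_zero_C, sub_self]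
  unit f := ⟨starSeries_one hnab hr _, one_starSeries hnab hr _⟩

end Product

end Star

end Fedosov

end

theorem mainTheorem2 {X : Type u} [TopologicalSpace X] [T2Space X] [SecondCountableTopology X]
    [LocallyConnectedSpace X] [ParacompactSpace X] (S : OrbispaceFunctor.{u, v, w} X)
    (Ω : S.SymplecticForm) (nab : S.Connection) (hnab : nab.IsSymplectic Ω) :
    (∃! r : S.WeylFamily 1, IsFedosovForm Ω nab r) ∧
    ∀ r : S.WeylFamily 1, IsFedosovForm Ω nab r →
      (∀ a : S.WeylFamily 0, IsWeylSection a → connD Ω nab r (connD Ω nab r a) = 0) ∧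
      ∃ Q : PowerSeries S.smoothFunctions → S.WeylFamily 0,
        (∀ f, IsFlatSection Ω nab r (Q f) ∧ HasSymbol (Q f) f) ∧
        (∀ a f, IsFlatSection Ω nab r a → HasSymbol a f → Q f = a) ∧
        (∀ a, IsFlatSection Ω nab r a → ∃ f, HasSymbol a f) ∧
        ∃ star : S.FormalProduct,
          (∀ f g : S.smoothFunctions,
            HasSymbol (circ Ω (Q (PowerSeries.C f)) (Q (PowerSeries.C g)))
              (star (PowerSeries.C f) (PowerSeries.C g))) ∧
          (∀ star' : S.FormalProduct,
            (∀ f g : S.smoothFunctions,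
              HasSymbol (circ Ω (Q (PowerSeries.C f)) (Q (PowerSeries.C g)))
                (star' (PowerSeries.C f) (PowerSeries.C g))) → star' = star) ∧
          IsStarProduct Ω star := by
  refine ⟨Fedosov.existsUnique_isFedosovForm hnab, fun r hr =>
    ⟨fun a ha => Fedosov.connD_connD hnab hr ha, Fedosov.flatLift hnab hr,
      fun f => ⟨Fedosov.flatLift_flat hnab hr f, Fedosov.flatLift_symbol hnab hr f⟩,
      fun a f ha haf => Fedosov.flatLift_eq hnab hr ha haf,
      fun a ha => Fedosov.exists_hasSymbol ha.1, Fedosov.starProduct hnab hr,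
      fun f g => Fedosov.starSeries_symbol hnab hr _ _, fun star' h => ?_,
      Fedosov.isStarProduct_starProduct hnab hr⟩⟩
  exact Fedosov.powerSeries_bilinear_ext fun f g =>
    Fedosov.hasSymbol_unique (h f g) (Fedosov.starSeries_symbol hnab hr _ _)
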